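/- **Local well-posedness for the 2D NLS equation with one concentrated nonlinearity.** *Setting.* Fix $\mathbf y\in\mathbb R^2$, $\beta_0\in\mathbb R$, $\sigma\ge\frac12$ and $\lambda>0$. Let $\widehat f(\mathbf p)=\frac1{2\pi}\int_{\mathbb R^2}e^{-i\mathbf p\cdot\mathbf x}f(\mathbf x)\,d\mathbf x$ and $p=|\mathbf p|$. Let $K_0(\sqrt\lambda|\mathbf x|)$ be the inverse Fourier transform of $(p^2+\lambda)^{-1}$ (the Macdonald function of order $0$), $\gamma$ Euler's constant, and $\langle\cdot,\cdot\rangle$ the scalar product of $L^2(\mathbb R^2)$, conjugate-linear in the first entry. The form domain is $$\mathscr D[\mathcal F]=\Big\{\psi\in L^2(\mathbb R^2):\ \psi=\phi_\lambda+\tfrac1{2\pi}\,q\,K_0(\sqrt\lambda|\cdot-\mathbf y|),\ \phi_\lambda\in H^1(\mathbb R^2),\ q\in\mathbb C\Big\};$$ the regular part $\phi_\lambda$ and the charge $q$ are determined by $\psi$. Let $$\mathscr D=\big\{\psi\in\mathscr D[\mathcal F]:\ (1+p^{\varepsilon})\,\widehat{\phi_\lambda}\in L^1(\mathbb R^2)\text{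 for some }\varepsilon>0\big\}.$$ For $\alpha\in\mathbb R$ and $\chi,\psi\in\mathscr D[\mathcal F]$ with regular parts $\chi_\lambda,\phi_\lambda$ and charges $q_\chi,q$ put $$\mathcal F_\alpha[\chi,\psi]=\int_{\mathbb R^2}\big\{\nabla\chi_\lambda^*\cdot\nabla\phi_\lambda+\lambda\chi_\lambda^*\phi_\lambda-\lambda\chi^*\psi\big\}\,d\mathbf x+\Big(\alpha+\tfrac1{2\pi}\log\tfrac{\sqrt\lambda}2+\tfrac{\gamma}{2\pi}\Big)q_\chi^*\,q .$$ Let $U_0(t)=e^{it\Delta}$ on $L^2(\mathbb R^2)$, $U_0(t;r)=\dfrac{e^{-r^2/(4it)}}{2it}$, and let $\mathcal I(t)=\int_0^\infty\frac{t^{\tau-1}}{\Gamma(\tau)}\,d\tau$ be the Volterra function of order $-1$. For $T>0$ and $\psi_0\in\mathscr D[\mathcal F]$, a *solution on $[0,T]$ of the weak Cauchy problem* is a path $[0,T]\ni t\mapsto\psi_t\in\mathscr D[\mathcal F]$, with bounded charge $q(t)$, such that $\psi_{t=0}=\psi_0$ and, for every $\chi\in\mathscr D[\mathcal F]$ and every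 $t\in[0,T]$, $$i\frac{d}{dt}\langle\chi,\psi_t\rangle=\mathcal F_{\alpha(t)}[\chi,\psi_t],\qquad \alpha(t)=\beta_0|q(t)|^{2\sigma}$$ (one-sided derivatives at the end points). *Theorem.* Let $\psi_0\in\mathscr D$. For every $t>0$ the function $U_0(t)\psi_0$ has a continuous representative, whose value at $\mathbf y$ is denoted by $(U_0(t)\psi_0)(\mathbf y)$. There exists $T>0$ such that: 1. The charge equation $$q(t)+4\pi\beta_0\int_0^t\mathcal I(t-\tau)|q(\tau)|^{2\sigma}q(\tau)\,d\tau-2\Big(\log2-\gamma+\tfrac{i\pi}4\Big)\int_0^t\mathcal I(t-\tau)q(\tau)\,d\tau=4\pi\int_0^t\mathcal I(t-\tau)(U_0(\tau)\psi_0)(\mathbf y)\,d\tau,\quad 0<t\le T,$$ in which all integrals converge absolutely, has exactly one solution $q\in C[0,T]$, and $q\in H^{1/2}(0,T)$. 2. The weak Cauchy problem with initial datum $\psi_0$ has exactly one solution $\psi_t$ on $[0,T]$. It is given, for all $t\in[0,T]$, by $$\psi_t=U_0(t)\psi_0+\frac i{2\pi}\int_0^tU_0(t-\tau;|\cdot-\mathbf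 y|)\,q(\tau)\,d\tau,$$ where $q$ is the solution of the charge equation in 1 and the integral is the limit in $L^2(\mathbb R^2)$, as $\varepsilon\to0^+$, of the integrals over $[0,t-\varepsilon]$; and the charge of $\psi_t$ is $q(t)$. -/

import Mathlib

open MeasureTheory Set Filter Topology
open scoped ENNReal FourierTransform SchwartzMap LineDeriv

noncomputable section

namespace PointNLS

/-- The plane `ℝ²` with its Euclidean norm. -/
abbrev Plane : Type := EuclideanSpace ℝ (Fin 2)

/-- The complex Hilbert space `L²(ℝ²)`; `inner ℂ` is conjugate-linear in its first argument. -/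
abbrev L2 : Type := Lp ℂ 2 (volume : Measure Plane)

/-! ### Fourier transform and free evolution

The transform `𝓕` of Mathlib is `∫ exp (-2πi x·ξ) f x dx`; in terms of the frequency `p = 2πξ` the
unitary transform `(2π)⁻¹ ∫ exp (-i x·p) f x dx` is therefore `(2π)⁻¹ 𝓕 f (p / 2π)`. -/

/-- The unitary Fourier transform `f̂ p = (2π)⁻¹ ∫ exp (-i x·p) f x dx` on `L²(ℝ²)`
(a representative of it). -/
def hat (f : L2) (p : Plane) : ℂ :=
  (2 * Real.pi : ℂ)⁻¹ * (𝓕 f : L2) ((2 * Real.pi)⁻¹ • p)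

theorem memLp_phase_mul (t : ℝ) (f : L2) :
    MemLp (fun ξ : Plane ↦
      Complex.exp (-Complex.I * ((t * (2 * Real.pi * ‖ξ‖) ^ 2 : ℝ) : ℂ)) * f ξ) 2 volume := by
  have hc : Continuous (fun ξ : Plane ↦
      Complex.exp (-Complex.I * ((t * (2 * Real.pi * ‖ξ‖) ^ 2 : ℝ) : ℂ))) := by fun_prop
  refine (Lp.memLp f).of_le (hc.aestronglyMeasurable.mul (Lp.aestronglyMeasurable f)) ?_
  filter_upwards with ξ
  have h : ‖Complex.exp (-Complex.I * ((t * (2 * Real.pi * ‖ξ‖) ^ 2 : ℝ) : ℂ))‖ = 1 := by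
    rw [neg_mul, ← mul_neg, mul_comm, ← Complex.ofReal_neg]
    exact Complex.norm_exp_ofReal_mul_I _
  rw [norm_mul, h, one_mul]

/-- The free Schrödinger group `U₀(t) = exp (i t Δ)` on `L²(ℝ²)`: multiplication by
`exp (-i t |p|²)`, `p = 2πξ`, on the Fourier side. -/
def U₀ (t : ℝ) (f : L2) : L2 :=
  𝓕⁻ ((memLp_phase_mul t (𝓕 f)).toLp _)

/-- The kernel `U₀(t; r) = exp (-r² / (4 i t)) / (2 i t)`; the integral kernel of `U₀(t)` with
respect to the measure `(2π)⁻¹ dx`. -/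
def freeKernel (t r : ℝ) : ℂ :=
  Complex.exp (-(r : ℂ) ^ 2 / (4 * Complex.I * t)) / (2 * Complex.I * t)

/-- The value at `y` of an `L²` class: the value of its continuous representative
(zero if there is none). -/
def valueAt (f : L2) (y : Plane) : ℂ :=
  open Classical in
  if h : ∃ g : Plane → ℂ, Continuous g ∧ f =ᵐ[volume] g then h.choose y else 0

/-! ### The form domain and the quadratic form -/

theorem memLp_green (y : Plane) {lam : ℝ} (hlam : 0 < lam) :
    MemLp (fun ξ : Plane ↦ Complex.exp (-Complex.I * ((2 * Real.pi * inner ℝ ξ y : ℝ) : ℂ)) /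
      (((2 * Real.pi * ‖ξ‖) ^ 2 + lam : ℝ) : ℂ)) 2 volume := by
  have hpos : ∀ ξ : Plane, 0 < (2 * Real.pi * ‖ξ‖) ^ 2 + lam := fun ξ ↦ by positivity
  have hbase : MemLp (fun ξ : Plane ↦ (1 + ‖ξ‖ ^ 2) ^ (-1 : ℝ)) 2 volume := by
    have hcont : Continuous (fun ξ : Plane ↦ (1 + ‖ξ‖ ^ 2) ^ (-1 : ℝ)) := by
      refine Continuous.rpow_const (by fun_prop) fun ξ ↦ Or.inl (by positivity)
    rw [memLp_two_iff_integrable_sq hcont.aestronglyMeasurable]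
    have h4 : (Module.finrank ℝ Plane : ℝ) < 4 := by simp; norm_num
    refine (integrable_rpow_neg_one_add_norm_sq (E := Plane) (μ := volume) h4).congr ?_
    filter_upwards with ξ
    rw [← Real.rpow_mul_natCast (by positivity)]
    norm_num
  have hcont : Continuous (fun ξ : Plane ↦
      Complex.exp (-Complex.I * ((2 * Real.pi * inner ℝ ξ y : ℝ) : ℂ)) /
      (((2 * Real.pi * ‖ξ‖) ^ 2 + lam : ℝ) : ℂ)) := by
    refine Continuous.div (by fun_prop) (by fun_prop) fun ξ ↦ ?_
    exact_mod_cast (hpos ξ).ne'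
  refine hbase.of_le_mul (c := 1 + lam⁻¹) hcont.aestronglyMeasurable ?_
  filter_upwards with ξ
  have h : ‖Complex.exp (-Complex.I * ((2 * Real.pi * inner ℝ ξ y : ℝ) : ℂ))‖ = 1 := by
    rw [Complex.norm_exp]
    simp
  have h1 : (1 : ℝ) ≤ (2 * Real.pi) ^ 2 := by nlinarith [Real.pi_gt_three]
  rw [norm_div, h, Complex.norm_real, Real.norm_of_nonneg (hpos ξ).le, Real.rpow_neg_one,
    Real.norm_of_nonneg (by positivity), ← div_eq_mul_inv, div_le_div_iff₀ (hpos ξ) (by positivity)]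
  have h2 : lam⁻¹ * lam = 1 := inv_mul_cancel₀ hlam.ne'
  have h3 : 0 < lam⁻¹ := inv_pos.mpr hlam
  have h4 : ‖ξ‖ ^ 2 ≤ (2 * Real.pi) ^ 2 * ‖ξ‖ ^ 2 := le_mul_of_one_le_left (by positivity) h1
  have h5 : 0 ≤ lam⁻¹ * ((2 * Real.pi) ^ 2 * ‖ξ‖ ^ 2) := by positivity
  nlinarith

/-- The Green function `(2π)⁻¹ K₀(√λ |x - y|)` of `-Δ + λ` as an element of `L²(ℝ²)`. Here
`K₀(√λ |x|)` is the inverse unitary Fourier transform of `(|p|² + λ)⁻¹`, so that, with `p = 2πξ`,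
the transform `𝓕` of the Green function is `exp (-2πi ξ·y) / (|2πξ|² + λ)`. -/
def green (y : Plane) {lam : ℝ} (hlam : 0 < lam) : L2 :=
  𝓕⁻ ((memLp_green y hlam).toLp _)

/-- `g` is the weak gradient of `f`: the distributional partial derivatives of `f ∈ L²` are the
functions `g 0, g 1 ∈ L²`. Thus `f ∈ H¹(ℝ²)` means that such a `g` exists. -/
def IsWeakGradient (f : L2) (g : Fin 2 → L2) : Prop :=
  ∀ j : Fin 2, ∂_{(EuclideanSpace.single j (1 : ℝ) : Plane)} (f : 𝓢'(Plane, ℂ)) =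
    (g j : 𝓢'(Plane, ℂ))

/-- An element `ψ = φ + q (2π)⁻¹ K₀(√λ |· - y|)` of the form domain, given by its regular part
`φ ∈ H¹(ℝ²)` (with its weak gradient) and its charge `q ∈ ℂ`. All of these data are determined by
`ψ`, since `K₀(√λ |· - y|)` is not in `H¹(ℝ²)`. -/
structure FormDomain (y : Plane) {lam : ℝ} (hlam : 0 < lam) where
  reg : L2
  grad : Fin 2 → L2
  isWeakGradient : IsWeakGradient reg grad
  charge : ℂ

/-- The `L²` function underlying an element of the form domain. -/
def FormDomain.toL2 {y : Plane} {lam : ℝ} {hlam : 0 < lam} (ψ : FormDomain y hlam) : L2 :=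
  ψ.reg + ψ.charge • green y hlam

/-- The restricted form domain `𝒟`: `(1 + |p|^ε) φ̂(p)` is in `L¹(ℝ²)` for some `ε > 0`, where `φ`
is the regular part. -/
def FormDomain.IsAdmissible {y : Plane} {lam : ℝ} {hlam : 0 < lam}
    (ψ : FormDomain y hlam) : Prop :=
  ∃ ε : ℝ, 0 < ε ∧ Integrable (fun p : Plane ↦ ((1 + ‖p‖ ^ ε : ℝ) : ℂ) * hat ψ.reg p) volume

/-- The sesquilinear form
`∫ (∇χ_λ^* · ∇φ_λ + λ χ_λ^* φ_λ - λ χ^* ψ) + (α + (2π)⁻¹ log (√λ/2) + γ/(2π)) q_χ^* q_ψ`. -/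
def form {y : Plane} {lam : ℝ} {hlam : 0 < lam} (α : ℝ) (χ ψ : FormDomain y hlam) : ℂ :=
  (∑ j : Fin 2, inner ℂ (χ.grad j) (ψ.grad j)) + lam * inner ℂ χ.reg ψ.reg
    - lam * inner ℂ χ.toL2 ψ.toL2
    + ((α + 1 / (2 * Real.pi) * Real.log (Real.sqrt lam / 2)
        + Real.eulerMascheroniConstant / (2 * Real.pi) : ℝ) : ℂ)
      * (starRingEnd ℂ χ.charge * ψ.charge)

/-- `ψ` solves on `[0, T]` the weak Cauchy problem `i d/dt ⟨χ, ψ_t⟩ = F_{α(t)}[χ, ψ_t]` for all `χ`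
in the form domain, `α(t) = β₀ |q(t)|^{2σ}`, with initial datum `ψ₀`. The path has values in the
form domain, its charge is bounded, and the derivative is one-sided at the end points. -/
structure IsWeakSolution {y : Plane} {lam : ℝ} {hlam : 0 < lam} (β₀ σ T : ℝ)
    (ψ₀ : FormDomain y hlam) (ψ : ℝ → FormDomain y hlam) : Prop where
  initial : (ψ 0).toL2 = ψ₀.toL2
  bounded_charge : ∃ C : ℝ, ∀ t ∈ Icc 0 T, ‖(ψ t).charge‖ ≤ C
  equation : ∀ χ : FormDomain y hlam, ∀ t ∈ Icc 0 T,
    HasDerivWithinAt (fun s : ℝ ↦ inner ℂ χ.toL2 (ψ s).toL2)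
      (-Complex.I * form (β₀ * ‖(ψ t).charge‖ ^ (2 * σ)) χ (ψ t)) (Icc 0 T) t

/-! ### The charge equation -/

/-- The Volterra function of order `-1`. -/
def volterraI (t : ℝ) : ℝ :=
  ∫ τ in Ioi (0 : ℝ), t ^ (τ - 1) / Real.Gamma τ

/-- `q` is a continuous solution on `[0, T]` of the charge equation, all integrals being absolutely
convergent. The equation is imposed for `0 < t ≤ T` only: at `t = 0` all integrals vanish, whereas
`q 0` is the limit of the right-hand side for `t → 0+`. -/
structure IsChargeSolution (y : Plane) (β₀ σ T : ℝ) (ψ₀ : L2) (q : ℝ → ℂ) : Prop where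
  continuousOn : ContinuousOn q (Icc 0 T)
  integrable_nonlinear : ∀ t ∈ Ioc 0 T, IntervalIntegrable
    (fun τ : ℝ ↦ (volterraI (t - τ) : ℂ) * ((‖q τ‖ ^ (2 * σ) : ℝ) : ℂ) * q τ) volume 0 t
  integrable_linear : ∀ t ∈ Ioc 0 T, IntervalIntegrable
    (fun τ : ℝ ↦ (volterraI (t - τ) : ℂ) * q τ) volume 0 t
  integrable_source : ∀ t ∈ Ioc 0 T, IntervalIntegrable
    (fun τ : ℝ ↦ (volterraI (t - τ) : ℂ) * valueAt (U₀ τ ψ₀) y) volume 0 t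
  equation : ∀ t ∈ Ioc 0 T,
    q t + 4 * Real.pi * β₀ *
        (∫ τ in (0 : ℝ)..t, (volterraI (t - τ) : ℂ) * ((‖q τ‖ ^ (2 * σ) : ℝ) : ℂ) * q τ)
      - 2 * (Real.log 2 - Real.eulerMascheroniConstant + Complex.I * Real.pi / 4) *
        (∫ τ in (0 : ℝ)..t, (volterraI (t - τ) : ℂ) * q τ)
      = 4 * Real.pi * ∫ τ in (0 : ℝ)..t, (volterraI (t - τ) : ℂ) * valueAt (U₀ τ ψ₀) y

/-- The seminorm of `H^{1/2}(0, T)` of `q` is finite. -/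
def FiniteHalfSeminorm (T : ℝ) (q : ℝ → ℂ) : Prop :=
  ∫⁻ t in Ioo 0 T, ∫⁻ s in Ioo 0 T, ‖q t - q s‖ₑ ^ 2 / ENNReal.ofReal ((t - s) ^ 2) < ∞

/-- `f = U₀(t) ψ₀ + (i/2π) ∫₀ᵗ U₀(t - τ; |· - y|) q(τ) dτ`. As the kernel is not absolutely
integrable at `τ = t`, the integral is the limit in `L²(ℝ²)`, for `ε → 0+`, of the absolutely
convergent integrals over `[0, t - ε]`. -/
def IsAnsatz (y : Plane) (ψ₀ : L2) (q : ℝ → ℂ) (t : ℝ) (f : L2) : Prop :=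
  Tendsto (fun ε : ℝ ↦ eLpNorm (fun x : Plane ↦ f x - ((U₀ t ψ₀ : L2) x
      + Complex.I / (2 * Real.pi) * ∫ τ in Icc 0 (t - ε), freeKernel (t - τ) ‖x - y‖ * q τ))
      2 volume)
    (𝓝[>] 0) (𝓝 0)

end PointNLS

end

open PointNLS

noncomputable section

namespace PointNLS

/-! ### The Fourier transform on `L¹ ∩ L²` -/

section FourierL2

variable {V : Type*} [NormedAddCommGroup V] [InnerProductSpace ℝ V] [FiniteDimensional ℝ V]
  [MeasurableSpace V] [BorelSpace V]

theorem ae_eq_of_integral_schwartz_eq {f g : V → ℂ} (hf : LocallyIntegrable f volume)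
    (hg : LocallyIntegrable g volume)
    (h : ∀ u : 𝓢(V, ℂ), HasCompactSupport u → ∫ x, u x • f x = ∫ x, u x • g x) :
    f =ᵐ[volume] g := by
  have key : ∀ᵐ x ∂(volume : Measure V), (f - g) x = 0 := by
    refine ae_eq_zero_of_integral_contDiff_smul_eq_zero (hf.sub hg) fun u hu hcu ↦ ?_
    have hg₁ : HasCompactSupport (Complex.ofRealCLM ∘ u) := hcu.comp_left rfl
    have hg₂ : ContDiff ℝ (↑(⊤ : ℕ∞)) (Complex.ofRealCLM ∘ u) := by fun_prop
    have h1 := h (hg₁.toSchwartzMap hg₂) hg₁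
    have hi : ∀ k : V → ℂ, LocallyIntegrable k volume →
        Integrable (fun x ↦ u x • k x) volume := fun k hk ↦
      hk.integrable_smul_left_of_hasCompactSupport hu.continuous hcu
    simp only [Pi.sub_apply, smul_sub]
    rw [integral_sub (hi f hf) (hi g hg), sub_eq_zero]
    simpa using h1
  filter_upwards [key] with x hx
  exact sub_eq_zero.mp hx

/-- The `L²` transform is an extension by continuity, not an integral. As a tempered distribution it
acts by transposition on Schwartz functions, and Fubini moves the integral transform of `m` across
the same pairing, so both functions define one distribution. -/
theorem fourier_toLp_ae_eq {m : V → ℂ} (h1 : Integrable m volume) (h2 : MemLp m 2 volume) :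
    (𝓕 (h2.toLp m) : Lp ℂ 2 (volume : Measure V)) =ᵐ[volume] 𝓕 m := by
  have hc : Continuous (𝓕 m) :=
    VectorFourier.fourierIntegral_continuous Real.continuous_fourierChar
      (by simpa using continuous_inner) h1
  refine ae_eq_of_integral_schwartz_eq ((Lp.memLp _).locallyIntegrable (by norm_num))
    hc.locallyIntegrable fun u _ ↦ ?_
  have e1 := Lp.toTemperedDistribution_apply (𝓕 (h2.toLp m) : Lp ℂ 2 (volume : Measure V)) u
  rw [← e1, ← Lp.fourier_toTemperedDistribution_eq, TemperedDistribution.fourier_apply,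
    Lp.toTemperedDistribution_apply]
  have e2 : ∫ x, (𝓕 u) x • (h2.toLp m) x = ∫ x, (𝓕 (u : V → ℂ)) x • m x := by
    refine integral_congr_ae ?_
    filter_upwards [h2.coeFn_toLp] with x hx
    rw [hx, SchwartzMap.fourier_coe]
  rw [e2]
  have e3 := VectorFourier.integral_fourierIntegral_smul_eq_flip (μ := (volume : Measure V))
    (ν := (volume : Measure V)) (L := innerₗ V) (f := (u : V → ℂ)) (g := m)
    Real.continuous_fourierChar (by simpa using continuous_inner) u.integrable h1
  rw [flip_innerₗ] at e3
  exact e3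

theorem fourierInv_toLp_ae_eq {m : V → ℂ} (h1 : Integrable m volume) (h2 : MemLp m 2 volume) :
    (𝓕⁻ (h2.toLp m) : Lp ℂ 2 (volume : Measure V)) =ᵐ[volume] 𝓕⁻ m := by
  have hc : Continuous (𝓕⁻ m) := by
    have : 𝓕⁻ m = fun v ↦ 𝓕 m (-v) := funext fun v ↦ Real.fourierInv_eq_fourier_neg m v
    rw [this]
    exact (VectorFourier.fourierIntegral_continuous Real.continuous_fourierChar
      (by simpa using continuous_inner) h1).comp continuous_neg
  refine ae_eq_of_integral_schwartz_eq ((Lp.memLp _).locallyIntegrable (by norm_num))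
    hc.locallyIntegrable fun u _ ↦ ?_
  have e1 := Lp.toTemperedDistribution_apply (𝓕⁻ (h2.toLp m) : Lp ℂ 2 (volume : Measure V)) u
  rw [← e1, ← Lp.fourierInv_toTemperedDistribution_eq, TemperedDistribution.fourierInv_apply,
    Lp.toTemperedDistribution_apply]
  have e2 : ∫ x, (𝓕⁻ u) x • (h2.toLp m) x = ∫ x, (𝓕⁻ (u : V → ℂ)) x • m x := by
    refine integral_congr_ae ?_
    filter_upwards [h2.coeFn_toLp] with x hx
    rw [hx, SchwartzMap.fourierInv_coe]
  rw [e2]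
  -- The inverse transform is the Fourier integral for the pairing `-innerₗ V`, which is still
  -- symmetric, so the multiplication formula applies to it as well.
  have e3 := VectorFourier.integral_fourierIntegral_smul_eq_flip (μ := (volume : Measure V))
    (ν := (volume : Measure V)) (L := -innerₗ V) (f := (u : V → ℂ)) (g := m)
    Real.continuous_fourierChar
    (by simpa using (by fun_prop : Continuous fun p : V × V ↦ -inner ℝ p.1 p.2)) u.integrable h1
  have e4 : (-innerₗ V).flip = -innerₗ V := by
    ext x y
    simp [real_inner_comm]
  rw [e4] at e3
  exact e3

/-- If `m n → m` in `L²` and the inverse transforms of the integrable functions `m n` converge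
pointwise to `g`, then `g` represents the inverse transform of `m`. -/
theorem fourierInv_toLp_ae_eq_of_tendsto {m : V → ℂ} {M : ℕ → V → ℂ} (hm : MemLp m 2 volume)
    (h1 : ∀ n, Integrable (M n) volume) (h2 : ∀ n, MemLp (M n) 2 volume)
    (hlim : Tendsto (fun n ↦ eLpNorm (M n - m) 2 volume) atTop (𝓝 0)) {g : V → ℂ}
    (hg : ∀ x, Tendsto (fun n ↦ 𝓕⁻ (M n) x) atTop (𝓝 (g x))) :
    (𝓕⁻ (hm.toLp m) : Lp ℂ 2 (volume : Measure V)) =ᵐ[volume] g := by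
  have t1 : Tendsto (fun n ↦ (h2 n).toLp (M n)) atTop (𝓝 (hm.toLp m)) := by
    rw [Lp.tendsto_Lp_iff_tendsto_eLpNorm'']
    exact hlim
  have t2 : Tendsto (fun n ↦ (𝓕⁻ ((h2 n).toLp (M n)) : Lp ℂ 2 (volume : Measure V))) atTop
      (𝓝 (𝓕⁻ (hm.toLp m))) :=
    ((Lp.fourierTransformₗᵢ V ℂ).symm.continuous.tendsto _).comp t1
  have t3 := tendstoInMeasure_of_tendsto_Lp t2
  obtain ⟨ns, hns, hae⟩ := t3.exists_seq_tendsto_ae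
  have hall : ∀ᵐ x : V, ∀ n, (𝓕⁻ ((h2 n).toLp (M n)) : Lp ℂ 2 (volume : Measure V)) x
      = 𝓕⁻ (M n) x := ae_all_iff.2 fun n ↦ fourierInv_toLp_ae_eq (h1 n) (h2 n)
  filter_upwards [hae, hall] with x hx hx'
  simp only [hx'] at hx
  exact tendsto_nhds_unique hx ((hg x).comp hns.tendsto_atTop)

end FourierL2

/-! ### Radial integrals in the variable `|p|²`, phases and plane waves. -/

/-- The symbol `|p|²`, `p = 2πξ`, of `-Δ`. -/
def symb (ξ : Plane) : ℝ := (2 * Real.pi * ‖ξ‖) ^ 2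

theorem continuous_symb : Continuous symb := by unfold symb; fun_prop

theorem symb_nonneg (ξ : Plane) : 0 ≤ symb ξ := sq_nonneg _

/-- A sublevel set `|p|² ≤ c` is a disc of area `c / (4π)`, linear in `c`. In two dimensions `|p|²`
thus has constant density, and plane integrals of radial functions become unweighted half-line
integrals to which one-dimensional Plancherel applies. -/
theorem map_symb_volume : (volume : Measure Plane).map symb =
    ENNReal.ofReal (1 / (4 * Real.pi)) • volume.restrict (Ioi 0) := by
  have hm : Measurable symb := continuous_symb.measurable
  have key : ∀ a b : ℝ, a < b → (volume : Measure Plane).map symb (Ioc a b) =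
    (ENNReal.ofReal (1 / (4 * Real.pi)) • volume.restrict (Ioi 0)) (Ioc a b) := by
    intro a b hab
    have hIic : ∀ c : ℝ, 0 ≤ c → (volume : Measure Plane) (symb ⁻¹' Iic c) =
        ENNReal.ofReal (c / (4 * Real.pi)) := by
      intro c hc
      have : symb ⁻¹' Iic c = Metric.closedBall 0 (Real.sqrt c / (2 * Real.pi)) := by
        ext ξ
        simp only [mem_preimage, mem_Iic, symb, Metric.mem_closedBall, dist_zero_right]
        rw [le_div_iff₀ (by positivity), mul_comm, Real.le_sqrt (by positivity) hc]
      rw [this, EuclideanSpace.volume_closedBall_fin_two, ← ENNReal.ofReal_pow (by positivity),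
        ← ENNReal.ofReal_mul (by positivity), div_pow, Real.sq_sqrt hc]
      congr 1
      field_simp
      norm_num
    have hIic0 : ∀ c : ℝ, (volume : Measure Plane) (symb ⁻¹' Iic c) =
        ENNReal.ofReal (c / (4 * Real.pi)) := by
      intro c
      rcases le_or_gt 0 c with hc | hc
      · exact hIic c hc
      · have h0 : symb ⁻¹' Iic c = ∅ := by
          ext ξ
          simpa using hc.trans_le (symb_nonneg ξ)
        rw [h0, measure_empty, ENNReal.ofReal_of_nonpos]
        exact div_nonpos_of_nonpos_of_nonneg hc.le (by positivity)
    rw [Measure.map_apply hm measurableSet_Ioc, ← Iic_sdiff_Iic, preimage_sdiff,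
      measure_sdiff (preimage_mono (Iic_subset_Iic.2 hab.le))
        (hm measurableSet_Iic).nullMeasurableSet (by rw [hIic0]; exact ENNReal.ofReal_ne_top),
      hIic0, hIic0, Iic_sdiff_Iic, Measure.smul_apply, Measure.restrict_apply measurableSet_Ioc,
      Ioc_inter_Ioi, Real.volume_Ioc, smul_eq_mul, ← ENNReal.ofReal_mul (by positivity)]
    rcases le_or_gt 0 a with ha | ha
    · rw [max_eq_left ha, ← ENNReal.ofReal_sub _ (by positivity)]
      congr 1
      ring
    · rw [max_eq_right ha.le, ENNReal.ofReal_of_nonpos (p := a / (4 * Real.pi))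
        (div_nonpos_of_nonpos_of_nonneg ha.le (by positivity)), tsub_zero]
      congr 1
      ring
  refine Measure.ext_of_Ioc' _ _ (fun a b hab ↦ ?_) key
  rw [key a b hab, Measure.smul_apply, smul_eq_mul]
  exact ENNReal.mul_ne_top ENNReal.ofReal_ne_top
    ((Measure.restrict_apply_le _ _).trans_lt measure_Ioc_lt_top).ne

theorem lintegral_comp_symb {F : ℝ → ℝ≥0∞} (hF : Measurable F) :
    ∫⁻ ξ, F (symb ξ) = ENNReal.ofReal (1 / (4 * Real.pi)) * ∫⁻ ω in Ioi 0, F ω := by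
  rw [← lintegral_map hF continuous_symb.measurable, map_symb_volume, lintegral_smul_measure,
    smul_eq_mul]


/-- The phase `exp (-i t ω)`. -/
def phase (t ω : ℝ) : ℂ := Complex.exp (-Complex.I * ((t * ω : ℝ) : ℂ))

/-- The plane wave `exp (-2πi ξ·y)`. -/
def wave (y ξ : Plane) : ℂ := Complex.exp (-Complex.I * ((2 * Real.pi * inner ℝ ξ y : ℝ) : ℂ))

theorem norm_cexp_neg_I_mul_ofReal (x : ℝ) : ‖Complex.exp (-Complex.I * (x : ℂ))‖ = 1 := by
  rw [neg_mul, ← mul_neg, mul_comm, ← Complex.ofReal_neg]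
  exact Complex.norm_exp_ofReal_mul_I _

@[simp] theorem norm_phase (t ω : ℝ) : ‖phase t ω‖ = 1 := norm_cexp_neg_I_mul_ofReal _

@[simp] theorem norm_wave (y ξ : Plane) : ‖wave y ξ‖ = 1 := norm_cexp_neg_I_mul_ofReal _

@[simp] theorem phase_zero_left (ω : ℝ) : phase 0 ω = 1 := by simp [phase]

theorem phase_add (s t ω : ℝ) : phase (s + t) ω = phase s ω * phase t ω := by
  rw [phase, phase, phase, ← Complex.exp_add]
  congr 1
  push_cast
  ring

theorem conj_wave_mul_wave (y ξ : Plane) : starRingEnd ℂ (wave y ξ) * wave y ξ = 1 := by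
  rw [← Complex.normSq_eq_conj_mul_self, Complex.normSq_eq_norm_sq, norm_wave]
  norm_num

theorem continuous_phase : Continuous fun p : ℝ × ℝ ↦ phase p.1 p.2 := by unfold phase; fun_prop

@[fun_prop]
theorem Continuous.phase {X : Type*} [TopologicalSpace X] {f g : X → ℝ} (hf : Continuous f)
    (hg : Continuous g) : Continuous fun x ↦ phase (f x) (g x) :=
  continuous_phase.comp (hf.prodMk hg)

@[fun_prop]
theorem continuous_wave (y : Plane) : Continuous (wave y) := by unfold wave; fun_prop

theorem hasDerivAt_phase (t ω : ℝ) :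
    HasDerivAt (fun s ↦ phase s ω) (-Complex.I * ω * phase t ω) t := by
  have h : HasDerivAt (fun s : ℝ ↦ -Complex.I * ((s * ω : ℝ) : ℂ)) (-Complex.I * ω) t := by
    have := (((hasDerivAt_id t).mul_const ω).ofReal_comp).const_mul (-Complex.I)
    simpa using this
  have := h.cexp
  rw [mul_comm] at this
  exact this

attribute [fun_prop] continuous_symb

/-! ### The free group, the Green function and weak gradients on the Fourier side. -/

theorem fourier_U₀ (t : ℝ) (f : L2) :
    (𝓕 (U₀ t f) : L2) =ᵐ[volume] fun ξ ↦ phase t (symb ξ) * (𝓕 f : L2) ξ := by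
  rw [U₀, FourierTransform.fourier_fourierInv_eq]
  exact MemLp.coeFn_toLp _

theorem fourier_green (y : Plane) {lam : ℝ} (hlam : 0 < lam) :
    (𝓕 (green y hlam) : L2) =ᵐ[volume] fun ξ ↦ wave y ξ / ((symb ξ + lam : ℝ) : ℂ) := by
  rw [green, FourierTransform.fourier_fourierInv_eq]
  exact MemLp.coeFn_toLp _

theorem inner_eq_integral_fourier (f g : L2) :
    inner ℂ f g = ∫ ξ, starRingEnd ℂ ((𝓕 f : L2) ξ) * (𝓕 g : L2) ξ := by
  rw [← Lp.inner_fourier_eq, L2.inner_def]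
  refine integral_congr_ae (Eventually.of_forall fun ξ ↦ ?_)
  exact (RCLike.inner_apply _ _).trans (mul_comm _ _)

theorem L2.ext_fourier {f g : L2} (h : (𝓕 f : L2) =ᵐ[volume] (𝓕 g : L2)) : f = g := by
  have : (𝓕 f : L2) = 𝓕 g := Lp.ext h
  simpa using congrArg (fun u : L2 ↦ (𝓕⁻ u : L2)) this

/-- The transform is injective on tempered distributions and turns `∂_j` into multiplication by `2πi
ξ_j`. Both sides are then locally integrable functions, for which equality as distributions is
equality almost everywhere. -/
theorem isWeakGradient_iff (f : L2) (g : Fin 2 → L2) : IsWeakGradient f g ↔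
    ∀ j, (𝓕 (g j) : L2) =ᵐ[volume]
      fun ξ ↦ 2 * Real.pi * Complex.I * ((ξ j : ℝ) : ℂ) * (𝓕 f : L2) ξ := by
  refine forall_congr' fun j ↦ ?_
  set e : Plane := EuclideanSpace.single j (1 : ℝ) with he
  have hinj : ∂_{e} (f : 𝓢'(Plane, ℂ)) = (g j : 𝓢'(Plane, ℂ)) ↔
      𝓕 (∂_{e} (f : 𝓢'(Plane, ℂ))) = 𝓕 (g j : 𝓢'(Plane, ℂ)) := by
    refine ⟨fun h ↦ by rw [h], fun h ↦ ?_⟩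
    simpa using congrArg (fun u : 𝓢'(Plane, ℂ) ↦ (𝓕⁻ u : 𝓢'(Plane, ℂ))) h
  rw [hinj, TemperedDistribution.fourier_lineDerivOp_eq, Lp.fourier_toTemperedDistribution_eq,
    Lp.fourier_toTemperedDistribution_eq]
  have hin : ∀ ξ : Plane, inner ℝ ξ e = ξ j := fun ξ ↦ by
    simp [he, EuclideanSpace.inner_single_right]
  have hgr : (fun ξ : Plane ↦ inner ℝ ξ e).HasTemperateGrowth := by fun_prop
  have hgr' : (fun ξ : Plane ↦ ((inner ℝ ξ e : ℝ) : ℂ)).HasTemperateGrowth := by fun_prop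
  have happ : ∀ u : 𝓢(Plane, ℂ), ((2 * Real.pi * Complex.I) • TemperedDistribution.smulLeftCLM ℂ
      (fun ξ : Plane ↦ ((inner ℝ ξ e : ℝ) : ℂ)) ((𝓕 f : L2) : 𝓢'(Plane, ℂ))) u =
      ∫ ξ, u ξ • (2 * Real.pi * Complex.I * ((ξ j : ℝ) : ℂ) * (𝓕 f : L2) ξ) := by
    intro u
    rw [show ∀ (c : ℂ) (D : 𝓢'(Plane, ℂ)), (c • D) u = c • D u from fun _ _ ↦ rfl,
      TemperedDistribution.smulLeftCLM_apply_apply,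
      Lp.toTemperedDistribution_apply, smul_eq_mul, ← integral_const_mul]
    refine integral_congr_ae (Eventually.of_forall fun ξ ↦ ?_)
    simp only [SchwartzMap.smulLeftCLM_apply_apply hgr']
    simp only [hin, smul_eq_mul]
    ring
  have hli : LocallyIntegrable (fun ξ : Plane ↦
      2 * Real.pi * Complex.I * ((ξ j : ℝ) : ℂ) * (𝓕 f : L2) ξ) volume := by
    have h0 : LocallyIntegrable (fun ξ ↦ (𝓕 f : L2) ξ) volume :=
      (Lp.memLp _).locallyIntegrable (by norm_num)
    have hcont : Continuous (fun ξ : Plane ↦ 2 * Real.pi * Complex.I * ((ξ j : ℝ) : ℂ)) := by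
      fun_prop
    exact h0.continuous_smul hcont
  constructor
  · intro h
    refine ae_eq_of_integral_schwartz_eq ((Lp.memLp _).locallyIntegrable (by norm_num)) hli
      fun u _ ↦ ?_
    rw [← happ, ← Lp.toTemperedDistribution_apply, ← h]
  · intro h
    ext u
    rw [happ, Lp.toTemperedDistribution_apply]
    refine integral_congr_ae ?_
    filter_upwards [h] with ξ hξ
    rw [hξ]

/-! ### Plancherel's theorem in the time variable. -/

theorem eLpNorm_two_sq {α E : Type*} [MeasurableSpace α] [NormedAddCommGroup E] {μ : Measure α}
    (f : α → E) : eLpNorm f 2 μ ^ 2 = ∫⁻ x, ‖f x‖ₑ ^ 2 ∂μ := by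
  have := eLpNorm_nnreal_pow_eq_lintegral (μ := μ) (f := f) (p := 2) (by norm_num)
  simpa using this

theorem lintegral_comp_div_const {F : ℝ → ℝ≥0∞} (hF : Measurable F) {c : ℝ} (hc : 0 < c) :
    ∫⁻ ω, F (ω / c) = ENNReal.ofReal c * ∫⁻ x, F x := by
  have h := Real.map_volume_mul_right (a := c⁻¹) (inv_ne_zero hc.ne')
  simp only [div_eq_mul_inv]
  rw [← lintegral_map hF (measurable_mul_const c⁻¹), h, lintegral_smul_measure, inv_inv, abs_of_pos hc, smul_eq_mul]

/-- Plancherel's theorem on the line with the phases `exp (-i s ω)`. -/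
theorem lintegral_integral_phase_sq {u : ℝ → ℂ} (h1 : Integrable u volume)
    (h2 : MemLp u 2 volume) :
    ∫⁻ ω, ‖∫ s, phase s ω * u s‖ₑ ^ 2 = ENNReal.ofReal (2 * Real.pi) * ∫⁻ s, ‖u s‖ₑ ^ 2 := by
  have hF : ∀ ω : ℝ, ∫ s, phase s ω * u s = 𝓕 u (ω / (2 * Real.pi)) := by
    intro ω
    rw [Real.fourier_eq']
    refine integral_congr_ae (Eventually.of_forall fun s ↦ ?_)
    simp only [phase, smul_eq_mul]
    congr 2
    have hpi : (Real.pi : ℂ) ≠ 0 := by exact_mod_cast Real.pi_ne_zero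
    simp
    field_simp
  have hc : Continuous (𝓕 u) :=
    VectorFourier.fourierIntegral_continuous Real.continuous_fourierChar
      (by simpa using (by fun_prop : Continuous fun p : ℝ × ℝ ↦ p.2 * p.1)) h1
  simp only [hF]
  rw [lintegral_comp_div_const (F := fun x ↦ ‖𝓕 u x‖ₑ ^ 2)
    (hc.measurable.enorm.pow_const 2) (by positivity)]
  congr 1
  have e := Lp.norm_fourier_eq (h2.toLp u)
  have e2 : eLpNorm (𝓕 (h2.toLp u) : Lp ℂ 2 (volume : Measure ℝ)) 2 volume
      = eLpNorm (h2.toLp u) 2 volume := by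
    rw [← Lp.enorm_def, ← Lp.enorm_def]
    exact enorm_eq_iff_norm_eq.2 e
  rw [eLpNorm_congr_ae (fourier_toLp_ae_eq h1 h2), eLpNorm_congr_ae h2.coeFn_toLp] at e2
  rw [← eLpNorm_two_sq, e2, eLpNorm_two_sq]


/-! ### The Volterra function of order `-1` -/

/-- The function `1 / Γ` on the positive half-line, extended by zero. -/
def recipGamma (s : ℝ) : ℝ := (Ioi (0 : ℝ)).indicator (fun s ↦ (Real.Gamma s)⁻¹) s

theorem recipGamma_of_pos {s : ℝ} (hs : 0 < s) : recipGamma s = (Real.Gamma s)⁻¹ :=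
  indicator_of_mem (mem_Ioi.2 hs) _

theorem recipGamma_nonneg (s : ℝ) : 0 ≤ recipGamma s :=
  indicator_nonneg (fun _ hs ↦ inv_nonneg.2 (Real.Gamma_pos_of_pos hs).le) s

theorem measurable_recipGamma : Measurable recipGamma := by
  have hc : ContinuousOn (fun s : ℝ ↦ (Real.Gamma s)⁻¹) (Ioi 0) := by
    refine ContinuousOn.inv₀ (fun s hs ↦ ?_) fun s hs ↦ (Real.Gamma_pos_of_pos hs).ne'
    refine (Real.differentiableAt_Gamma fun m ↦ ?_).continuousAt.continuousWithinAt
    have : (0 : ℝ) < s := hs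
    have h2 : (0 : ℝ) ≤ m := m.cast_nonneg
    linarith
  exact hc.measurable_piecewise continuousOn_const measurableSet_Ioi

/-- On `x > 1` the weight `x^(s-1)` is at least `1`; discarding `(0, 1]` from Euler's integral
leaves at least `∫₁^∞ e^{-x} dx`. -/
theorem exp_neg_one_le_Gamma {s : ℝ} (hs : 1 ≤ s) : Real.exp (-1) ≤ Real.Gamma s := by
  have hs0 : 0 < s := by linarith
  rw [Real.Gamma_eq_integral hs0, ← integral_exp_neg_Ioi 1]
  have hint := Real.GammaIntegral_convergent hs0
  calc ∫ x in Ioi (1 : ℝ), Real.exp (-x)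
      ≤ ∫ x in Ioi (1 : ℝ), Real.exp (-x) * x ^ (s - 1) := by
        refine setIntegral_mono_on (integrableOn_exp_neg_Ioi 1)
          (hint.mono_set (Ioi_subset_Ioi zero_le_one)) measurableSet_Ioi fun x hx ↦ ?_
        have : 1 ≤ x ^ (s - 1) := Real.one_le_rpow (le_of_lt hx) (by linarith)
        exact le_mul_of_one_le_right (Real.exp_pos _).le this
    _ ≤ ∫ x in Ioi (0 : ℝ), Real.exp (-x) * x ^ (s - 1) := by
        refine setIntegral_mono_set hint ?_ (Ioi_subset_Ioi zero_le_one).eventuallyLE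
        filter_upwards [ae_restrict_mem measurableSet_Ioi] with x hx
        exact mul_nonneg (Real.exp_pos _).le (Real.rpow_nonneg (le_of_lt hx) _)

theorem inv_Gamma_le {s : ℝ} (hs : 1 ≤ s) : (Real.Gamma s)⁻¹ ≤ 3 := by
  have h := inv_anti₀ (Real.exp_pos _) (exp_neg_one_le_Gamma hs)
  rw [Real.exp_neg, inv_inv] at h
  have := Real.exp_one_lt_d9
  linarith

/-- From `Γ(s+1) = s Γ(s)`. The linear vanishing of `1/Γ` at `0` is what makes `volterraI`
integrable at the origin; boundedness of `1/Γ` alone would give only `1/(t |log t|)`. -/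
theorem recipGamma_le (s : ℝ) (hs : 0 < s) : recipGamma s ≤ 3 * s := by
  rw [recipGamma_of_pos hs]
  have h1 := inv_Gamma_le (s := s + 1) (by linarith)
  rw [Real.Gamma_add_one hs.ne', mul_inv] at h1
  have : (Real.Gamma s)⁻¹ = s * (s⁻¹ * (Real.Gamma s)⁻¹) := by field_simp
  rw [this, mul_comm 3 s]
  exact mul_le_mul_of_nonneg_left h1 hs.le

theorem volterraI_eq (t : ℝ) : volterraI t = ∫ s in Ioi (0 : ℝ), t ^ (s - 1) * recipGamma s := by
  rw [volterraI]
  refine setIntegral_congr_fun measurableSet_Ioi fun s hs ↦ ?_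
  simp only [recipGamma_of_pos (mem_Ioi.1 hs), div_eq_mul_inv]

theorem measurable_volterra_kernel :
    Measurable fun p : ℝ × ℝ ↦ p.1 ^ (p.2 - 1) * recipGamma p.2 :=
  (measurable_fst.pow (measurable_snd.sub_const 1)).mul
    (measurable_recipGamma.comp measurable_snd)

theorem measurable_volterraI : Measurable volterraI := by
  have : volterraI = fun t ↦ ∫ s in Ioi (0 : ℝ), t ^ (s - 1) * recipGamma s :=
    funext volterraI_eq
  rw [this]
  exact (measurable_volterra_kernel.stronglyMeasurable.integral_prod_right).measurable

theorem volterraI_nonneg {t : ℝ} (ht : 0 ≤ t) : 0 ≤ volterraI t := by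
  rw [volterraI_eq]
  exact setIntegral_nonneg measurableSet_Ioi fun s _ ↦
    mul_nonneg (Real.rpow_nonneg ht _) (recipGamma_nonneg s)

theorem neg_log_pos {t : ℝ} (h0 : 0 < t) (h1 : t < 1) : 0 < -Real.log t :=
  neg_pos.2 (Real.log_neg h0 h1)

theorem rpow_sub_one_eq {t : ℝ} (h0 : 0 < t) (s : ℝ) :
    t ^ (s - 1) = t⁻¹ * Real.exp (-(-Real.log t * s)) := by
  rw [Real.rpow_sub_one h0.ne', Real.rpow_def_of_pos h0]
  rw [neg_mul, neg_neg, div_eq_mul_inv, mul_comm]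

theorem integral_mul_rpow_sub_one {t : ℝ} (h0 : 0 < t) (h1 : t < 1) :
    IntegrableOn (fun s ↦ s * t ^ (s - 1)) (Ioi 0) ∧
    ∫ s in Ioi (0 : ℝ), s * t ^ (s - 1) = 1 / (t * Real.log t ^ 2) := by
  have hl := neg_log_pos h0 h1
  have h := Real.integral_rpow_mul_exp_neg_mul_Ioi (a := 2) (by norm_num) hl
  have e : ∫ s in Ioi (0 : ℝ), s * t ^ (s - 1) = 1 / (t * Real.log t ^ 2) := by
    have : ∀ s : ℝ, s * t ^ (s - 1) =
        t⁻¹ * (s ^ ((2 : ℝ) - 1) * Real.exp (-(-Real.log t * s))) := by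
      intro s
      rw [rpow_sub_one_eq h0, show (2 : ℝ) - 1 = 1 by norm_num, Real.rpow_one]
      ring
    simp only [this]
    rw [integral_const_mul, h]
    have hl' : Real.log t ≠ 0 := by linarith
    rw [Real.Gamma_two, mul_one]
    norm_num
    ring
  refine ⟨?_, e⟩
  -- The Bochner integral of a non-integrable function is `0`, whereas the value just computed is
  -- positive.
  by_contra hn
  rw [integral_undef hn] at e
  have : 0 < 1 / (t * Real.log t ^ 2) := by
    have hl' : Real.log t ≠ 0 := by linarith
    positivity
  linarith

theorem integrableOn_volterra_kernel {t : ℝ} (h0 : 0 < t) (h1 : t < 1) :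
    IntegrableOn (fun s ↦ t ^ (s - 1) * recipGamma s) (Ioi 0) := by
  refine Integrable.mono' ((integral_mul_rpow_sub_one h0 h1).1.const_mul 3) ?_ ?_
  · exact (measurable_volterra_kernel.comp (measurable_const.prodMk measurable_id)).aestronglyMeasurable
  · filter_upwards [ae_restrict_mem measurableSet_Ioi] with s hs
    rw [Real.norm_of_nonneg (mul_nonneg (Real.rpow_nonneg h0.le _) (recipGamma_nonneg s))]
    have := mul_le_mul_of_nonneg_left (recipGamma_le s hs) (Real.rpow_nonneg h0.le (s - 1))
    linarith

/-- Insert `1/Γ(s) ≤ 3s` under the integral. The majorant is three times the derivative of `-1/log`,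
hence integrable at `0`, with a primitive that tends to `0` only logarithmically. -/
theorem volterraI_le {t : ℝ} (h0 : 0 < t) (h1 : t < 1) :
    volterraI t ≤ 3 * (1 / (t * Real.log t ^ 2)) := by
  rw [volterraI_eq, ← (integral_mul_rpow_sub_one h0 h1).2, ← integral_const_mul]
  refine setIntegral_mono_on (integrableOn_volterra_kernel h0 h1)
    ((integral_mul_rpow_sub_one h0 h1).1.const_mul 3) measurableSet_Ioi fun s hs ↦ ?_
  have := mul_le_mul_of_nonneg_left (recipGamma_le s hs) (Real.rpow_nonneg h0.le (s - 1))
  linarith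

/-! ### The logarithmic modulus and the primitive of the Volterra function. -/

/-- The modulus of continuity `1 / |log h|`. -/
def logMod (h : ℝ) : ℝ := -(Real.log h)⁻¹

theorem continuousOn_logMod : ContinuousOn logMod (Ico 0 1) := by
  intro x hx
  rcases eq_or_lt_of_le hx.1 with h | h
  · subst h
    have h1 : Tendsto logMod (𝓝[>] 0) (𝓝 0) := by
      have := (tendsto_inv_atBot_zero.comp Real.tendsto_log_nhdsGT_zero).neg
      exact (by simpa [Function.comp_def] using this : Tendsto (fun x ↦ -(Real.log x)⁻¹) (𝓝[>] 0) (𝓝 0))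
    have h2 : ContinuousWithinAt logMod (Ici 0) 0 := by
      rw [← Ioi_insert, continuousWithinAt_insert_self]
      unfold ContinuousWithinAt
      simpa [logMod] using h1
    exact h2.mono Ico_subset_Ici_self
  · have : Real.log x ≠ 0 := (Real.log_neg h hx.2).ne
    exact ((Real.continuousAt_log h.ne').inv₀ this).neg.continuousWithinAt

theorem hasDerivAt_logMod {x : ℝ} (h0 : 0 < x) (h1 : x < 1) :
    HasDerivAt logMod (1 / (x * Real.log x ^ 2)) x := by
  have hl : Real.log x ≠ 0 := (Real.log_neg h0 h1).ne
  have := ((Real.hasDerivAt_log h0.ne').inv hl).neg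
  refine this.congr_deriv ?_
  field_simp

theorem integrableOn_deriv_logMod {r : ℝ} (h1 : r < 1) :
    IntegrableOn (fun x : ℝ ↦ 1 / (x * Real.log x ^ 2)) (Ioc 0 r) := by
  refine intervalIntegral.integrableOn_deriv_of_nonneg (g := logMod)
    (continuousOn_logMod.mono fun x hx ↦ ⟨hx.1, hx.2.trans_lt h1⟩)
    (fun x hx ↦ hasDerivAt_logMod hx.1 (hx.2.trans h1)) fun x hx ↦ ?_
  have := hx.1
  positivity

theorem integral_deriv_logMod {r : ℝ} (h0 : 0 ≤ r) (h1 : r < 1) :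
    ∫ x in (0 : ℝ)..r, 1 / (x * Real.log x ^ 2) = logMod r := by
  rw [intervalIntegral.integral_eq_sub_of_hasDerivAt_of_le h0
    (continuousOn_logMod.mono fun x hx ↦ ⟨hx.1, hx.2.trans_lt h1⟩)
    (fun x hx ↦ hasDerivAt_logMod hx.1 (hx.2.trans h1))
    ((intervalIntegrable_iff_integrableOn_Ioc_of_le h0).2 (integrableOn_deriv_logMod h1))]
  simp [logMod]

theorem integrableOn_volterraI {r : ℝ} (h1 : r < 1) : IntegrableOn volterraI (Ioc 0 r) := by
  refine Integrable.mono' ((integrableOn_deriv_logMod h1).const_mul 3)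
    measurable_volterraI.aestronglyMeasurable ?_
  filter_upwards [ae_restrict_mem measurableSet_Ioc] with s hs
  rw [Real.norm_of_nonneg (volterraI_nonneg hs.1.le)]
  exact volterraI_le hs.1 (hs.2.trans_lt h1)

theorem intervalIntegrable_volterraI {r : ℝ} (h0 : 0 ≤ r) (h1 : r < 1) :
    IntervalIntegrable volterraI volume 0 r :=
  (intervalIntegrable_iff_integrableOn_Ioc_of_le h0).2 (integrableOn_volterraI h1)

/-- The primitive of the Volterra function. -/
def volterraN (t : ℝ) : ℝ := ∫ s in (0 : ℝ)..t, volterraI s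

theorem volterraN_le {t : ℝ} (h0 : 0 ≤ t) (h1 : t < 1) : volterraN t ≤ 3 * logMod t := by
  rw [← integral_deriv_logMod h0 h1, ← intervalIntegral.integral_const_mul]
  refine intervalIntegral.integral_mono_on_of_le_Ioo h0 (intervalIntegrable_volterraI h0 h1)
    (((intervalIntegrable_iff_integrableOn_Ioc_of_le h0).2
      (integrableOn_deriv_logMod h1)).const_mul 3) fun x hx ↦
    volterraI_le hx.1 (hx.2.trans h1)

theorem volterraN_nonneg {t : ℝ} (h0 : 0 ≤ t) : 0 ≤ volterraN t :=
  intervalIntegral.integral_nonneg h0 fun _ hs ↦ volterraI_nonneg hs.1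


/-! ### The Sonine identity, from Euler's Beta integral. -/

theorem integral_beta {s b t : ℝ} (hs : 0 < s) (hb : 0 < b) (ht : 0 < t) :
    IntegrableOn (fun τ ↦ (t - τ) ^ (s - 1) * τ ^ (b - 1)) (Ioc 0 t) ∧
    ∫ τ in Ioc 0 t, (t - τ) ^ (s - 1) * τ ^ (b - 1) =
      t ^ (s + b - 1) * (Real.Gamma s * Real.Gamma b / Real.Gamma (s + b)) := by
  have e : ∫ τ in Ioc 0 t, (t - τ) ^ (s - 1) * τ ^ (b - 1) =
      t ^ (s + b - 1) * (Real.Gamma s * Real.Gamma b / Real.Gamma (s + b)) := by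
    have h := Complex.betaIntegral_scaled (b : ℂ) (s : ℂ) ht
    rw [Complex.betaIntegral_eq_Gamma_mul_div _ _ (by simpa) (by simpa)] at h
    have h2 : ∫ x in (0 : ℝ)..t, (x : ℂ) ^ ((b : ℂ) - 1) * ((t : ℂ) - x) ^ ((s : ℂ) - 1) =
        ((∫ x in (0 : ℝ)..t, (t - x) ^ (s - 1) * x ^ (b - 1) : ℝ) : ℂ) := by
      rw [← intervalIntegral.integral_ofReal]
      refine intervalIntegral.integral_congr fun x hx ↦ ?_
      rw [uIcc_of_le ht.le] at hx
      rw [Complex.ofReal_mul, Complex.ofReal_cpow hx.1, Complex.ofReal_cpow (by linarith [hx.2])]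
      push_cast
      ring
    rw [h2] at h
    rw [← intervalIntegral.integral_of_le ht.le]
    rw [← Complex.ofReal_add, Complex.Gamma_ofReal, Complex.Gamma_ofReal, Complex.Gamma_ofReal,
      ← Complex.ofReal_one, ← Complex.ofReal_sub, ← Complex.ofReal_cpow ht.le, ← Complex.ofReal_mul,
      ← Complex.ofReal_div, ← Complex.ofReal_mul, Complex.ofReal_inj] at h
    rw [h, add_comm s b, mul_comm (Real.Gamma s)]
  refine ⟨?_, e⟩
  by_contra hn
  rw [integral_undef hn] at e
  have h1 := Real.Gamma_pos_of_pos hs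
  have h2 := Real.Gamma_pos_of_pos hb
  have h3 := Real.Gamma_pos_of_pos (add_pos hs hb)
  have h4 := Real.rpow_pos_of_pos ht (s + b - 1)
  have : 0 < t ^ (s + b - 1) * (Real.Gamma s * Real.Gamma b / Real.Gamma (s + b)) := by positivity
  linarith

/-- The Beta integral in `τ` replaces `1/Γ(s)` by `Γ(b)/Γ(s+b)`. The integrand is non-negative, so
the iterated integral is also that of its absolute value, and its finiteness justifies Fubini. -/
theorem integrable_volterra_power {b t : ℝ} (hb : 0 < b) (h0 : 0 < t) (h1 : t < 1) :
    Integrable (Function.uncurry fun τ s : ℝ ↦ (t - τ) ^ (s - 1) * recipGamma s * τ ^ (b - 1))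
      ((volume.restrict (Ioc 0 t)).prod (volume.restrict (Ioi 0))) ∧
    ∀ s : ℝ, 0 < s → ∫ τ in Ioc 0 t, (t - τ) ^ (s - 1) * recipGamma s * τ ^ (b - 1) =
      Real.Gamma b * (t ^ (s + b - 1) * recipGamma (s + b)) := by
  have hval : ∀ s : ℝ, 0 < s →
      ∫ τ in Ioc 0 t, (t - τ) ^ (s - 1) * recipGamma s * τ ^ (b - 1) =
      Real.Gamma b * (t ^ (s + b - 1) * recipGamma (s + b)) := by
    intro s hs
    have := (integral_beta hs hb h0).2
    have hG := (Real.Gamma_pos_of_pos hs).ne'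
    calc ∫ τ in Ioc 0 t, (t - τ) ^ (s - 1) * recipGamma s * τ ^ (b - 1)
        = ∫ τ in Ioc 0 t, recipGamma s * ((t - τ) ^ (s - 1) * τ ^ (b - 1)) := by
          congr 1; ext τ; ring
      _ = _ := by
          rw [integral_const_mul, this, recipGamma_of_pos hs, recipGamma_of_pos (add_pos hs hb)]
          field_simp
  have hmeas : Measurable
      (Function.uncurry fun τ s : ℝ ↦ (t - τ) ^ (s - 1) * recipGamma s * τ ^ (b - 1)) :=
    (measurable_volterra_kernel.comp ((measurable_fst.const_sub t).prodMk measurable_snd)).mul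
      (measurable_fst.pow_const (b - 1))
  refine ⟨(integrable_prod_iff' hmeas.aestronglyMeasurable).2 ⟨?_, ?_⟩, hval⟩
  · filter_upwards [ae_restrict_mem measurableSet_Ioi] with s hs
    have := (integral_beta hs hb h0).1.const_mul (recipGamma s)
    refine this.congr (Eventually.of_forall fun τ ↦ ?_)
    simp only [Function.uncurry]
    ring
  · have hnn : ∀ s ∈ Ioi (0 : ℝ), ∫ τ in Ioc 0 t, ‖Function.uncurry
        (fun τ s : ℝ ↦ (t - τ) ^ (s - 1) * recipGamma s * τ ^ (b - 1)) (τ, s)‖ =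
        Real.Gamma b * (t ^ (s + b - 1) * recipGamma (s + b)) := by
      intro s hs
      rw [← hval s hs]
      refine setIntegral_congr_fun measurableSet_Ioc fun τ hτ ↦ ?_
      simp only [Function.uncurry]
      refine Real.norm_of_nonneg (mul_nonneg (mul_nonneg ?_ (recipGamma_nonneg s)) ?_)
      · exact Real.rpow_nonneg (by linarith [hτ.2]) _
      · exact Real.rpow_nonneg hτ.1.le _
    have hsh : IntegrableOn (fun s ↦ t ^ (s + b - 1) * recipGamma (s + b)) (Ioi 0) := by
      have h := (measurePreserving_add_right (volume : Measure ℝ) b).integrableOn_comp_preimage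
        (measurableEmbedding_addRight b) (f := fun s ↦ t ^ (s - 1) * recipGamma s) (s := Ioi b)
      have hp : (fun x : ℝ ↦ x + b) ⁻¹' Ioi b = Ioi 0 := by ext; simp
      rw [hp] at h
      exact h.2 ((integrableOn_volterra_kernel h0 h1).mono_set (Ioi_subset_Ioi hb.le))
    refine Integrable.congr (hsh.const_mul (Real.Gamma b)) ?_
    filter_upwards [ae_restrict_mem measurableSet_Ioi] with s hs
    exact (hnn s hs).symm

/-- Fubini and the shift `s ↦ s + b`. Convolving with `τ^(b-1)` amounts to raising the lower limit
of the `s`-integral to `b`, up to the factor `Γ(b)`; a derivative in `b` at `1` then produces a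
logarithm. -/
theorem integral_volterraI_mul_rpow {b t : ℝ} (hb : 0 < b) (h0 : 0 < t) (h1 : t < 1) :
    IntegrableOn (fun τ ↦ volterraI (t - τ) * τ ^ (b - 1)) (Ioc 0 t) ∧
    ∫ τ in Ioc 0 t, volterraI (t - τ) * τ ^ (b - 1) =
      Real.Gamma b * ∫ s in Ioi b, t ^ (s - 1) * recipGamma s := by
  obtain ⟨hint, hval⟩ := integrable_volterra_power hb h0 h1
  have hin : ∀ τ, ∫ s in Ioi (0 : ℝ), (t - τ) ^ (s - 1) * recipGamma s * τ ^ (b - 1) =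
      volterraI (t - τ) * τ ^ (b - 1) := fun τ ↦ by
    rw [integral_mul_const, volterraI_eq]
  constructor
  · have := hint.integral_prod_left
    refine this.congr (Eventually.of_forall fun τ ↦ ?_)
    simp only [Function.uncurry]
    exact hin τ
  · simp only [← hin]
    rw [integral_integral_swap hint, setIntegral_congr_fun measurableSet_Ioi fun s hs ↦ hval s hs,
      integral_const_mul]
    congr 1
    have h := (measurePreserving_add_right (volume : Measure ℝ) b).setIntegral_preimage_emb
        (measurableEmbedding_addRight b) (fun s ↦ t ^ (s - 1) * recipGamma s) (Ioi b)
    have hp : (fun x : ℝ ↦ x + b) ⁻¹' Ioi b = Ioi 0 := by ext; simp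
    rw [hp] at h
    exact h

/-- A majorant of the `b`-derivative of `τ^(b-1)` that is uniform in `b ≥ 1/2`: a factor `τ^(1/4)`
absorbs the logarithm and leaves `τ^(-3/4)`, whose product with the Volterra function is still
integrable. -/
theorem abs_log_mul_rpow_le {τ b : ℝ} (h0 : 0 < τ) (h1 : τ ≤ 1) (hb : 1 / 2 ≤ b) :
    |τ ^ (b - 1) * Real.log τ| ≤ 4 * τ ^ ((1 / 4 : ℝ) - 1) := by
  have hl := Real.abs_log_mul_self_rpow_lt τ (1 / 4) h0 h1 (by norm_num)
  have e : τ ^ (b - 1) ≤ τ ^ ((1 / 2 : ℝ) - 1) :=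
    Real.rpow_le_rpow_of_exponent_ge h0 h1 (by linarith)
  have e2 : τ ^ ((1 / 2 : ℝ) - 1) = τ ^ (1 / 4 : ℝ) * τ ^ ((1 / 4 : ℝ) - 1) := by
    rw [← Real.rpow_add h0]; norm_num
  have p := Real.rpow_pos_of_pos h0 ((1 / 4 : ℝ) - 1)
  have p2 := Real.rpow_pos_of_pos h0 (1 / 4 : ℝ)
  have p3 := Real.rpow_pos_of_pos h0 (b - 1)
  rw [abs_mul, abs_of_pos p3]
  rw [abs_mul, abs_of_pos p2] at hl
  calc τ ^ (b - 1) * |Real.log τ| ≤ τ ^ ((1 / 2 : ℝ) - 1) * |Real.log τ| :=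
        mul_le_mul_of_nonneg_right e (abs_nonneg _)
    _ = (|Real.log τ| * τ ^ (1 / 4 : ℝ)) * τ ^ ((1 / 4 : ℝ) - 1) := by rw [e2]; ring
    _ ≤ 4 * τ ^ ((1 / 4 : ℝ) - 1) := by
        refine mul_le_mul_of_nonneg_right ?_ p.le
        norm_num at hl
        linarith

/-- Differentiation in the lower limit gives minus the integrand at `1`, which is `t⁰/Γ(1) = 1` for
every `t`. This is the constant on the right of the Sonine identity. -/
theorem hasDerivAt_tail_volterra {t : ℝ} (h0 : 0 < t) (h1 : t < 1) :
    HasDerivAt (fun b ↦ ∫ s in Ioi b, t ^ (s - 1) * recipGamma s) (-1) 1 := by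
  have hcont : ContinuousAt (fun s ↦ t ^ (s - 1) * recipGamma s) 1 := by
    have hr : ContinuousAt (fun s : ℝ ↦ (Real.Gamma s)⁻¹) 1 := by
      refine ContinuousAt.inv₀ (Real.hasDerivAt_Gamma_one.continuousAt) (by simp)
    have hr' : ContinuousAt recipGamma 1 := hr.congr (by
      filter_upwards [Ioi_mem_nhds (zero_lt_one (α := ℝ))] with s hs
      exact (recipGamma_of_pos hs).symm)
    refine ContinuousAt.mul ?_ hr'
    exact (Real.continuousAt_const_rpow h0.ne').comp (by fun_prop)
  have hI := integrableOn_volterra_kernel h0 h1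
  have hii : ∀ b : ℝ, 0 ≤ b → IntervalIntegrable (fun s ↦ t ^ (s - 1) * recipGamma s) volume 0 b :=
    fun b hb ↦ (intervalIntegrable_iff_integrableOn_Ioc_of_le hb).2
      (hI.mono_set Ioc_subset_Ioi_self)
  have hd := intervalIntegral.integral_hasDerivAt_right (hii 1 zero_le_one)
    (measurable_volterra_kernel.comp (measurable_const.prodMk measurable_id)).stronglyMeasurable.stronglyMeasurableAtFilter hcont
  have hv : t ^ ((1 : ℝ) - 1) * recipGamma 1 = 1 := by
    rw [recipGamma_of_pos one_pos]; simp
  have hd2 := (hd.const_sub (∫ s in Ioi (0 : ℝ), t ^ (s - 1) * recipGamma s))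
  rw [hv] at hd2
  refine hd2.congr_of_eventuallyEq ?_
  filter_upwards [Ioi_mem_nhds (zero_lt_one (α := ℝ))] with b hb
  have hb' : (0 : ℝ) ≤ b := le_of_lt hb
  rw [intervalIntegral.integral_of_le hb', eq_sub_iff_add_eq, add_comm,
    ← setIntegral_union (Ioc_disjoint_Ioi le_rfl) measurableSet_Ioi
      (hI.mono_set Ioc_subset_Ioi_self) (hI.mono_set (Ioi_subset_Ioi hb')), Ioc_union_Ioi_eq_Ioi hb']

/-- The kernel `-γ - log t`, the Sonine companion of the Volterra function. -/
def logKer (t : ℝ) : ℝ := -Real.eulerMascheroniConstant - Real.log t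

theorem integrableOn_volterraI_sub {t : ℝ} (h0 : 0 < t) (h1 : t < 1) :
    IntegrableOn (fun τ ↦ volterraI (t - τ)) (Ioc 0 t) := by
  have := (integral_volterraI_mul_rpow one_pos h0 h1).1
  simpa using this

/-- The Sonine identity `I * (-γ - log) = 1`. -/
theorem integral_volterraI_mul_logKer {t : ℝ} (h0 : 0 < t) (h1 : t < 1) :
    IntegrableOn (fun τ ↦ volterraI (t - τ) * logKer τ) (Ioc 0 t) ∧
    ∫ τ in Ioc 0 t, volterraI (t - τ) * logKer τ = 1 := by
  have hm : Measurable fun τ ↦ volterraI (t - τ) := measurable_volterraI.comp (measurable_const.sub measurable_id)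
  -- The formula for `I * τ^(b-1)` is differentiated at `b = 1`. Its left side gives `I * log`; its
  -- right side gives `-γ (I * 1) - 1`, because `Γ'(1) = -γ`.
  have hD := hasDerivAt_integral_of_dominated_loc_of_deriv_le (μ := volume.restrict (Ioc 0 t))
    (F := fun b τ ↦ volterraI (t - τ) * τ ^ (b - 1))
    (F' := fun b τ ↦ volterraI (t - τ) * (τ ^ (b - 1) * Real.log τ))
    (bound := fun τ ↦ 4 * (volterraI (t - τ) * τ ^ ((1 / 4 : ℝ) - 1)))
    (x₀ := 1) (s := Ioi (1 / 2 : ℝ)) (Ioi_mem_nhds (by norm_num))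
    (Eventually.of_forall fun b ↦ (hm.mul (measurable_id.pow_const _)).aestronglyMeasurable)
    (integral_volterraI_mul_rpow one_pos h0 h1).1
    (hm.mul ((measurable_id.pow_const _).mul Real.measurable_log)).aestronglyMeasurable
    (by
      filter_upwards [ae_restrict_mem measurableSet_Ioc] with τ hτ b hb
      have hn := volterraI_nonneg (t := t - τ) (by linarith [hτ.2])
      rw [norm_mul, Real.norm_of_nonneg hn]
      have := mul_le_mul_of_nonneg_left
        (abs_log_mul_rpow_le hτ.1 (by linarith [hτ.2]) (le_of_lt hb)) hn
      rw [Real.norm_eq_abs]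
      linarith)
    ((integral_volterraI_mul_rpow (by norm_num) h0 h1).1.const_mul 4)
    (by
      filter_upwards [ae_restrict_mem measurableSet_Ioc] with τ hτ b hb
      have h := ((hasDerivAt_id b).sub_const 1).const_rpow (a := τ) hτ.1
      have h2 := h.const_mul (volterraI (t - τ))
      refine h2.congr_deriv ?_
      simp
      left
      ring)
  obtain ⟨hint, hder⟩ := hD
  have hR := hasDerivAt_tail_volterra h0 h1
  have hder2 := Real.hasDerivAt_Gamma_one.mul hR
  have hder3 : HasDerivAt (fun b : ℝ ↦ ∫ τ in Ioc 0 t, volterraI (t - τ) * τ ^ (b - 1))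
      (-Real.eulerMascheroniConstant * (∫ s in Ioi (1 : ℝ), t ^ (s - 1) * recipGamma s)
        + Real.Gamma 1 * (-1)) 1 := by
    refine hder2.congr_of_eventuallyEq ?_
    filter_upwards [Ioi_mem_nhds (zero_lt_one (α := ℝ))] with b hb
    exact (integral_volterraI_mul_rpow hb h0 h1).2
  have hu := hder.unique hder3
  have hN := (integral_volterraI_mul_rpow one_pos h0 h1).2
  simp only [sub_self, Real.rpow_zero, one_mul, mul_one, Real.Gamma_one] at hu hN hint
  have hI := integrableOn_volterraI_sub h0 h1
  have hsplit : ∀ τ, volterraI (t - τ) * logKer τ =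
      -Real.eulerMascheroniConstant * volterraI (t - τ) - volterraI (t - τ) * Real.log τ := by
    intro τ; rw [logKer]; ring
  simp only [hsplit]
  refine ⟨(hI.const_mul _).sub hint, ?_⟩
  rw [integral_sub (hI.const_mul _) hint, integral_const_mul, hu, hN]
  ring


/-! ### Moduli of continuity for convolutions with the Volterra function -/

theorem logMod_nonneg {h : ℝ} (h0 : 0 ≤ h) (h1 : h ≤ 1) : 0 ≤ logMod h :=
  neg_nonneg.2 (inv_nonpos.2 (Real.log_nonpos h0 h1))

theorem self_le_logMod {h : ℝ} (h0 : 0 ≤ h) (h1 : h < 1) : h ≤ logMod h := by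
  rcases eq_or_lt_of_le h0 with rfl | hp
  · simp [logMod]
  · have hl := neg_log_pos hp h1
    have h2 := Real.one_sub_inv_le_log_of_pos hp
    rw [logMod, ← inv_neg]
    rw [le_inv_comm₀ hp hl]
    linarith

theorem volterraN_mono {s t : ℝ} (hs : 0 ≤ s) (hst : s ≤ t) (ht : t < 1) :
    volterraN s ≤ volterraN t := by
  refine intervalIntegral.integral_mono_interval le_rfl hs hst ?_
    (intervalIntegrable_volterraI (hs.trans hst) ht)
  filter_upwards [ae_restrict_mem measurableSet_Ioc] with x hx
  exact volterraI_nonneg hx.1.le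

/-- The exponent integral is cut at `s = 1`: `t^(s-1)` decreases in `t` for `s < 1` and increases
for `s > 1`. So `I` is a decreasing function plus the bounded increasing `J`, and the variation of
each part is a signed difference, which later telescopes. -/
theorem volterraI_split_bound : ∃ (M : ℝ) (J : ℝ → ℝ), 0 ≤ M ∧ Measurable J ∧
    (∀ x, 0 < x → x ≤ 1 / 8 → 0 ≤ J x ∧ J x ≤ M) ∧
    (∀ x h, 0 < x → 0 ≤ h → x + h ≤ 1 / 8 →
      J x ≤ J (x + h) ∧ |volterraI (x + h) - volterraI x| ≤
        (volterraI x - volterraI (x + h)) + 2 * (J (x + h) - J x)) := by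
  set J : ℝ → ℝ := fun t ↦ ∫ s in Ioi (1 : ℝ), t ^ (s - 1) * recipGamma s with hJ
  have hint : ∀ x : ℝ, 0 < x → x ≤ 1 / 8 →
      IntegrableOn (fun s ↦ x ^ (s - 1) * recipGamma s) (Ioi 0) := fun x h0 h1 ↦
    integrableOn_volterra_kernel h0 (by linarith)
  have hmono : ∀ x y : ℝ, 0 < x → x ≤ y → y ≤ 1 / 8 → J x ≤ J y := by
    intro x y hx hxy hy
    refine setIntegral_mono_on ((hint x hx (hxy.trans hy)).mono_set (Ioi_subset_Ioi zero_le_one))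
      ((hint y (hx.trans_le hxy) hy).mono_set (Ioi_subset_Ioi zero_le_one)) measurableSet_Ioi
      fun s hs ↦ mul_le_mul_of_nonneg_right ?_ (recipGamma_nonneg s)
    exact Real.rpow_le_rpow hx.le hxy (by linarith [mem_Ioi.1 hs])
  have hnn : ∀ x : ℝ, 0 < x → 0 ≤ J x := fun x hx ↦ setIntegral_nonneg measurableSet_Ioi
    fun s _ ↦ mul_nonneg (Real.rpow_nonneg hx.le _) (recipGamma_nonneg s)
  have hsplit : ∀ x : ℝ, 0 < x → x ≤ 1 / 8 →
      volterraI x = (∫ s in Ioc (0 : ℝ) 1, x ^ (s - 1) * recipGamma s) + J x := by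
    intro x h0 h1
    rw [volterraI_eq, ← Ioc_union_Ioi_eq_Ioi (zero_le_one (α := ℝ)),
      setIntegral_union (Ioc_disjoint_Ioi le_rfl) measurableSet_Ioi
      ((hint x h0 h1).mono_set Ioc_subset_Ioi_self)
      ((hint x h0 h1).mono_set (Ioi_subset_Ioi zero_le_one))]
  have hanti : ∀ x y : ℝ, 0 < x → x ≤ y → y ≤ 1 / 8 →
      (∫ s in Ioc (0 : ℝ) 1, y ^ (s - 1) * recipGamma s) ≤
      ∫ s in Ioc (0 : ℝ) 1, x ^ (s - 1) * recipGamma s := by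
    intro x y hx hxy hy
    refine setIntegral_mono_on ((hint y (hx.trans_le hxy) hy).mono_set Ioc_subset_Ioi_self)
      ((hint x hx (hxy.trans hy)).mono_set Ioc_subset_Ioi_self) measurableSet_Ioc
      fun s hs ↦ mul_le_mul_of_nonneg_right ?_ (recipGamma_nonneg s)
    exact Real.rpow_le_rpow_of_nonpos hx hxy (by linarith [hs.2])
  refine ⟨J (1 / 8), J, hnn _ (by norm_num), ?_, fun x h0 h1 ↦ ⟨hnn x h0, hmono _ _ h0 h1 le_rfl⟩,
    fun x h h0 hh h1 ↦ ⟨hmono _ _ h0 (by linarith) h1, ?_⟩⟩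
  · exact (measurable_volterra_kernel.stronglyMeasurable.integral_prod_right).measurable
  · have e1 := hsplit x h0 (by linarith)
    have e2 := hsplit (x + h) (by linarith) h1
    have e3 := hanti x (x + h) h0 (by linarith) h1
    have e4 := hmono x (x + h) h0 (by linarith) h1
    rw [abs_le]
    constructor <;> linarith

/-- The signed differences of `volterraI_split_bound` telescope on integration. What remains is at
most `volterraN h`, coming from the singularity, and an integral of the bounded part over an
interval of length `h`. -/
theorem exists_integral_abs_volterraI_shift_le : ∃ C : ℝ, 0 ≤ C ∧ ∀ s h : ℝ, 0 ≤ s → 0 ≤ h →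
    s + h ≤ 1 / 8 → ∫ x in (0 : ℝ)..s, |volterraI (x + h) - volterraI x| ≤ C * logMod h := by
  obtain ⟨M, J, hM, hJm, hJb, hJ⟩ := volterraI_split_bound
  refine ⟨3 + 2 * M, by positivity, fun s h hs hh hsh ↦ ?_⟩
  have hJi : ∀ a b, 0 ≤ a → a ≤ b → b ≤ 1 / 8 → IntervalIntegrable J volume a b := by
    intro a b ha hab hb
    rw [intervalIntegrable_iff_integrableOn_Ioc_of_le hab]
    refine Measure.integrableOn_of_bounded (M := M) measure_Ioc_lt_top.ne hJm.aestronglyMeasurable ?_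
    filter_upwards [ae_restrict_mem measurableSet_Ioc] with x hx
    obtain ⟨h1, h2⟩ := hJb x (ha.trans_lt hx.1) (hx.2.trans hb)
    rwa [Real.norm_of_nonneg h1]
  have hIi : ∀ a b, 0 ≤ a → a ≤ b → b ≤ 1 / 8 → IntervalIntegrable volterraI volume a b := by
    intro a b ha hab hb
    rw [intervalIntegrable_iff_integrableOn_Ioc_of_le hab]
    exact (integrableOn_volterraI (r := 1 / 8) (by norm_num)).mono_set (Ioc_subset_Ioc ha hb)
  have hIs : IntervalIntegrable (fun x ↦ volterraI (x + h)) volume 0 s := by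
    have := (hIi h (s + h) hh (by linarith) hsh).comp_add_right h
    simpa using this
  have hJs : IntervalIntegrable (fun x ↦ J (x + h)) volume 0 s := by
    have := (hJi h (s + h) hh (by linarith) hsh).comp_add_right h
    simpa using this
  have hI0 := hIi 0 s le_rfl hs (by linarith)
  have hJ0 := hJi 0 s le_rfl hs (by linarith)
  have step : ∫ x in (0 : ℝ)..s, |volterraI (x + h) - volterraI x| ≤
      ∫ x in (0 : ℝ)..s, ((volterraI x - volterraI (x + h)) + 2 * (J (x + h) - J x)) := by
    refine intervalIntegral.integral_mono_on_of_le_Ioo hs (hIs.sub hI0).abs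
      ((hI0.sub hIs).add ((hJs.sub hJ0).const_mul 2)) fun x hx ↦ ?_
    exact (hJ x h hx.1 hh (by linarith [hx.2])).2
  rw [intervalIntegral.integral_add (hI0.sub hIs) ((hJs.sub hJ0).const_mul 2),
    intervalIntegral.integral_const_mul, intervalIntegral.integral_sub hI0 hIs,
    intervalIntegral.integral_sub hJs hJ0, intervalIntegral.integral_comp_add_right,
    intervalIntegral.integral_comp_add_right, zero_add] at step
  have a1 := intervalIntegral.integral_add_adjacent_intervals (hIi 0 h le_rfl hh (by linarith))
    (hIi h (s + h) hh (by linarith) hsh)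
  have a2 := intervalIntegral.integral_add_adjacent_intervals (hJi 0 h le_rfl hh (by linarith))
    (hJi h (s + h) hh (by linarith) hsh)
  have a3 := intervalIntegral.integral_add_adjacent_intervals hJ0
    (hJi s (s + h) hs (by linarith) hsh)
  have b1 : volterraN s ≤ volterraN (s + h) := volterraN_mono hs (by linarith) (by linarith)
  have b2 : volterraN h ≤ 3 * logMod h := volterraN_le hh (by linarith)
  have b3 : 0 ≤ ∫ x in (0 : ℝ)..h, J x := by
    refine intervalIntegral.integral_nonneg_of_ae_restrict hh ?_
    rw [EventuallyLE, ae_restrict_congr_set Ioc_ae_eq_Icc.symm]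
    filter_upwards [ae_restrict_mem measurableSet_Ioc] with x hx
    exact (hJb x hx.1 (by linarith [hx.2])).1
  have b4 : ∫ x in s..(s + h), J x ≤ M * h := by
    have := intervalIntegral.integral_mono_on_of_le_Ioo (show s ≤ s + h by linarith)
      (hJi s (s + h) hs (by linarith) hsh) (intervalIntegrable_const (c := M))
      fun x hx ↦ (hJb x (by linarith [hx.1]) (by linarith [hx.2])).2
    rw [intervalIntegral.integral_const, smul_eq_mul] at this
    linarith
  have b5 : M * h ≤ M * logMod h :=
    mul_le_mul_of_nonneg_left (self_le_logMod hh (by linarith)) hM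
  unfold volterraN at b1 b2
  linarith

/-- The convolution with the Volterra function. -/
def volterraConv (g : ℝ → ℂ) (t : ℝ) : ℂ := ∫ r in (0 : ℝ)..t, (volterraI (t - r) : ℂ) * g r

theorem intervalIntegrable_volterraI_sub {s t : ℝ} (hs : 0 ≤ s) (hst : s ≤ t) (ht : t < 1) :
    IntervalIntegrable (fun r ↦ volterraI (t - r)) volume s t := by
  have := (intervalIntegrable_volterraI (r := t - s) (by linarith) (by linarith)).comp_sub_left t
  simpa using this.symm

theorem intervalIntegrable_volterraI_mul {g : ℝ → ℂ} {G a b t : ℝ} (ha : 0 ≤ a) (hab : a ≤ b)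
    (hbt : b ≤ t) (ht : t < 1) (hg : AEStronglyMeasurable g (volume.restrict (Ioc 0 t)))
    (hG : ∀ r ∈ Ioc 0 t, ‖g r‖ ≤ G) :
    IntervalIntegrable (fun r ↦ (volterraI (t - r) : ℂ) * g r) volume a b := by
  rw [intervalIntegrable_iff_integrableOn_Ioc_of_le hab]
  have h1 : IntegrableOn (fun r ↦ (volterraI (t - r) : ℂ)) (Ioc 0 t) := by
    have := (intervalIntegrable_iff_integrableOn_Ioc_of_le (ha.trans (hab.trans hbt))).1
      (intervalIntegrable_volterraI_sub le_rfl (ha.trans (hab.trans hbt)) ht)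
    exact this.ofReal
  have h2 : IntegrableOn (fun r ↦ (volterraI (t - r) : ℂ) * g r) (Ioc 0 t) := by
    refine Integrable.mul_bdd (c := G) h1 hg ?_
    filter_upwards [ae_restrict_mem measurableSet_Ioc] with r hr
    exact hG r hr
  exact h2.mono_set (Ioc_subset_Ioc ha hbt)

/-- On `[0, s]` the two kernels differ little in `L¹`; the new interval `[s, t]` contributes at most
`G` times `volterraN (t - s)`. No continuity of `g` enters: convolution with the Volterra function
turns a bounded function into one with modulus `1/|log h|`. -/
theorem exists_norm_volterraConv_sub_le : ∃ C : ℝ, 0 ≤ C ∧ ∀ (g : ℝ → ℂ) (G T : ℝ), 0 ≤ G →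
    T ≤ 1 / 8 → AEStronglyMeasurable g (volume.restrict (Ioc 0 T)) →
    (∀ r ∈ Ioc 0 T, ‖g r‖ ≤ G) → ∀ s t : ℝ, 0 ≤ s → s ≤ t → t ≤ T →
    ‖volterraConv g t - volterraConv g s‖ ≤ C * G * logMod (t - s) := by
  obtain ⟨C, hC, hCb⟩ := exists_integral_abs_volterraI_shift_le
  refine ⟨C + 3, by positivity, fun g G T hG hT hg hgG s t hs hst htT ↦ ?_⟩
  have ht1 : t < 1 := by linarith
  have hgt : AEStronglyMeasurable g (volume.restrict (Ioc 0 t)) :=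
    hg.mono_measure (Measure.restrict_mono (Ioc_subset_Ioc_right htT) le_rfl)
  have hgs : AEStronglyMeasurable g (volume.restrict (Ioc 0 s)) :=
    hg.mono_measure (Measure.restrict_mono (Ioc_subset_Ioc_right (hst.trans htT)) le_rfl)
  have hGt : ∀ r ∈ Ioc 0 t, ‖g r‖ ≤ G := fun r hr ↦ hgG r ⟨hr.1, hr.2.trans htT⟩
  have i1 := intervalIntegrable_volterraI_mul le_rfl hs hst ht1 hgt hGt
  have i2 := intervalIntegrable_volterraI_mul hs hst le_rfl ht1 hgt hGt
  have i3 := intervalIntegrable_volterraI_mul le_rfl hs le_rfl (by linarith) hgs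
    (fun r hr ↦ hgG r ⟨hr.1, hr.2.trans (hst.trans htT)⟩)
  have e : volterraConv g t - volterraConv g s =
      (∫ r in (0 : ℝ)..s, ((volterraI (t - r) : ℂ) * g r - (volterraI (s - r) : ℂ) * g r)) +
      ∫ r in s..t, (volterraI (t - r) : ℂ) * g r := by
    rw [volterraConv, volterraConv, ← intervalIntegral.integral_add_adjacent_intervals i1 i2,
      intervalIntegral.integral_sub i1 i3]
    ring
  have hIt := intervalIntegrable_volterraI_sub le_rfl (hs.trans hst) ht1
  have hIs := intervalIntegrable_volterraI_sub le_rfl hs (show s < 1 by linarith)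
  have hIt' : IntervalIntegrable (fun r ↦ volterraI (t - r)) volume 0 s :=
    hIt.mono_set (by rw [uIcc_of_le hs, uIcc_of_le (hs.trans hst)]; exact Icc_subset_Icc_right hst)
  have b1 : ‖∫ r in (0 : ℝ)..s, ((volterraI (t - r) : ℂ) * g r - (volterraI (s - r) : ℂ) * g r)‖ ≤
      G * (C * logMod (t - s)) := by
    have hb := hCb s (t - s) hs (by linarith) (by linarith)
    have hsub := intervalIntegral.integral_comp_sub_left (a := 0) (b := s)
      (fun x ↦ |volterraI (x + (t - s)) - volterraI x|) s
    simp only [sub_self, sub_zero] at hsub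
    rw [← hsub] at hb
    refine (intervalIntegral.norm_integral_le_of_norm_le hs ?_ (((hIt'.sub hIs).abs).const_mul G)).trans ?_
    · refine Eventually.of_forall fun r hr ↦ ?_
      rw [← sub_mul, norm_mul, ← Complex.ofReal_sub, Complex.norm_real, Real.norm_eq_abs, mul_comm]
      exact mul_le_mul_of_nonneg_right (hgG r ⟨hr.1, by linarith [hr.2]⟩) (abs_nonneg _)
    · rw [intervalIntegral.integral_const_mul]
      refine mul_le_mul_of_nonneg_left (le_of_eq_of_le ?_ hb) hG
      congr 1
      ext r
      congr 3
      ring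
  have b2 : ‖∫ r in s..t, (volterraI (t - r) : ℂ) * g r‖ ≤ G * (3 * logMod (t - s)) := by
    refine (intervalIntegral.norm_integral_le_of_norm_le hst ?_
      ((intervalIntegrable_volterraI_sub hs hst ht1).const_mul G)).trans ?_
    · refine Eventually.of_forall fun r hr ↦ ?_
      rw [norm_mul, Complex.norm_real, Real.norm_of_nonneg (volterraI_nonneg (by linarith [hr.2])),
        mul_comm]
      exact mul_le_mul_of_nonneg_right (hgG r ⟨by linarith [hr.1], by linarith [hr.2]⟩)
        (volterraI_nonneg (by linarith [hr.2]))
    · rw [intervalIntegral.integral_const_mul, intervalIntegral.integral_comp_sub_left volterraI t]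
      simp only [sub_self]
      exact mul_le_mul_of_nonneg_left (volterraN_le (by linarith) (by linarith)) hG
  rw [e]
  refine (norm_add_le _ _).trans ((add_le_add b1 b2).trans (le_of_eq ?_))
  ring


/-! ### The seminorm of `H^{1/2}` through increments -/

/-- The squared `L²` norm of the increment `q (· + h) - q` on `(0, T - h)`. -/
def incr (q : ℝ → ℂ) (T h : ℝ) : ℝ≥0∞ := ∫⁻ s in Ioo 0 (T - h), ‖q (s + h) - q s‖ₑ ^ 2

/-- The half-order seminorm in terms of increments. -/
def halfNorm (q : ℝ → ℂ) (T : ℝ) : ℝ≥0∞ := ∫⁻ h in Ioo 0 T, incr q T h / ENNReal.ofReal (h ^ 2)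

theorem measurable_incr {q : ℝ → ℂ} (hq : Measurable q) (T : ℝ) : Measurable (incr q T) := by
  have h1 : ∀ h, incr q T h = ∫⁻ s, (Ioo 0 (T - h)).indicator (fun s ↦ ‖q (s + h) - q s‖ₑ ^ 2) s :=
    fun h ↦ (lintegral_indicator measurableSet_Ioo _).symm
  rw [funext h1]
  refine Measurable.lintegral_prod_right' (f := fun p : ℝ × ℝ ↦
    (Ioo 0 (T - p.1)).indicator (fun s ↦ ‖q (s + p.1) - q s‖ₑ ^ 2) p.2) ?_
  have hs : MeasurableSet {p : ℝ × ℝ | p.2 ∈ Ioo 0 (T - p.1)} :=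
    (measurableSet_lt measurable_const measurable_snd).inter
      (measurableSet_lt measurable_snd (measurable_const.sub measurable_fst))
  have hf : Measurable fun p : ℝ × ℝ ↦ ‖q (p.2 + p.1) - q p.2‖ₑ ^ 2 :=
    (((hq.comp (measurable_snd.add measurable_fst)).sub (hq.comp measurable_snd)).enorm).pow_const 2
  exact hf.indicator hs

/-- The integrand is symmetric, so the square is covered by two copies of the triangle `t < s`;
there `s = t + h` and Tonelli give the integral over increments. -/
theorem finiteHalfSeminorm_of_halfNorm {q : ℝ → ℂ} {T : ℝ} (hq : Measurable q)
    (h : halfNorm q T < ∞) : FiniteHalfSeminorm T q := by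
  set f : ℝ → ℝ → ℝ≥0∞ := fun t s ↦ if 0 < t ∧ t < T ∧ 0 < s ∧ s < T then
    ‖q t - q s‖ₑ ^ 2 / ENNReal.ofReal ((t - s) ^ 2) else 0 with hf
  have hsym : ∀ t s, f t s = f s t := by
    intro t s
    simp only [hf]
    rw [← enorm_neg (q t - q s), neg_sub, ← neg_sub s t, neg_sq]
    congr 1
    exact propext ⟨fun ⟨a, b, c, d⟩ ↦ ⟨c, d, a, b⟩, fun ⟨a, b, c, d⟩ ↦ ⟨c, d, a, b⟩⟩
  have hmf : Measurable (Function.uncurry f) := by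
    refine Measurable.ite ?_ ?_ measurable_const
    · exact (measurableSet_lt measurable_const measurable_fst).inter
        ((measurableSet_lt measurable_fst measurable_const).inter
        ((measurableSet_lt measurable_const measurable_snd).inter
        (measurableSet_lt measurable_snd measurable_const)))
    · exact ((((hq.comp measurable_fst).sub (hq.comp measurable_snd)).enorm).pow_const 2).div
        ((measurable_fst.sub measurable_snd).pow_const 2).ennreal_ofReal
  set u : ℝ → ℝ → ℝ≥0∞ := fun t s ↦ if t < s then f t s else 0 with hu
  have hmu : Measurable (Function.uncurry u) :=
    Measurable.ite (measurableSet_lt measurable_fst measurable_snd) hmf measurable_const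
  have hle : ∀ t s, f t s ≤ u t s + u s t := by
    intro t s
    rcases lt_trichotomy t s with h | h | h
    · simp [hu, h]
    · subst h; simp [hf]
    · simp [hu, h, hsym t s]
  have e1 : ∫⁻ t in Ioo 0 T, ∫⁻ s in Ioo 0 T, ‖q t - q s‖ₑ ^ 2 / ENNReal.ofReal ((t - s) ^ 2) ≤
      ∫⁻ t, ∫⁻ s, f t s := by
    rw [← lintegral_indicator measurableSet_Ioo]
    refine lintegral_mono fun t ↦ ?_
    by_cases ht : t ∈ Ioo 0 T
    · rw [indicator_of_mem ht, ← lintegral_indicator measurableSet_Ioo]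
      refine lintegral_mono fun s ↦ ?_
      by_cases hs : s ∈ Ioo 0 T
      · rw [indicator_of_mem hs]
        simp only [hf]
        rw [if_pos ⟨ht.1, ht.2, hs.1, hs.2⟩]
      · rw [indicator_of_notMem hs]; exact zero_le
    · rw [indicator_of_notMem ht]; exact zero_le
  have e2 : ∫⁻ t, ∫⁻ s, u t s = halfNorm q T := by
    have : ∀ t, ∫⁻ s, u t s = ∫⁻ h, u t (t + h) := fun t ↦
      (lintegral_add_left_eq_self (fun s ↦ u t s) t).symm
    simp only [this]
    rw [lintegral_lintegral_swap, halfNorm, ← lintegral_indicator measurableSet_Ioo]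
    · refine lintegral_congr fun h ↦ ?_
      by_cases hh : h ∈ Ioo 0 T
      · rw [indicator_of_mem hh, incr, ENNReal.div_eq_inv_mul, ← lintegral_const_mul',
          ← lintegral_indicator measurableSet_Ioo]
        · refine lintegral_congr fun t ↦ ?_
          simp only [hu, hf]
          rw [if_pos (by linarith [hh.1])]
          by_cases ht : t ∈ Ioo 0 (T - h)
          · rw [indicator_of_mem ht, if_pos ⟨ht.1, by linarith [ht.2, hh.1], by linarith [ht.1, hh.1],
              by linarith [ht.2]⟩, ENNReal.div_eq_inv_mul, ← enorm_neg, neg_sub]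
            congr 2
            congr 1
            ring
          · rw [indicator_of_notMem ht, if_neg]
            exact fun hc ↦ ht ⟨hc.1, by linarith [hc.2.2.2]⟩
        · exact ENNReal.inv_ne_top.2 (ENNReal.ofReal_pos.2 (pow_pos hh.1 2)).ne'
      · rw [indicator_of_notMem hh]
        refine (lintegral_congr fun t ↦ ?_).trans lintegral_zero
        simp only [hu, hf]
        split_ifs with h1 h2
        · exact absurd ⟨by linarith, by linarith [h2.1, h2.2.2.2]⟩ hh
        · rfl
        · rfl
    · exact (hmu.comp (measurable_fst.prodMk (measurable_fst.add measurable_snd))).aemeasurable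
  rw [FiniteHalfSeminorm]
  refine e1.trans_lt ?_
  calc ∫⁻ t, ∫⁻ s, f t s ≤ ∫⁻ t, ∫⁻ s, (u t s + u s t) :=
        lintegral_mono fun t ↦ lintegral_mono fun s ↦ hle t s
    _ = ∫⁻ t, ((∫⁻ s, u t s) + ∫⁻ s, u s t) := lintegral_congr fun t ↦
        lintegral_add_left (hmu.comp (measurable_const.prodMk measurable_id)) _
    _ = (∫⁻ t, ∫⁻ s, u t s) + ∫⁻ t, ∫⁻ s, u s t :=
        lintegral_add_left hmu.lintegral_prod_right' _
    _ = halfNorm q T + halfNorm q T := by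
        rw [e2, lintegral_lintegral_swap (f := fun t s ↦ u s t)
          (hmu.comp measurable_swap).aemeasurable, e2]
    _ < ∞ := ENNReal.add_lt_top.2 ⟨h, h⟩

/-! ### The half-derivative of the primitive of the Volterra function. -/

/-- In the variable `u = 1/x` this is the decrease of `log u / √u` beyond `e²`. The function
increases up to `e⁻²`, and `1/8 < e⁻²` accounts for the restriction of all times to `[0, 1/8]`. -/
theorem mul_log_sq_mono {x y : ℝ} (hx : 0 < x) (hxy : x ≤ y) (hy : y ≤ 1 / 8) :
    x * Real.log x ^ 2 ≤ y * Real.log y ^ 2 := by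
  have hexp : Real.exp 2 ≤ 8 := by
    have h := Real.exp_one_lt_d9
    have : Real.exp 2 = Real.exp 1 ^ 2 := by rw [← Real.exp_nat_mul]; norm_num
    rw [this]
    have := Real.exp_pos 1
    nlinarith
  have hy0 := hx.trans_le hxy
  have h1 : Real.exp 2 ≤ y⁻¹ := by
    have := inv_anti₀ hy0 hy
    norm_num at this
    linarith
  have h2 := Real.log_div_sqrt_antitoneOn (mem_Ici.2 h1)
    (mem_Ici.2 (h1.trans (inv_anti₀ hx hxy))) (inv_anti₀ hx hxy)
  simp only [Real.log_inv, Real.sqrt_inv, div_inv_eq_mul] at h2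
  have key : ∀ z : ℝ, 0 < z → z * Real.log z ^ 2 = (-Real.log z * √z) ^ 2 := fun z hz ↦ by
    rw [mul_pow, Real.sq_sqrt hz.le]; ring
  rw [key x hx, key y hy0]
  have h3 := neg_log_pos hx (by linarith)
  exact pow_le_pow_left₀ (by positivity) h2 2

theorem one_le_log_sq {x : ℝ} (hx : 0 < x) (hx8 : x ≤ 1 / 8) : 1 ≤ Real.log x ^ 2 := by
  have h1 : Real.log x ≤ -1 := by
    rw [Real.log_le_iff_le_exp hx, Real.exp_neg]
    have h := Real.exp_one_lt_d9
    have h2 : (8 : ℝ)⁻¹ ≤ (Real.exp 1)⁻¹ := inv_anti₀ (Real.exp_pos 1) (by linarith)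
    linarith
  nlinarith

/-- The first bound is the logarithmic modulus of a convolution with the constant `1` and serves for
`h ≥ s`. The second integrates the decreasing majorant of `I` over `[s, s + h]` and serves for `h <
s`. -/
theorem exists_volterraN_sub_le : ∃ C : ℝ, 0 ≤ C ∧ ∀ s h : ℝ, 0 < s → 0 < h → s + h ≤ 1 / 8 →
    |volterraN (s + h) - volterraN s| ≤ C * logMod h ∧
    |volterraN (s + h) - volterraN s| ≤ C * (h * (1 / (s * Real.log s ^ 2))) := by
  obtain ⟨C, hC, hCb⟩ := exists_norm_volterraConv_sub_le
  have hconv : ∀ t, volterraConv (fun _ ↦ 1) t = (volterraN t : ℂ) := by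
    intro t
    simp only [volterraConv, mul_one]
    rw [intervalIntegral.integral_ofReal, intervalIntegral.integral_comp_sub_left volterraI t]
    simp [volterraN]
  refine ⟨C + 3, by positivity, fun s h hs hh hsh ↦ ⟨?_, ?_⟩⟩
  · have := hCb (fun _ ↦ 1) 1 (1 / 8) zero_le_one le_rfl aestronglyMeasurable_const (by simp)
      s (s + h) hs.le (by linarith) hsh
    rw [hconv, hconv, ← Complex.ofReal_sub, Complex.norm_real, Real.norm_eq_abs,
      add_sub_cancel_left, mul_one] at this
    have := logMod_nonneg hh.le (by linarith)
    nlinarith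
  · have hIi : IntervalIntegrable volterraI volume s (s + h) := by
      rw [intervalIntegrable_iff_integrableOn_Ioc_of_le (by linarith)]
      exact (integrableOn_volterraI (r := 1 / 8) (by norm_num)).mono_set (Ioc_subset_Ioc hs.le hsh)
    have e := intervalIntegral.integral_add_adjacent_intervals
      (intervalIntegrable_volterraI hs.le (show s < 1 by linarith)) hIi
    have e' : volterraN (s + h) - volterraN s = ∫ x in s..(s + h), volterraI x := by
      unfold volterraN; linarith
    have hnn : 0 ≤ ∫ x in s..(s + h), volterraI x :=
      intervalIntegral.integral_nonneg (by linarith) fun x hx ↦ volterraI_nonneg (hs.le.trans hx.1)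
    rw [e', abs_of_nonneg hnn]
    have hb := intervalIntegral.integral_mono_on_of_le_Ioo (show s ≤ s + h by linarith) hIi
      (intervalIntegrable_const (c := 3 * (1 / (s * Real.log s ^ 2)))) fun x hx ↦ by
        refine (volterraI_le (hs.trans hx.1) (by linarith [hx.2])).trans ?_
        have h1 := one_le_log_sq hs (by linarith)
        refine mul_le_mul_of_nonneg_left (one_div_le_one_div_of_le (by positivity)
          (mul_log_sq_mono hs hx.1.le (by linarith [hx.2]))) (by norm_num)
    rw [intervalIntegral.integral_const, smul_eq_mul] at hb
    have : 0 ≤ h * (1 / (s * Real.log s ^ 2)) := by positivity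
    nlinarith

theorem lintegral_deriv_logMod_lt_top (c : ℝ) :
    ∫⁻ x in Ioo (0 : ℝ) (1 / 8), ENNReal.ofReal (c * (1 / (x * Real.log x ^ 2))) < ∞ := by
  have := ((integrableOn_deriv_logMod (r := 1 / 8) (by norm_num)).mono_set
    Ioo_subset_Ioc_self).const_mul c
  exact this.lintegral_lt_top

theorem logMod_sq_div {h : ℝ} (hh : 0 < h) : logMod h ^ 2 / h = 1 / (h * Real.log h ^ 2) := by
  rw [logMod, neg_sq, inv_pow]
  field_simp

/-- The primitive is only logarithmically continuous, but its steepness is concentrated at the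
origin. For `h < s` (the part `A`) the slope bound, integrated in `h` over `(0, s)`, gives at most
`C²/(s log² s)` since `log² s ≥ 1`; for `s ≤ h` (the part `B`) the modulus, integrated in `s` over
`(0, h)`, gives `C²/(h log² h)`. Both are multiples of the derivative of `logMod`. -/
theorem halfNorm_volterraN_lt_top {T : ℝ} (hT : T ≤ 1 / 8) :
    halfNorm (fun t ↦ (volterraN t : ℂ)) T < ∞ := by
  obtain ⟨C, hC, hCb⟩ := exists_volterraN_sub_le
  set A : ℝ → ℝ → ℝ≥0∞ := fun h s ↦ if 0 < h ∧ h < s ∧ s < 1 / 8 then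
    ENNReal.ofReal (C ^ 2 * (1 / (s * Real.log s ^ 2)) ^ 2) else 0 with hA
  set B : ℝ → ℝ → ℝ≥0∞ := fun h s ↦ if 0 < h ∧ 0 < s ∧ s ≤ h ∧ h < 1 / 8 then
    ENNReal.ofReal (C ^ 2 * logMod h ^ 2 / h ^ 2) else 0 with hB
  have hmA : Measurable (Function.uncurry A) := by
    refine Measurable.ite ?_ (by fun_prop) measurable_const
    exact (measurableSet_lt measurable_const measurable_fst).inter
      ((measurableSet_lt measurable_fst measurable_snd).inter
      (measurableSet_lt measurable_snd measurable_const))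
  have hmB : Measurable (Function.uncurry B) := by
    refine Measurable.ite ?_ (by unfold logMod; fun_prop) measurable_const
    exact (measurableSet_lt measurable_const measurable_fst).inter
      ((measurableSet_lt measurable_const measurable_snd).inter
      ((measurableSet_le measurable_snd measurable_fst).inter
      (measurableSet_lt measurable_fst measurable_const)))
  have step : halfNorm (fun t ↦ (volterraN t : ℂ)) T ≤ ∫⁻ h, ∫⁻ s, (A h s + B h s) := by
    rw [halfNorm, ← lintegral_indicator measurableSet_Ioo]
    refine lintegral_mono fun h ↦ ?_
    by_cases hh : h ∈ Ioo 0 T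
    · rw [indicator_of_mem hh, incr, ENNReal.div_eq_inv_mul, ← lintegral_const_mul',
          ← lintegral_indicator measurableSet_Ioo]
      · refine lintegral_mono fun s ↦ ?_
        by_cases hs : s ∈ Ioo 0 (T - h)
        · rw [indicator_of_mem hs, ← Complex.ofReal_sub, ← ENNReal.div_eq_inv_mul]
          have hh2 : (0 : ℝ) < h ^ 2 := pow_pos hh.1 2
          obtain ⟨b1, b2⟩ := hCb s h hs.1 hh.1 (by linarith [hs.2])
          have hn : ‖((volterraN (s + h) - volterraN s : ℝ) : ℂ)‖ₑ ^ 2 =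
              ENNReal.ofReal (|volterraN (s + h) - volterraN s| ^ 2) := by
            rw [← ofReal_norm, Complex.norm_real, Real.norm_eq_abs,
              ENNReal.ofReal_pow (abs_nonneg _)]
          rw [hn, ← ENNReal.ofReal_div_of_pos hh2]
          rcases lt_or_ge h s with hlt | hge
          · refine le_trans ?_ (le_add_right le_rfl)
            simp only [hA]
            rw [if_pos ⟨hh.1, hlt, by linarith [hs.2, hh.1]⟩]
            refine ENNReal.ofReal_le_ofReal ?_
            rw [div_le_iff₀ hh2]
            refine (pow_le_pow_left₀ (abs_nonneg _) b2 2).trans (le_of_eq ?_)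
            ring
          · refine le_trans ?_ (le_add_left le_rfl)
            simp only [hB]
            rw [if_pos ⟨hh.1, hs.1, hge, by linarith [hs.2, hs.1, hh.2]⟩]
            refine ENNReal.ofReal_le_ofReal ?_
            rw [← mul_pow]
            exact div_le_div_of_nonneg_right (pow_le_pow_left₀ (abs_nonneg _) b1 2) hh2.le
        · rw [indicator_of_notMem hs]; exact zero_le
      · exact ENNReal.inv_ne_top.2 (ENNReal.ofReal_pos.2 (pow_pos hh.1 2)).ne'
    · rw [indicator_of_notMem hh]; exact zero_le
  have eA : ∫⁻ h, ∫⁻ s, A h s < ∞ := by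
    rw [lintegral_lintegral_swap hmA.aemeasurable]
    refine lt_of_le_of_lt ?_ (lintegral_deriv_logMod_lt_top (C ^ 2))
    rw [← lintegral_indicator measurableSet_Ioo]
    refine lintegral_mono fun s ↦ ?_
    by_cases hs : s ∈ Ioo (0 : ℝ) (1 / 8)
    · rw [indicator_of_mem hs]
      have : ∀ h, A h s = (Ioo 0 s).indicator
          (fun _ ↦ ENNReal.ofReal (C ^ 2 * (1 / (s * Real.log s ^ 2)) ^ 2)) h := by
        intro h
        simp only [hA, indicator_apply, mem_Ioo]
        congr 1
        exact propext ⟨fun ⟨a, b, _⟩ ↦ ⟨a, b⟩, fun ⟨a, b⟩ ↦ ⟨a, b, hs.2⟩⟩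
      simp only [this]
      rw [lintegral_indicator measurableSet_Ioo, setLIntegral_const, Real.volume_Ioo, sub_zero,
        ← ENNReal.ofReal_mul (by positivity)]
      refine ENNReal.ofReal_le_ofReal ?_
      have h1 := one_le_log_sq hs.1 hs.2.le
      have hs0 := hs.1
      have e : C ^ 2 * (1 / (s * Real.log s ^ 2)) ^ 2 * s =
          (C ^ 2 * (1 / (s * Real.log s ^ 2))) * (1 / Real.log s ^ 2) := by
        field_simp
      rw [e]
      refine mul_le_of_le_one_right (by positivity) ?_
      rw [div_le_one (by positivity)]
      exact h1
    · rw [indicator_of_notMem hs]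
      refine le_of_eq ((lintegral_congr fun h ↦ ?_).trans lintegral_zero)
      simp only [hA]
      exact if_neg fun hc ↦ hs ⟨hc.1.trans hc.2.1, hc.2.2⟩
  have eB : ∫⁻ h, ∫⁻ s, B h s < ∞ := by
    refine lt_of_le_of_lt ?_ (lintegral_deriv_logMod_lt_top (C ^ 2))
    rw [← lintegral_indicator measurableSet_Ioo]
    refine lintegral_mono fun h ↦ ?_
    by_cases hh : h ∈ Ioo (0 : ℝ) (1 / 8)
    · rw [indicator_of_mem hh]
      have : ∀ s, B h s = (Ioc 0 h).indicator
          (fun _ ↦ ENNReal.ofReal (C ^ 2 * logMod h ^ 2 / h ^ 2)) s := by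
        intro s
        simp only [hB, indicator_apply, mem_Ioc]
        congr 1
        exact propext ⟨fun ⟨_, b, c, _⟩ ↦ ⟨b, c⟩, fun ⟨a, b⟩ ↦ ⟨hh.1, a, b, hh.2⟩⟩
      simp only [this]
      rw [lintegral_indicator measurableSet_Ioc, setLIntegral_const, Real.volume_Ioc, sub_zero,
        ← ENNReal.ofReal_mul (by positivity)]
      refine ENNReal.ofReal_le_ofReal (le_of_eq ?_)
      have hh0 := hh.1
      rw [← logMod_sq_div hh.1]
      field_simp
    · rw [indicator_of_notMem hh]
      refine le_of_eq ((lintegral_congr fun s ↦ ?_).trans lintegral_zero)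
      simp only [hB]
      exact if_neg fun hc ↦ hh ⟨hc.1, hc.2.2.2⟩
  refine step.trans_lt ?_
  have : ∫⁻ h, ∫⁻ s, (A h s + B h s) = (∫⁻ h, ∫⁻ s, A h s) + ∫⁻ h, ∫⁻ s, B h s := by
    rw [← lintegral_add_left (f := fun h ↦ ∫⁻ s, A h s) hmA.lintegral_prod_right']
    exact lintegral_congr fun h ↦
      lintegral_add_left (hmA.comp (measurable_const.prodMk measurable_id)) _
  rw [this]
  exact ENNReal.add_lt_top.2 ⟨eA, eB⟩


/-! ### The boundary value of the evolved Green function -/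

theorem integrableOn_rpow_mul_exp {a l : ℝ} (ha : 0 < a) (hl : 0 < l) :
    IntegrableOn (fun r : ℝ ↦ r ^ (a - 1) * Real.exp (-(l * r))) (Ioi 0) := by
  by_contra hn
  have h := Real.integral_rpow_mul_exp_neg_mul_Ioi ha hl
  rw [integral_undef hn] at h
  have h1 := Real.Gamma_pos_of_pos ha
  have : 0 < (1 / l) ^ a * Real.Gamma a := by positivity
  linarith

theorem abs_log_le {r : ℝ} (hr : 0 < r) : |Real.log r| ≤ 4 * r ^ ((3 / 4 : ℝ) - 1) + r := by
  rcases le_or_gt r 1 with h | h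
  · have h1 := abs_log_mul_rpow_le (τ := r) (b := 1) hr h (by norm_num)
    have h2 : r ^ ((1 / 4 : ℝ) - 1) * r ^ (1 / 2 : ℝ) = r ^ ((3 / 4 : ℝ) - 1) := by
      rw [← Real.rpow_add hr]; norm_num
    have hl := Real.abs_log_mul_self_rpow_lt r (1 / 4) hr h (by norm_num)
    have p2 := Real.rpow_pos_of_pos hr (1 / 4 : ℝ)
    rw [abs_mul, abs_of_pos p2] at hl
    have h3 : r ^ (1 / 4 : ℝ) * r ^ ((3 / 4 : ℝ) - 1) = 1 := by
      rw [← Real.rpow_add hr]; norm_num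
    have p3 := Real.rpow_pos_of_pos hr ((3 / 4 : ℝ) - 1)
    calc |Real.log r| = (|Real.log r| * r ^ (1 / 4 : ℝ)) * r ^ ((3 / 4 : ℝ) - 1) := by
          rw [mul_assoc, h3, mul_one]
      _ ≤ 4 * r ^ ((3 / 4 : ℝ) - 1) :=
          mul_le_mul_of_nonneg_right (by norm_num at hl; linarith) p3.le
      _ ≤ _ := by linarith
  · rw [abs_of_nonneg (Real.log_nonneg h.le)]
    have := Real.log_le_sub_one_of_pos hr
    have p3 := Real.rpow_pos_of_pos hr ((3 / 4 : ℝ) - 1)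
    linarith

theorem integrableOn_exp_mul_log {l : ℝ} (hl : 0 < l) :
    IntegrableOn (fun r : ℝ ↦ Real.exp (-(l * r)) * Real.log r) (Ioi 0) := by
  refine Integrable.mono' (((integrableOn_rpow_mul_exp (a := 3 / 4) (by norm_num) hl).const_mul 4).add
    (integrableOn_rpow_mul_exp (a := 2) (by norm_num) hl)) (by fun_prop) ?_
  filter_upwards [ae_restrict_mem measurableSet_Ioi] with r hr
  have hr' : (0 : ℝ) < r := hr
  rw [norm_mul, Real.norm_eq_abs, Real.norm_eq_abs, abs_of_pos (Real.exp_pos _)]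
  have := mul_le_mul_of_nonneg_left (abs_log_le hr') (Real.exp_pos (-(l * r))).le
  have e : r ^ ((2 : ℝ) - 1) = r := by norm_num
  simp only [Pi.add_apply, e]
  linarith

/-- The integral is the derivative of Euler's integral at `1`, hence `Γ'(1)`. -/
theorem integral_exp_neg_mul_log : ∫ u in Ioi (0 : ℝ), Real.exp (-u) * Real.log u =
    -Real.eulerMascheroniConstant := by
  have h1 := Complex.hasDerivAt_GammaIntegral (s := 1) (by simp)
  have h2 : HasDerivAt Complex.GammaIntegral (-(Real.eulerMascheroniConstant : ℂ)) 1 := by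
    refine Complex.hasDerivAt_Gamma_one.congr_of_eventuallyEq ?_
    have : ∀ᶠ s : ℂ in 𝓝 1, 0 < s.re :=
      (Complex.continuous_re.isOpen_preimage _ isOpen_Ioi).mem_nhds (by simp)
    filter_upwards [this] with s hs
    exact (Complex.Gamma_eq_integral hs).symm
  have h3 := h1.unique h2
  have h4 : ∫ t : ℝ in Ioi 0, (t : ℂ) ^ ((1 : ℂ) - 1) * (Real.log t * Real.exp (-t)) =
      ((∫ u in Ioi (0 : ℝ), Real.exp (-u) * Real.log u : ℝ) : ℂ) := by
    rw [← integral_complex_ofReal]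
    refine integral_congr_ae (Eventually.of_forall fun t ↦ ?_)
    simp [mul_comm]
  rw [h4] at h3
  exact_mod_cast h3

theorem integral_exp_mul_log {l : ℝ} (hl : 0 < l) :
    l * ∫ r in Ioi (0 : ℝ), Real.exp (-(l * r)) * Real.log r =
      -Real.eulerMascheroniConstant - Real.log l := by
  have h := integral_comp_mul_left_Ioi' (fun u ↦ Real.exp (-u) * (Real.log u - Real.log l)) 0 hl
  rw [mul_zero, smul_eq_mul] at h
  have e1 : ∫ r in Ioi (0 : ℝ), Real.exp (-(l * r)) * (Real.log (l * r) - Real.log l) =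
      ∫ r in Ioi (0 : ℝ), Real.exp (-(l * r)) * Real.log r := by
    refine setIntegral_congr_fun measurableSet_Ioi fun r hr ↦ ?_
    rw [Real.log_mul hl.ne' (ne_of_gt hr)]
    ring
  rw [e1] at h
  rw [h]
  simp only [mul_sub]
  have i1 := integrableOn_exp_mul_log one_pos
  simp only [one_mul] at i1
  rw [integral_sub i1 ((integrableOn_exp_neg_Ioi 0).mul_const _), integral_exp_neg_mul_log,
    integral_mul_const, integral_exp_neg_Ioi_zero, one_mul]

/-- The integrand of `greenTrace`. -/
def greenTraceKer (lam r s : ℝ) : ℂ := Real.exp (-(lam * r)) / (r + Complex.I * s)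

/-- The value at the centre, times `4π`, of the free evolution of the Green function at time `s`. -/
def greenTrace (lam s : ℝ) : ℂ := ∫ r in Ioi (0 : ℝ), greenTraceKer lam r s

/-- The modulus dominates both `r` and `s`, so also their geometric mean with weights `3/4` and
`1/4`. With these weights `r^(-3/4)` is integrable at `0`, and `s^(-1/4)` is mild enough that the
primitive of `greenTrace` is Hölder of order `3/4`. -/
theorem norm_add_I_mul_ge {r s : ℝ} (hr : 0 < r) (hs : 0 < s) :
    r ^ (3 / 4 : ℝ) * s ^ (1 / 4 : ℝ) ≤ ‖(r : ℂ) + Complex.I * s‖ := by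
  set n := ‖(r : ℂ) + Complex.I * s‖ with hn
  have h1 : r ≤ n := by
    have := Complex.abs_re_le_norm ((r : ℂ) + Complex.I * s)
    simp at this
    exact (le_abs_self r).trans this
  have h2 : s ≤ n := by
    have := Complex.abs_im_le_norm ((r : ℂ) + Complex.I * s)
    simp at this
    exact (le_abs_self s).trans this
  have hn0 := hr.trans_le h1
  calc r ^ (3 / 4 : ℝ) * s ^ (1 / 4 : ℝ) ≤ n ^ (3 / 4 : ℝ) * n ^ (1 / 4 : ℝ) := by gcongr
    _ = n := by rw [← Real.rpow_add hn0]; norm_num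

theorem add_I_mul_ne_zero {r s : ℝ} (hr : 0 < r) : (r : ℂ) + Complex.I * s ≠ 0 := by
  intro h
  have := congrArg Complex.re h
  simp at this
  linarith

theorem norm_greenTraceKer_le {lam r s : ℝ} (hr : 0 < r) (hs : 0 < s) :
    ‖greenTraceKer lam r s‖ ≤
      s ^ (-(1 / 4) : ℝ) * (r ^ ((1 / 4 : ℝ) - 1) * Real.exp (-(lam * r))) := by
  have h := norm_add_I_mul_ge hr hs
  have p1 := Real.rpow_pos_of_pos hr (3 / 4 : ℝ)
  have p2 := Real.rpow_pos_of_pos hs (1 / 4 : ℝ)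
  rw [greenTraceKer, norm_div, Complex.norm_real, Real.norm_of_nonneg (Real.exp_pos _).le]
  have e : s ^ (-(1 / 4) : ℝ) * (r ^ ((1 / 4 : ℝ) - 1) * Real.exp (-(lam * r))) =
      Real.exp (-(lam * r)) / (r ^ (3 / 4 : ℝ) * s ^ (1 / 4 : ℝ)) := by
    rw [Real.rpow_neg hs.le, show ((1 / 4 : ℝ) - 1) = -(3 / 4) by norm_num, Real.rpow_neg hr.le]
    field_simp
  rw [e]
  exact div_le_div_of_nonneg_left (Real.exp_pos _).le (by positivity) h

theorem measurable_greenTraceKer (lam : ℝ) :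
    Measurable fun p : ℝ × ℝ ↦ greenTraceKer lam p.2 p.1 := by
  unfold greenTraceKer; fun_prop

theorem integrableOn_rpow_neg_quarter (S : ℝ) :
    IntegrableOn (fun s : ℝ ↦ s ^ (-(1 / 4) : ℝ)) (Ioc 0 S) := by
  rcases le_or_gt 0 S with h | h
  · exact (intervalIntegrable_iff_integrableOn_Ioc_of_le h).1
      (intervalIntegral.intervalIntegrable_rpow' (by norm_num))
  · rw [Ioc_eq_empty (by linarith)]; exact integrableOn_empty

theorem integrable_greenTraceKer {lam : ℝ} (hlam : 0 < lam) (S : ℝ) :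
    Integrable (Function.uncurry fun s r : ℝ ↦ greenTraceKer lam r s)
      ((volume.restrict (Ioc 0 S)).prod (volume.restrict (Ioi 0))) := by
  refine Integrable.mono' ((integrableOn_rpow_neg_quarter S).mul_prod
    (integrableOn_rpow_mul_exp (a := 1 / 4) (by norm_num) hlam))
    (measurable_greenTraceKer lam).aestronglyMeasurable ?_
  rw [Measure.prod_restrict]
  filter_upwards [ae_restrict_mem (measurableSet_Ioc.prod measurableSet_Ioi)] with p hp
  exact norm_greenTraceKer_le hp.2 hp.1.1

theorem integrableOn_greenTraceKer {lam s : ℝ} (hlam : 0 < lam) (hs : 0 < s) :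
    IntegrableOn (fun r ↦ greenTraceKer lam r s) (Ioi 0) := by
  refine Integrable.mono' ((integrableOn_rpow_mul_exp (a := 1 / 4) (by norm_num) hlam).const_mul
    (s ^ (-(1 / 4) : ℝ))) ((measurable_greenTraceKer lam).comp
      (measurable_const.prodMk measurable_id)).aestronglyMeasurable ?_
  filter_upwards [ae_restrict_mem measurableSet_Ioi] with r hr
  exact norm_greenTraceKer_le hr hs

theorem measurable_greenTrace (lam : ℝ) : Measurable (greenTrace lam) :=
  ((measurable_greenTraceKer lam).stronglyMeasurable.integral_prod_right
    (f := fun s r ↦ greenTraceKer lam r s)).measurable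

theorem exists_norm_greenTrace_le {lam : ℝ} (hlam : 0 < lam) : ∃ C : ℝ, 0 ≤ C ∧
    ∀ s, 0 < s → ‖greenTrace lam s‖ ≤ C * s ^ (-(1 / 4) : ℝ) := by
  refine ⟨∫ r in Ioi (0 : ℝ), r ^ ((1 / 4 : ℝ) - 1) * Real.exp (-(lam * r)),
    setIntegral_nonneg measurableSet_Ioi fun r hr ↦
      mul_nonneg (Real.rpow_nonneg (le_of_lt hr) _) (Real.exp_pos _).le, fun s hs ↦ ?_⟩
  rw [mul_comm, ← integral_const_mul]
  refine norm_integral_le_of_norm_le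
    ((integrableOn_rpow_mul_exp (a := 1 / 4) (by norm_num) hlam).const_mul _) ?_
  filter_upwards [ae_restrict_mem measurableSet_Ioi] with r hr
  exact norm_greenTraceKer_le hr hs

theorem integrableOn_greenTrace {lam : ℝ} (hlam : 0 < lam) (S : ℝ) :
    IntegrableOn (greenTrace lam) (Ioc 0 S) :=
  (integrable_greenTraceKer hlam S).integral_prod_left

/-- The principal logarithm is differentiable along the vertical segment from `r` to `r + is`, which
stays in the right half-plane. -/
theorem log_add_I_mul_eq {r s : ℝ} (hr : 0 < r) (hs : 0 ≤ s) :
    Complex.log (r + Complex.I * s) = Real.log r +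
      ∫ σ in Ioc (0 : ℝ) s, Complex.I / (r + Complex.I * σ) := by
  have hd : ∀ σ : ℝ, HasDerivAt (fun σ : ℝ ↦ Complex.log (r + Complex.I * σ))
      (Complex.I / (r + Complex.I * σ)) σ := by
    intro σ
    have h1 : HasDerivAt (fun σ : ℝ ↦ (r : ℂ) + Complex.I * σ) Complex.I σ := by
      have := ((hasDerivAt_id σ).ofReal_comp.const_mul Complex.I).const_add (r : ℂ)
      simpa using this
    exact h1.clog_real (Or.inl (by simpa using hr))
  have hc : Continuous fun σ : ℝ ↦ Complex.I / (r + Complex.I * σ) :=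
    Continuous.div (by fun_prop) (by fun_prop) fun σ ↦ add_I_mul_ne_zero hr
  have := intervalIntegral.integral_eq_sub_of_hasDerivAt (a := 0) (b := s) (fun σ _ ↦ hd σ)
    (hc.intervalIntegrable _ _)
  rw [intervalIntegral.integral_of_le hs] at this
  rw [this, Complex.ofReal_log hr.le]
  simp

/-- The basic identity `greenTrace - iλ ∫ greenTrace = -γ - log s - log λ - iπ/2`. -/
theorem greenTrace_sub_integral {lam s : ℝ} (hlam : 0 < lam) (hs : 0 < s) :
    greenTrace lam s - Complex.I * lam * ∫ σ in (0 : ℝ)..s, greenTrace lam σ =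
      (logKer s : ℂ) - Real.log lam - Complex.I * Real.pi / 2 := by
  have hint := integrable_greenTraceKer hlam s
  have hker : ∀ r ∈ Ioi (0 : ℝ), (Real.exp (-(lam * r)) : ℂ) * Complex.log (r + Complex.I * s) =
      ((Real.exp (-(lam * r)) * Real.log r : ℝ) : ℂ) +
        Complex.I * ∫ σ in Ioc (0 : ℝ) s, greenTraceKer lam r σ := by
    intro r hr
    rw [log_add_I_mul_eq hr hs.le, mul_add, ← integral_const_mul, ← integral_const_mul]
    push_cast
    congr 1
    refine integral_congr_ae (Eventually.of_forall fun σ ↦ ?_)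
    simp only [greenTraceKer]
    push_cast
    ring
  have i1 : IntegrableOn (fun r : ℝ ↦ ((Real.exp (-(lam * r)) * Real.log r : ℝ) : ℂ)) (Ioi 0) :=
    (integrableOn_exp_mul_log hlam).ofReal
  have i2 : IntegrableOn (fun r : ℝ ↦ Complex.I * ∫ σ in Ioc (0 : ℝ) s, greenTraceKer lam r σ)
      (Ioi 0) := (hint.integral_prod_right).const_mul _
  have i3 : IntegrableOn (fun r : ℝ ↦
      (Real.exp (-(lam * r)) : ℂ) * Complex.log (r + Complex.I * s)) (Ioi 0) :=
    (i1.add i2).congr (by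
      filter_upwards [ae_restrict_mem measurableSet_Ioi] with r hr
      exact (hker r hr).symm)
  -- With the logarithm expanded along the vertical segment, the weighted integral splits into the
  -- real one and, after Fubini, the primitive of `greenTrace`.
  have hW : lam * ∫ r in Ioi (0 : ℝ), (Real.exp (-(lam * r)) : ℂ) * Complex.log (r + Complex.I * s)
      = -Real.eulerMascheroniConstant - Real.log lam +
        Complex.I * lam * ∫ σ in (0 : ℝ)..s, greenTrace lam σ := by
    rw [setIntegral_congr_fun measurableSet_Ioi hker, integral_add i1 i2, integral_const_mul,
      intervalIntegral.integral_of_le hs.le, integral_complex_ofReal, mul_add, ← Complex.ofReal_mul,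
      integral_exp_mul_log hlam]
    have : ∫ r in Ioi (0 : ℝ), ∫ σ in Ioc (0 : ℝ) s, greenTraceKer lam r σ =
        ∫ σ in Ioc (0 : ℝ) s, greenTrace lam σ := (integral_integral_swap hint).symm
    rw [this]
    push_cast
    ring
  have hsl : ∀ r : ℝ, 0 ≤ r → (r : ℂ) + Complex.I * s ∈ Complex.slitPlane := fun r _ ↦
    Or.inr (by simpa using hs.ne')
  -- Integration by parts in `r`: `e^{-λr} log(r + is)` vanishes at infinity and equals `log s +
  -- iπ/2` at `r = 0`; its derivative contains the integrand of `greenTrace`.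
  have hd : ∀ r ∈ Ici (0 : ℝ), HasDerivAt (fun r : ℝ ↦
      (Real.exp (-(lam * r)) : ℂ) * Complex.log (r + Complex.I * s))
      (-lam * ((Real.exp (-(lam * r)) : ℂ) * Complex.log (r + Complex.I * s)) +
        greenTraceKer lam r s) r := by
    intro r hr
    have h1 : HasDerivAt (fun r : ℝ ↦ (r : ℂ) + Complex.I * s) 1 r := by
      simpa using (hasDerivAt_id r).ofReal_comp.add_const (Complex.I * s)
    have h2 := h1.clog_real (hsl r hr)
    have h3 : HasDerivAt (fun r : ℝ ↦ Real.exp (-(lam * r))) (-lam * Real.exp (-(lam * r))) r := by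
      have := ((hasDerivAt_id r).const_mul lam).neg.exp
      refine this.congr_deriv ?_
      simp
      ring
    have h4 := h3.ofReal_comp.mul h2
    refine h4.congr_deriv ?_
    rw [greenTraceKer]
    push_cast
    ring
  have i4 := integrableOn_greenTraceKer hlam hs
  have i5 : IntegrableOn (fun r : ℝ ↦
      -(lam : ℂ) * ((Real.exp (-(lam * r)) : ℂ) * Complex.log (r + Complex.I * s)) +
        greenTraceKer lam r s) (Ioi 0) := (i3.const_mul _).add i4
  have ht := tendsto_zero_of_hasDerivAt_of_integrableOn_Ioi
    (fun r hr ↦ hd r (mem_Ici.2 (le_of_lt hr))) i5 i3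
  have hI := integral_Ioi_of_hasDerivAt_of_tendsto' hd i5 ht
  rw [integral_add (i3.const_mul _) i4, integral_const_mul] at hI
  have hlog : Complex.log (Complex.I * s) = Real.log s + Complex.I * Real.pi / 2 := by
    rw [mul_comm, Complex.log_ofReal_mul hs Complex.I_ne_zero, Complex.log_I]
    ring
  simp only [Complex.ofReal_zero, mul_zero, neg_zero, Real.exp_zero, Complex.ofReal_one, one_mul,
    zero_add, zero_sub, hlog, neg_mul, hW] at hI
  have hg : greenTrace lam s = ∫ r in Ioi (0 : ℝ), greenTraceKer lam r s := rfl
  rw [← hg] at hI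
  rw [logKer]
  push_cast
  linear_combination hI


/-! ### Convolutions on a finite interval -/

/-- The convolution `∫₀ᵗ a (t - τ) b τ dτ`. -/
def conv (a b : ℝ → ℂ) (t : ℝ) : ℂ := ∫ τ in (0 : ℝ)..t, a (t - τ) * b τ

theorem conv_eq_setIntegral (a b : ℝ → ℂ) {t : ℝ} (ht : 0 ≤ t) :
    conv a b t = ∫ τ in Ioc 0 t, a (t - τ) * b τ := intervalIntegral.integral_of_le ht

theorem conv_comm (a b : ℝ → ℂ) (t : ℝ) : conv a b t = conv b a t := by
  have := intervalIntegral.integral_comp_sub_left (a := 0) (b := t) (fun τ ↦ a τ * b (t - τ)) t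
  simp only [sub_self, sub_zero, sub_sub_cancel] at this
  rw [conv, this, conv]
  exact intervalIntegral.integral_congr fun τ _ ↦ mul_comm _ _

theorem integrableOn_conv_comm {a b : ℝ → ℂ} {t : ℝ} (ht : 0 ≤ t)
    (h : IntegrableOn (fun τ ↦ a (t - τ) * b τ) (Ioc 0 t)) :
    IntegrableOn (fun τ ↦ b (t - τ) * a τ) (Ioc 0 t) := by
  rw [← intervalIntegrable_iff_integrableOn_Ioc_of_le ht] at h ⊢
  have := (h.comp_sub_left t).symm
  simpa [mul_comm] using this

/-- Fubini on the triangle `r < s ≤ t`. As the kernels are singular, the only quantitative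
assumption on them is a bound for the `L¹` norm of `a (u - ·) b`, uniform in `u`; this controls the
inner integral for each `r`, and `g` need only be integrable. -/
theorem conv_assoc {a b g : ℝ → ℂ} {t M : ℝ} (ha : Measurable a) (hb : Measurable b) (ht : 0 ≤ t)
    (hab : ∀ u ∈ Ioc 0 t, IntegrableOn (fun x ↦ a (u - x) * b x) (Ioc 0 u) ∧
      ∫ x in Ioc 0 u, ‖a (u - x) * b x‖ ≤ M) (hg : IntegrableOn g (Ioc 0 t)) :
    conv a (conv b g) t = conv (conv a b) g t ∧
    IntegrableOn (fun s ↦ a (t - s) * conv b g s) (Ioc 0 t) ∧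
    IntegrableOn (fun r ↦ conv a b (t - r) * g r) (Ioc 0 t) := by
  set μ := (volume : Measure ℝ).restrict (Ioc 0 t) with hμ
  set f : ℝ → ℝ → ℂ := fun s r ↦ (if r < s then a (t - s) * b (s - r) else 0) * g r with hf
  have hmeas : AEStronglyMeasurable (Function.uncurry f) (μ.prod μ) := by
    have h1 : Measurable fun p : ℝ × ℝ ↦ (if p.2 < p.1 then a (t - p.1) * b (p.1 - p.2) else 0) :=
      Measurable.ite (measurableSet_lt measurable_snd measurable_fst)
        ((ha.comp (measurable_const.sub measurable_fst)).mul
          (hb.comp (measurable_fst.sub measurable_snd))) measurable_const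
    exact h1.aestronglyMeasurable.mul hg.aestronglyMeasurable.comp_snd
  have hset : ∀ r ∈ Ioc 0 t, ∀ k : ℝ → ℝ → ℂ,
      ((fun s ↦ if r < s then k s r else 0) =ᵐ[μ] (Ioc r t).indicator fun s ↦ k s r) := by
    intro r hr k
    filter_upwards [ae_restrict_mem measurableSet_Ioc] with s hs
    by_cases h : r < s
    · rw [if_pos h, indicator_of_mem (mem_Ioc.2 ⟨h, hs.2⟩)]
    · rw [if_neg h, indicator_of_notMem fun hc ↦ h hc.1]
  have hinner : ∀ r ∈ Ioc 0 t, Integrable (fun s ↦ f s r) μ ∧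
      (∫ s, f s r ∂μ = conv a b (t - r) * g r) ∧ ∫ s, ‖f s r‖ ∂μ ≤ M * ‖g r‖ := by
    intro r hr
    have hk : IntegrableOn (fun s ↦ a (t - s) * b (s - r)) (Ioc r t) ∧
        ∫ s in Ioc r t, a (t - s) * b (s - r) = conv a b (t - r) ∧
        ∫ s in Ioc r t, ‖a (t - s) * b (s - r)‖ ≤ max M 0 ∧
        (r < t → ∫ s in Ioc r t, ‖a (t - s) * b (s - r)‖ ≤ M) := by
      rcases eq_or_lt_of_le hr.2 with h | h
      · subst h
        simp [conv]
      · obtain ⟨h1, h2⟩ := hab (t - r) ⟨by linarith, by linarith [hr.1]⟩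
        have hpre : (fun x : ℝ ↦ x + r) ⁻¹' Ioc r t = Ioc 0 (t - r) := by
          ext x; simp only [mem_preimage, mem_Ioc]
          constructor <;> rintro ⟨h1, h2⟩ <;> constructor <;> linarith
        have hmp := measurePreserving_add_right (volume : Measure ℝ) r
        have hem := measurableEmbedding_addRight r
        have e : ∀ x : ℝ, a (t - (x + r)) * b (x + r - r) = a (t - r - x) * b x := fun x ↦ by
          rw [show t - (x + r) = t - r - x by ring, add_sub_cancel_right]
        have i1 := hmp.integrableOn_comp_preimage hem (f := fun s ↦ a (t - s) * b (s - r))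
          (s := Ioc r t)
        have i2 := hmp.setIntegral_preimage_emb hem (fun s ↦ a (t - s) * b (s - r)) (Ioc r t)
        have i3 := hmp.setIntegral_preimage_emb hem (fun s ↦ ‖a (t - s) * b (s - r)‖) (Ioc r t)
        rw [hpre] at i1 i2 i3
        simp only [Function.comp_def, e] at i1 i2 i3
        rw [← i2, ← i3, conv_eq_setIntegral a b (by linarith)]
        exact ⟨i1.1 h1, rfl, h2.trans (le_max_left _ _), fun _ ↦ h2⟩
    have hfr : (fun s ↦ f s r) =ᵐ[μ] fun s ↦
        (Ioc r t).indicator (fun s ↦ a (t - s) * b (s - r)) s * g r := by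
      filter_upwards [hset r hr fun s r ↦ a (t - s) * b (s - r)] with s hs
      simp only [hf]
      rw [hs]
    have hsub : Ioc r t ∩ Ioc 0 t = Ioc r t :=
      inter_eq_left.2 (Ioc_subset_Ioc_left hr.1.le)
    have hi : Integrable ((Ioc r t).indicator fun s ↦ a (t - s) * b (s - r)) μ := by
      rw [integrable_indicator_iff measurableSet_Ioc, IntegrableOn, hμ,
        Measure.restrict_restrict measurableSet_Ioc, hsub]
      exact hk.1
    refine ⟨(hi.mul_const (g r)).congr hfr.symm, ?_, ?_⟩
    · rw [integral_congr_ae hfr, integral_mul_const, integral_indicator measurableSet_Ioc, hμ,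
        Measure.restrict_restrict measurableSet_Ioc, hsub, hk.2.1]
    · have hn : ∀ᵐ s ∂μ, ‖f s r‖ =
          (Ioc r t).indicator (fun s ↦ ‖a (t - s) * b (s - r)‖) s * ‖g r‖ := by
        filter_upwards [hfr] with s hs
        rw [hs, norm_mul, norm_indicator_eq_indicator_norm]
      rw [integral_congr_ae hn, integral_mul_const, integral_indicator measurableSet_Ioc, hμ,
        Measure.restrict_restrict measurableSet_Ioc, hsub]
      rcases eq_or_lt_of_le hr.2 with h | h
      · have hM : 0 ≤ M := (integral_nonneg fun _ ↦ norm_nonneg _).trans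
          (hab t ⟨hr.1.trans_le hr.2, le_rfl⟩).2
        rw [h, Ioc_self, setIntegral_empty, zero_mul]
        exact mul_nonneg hM (norm_nonneg _)
      · exact mul_le_mul_of_nonneg_right (hk.2.2.2 h) (norm_nonneg _)
  have hint : Integrable (Function.uncurry f) (μ.prod μ) := by
    refine (integrable_prod_iff' hmeas).2 ⟨?_, ?_⟩
    · filter_upwards [ae_restrict_mem measurableSet_Ioc] with r hr
      exact (hinner r hr).1
    · refine Integrable.mono' (hg.norm.const_mul M) hmeas.norm.prod_swap.integral_prod_right' ?_
      filter_upwards [ae_restrict_mem measurableSet_Ioc] with r hr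
      rw [Real.norm_of_nonneg (integral_nonneg fun _ ↦ norm_nonneg _)]
      exact (hinner r hr).2.2
  have hs : ∀ s ∈ Ioc 0 t, ∫ r, f s r ∂μ = a (t - s) * conv b g s := by
    intro s hs
    have : ∀ᵐ r ∂μ, f s r = (Ioo 0 s).indicator (fun r ↦ a (t - s) * (b (s - r) * g r)) r := by
      filter_upwards [ae_restrict_mem measurableSet_Ioc] with r hr
      simp only [hf]
      by_cases h : r < s
      · rw [if_pos h, indicator_of_mem (mem_Ioo.2 ⟨hr.1, h⟩), mul_assoc]
      · rw [if_neg h, indicator_of_notMem fun hc ↦ h hc.2, zero_mul]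
    rw [integral_congr_ae this, integral_indicator measurableSet_Ioo, hμ,
      Measure.restrict_restrict measurableSet_Ioo,
      inter_eq_left.2 (Ioo_subset_Ioc_self.trans (Ioc_subset_Ioc_right hs.2)),
      integral_const_mul, conv_eq_setIntegral b g hs.1.le, integral_Ioc_eq_integral_Ioo]
  refine ⟨?_, ?_, ?_⟩
  · rw [conv_eq_setIntegral _ _ ht, conv_eq_setIntegral _ _ ht]
    rw [← setIntegral_congr_fun measurableSet_Ioc hs, integral_integral_swap hint]
    exact setIntegral_congr_fun measurableSet_Ioc fun r hr ↦ (hinner r hr).2.1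
  · refine (hint.integral_prod_left).congr ?_
    filter_upwards [ae_restrict_mem measurableSet_Ioc] with s h
    exact hs s h
  · refine (hint.integral_prod_right).congr ?_
    filter_upwards [ae_restrict_mem measurableSet_Ioc] with r hr
    exact (hinner r hr).2.1

/-! ### Sonine inversion -/

theorem logKer_nonneg {t : ℝ} (h0 : 0 < t) (h1 : t ≤ 1 / 8) : 0 ≤ logKer t := by
  have h := Real.eulerMascheroniConstant_lt_two_thirds
  have : Real.log t ≤ -1 := by
    rw [Real.log_le_iff_le_exp h0, Real.exp_neg]
    have h := Real.exp_one_lt_d9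
    have h2 : (8 : ℝ)⁻¹ ≤ (Real.exp 1)⁻¹ := inv_anti₀ (Real.exp_pos 1) (by linarith)
    linarith
  rw [logKer]; linarith

/-- The Volterra function with complex values. -/
def volC (t : ℝ) : ℂ := (volterraI t : ℂ)

/-- The logarithmic kernel with complex values. -/
def logC (t : ℝ) : ℂ := (logKer t : ℂ)

theorem measurable_volC : Measurable volC := Complex.measurable_ofReal.comp measurable_volterraI

theorem measurable_logC : Measurable logC :=
  Complex.measurable_ofReal.comp (Real.measurable_log.const_sub _)

theorem conv_volC (g : ℝ → ℂ) (t : ℝ) : conv volC g t = volterraConv g t := rfl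

theorem conv_volC_logC {u : ℝ} (h0 : 0 < u) (h1 : u ≤ 1 / 8) :
    IntegrableOn (fun x ↦ volC (u - x) * logC x) (Ioc 0 u) ∧
    ∫ x in Ioc 0 u, ‖volC (u - x) * logC x‖ ≤ 1 ∧ conv volC logC u = 1 := by
  obtain ⟨h2, h3⟩ := integral_volterraI_mul_logKer h0 (by linarith)
  have e : ∀ x, volC (u - x) * logC x = ((volterraI (u - x) * logKer x : ℝ) : ℂ) := fun x ↦ by
    simp [volC, logC]
  simp only [conv_eq_setIntegral _ _ h0.le, e]
  refine ⟨h2.ofReal, ?_, ?_⟩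
  · rw [← h3]
    refine le_of_eq (setIntegral_congr_fun measurableSet_Ioc fun x hx ↦ ?_)
    simp only [Complex.norm_real]
    exact Real.norm_of_nonneg (mul_nonneg (volterraI_nonneg (by linarith [hx.2]))
      (logKer_nonneg hx.1 (by linarith [hx.2])))
  · rw [integral_complex_ofReal, h3, Complex.ofReal_one]

theorem conv_logC_volC {u : ℝ} (h0 : 0 < u) (h1 : u ≤ 1 / 8) :
    IntegrableOn (fun x ↦ logC (u - x) * volC x) (Ioc 0 u) ∧
    ∫ x in Ioc 0 u, ‖logC (u - x) * volC x‖ ≤ 1 ∧ conv logC volC u = 1 := by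
  obtain ⟨i1, i2, i3⟩ := conv_volC_logC h0 h1
  refine ⟨integrableOn_conv_comm h0.le i1, ?_, by rw [conv_comm]; exact i3⟩
  have := intervalIntegral.integral_comp_sub_left (a := 0) (b := u)
    (fun τ ↦ ‖volC (u - τ) * logC τ‖) u
  simp only [sub_self, sub_zero, sub_sub_cancel] at this
  rw [intervalIntegral.integral_of_le h0.le, intervalIntegral.integral_of_le h0.le] at this
  refine le_trans (le_of_eq ?_) i2
  rw [← this]
  refine integral_congr_ae (Eventually.of_forall fun x ↦ ?_)
  simp only [mul_comm]

theorem integrableOn_volC_sub {u : ℝ} (h0 : 0 ≤ u) (h1 : u ≤ 1 / 8) :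
    IntegrableOn (fun x ↦ volC (u - x)) (Ioc 0 u) := by
  have := (intervalIntegrable_iff_integrableOn_Ioc_of_le h0).1
    (intervalIntegrable_volterraI_sub le_rfl h0 (show u < 1 by linarith))
  exact this.ofReal

theorem integral_norm_volC_sub_le {u : ℝ} (h0 : 0 ≤ u) :
    ∫ x in Ioc 0 u, ‖volC (u - x)‖ ≤ volterraN u := by
  have h := intervalIntegral.integral_comp_sub_left (a := 0) (b := u) volterraI u
  simp only [sub_self, sub_zero] at h
  rw [volterraN, ← h, intervalIntegral.integral_of_le h0]
  refine le_of_eq (setIntegral_congr_fun measurableSet_Ioc fun x hx ↦ ?_)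
  simp only [volC, Complex.norm_real]
  exact Real.norm_of_nonneg (volterraI_nonneg (by linarith [hx.2]))

/-- If `J * q = 1 * G` on `[0, T]`, where `J = -γ - log`, then `q = I * G` almost everywhere. -/
theorem ae_eq_conv_volC_of_conv_logC {q G : ℝ → ℂ} {T : ℝ} (hT : T ≤ 1 / 8)
    (hq : IntegrableOn q (Ioc 0 T)) (hG : IntegrableOn G (Ioc 0 T))
    (h : ∀ t ∈ Ioc 0 T, conv logC q t = conv (fun _ ↦ 1) G t) :
    ∀ᵐ t ∂volume.restrict (Ioc 0 T), q t = conv volC G t := by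
  have hsub : ∀ t ∈ Ioc 0 T, Ioc 0 t ⊆ Ioc 0 T := fun t ht ↦ Ioc_subset_Ioc_right ht.2
  -- Convolving the hypothesis with `I` and using `I * J = 1` gives `1 * q = I * (1 * G) = 1 * (I *
  -- G)`, an equality of primitives.
  have key : ∀ t ∈ Ioc 0 T, conv (fun _ ↦ 1) q t = conv (fun _ ↦ 1) (conv volC G) t ∧
      IntegrableOn (conv volC G) (Ioc 0 t) := by
    intro t ht
    have t8 : t ≤ 1 / 8 := ht.2.trans hT
    obtain ⟨a1, -, -⟩ := conv_assoc measurable_volC measurable_logC ht.1.le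
      (fun u hu ↦ ⟨(conv_volC_logC hu.1 (hu.2.trans t8)).1,
        (conv_volC_logC hu.1 (hu.2.trans t8)).2.1⟩) (hq.mono_set (hsub t ht))
    obtain ⟨a2, -, -⟩ := conv_assoc (b := fun _ ↦ 1) measurable_volC measurable_const ht.1.le
      (M := volterraN t) (fun u hu ↦ by
        simp only [mul_one]
        exact ⟨integrableOn_volC_sub hu.1.le (hu.2.trans t8),
          (integral_norm_volC_sub_le hu.1.le).trans
            (volterraN_mono hu.1.le hu.2 (by linarith))⟩) (hG.mono_set (hsub t ht))
    obtain ⟨a3, a4, -⟩ := conv_assoc (a := fun _ ↦ 1) measurable_const measurable_volC ht.1.le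
      (M := volterraN t) (g := G) (fun u hu ↦ by
        have h1 := integrableOn_conv_comm (b := fun _ ↦ 1) hu.1.le (by
          simpa using integrableOn_volC_sub hu.1.le (hu.2.trans t8))
        refine ⟨h1, ?_⟩
        have h2 := intervalIntegral.integral_comp_sub_left (a := 0) (b := u) (fun x ↦ ‖volC x‖) u
        simp only [sub_self, sub_zero] at h2
        rw [intervalIntegral.integral_of_le hu.1.le, intervalIntegral.integral_of_le hu.1.le] at h2
        simp only [one_mul]
        rw [← h2]
        exact (integral_norm_volC_sub_le hu.1.le).trans
            (volterraN_mono hu.1.le hu.2 (by linarith))) (hG.mono_set (hsub t ht))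
    simp only [one_mul] at a4
    refine ⟨?_, a4⟩
    have e1 : conv volC (conv logC q) t = conv volC (conv (fun _ ↦ 1) G) t := by
      rw [conv_eq_setIntegral _ _ ht.1.le, conv_eq_setIntegral _ _ ht.1.le]
      refine setIntegral_congr_fun measurableSet_Ioc fun s hs ↦ ?_
      simp only [h s (hsub t ht hs)]
    have e2 : conv (conv volC logC) q t = conv (fun _ ↦ 1) q t := by
      rw [conv_eq_setIntegral _ _ ht.1.le, conv_eq_setIntegral _ _ ht.1.le,
        integral_Ioc_eq_integral_Ioo, integral_Ioc_eq_integral_Ioo]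
      refine setIntegral_congr_fun measurableSet_Ioo fun s hs ↦ ?_
      rw [(conv_volC_logC (u := t - s) (by linarith [hs.2]) (by linarith [hs.1])).2.2]
    have e3 : conv (conv volC fun _ ↦ 1) G t = conv (conv (fun _ ↦ 1) volC) G t := by
      congr 1
      exact funext fun s ↦ conv_comm _ _ s
    rw [← e2, ← a1, e1, a2, e3, a3]
  rcases le_or_gt T 0 with hT0 | hT0
  · rw [Ioc_eq_empty (by linarith)]; simp
  have hi := (key T ⟨hT0, le_rfl⟩).2
  -- Equal primitives are differentiated by Lebesgue's theorem; for this reason the conclusion holds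
  -- only almost everywhere.
  have hzero : ∀ᵐ t ∂volume.restrict (Ioc 0 T), q t - conv volC G t = 0 := by
    have hloc : IntegrableOn (fun t ↦ q t - conv volC G t) (Ioc 0 T) := hq.sub hi
    rw [ae_restrict_iff' measurableSet_Ioc]
    have h0 : ∀ t ∈ Icc 0 T, ∫ s in (0 : ℝ)..t, (q s - conv volC G s) = 0 := by
      intro t ht
      rw [intervalIntegral.integral_of_le ht.1]
      rcases eq_or_lt_of_le ht.1 with h | h
      · simp [← h]
      · obtain ⟨k1, k2⟩ := key t ⟨h, ht.2⟩
        rw [integral_sub (hq.mono_set (Ioc_subset_Ioc_right ht.2)) k2]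
        rw [conv_eq_setIntegral _ _ ht.1, conv_eq_setIntegral _ _ ht.1] at k1
        simp only [one_mul] at k1
        rw [k1, sub_self]
    have hder := IntervalIntegrable.ae_hasDerivAt_integral
      ((intervalIntegrable_iff_integrableOn_Ioc_of_le hT0.le).2 hloc)
    rw [uIcc_of_le hT0.le] at hder
    have hne : ∀ᵐ x : ℝ, x ≠ T := by simp [ae_iff, measure_singleton]
    filter_upwards [hder, hne] with x hx hxT hxm
    have d1 := hx ⟨hxm.1.le, hxm.2⟩ 0 ⟨le_rfl, hT0.le⟩
    have d2 : HasDerivAt (fun x ↦ ∫ s in (0 : ℝ)..x, (q s - conv volC G s)) 0 x := by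
      refine (hasDerivAt_const x (0 : ℂ)).congr_of_eventuallyEq ?_
      filter_upwards [Ioo_mem_nhds hxm.1 (lt_of_le_of_ne hxm.2 hxT)] with s hs
      exact h0 s ⟨hs.1.le, hs.2.le⟩
    exact d1.unique d2
  filter_upwards [hzero] with t ht
  exact sub_eq_zero.mp ht


/-! ### Forms of the charge equation -/

/-- A measurable function bounded on `(0, T]`. -/
def BddMeas (g : ℝ → ℂ) (T : ℝ) : Prop :=
  AEStronglyMeasurable g (volume.restrict (Ioc 0 T)) ∧ ∃ C : ℝ, 0 ≤ C ∧ ∀ r ∈ Ioc 0 T, ‖g r‖ ≤ C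

theorem BddMeas.mono {g : ℝ → ℂ} {T t : ℝ} (h : BddMeas g T) (ht : t ≤ T) : BddMeas g t :=
  ⟨h.1.mono_measure (Measure.restrict_mono (Ioc_subset_Ioc_right ht) le_rfl),
    h.2.imp fun _ hC ↦ ⟨hC.1, fun r hr ↦ hC.2 r ⟨hr.1, hr.2.trans ht⟩⟩⟩

theorem BddMeas.integrableOn {g : ℝ → ℂ} {T : ℝ} (h : BddMeas g T) : IntegrableOn g (Ioc 0 T) := by
  obtain ⟨hm, C, -, hC⟩ := h
  refine (integrableOn_const (C := C) measure_Ioc_lt_top.ne).mono' hm ?_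
  filter_upwards [ae_restrict_mem measurableSet_Ioc] with r hr using hC r hr

theorem BddMeas.add {f g : ℝ → ℂ} {T : ℝ} (hf : BddMeas f T) (hg : BddMeas g T) :
    BddMeas (fun t ↦ f t + g t) T := by
  obtain ⟨hm, C, hC0, hC⟩ := hf
  obtain ⟨hm', C', hC0', hC'⟩ := hg
  exact ⟨hm.add hm', C + C', by positivity, fun r hr ↦
    (norm_add_le _ _).trans (add_le_add (hC r hr) (hC' r hr))⟩

theorem BddMeas.const_mul {g : ℝ → ℂ} {T : ℝ} (hg : BddMeas g T) (c : ℂ) :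
    BddMeas (fun t ↦ c * g t) T := by
  obtain ⟨hm, C, hC0, hC⟩ := hg
  refine ⟨hm.const_mul c, ‖c‖ * C, by positivity, fun r hr ↦ ?_⟩
  rw [norm_mul]
  exact mul_le_mul_of_nonneg_left (hC r hr) (norm_nonneg _)

theorem BddMeas.sub {f g : ℝ → ℂ} {T : ℝ} (hf : BddMeas f T) (hg : BddMeas g T) :
    BddMeas (fun t ↦ f t - g t) T := by
  have := hf.add (hg.const_mul (-1))
  simpa [sub_eq_add_neg] using this

theorem _root_.ContinuousOn.bddMeas {g : ℝ → ℂ} {T : ℝ} (hg : ContinuousOn g (Icc 0 T)) :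
    BddMeas g T := by
  obtain ⟨C, hC⟩ := isCompact_Icc.exists_bound_of_continuousOn hg
  refine ⟨(hg.mono Ioc_subset_Icc_self).aestronglyMeasurable measurableSet_Ioc, max C 0,
    le_max_right _ _, fun r hr ↦ (hC r ⟨hr.1.le, hr.2⟩).trans (le_max_left _ _)⟩

theorem _root_.Continuous.bddMeas {g : ℝ → ℂ} (hg : Continuous g) (T : ℝ) : BddMeas g T :=
  hg.continuousOn.bddMeas

theorem BddMeas.integrableOn_conv {a g : ℝ → ℂ} {t : ℝ} (hg : BddMeas g t)
    (ha : IntegrableOn a (Ioc 0 t)) :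
    IntegrableOn (fun τ ↦ a (t - τ) * g τ) (Ioc 0 t) := by
  rcases le_or_gt t 0 with h | h
  · rw [Ioc_eq_empty (by linarith)]; exact integrableOn_empty
  obtain ⟨hm, C, -, hC⟩ := hg
  have h1 : IntegrableOn (fun τ ↦ a (t - τ)) (Ioc 0 t) := by
    have := integrableOn_conv_comm (a := fun _ ↦ 1) (b := a) h.le (by simpa using ha)
    simpa using this
  refine Integrable.mul_bdd (c := C) h1 hm ?_
  filter_upwards [ae_restrict_mem measurableSet_Ioc] with r hr using hC r hr

theorem integrableOn_volC {t : ℝ} (ht : t ≤ 1 / 8) : IntegrableOn volC (Ioc 0 t) :=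
  (integrableOn_volterraI (show t < 1 by linarith)).ofReal

theorem integrableOn_logC {t : ℝ} : IntegrableOn logC (Ioc 0 t) := by
  rcases le_or_gt t 0 with h | h
  · rw [Ioc_eq_empty (by linarith)]; exact integrableOn_empty
  have : IntegrableOn (fun x ↦ -Real.eulerMascheroniConstant - Real.log x) (Ioc 0 t) :=
    (integrableOn_const measure_Ioc_lt_top.ne).sub
      ((intervalIntegrable_iff_integrableOn_Ioc_of_le h.le).1
        intervalIntegral.intervalIntegrable_log')
  exact this.ofReal

theorem conv_add_right {a f g : ℝ → ℂ} {t : ℝ} (ht : 0 ≤ t)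
    (hf : IntegrableOn (fun τ ↦ a (t - τ) * f τ) (Ioc 0 t))
    (hg : IntegrableOn (fun τ ↦ a (t - τ) * g τ) (Ioc 0 t)) :
    conv a (fun τ ↦ f τ + g τ) t = conv a f t + conv a g t := by
  simp only [conv_eq_setIntegral _ _ ht, mul_add]
  exact integral_add hf hg

theorem conv_sub_right {a f g : ℝ → ℂ} {t : ℝ} (ht : 0 ≤ t)
    (hf : IntegrableOn (fun τ ↦ a (t - τ) * f τ) (Ioc 0 t))
    (hg : IntegrableOn (fun τ ↦ a (t - τ) * g τ) (Ioc 0 t)) :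
    conv a (fun τ ↦ f τ - g τ) t = conv a f t - conv a g t := by
  simp only [conv_eq_setIntegral _ _ ht, mul_sub]
  exact integral_sub hf hg

theorem conv_const_mul_right (a f : ℝ → ℂ) (c : ℂ) (t : ℝ) :
    conv a (fun τ ↦ c * f τ) t = c * conv a f t := by
  simp only [conv]
  rw [← intervalIntegral.integral_const_mul]
  exact intervalIntegral.integral_congr fun τ _ ↦ by ring

theorem conv_congr_right {a f g : ℝ → ℂ} {t : ℝ} (ht : 0 ≤ t) (h : ∀ τ ∈ Ioc 0 t, f τ = g τ) :
    conv a f t = conv a g t := by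
  simp only [conv_eq_setIntegral _ _ ht]
  exact setIntegral_congr_fun measurableSet_Ioc fun τ hτ ↦ by simp only [h τ hτ]

/-- The nonlinearity `|z|^{2σ} z`. -/
def nl (σ : ℝ) (z : ℂ) : ℂ := ((‖z‖ ^ (2 * σ) : ℝ) : ℂ) * z

/-- The constant `log 2 - γ + iπ/4` of the charge equation. -/
def chargeConst : ℂ := Real.log 2 - Real.eulerMascheroniConstant + Complex.I * Real.pi / 4

/-- The right-hand side `G` of the charge equation in the form `q = I * G`. -/
def chargeRHS (lam β₀ σ : ℝ) (q₀ : ℂ) (F q : ℝ → ℂ) (τ : ℝ) : ℂ :=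
  q₀ * greenTrace lam τ + 4 * Real.pi * F τ + 2 * chargeConst * q τ
    - 4 * Real.pi * β₀ * nl σ (q τ)

/-- The part of the regularized right-hand side which does not depend on `q`. -/
def regSource (lam : ℝ) (q₀ : ℂ) (F : ℝ → ℂ) (τ : ℝ) : ℂ :=
  -q₀ * (Real.log lam + Complex.I * Real.pi / 2)
    + Complex.I * lam * q₀ * (∫ s in (0 : ℝ)..τ, greenTrace lam s) + 4 * Real.pi * F τ

/-- The part of the regularized right-hand side which depends on `q`. -/
def regNonlin (β₀ σ : ℝ) (z : ℂ) : ℂ := 2 * chargeConst * z - 4 * Real.pi * β₀ * nl σ z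

/-- The right-hand side of the charge equation in the form `q = q₀ + I * g`. -/
def regRHS (lam β₀ σ : ℝ) (q₀ : ℂ) (F q : ℝ → ℂ) (τ : ℝ) : ℂ :=
  regSource lam q₀ F τ + regNonlin β₀ σ (q τ)

theorem continuous_nl {σ : ℝ} (hσ : 1 / 2 ≤ σ) : Continuous (nl σ) := by
  unfold nl
  have : Continuous fun z : ℂ ↦ ‖z‖ ^ (2 * σ) :=
    continuous_norm.rpow_const fun _ ↦ Or.inr (by linarith)
  fun_prop

theorem BddMeas.comp {q : ℝ → ℂ} {T : ℝ} (hq : BddMeas q T) {N : ℂ → ℂ} (hN : Continuous N) :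
    BddMeas (fun τ ↦ N (q τ)) T := by
  obtain ⟨hm, C, hC0, hC⟩ := hq
  obtain ⟨M, hM⟩ := (isCompact_closedBall (0 : ℂ) C).exists_bound_of_continuousOn hN.continuousOn
  exact ⟨hN.comp_aestronglyMeasurable hm, max M 0, le_max_right _ _, fun r hr ↦
    (hM _ (by simpa using hC r hr)).trans (le_max_left _ _)⟩

theorem continuous_regNonlin (β₀ : ℝ) {σ : ℝ} (hσ : 1 / 2 ≤ σ) : Continuous (regNonlin β₀ σ) := by
  have := continuous_nl hσ
  unfold regNonlin
  fun_prop

theorem continuousOn_integral_greenTrace {lam : ℝ} (hlam : 0 < lam) {T : ℝ} (hT : 0 ≤ T) :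
    ContinuousOn (fun τ ↦ ∫ s in (0 : ℝ)..τ, greenTrace lam s) (Icc 0 T) := by
  have := intervalIntegral.continuousOn_primitive_interval (μ := volume) (f := greenTrace lam)
    (a := 0) (b := T) ((integrableOn_Icc_iff_integrableOn_Ioc).2 (integrableOn_greenTrace hlam T)
      |> fun h ↦ by rwa [uIcc_of_le hT])
  rwa [uIcc_of_le hT] at this

theorem continuousOn_regSource {lam : ℝ} (hlam : 0 < lam) (q₀ : ℂ) {F : ℝ → ℂ} (hF : Continuous F)
    {T : ℝ} (hT : 0 ≤ T) : ContinuousOn (regSource lam q₀ F) (Icc 0 T) := by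
  have := continuousOn_integral_greenTrace hlam hT
  unfold regSource
  fun_prop

theorem bddMeas_regRHS {lam β₀ σ : ℝ} (hlam : 0 < lam) (hσ : 1 / 2 ≤ σ) (q₀ : ℂ) {F q : ℝ → ℂ}
    (hF : Continuous F) {T : ℝ} (hT : 0 ≤ T) (hq : BddMeas q T) :
    BddMeas (regRHS lam β₀ σ q₀ F q) T :=
  (continuousOn_regSource hlam q₀ hF hT).bddMeas.add (hq.comp (continuous_regNonlin β₀ hσ))

theorem greenTrace_eq {lam s : ℝ} (hlam : 0 < lam) (hs : 0 < s) :
    greenTrace lam s = logC s - (Real.log lam + Complex.I * Real.pi / 2) +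
      Complex.I * lam * ∫ σ in (0 : ℝ)..s, greenTrace lam σ := by
  have := greenTrace_sub_integral hlam hs
  rw [logC]
  linear_combination this

theorem chargeRHS_eq {lam β₀ σ : ℝ} (hlam : 0 < lam) (q₀ : ℂ) (F q : ℝ → ℂ) {τ : ℝ} (hτ : 0 < τ) :
    chargeRHS lam β₀ σ q₀ F q τ = q₀ * logC τ + regRHS lam β₀ σ q₀ F q τ := by
  rw [chargeRHS, greenTrace_eq hlam hτ, regRHS, regSource, regNonlin]
  ring

/-- The singular part of `G` is `q₀ (-γ - log)`, and its convolution with `I` is exactly `q₀` by the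
Sonine identity. What is left under the convolution is bounded, the form suited to a fixed-point
argument. -/
theorem conv_volC_chargeRHS {lam β₀ σ : ℝ} (hlam : 0 < lam) (hσ : 1 / 2 ≤ σ) (q₀ : ℂ) {F q : ℝ → ℂ}
    (hF : Continuous F) {t : ℝ} (ht0 : 0 < t) (ht : t ≤ 1 / 8) (hq : BddMeas q t) :
    conv volC (chargeRHS lam β₀ σ q₀ F q) t = q₀ + conv volC (regRHS lam β₀ σ q₀ F q) t := by
  rw [conv_congr_right ht0.le fun τ hτ ↦ chargeRHS_eq (β₀ := β₀) (σ := σ) hlam q₀ F q hτ.1,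
    conv_add_right ht0.le, conv_const_mul_right, (conv_volC_logC ht0 ht).2.2, mul_one]
  · refine ((conv_volC_logC ht0 ht).1.const_mul q₀).congr (Eventually.of_forall fun τ ↦ ?_)
    simp only
    ring
  · exact (bddMeas_regRHS hlam hσ q₀ hF ht0.le hq).integrableOn_conv (integrableOn_volC ht)

theorem integrableOn_chargeRHS {lam β₀ σ : ℝ} (hlam : 0 < lam) (hσ : 1 / 2 ≤ σ) (q₀ : ℂ)
    {F q : ℝ → ℂ} (hF : Continuous F) {T : ℝ} (hT : 0 ≤ T) (hq : BddMeas q T) :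
    IntegrableOn (chargeRHS lam β₀ σ q₀ F q) (Ioc 0 T) := by
  refine ((integrableOn_logC.const_mul q₀).add
    (bddMeas_regRHS (β₀ := β₀) hlam hσ q₀ hF hT hq).integrableOn).congr ?_
  filter_upwards [ae_restrict_mem measurableSet_Ioc] with τ hτ
  exact (chargeRHS_eq hlam q₀ F q hτ.1).symm

/-- The charge equation in integrated form. -/
theorem isChargeSolution_iff {y : Plane} {lam β₀ σ T : ℝ} {ψ₀ : L2} {q₀ : ℂ} {F q : ℝ → ℂ}
    (hlam : 0 < lam) (hσ : 1 / 2 ≤ σ) (hF : Continuous F) (hT : T ≤ 1 / 8)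
    (hv : ∀ τ, 0 < τ → valueAt (U₀ τ ψ₀) y = F τ + q₀ / (4 * Real.pi) * greenTrace lam τ) :
    IsChargeSolution y β₀ σ T ψ₀ q ↔ ContinuousOn q (Icc 0 T) ∧
      ∀ t ∈ Ioc 0 T, q t = q₀ + conv volC (regRHS lam β₀ σ q₀ F q) t := by
  have hpi : (Real.pi : ℂ) ≠ 0 := by exact_mod_cast Real.pi_ne_zero
  have main : ContinuousOn q (Icc 0 T) → ∀ t ∈ Ioc 0 T,
      IntegrableOn (fun τ ↦ volC (t - τ) * nl σ (q τ)) (Ioc 0 t) ∧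
      IntegrableOn (fun τ ↦ volC (t - τ) * q τ) (Ioc 0 t) ∧
      IntegrableOn (fun τ ↦ volC (t - τ) * valueAt (U₀ τ ψ₀) y) (Ioc 0 t) ∧
      q₀ + conv volC (regRHS lam β₀ σ q₀ F q) t = 4 * Real.pi * conv volC
        (fun τ ↦ valueAt (U₀ τ ψ₀) y) t + 2 * chargeConst * conv volC q t
        - 4 * Real.pi * β₀ * conv volC (fun τ ↦ nl σ (q τ)) t := by
    intro hc t ht
    have t8 := ht.2.trans hT
    have hq : BddMeas q t := hc.bddMeas.mono ht.2
    have i1 := (hq.comp (continuous_nl hσ)).integrableOn_conv (integrableOn_volC t8)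
    have i2 := hq.integrableOn_conv (integrableOn_volC t8)
    have hsrc : BddMeas (regSource lam q₀ F) t := (continuousOn_regSource hlam q₀ hF ht.1.le).bddMeas
    have hveq : ∀ τ ∈ Ioc 0 t, valueAt (U₀ τ ψ₀) y =
        (4 * Real.pi : ℂ)⁻¹ * (q₀ * logC τ + regSource lam q₀ F τ) := by
      intro τ hτ
      rw [hv τ hτ.1, greenTrace_eq hlam hτ.1, regSource]
      field_simp
      ring
    have i4 : IntegrableOn (fun τ ↦ volC (t - τ) * (q₀ * logC τ)) (Ioc 0 t) := by
      refine ((conv_volC_logC ht.1 t8).1.const_mul q₀).congr (Eventually.of_forall fun τ ↦ ?_)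
      simp only
      ring
    have i5 := hsrc.integrableOn_conv (integrableOn_volC t8)
    refine ⟨i1, i2, ?_, ?_⟩
    · refine ((i4.add i5).const_mul ((4 * Real.pi : ℂ)⁻¹)).congr ?_
      filter_upwards [ae_restrict_mem measurableSet_Ioc] with τ hτ
      rw [hveq τ hτ]
      simp only [Pi.add_apply]
      ring
    · rw [conv_congr_right ht.1.le hveq, conv_const_mul_right, conv_add_right ht.1.le i4 i5,
        conv_const_mul_right, (conv_volC_logC ht.1 t8).2.2]
      unfold regRHS regNonlin
      rw [conv_add_right ht.1.le i5, conv_sub_right ht.1.le, conv_const_mul_right,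
        conv_const_mul_right]
      · field_simp
        ring
      · exact (hq.const_mul _).integrableOn_conv (integrableOn_volC t8)
      · exact ((hq.comp (continuous_nl hσ)).const_mul _).integrableOn_conv (integrableOn_volC t8)
      · exact (hq.comp (continuous_regNonlin β₀ hσ)).integrableOn_conv (integrableOn_volC t8)
  have hnlform : ∀ t, (∫ τ in (0 : ℝ)..t, (volterraI (t - τ) : ℂ) * ((‖q τ‖ ^ (2 * σ) : ℝ) : ℂ) * q τ)
      = conv volC (fun τ ↦ nl σ (q τ)) t := fun t ↦
    intervalIntegral.integral_congr fun τ _ ↦ by simp only [nl, volC]; ring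
  constructor
  · intro h
    refine ⟨h.continuousOn, fun t ht ↦ ?_⟩
    rw [(main h.continuousOn t ht).2.2.2]
    have := h.equation t ht
    rw [hnlform] at this
    change q t + 4 * Real.pi * β₀ * _ - 2 * chargeConst * conv volC q t =
      4 * Real.pi * conv volC (fun τ ↦ valueAt (U₀ τ ψ₀) y) t at this
    linear_combination this
  · rintro ⟨hc, h⟩
    refine ⟨hc, fun t ht ↦ ?_, fun t ht ↦ ?_, fun t ht ↦ ?_, fun t ht ↦ ?_⟩
    · rw [intervalIntegrable_iff_integrableOn_Ioc_of_le ht.1.le]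
      refine (main hc t ht).1.congr (Eventually.of_forall fun τ ↦ ?_)
      simp only [nl, volC]; ring
    · rw [intervalIntegrable_iff_integrableOn_Ioc_of_le ht.1.le]
      exact (main hc t ht).2.1
    · rw [intervalIntegrable_iff_integrableOn_Ioc_of_le ht.1.le]
      exact (main hc t ht).2.2.1
    · rw [hnlform]
      change q t + 4 * Real.pi * β₀ * _ - 2 * chargeConst * conv volC q t =
        4 * Real.pi * conv volC (fun τ ↦ valueAt (U₀ τ ψ₀) y) t
      have := (main hc t ht).2.2.2
      rw [← h t ht] at this
      linear_combination this


/-! ### The integrated weak equation against the Green function -/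

theorem conv_one (g : ℝ → ℂ) (t : ℝ) : conv (fun _ ↦ 1) g t = ∫ s in (0 : ℝ)..t, g s := by
  simp [conv]

theorem conv_one_linear {f g h k : ℝ → ℂ} {t : ℝ} (ht : 0 ≤ t) (hf : IntegrableOn f (Ioc 0 t))
    (hg : IntegrableOn g (Ioc 0 t)) (hh : IntegrableOn h (Ioc 0 t)) (hk : IntegrableOn k (Ioc 0 t))
    (a b c d : ℂ) :
    conv (fun _ ↦ 1) (fun τ ↦ a * f τ + b * g τ + c * h τ - d * k τ) t =
      a * conv (fun _ ↦ 1) f t + b * conv (fun _ ↦ 1) g t + c * conv (fun _ ↦ 1) h t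
        - d * conv (fun _ ↦ 1) k t := by
  simp only [conv_eq_setIntegral _ _ ht, one_mul]
  have h2 : IntegrableOn (fun τ ↦ a * f τ + b * g τ) (Ioc 0 t) :=
    (hf.const_mul a).add (hg.const_mul b)
  have h3 : IntegrableOn (fun τ ↦ a * f τ + b * g τ + c * h τ) (Ioc 0 t) := h2.add (hh.const_mul c)
  rw [integral_sub h3 (hk.const_mul d), integral_add h2 (hh.const_mul c),
    integral_add (hf.const_mul a) (hg.const_mul b)]
  simp only [integral_const_mul]

theorem integrableOn_greenTrace_sub {lam : ℝ} (hlam : 0 < lam) {t : ℝ} (ht : 0 ≤ t) :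
    IntegrableOn (fun τ ↦ greenTrace lam (t - τ)) (Ioc 0 t) := by
  have := integrableOn_conv_comm (a := fun _ ↦ 1) (b := greenTrace lam) ht
    (by simpa using integrableOn_greenTrace hlam t)
  simpa using this

theorem integral_norm_greenTrace_sub_le {lam : ℝ} (hlam : 0 < lam) {t u : ℝ} (hu : 0 ≤ u)
    (hut : u ≤ t) :
    ∫ x in Ioc 0 u, ‖greenTrace lam (u - x)‖ ≤ ∫ x in Ioc 0 t, ‖greenTrace lam x‖ := by
  have h := intervalIntegral.integral_comp_sub_left (a := 0) (b := u)
    (fun x ↦ ‖greenTrace lam x‖) u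
  simp only [sub_self, sub_zero] at h
  rw [intervalIntegral.integral_of_le hu, intervalIntegral.integral_of_le hu] at h
  rw [h]
  exact setIntegral_mono_set (integrableOn_greenTrace hlam t).norm
    (Eventually.of_forall fun _ ↦ norm_nonneg _) (Ioc_subset_Ioc_right hut).eventuallyLE

theorem conv_one_greenTrace_assoc {lam : ℝ} (hlam : 0 < lam) {t : ℝ} (ht : 0 ≤ t) {g : ℝ → ℂ}
    (hg : IntegrableOn g (Ioc 0 t)) :
    conv (fun _ ↦ 1) (conv (greenTrace lam) g) t =
      conv (fun s ↦ ∫ σ in (0 : ℝ)..s, greenTrace lam σ) g t ∧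
    IntegrableOn (conv (greenTrace lam) g) (Ioc 0 t) ∧
    IntegrableOn (fun r ↦ (∫ σ in (0 : ℝ)..(t - r), greenTrace lam σ) * g r) (Ioc 0 t) := by
  have := conv_assoc (a := fun _ ↦ 1) (b := greenTrace lam) (g := g) (t := t)
    (M := ∫ x in Ioc 0 t, ‖greenTrace lam x‖) measurable_const (measurable_greenTrace lam) ht
    (fun u hu ↦ ⟨by simpa using integrableOn_greenTrace hlam u, by
      simp only [one_mul]
      exact setIntegral_mono_set (integrableOn_greenTrace hlam t).norm
        (Eventually.of_forall fun _ ↦ norm_nonneg _) (Ioc_subset_Ioc_right hu.2).eventuallyLE⟩) hg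
  simp only [one_mul, conv_one, funext (conv_one (greenTrace lam))] at this ⊢
  exact this

/-- The basic identity `greenTrace_eq`, convolved with `g`; associativity rewrites `1 * (greenTrace
* g)` through the primitive of `greenTrace`. -/
theorem conv_greenTrace_sub {lam : ℝ} (hlam : 0 < lam) {t : ℝ} (ht : 0 ≤ t) {g : ℝ → ℂ}
    (hg : BddMeas g t) :
    conv (greenTrace lam) g t - Complex.I * lam * conv (fun _ ↦ 1) (conv (greenTrace lam) g) t =
      conv logC g t - (Real.log lam + Complex.I * Real.pi / 2) * conv (fun _ ↦ 1) g t := by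
  obtain ⟨h1, -, h3⟩ := conv_one_greenTrace_assoc hlam ht hg.integrableOn
  have i1 := hg.integrableOn_conv (integrableOn_greenTrace hlam t)
  have i2 := hg.integrableOn_conv (integrableOn_logC (t := t))
  have i3 := hg.integrableOn
  rw [h1]
  simp only [conv_eq_setIntegral _ _ ht, one_mul]
  rw [← integral_const_mul, ← integral_const_mul, ← integral_sub i1 (h3.const_mul _),
    ← integral_sub i2 (i3.const_mul _)]
  rw [integral_Ioc_eq_integral_Ioo, integral_Ioc_eq_integral_Ioo]
  refine setIntegral_congr_fun measurableSet_Ioo fun τ hτ ↦ ?_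
  have := greenTrace_eq hlam (sub_pos.2 hτ.2)
  linear_combination g τ * this

/-- The charge relative to the evolution `q₀ exp (i λ t)` of a multiple of the Green function. -/
def relCharge (lam : ℝ) (q₀ : ℂ) (q : ℝ → ℂ) (t : ℝ) : ℂ :=
  q t - q₀ * phase (-lam) t

theorem continuous_phase_right (a : ℝ) : Continuous fun t : ℝ ↦ phase a t := by
  unfold phase; fun_prop

theorem BddMeas.relCharge {q : ℝ → ℂ} {T : ℝ} (hq : BddMeas q T) (lam : ℝ) (q₀ : ℂ) :
    BddMeas (relCharge lam q₀ q) T :=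
  hq.sub (((continuous_phase_right (-lam)).bddMeas T).const_mul q₀)

theorem conv_one_phase {lam : ℝ} (t : ℝ) :
    Complex.I * lam * conv (fun _ ↦ 1) (phase (-lam)) t = phase (-lam) t - 1 := by
  have h : ∀ s : ℝ, HasDerivAt (fun s : ℝ ↦ phase (-lam) s) (Complex.I * lam * phase (-lam) s) s := by
    intro s
    have h1 : HasDerivAt (fun s : ℝ ↦ -Complex.I * (((-lam) * s : ℝ) : ℂ)) (-Complex.I * ((-lam : ℝ) : ℂ)) s := by
      have : HasDerivAt (fun s : ℝ ↦ (-lam) * s) (-lam) s := by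
        simpa using (hasDerivAt_id s).const_mul (-lam)
      exact (this.ofReal_comp).const_mul _
    have := h1.cexp
    refine this.congr_deriv ?_
    rw [phase]; push_cast; ring
  have h2 := intervalIntegral.integral_eq_sub_of_hasDerivAt (a := 0) (b := t) (fun s _ ↦ h s)
    (by
      apply Continuous.intervalIntegrable
      have := continuous_phase_right (-lam)
      fun_prop)
  rw [conv_one, ← intervalIntegral.integral_const_mul, h2]
  simp [phase]

/-- The function `E(t) = e^{iλt}` satisfies `iλ (1 * E) = E - 1`. After associativity the terms with
`E` cancel and only `greenTrace * 1` survives. -/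
theorem conv_greenTrace_phase_sub {lam : ℝ} (hlam : 0 < lam) {t : ℝ} (ht : 0 ≤ t) :
    conv (greenTrace lam) (phase (-lam)) t -
      Complex.I * lam * conv (fun _ ↦ 1) (conv (greenTrace lam) (phase (-lam))) t =
      conv (fun _ ↦ 1) (greenTrace lam) t := by
  have hE : BddMeas (phase (-lam)) t := (continuous_phase_right (-lam)).bddMeas t
  have h1 : BddMeas (fun _ ↦ 1) t := continuous_const.bddMeas t
  have a1 := (conv_one_greenTrace_assoc hlam ht hE.integrableOn).1
  have a2 := (conv_assoc (a := greenTrace lam) (b := fun _ ↦ 1) (g := phase (-lam)) (t := t)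
    (M := ∫ x in Ioc 0 t, ‖greenTrace lam x‖) (measurable_greenTrace lam) measurable_const ht
    (fun u hu ↦ ⟨by simpa using integrableOn_greenTrace_sub hlam hu.1.le, by
      simpa using integral_norm_greenTrace_sub_le hlam hu.1.le hu.2⟩) hE.integrableOn)
  have a3 : conv (greenTrace lam) (fun _ ↦ 1) = fun s ↦ ∫ σ in (0 : ℝ)..s, greenTrace lam σ := by
    funext s
    rw [conv_comm, conv_one]
  have a2' := a2.1
  rw [a3] at a2'
  rw [a1, ← a2', ← conv_const_mul_right]
  rw [conv_congr_right ht (g := fun τ ↦ phase (-lam) τ - 1) fun τ _ ↦ conv_one_phase τ,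
    conv_sub_right ht (hE.integrableOn_conv (integrableOn_greenTrace hlam t))
      (h1.integrableOn_conv (integrableOn_greenTrace hlam t)), conv_comm _ (fun _ ↦ 1)]
  ring

/-- The constant `(2π)⁻¹ (log (√λ / 2) + γ)` of the quadratic form. -/
def formConst (lam : ℝ) : ℝ := 1 / (2 * Real.pi) * Real.log (Real.sqrt lam / 2)
        + Real.eulerMascheroniConstant / (2 * Real.pi)

/-- Here the constant of the quadratic form meets the constant `log 2 - γ + iπ/4` of the charge
equation. They differ by the `log λ + iπ/2` produced by `greenTrace`, so the linear coefficient of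
the charge equation does not depend on `λ`. -/
theorem four_pi_formConst {lam : ℝ} (hlam : 0 < lam) : (4 * Real.pi * formConst lam : ℂ) =
    Real.log lam + Complex.I * Real.pi / 2 - 2 * chargeConst := by
  have h : 4 * Real.pi * formConst lam =
      Real.log lam - 2 * Real.log 2 + 2 * Real.eulerMascheroniConstant := by
    rw [formConst, Real.log_div (Real.sqrt_pos.2 hlam).ne' two_ne_zero, Real.log_sqrt hlam.le]
    field_simp
    ring
  have h' : (4 * Real.pi * formConst lam : ℂ) = ((4 * Real.pi * formConst lam : ℝ) : ℂ) := by
    push_cast; ring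
  rw [h', h, chargeConst]
  push_cast
  ring

/-- The equation tested with the Green function is the charge equation before the inversion of
the logarithmic kernel. -/
theorem conv_logC_sub_eq {lam β₀ σ : ℝ} (hlam : 0 < lam) (hσ : 1 / 2 ≤ σ) (q₀ : ℂ) {F q : ℝ → ℂ}
    (hF : Continuous F) {t : ℝ} (ht : 0 ≤ t) (hq : BddMeas q t) :
    conv logC q t - conv (fun _ ↦ 1) (chargeRHS lam β₀ σ q₀ F q) t =
      conv (greenTrace lam) (relCharge lam q₀ q) t
      - Complex.I * lam * conv (fun _ ↦ 1) (conv (greenTrace lam) (relCharge lam q₀ q)) t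
      - 4 * Real.pi * conv (fun _ ↦ 1) F t
      + 4 * Real.pi * conv (fun _ ↦ 1)
        (fun s ↦ β₀ * nl σ (q s) + formConst lam * q s) t := by
  have hE : BddMeas (phase (-lam)) t := (continuous_phase_right (-lam)).bddMeas t
  have hFb := hF.bddMeas t
  have hn := hq.comp (continuous_nl hσ)
  have hone : ∀ {f : ℝ → ℂ}, IntegrableOn f (Ioc 0 t) →
      IntegrableOn (fun τ ↦ (fun _ : ℝ ↦ (1 : ℂ)) (t - τ) * f τ) (Ioc 0 t) := fun h ↦ by simpa using h
  have e1 := conv_greenTrace_sub hlam ht (hq.relCharge lam q₀)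
  have e2 := (conv_greenTrace_sub hlam ht hE).symm.trans (conv_greenTrace_phase_sub hlam ht)
  have e3 : conv logC (relCharge lam q₀ q) t = conv logC q t - q₀ * conv logC (phase (-lam)) t := by
    unfold relCharge
    rw [conv_sub_right ht (hq.integrableOn_conv integrableOn_logC)
      ((hE.const_mul q₀).integrableOn_conv integrableOn_logC), conv_const_mul_right]
  have e4 : conv (fun _ ↦ 1) (relCharge lam q₀ q) t =
      conv (fun _ ↦ 1) q t - q₀ * conv (fun _ ↦ 1) (phase (-lam)) t := by
    unfold relCharge
    rw [conv_sub_right ht (hone hq.integrableOn) (hone (hE.const_mul q₀).integrableOn),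
      conv_const_mul_right]
  have e5 : conv (fun _ ↦ 1) (chargeRHS lam β₀ σ q₀ F q) t =
      q₀ * conv (fun _ ↦ 1) (greenTrace lam) t + 4 * Real.pi * conv (fun _ ↦ 1) F t
      + 2 * chargeConst * conv (fun _ ↦ 1) q t
      - 4 * Real.pi * β₀ * conv (fun _ ↦ 1) (fun s ↦ nl σ (q s)) t := by
    exact conv_one_linear ht (integrableOn_greenTrace hlam t) hFb.integrableOn hq.integrableOn
      hn.integrableOn q₀ (4 * Real.pi) (2 * chargeConst) (4 * Real.pi * β₀)
  have e6 : conv (fun _ ↦ 1) (fun s ↦ β₀ * nl σ (q s) + formConst lam * q s) t =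
      β₀ * conv (fun _ ↦ 1) (fun s ↦ nl σ (q s)) t + formConst lam * conv (fun _ ↦ 1) q t := by
    have := conv_one_linear ht hn.integrableOn hq.integrableOn hq.integrableOn hq.integrableOn
      β₀ (formConst lam) 0 0
    simpa only [zero_mul, add_zero, sub_zero] using this
  rw [e1, e3, e4, e5, e6]
  linear_combination q₀ * e2 - conv (fun _ ↦ 1) q t * four_pi_formConst hlam

/-- A solution of the charge equation satisfies the equation before inversion. -/
theorem conv_logC_of_eq_conv_volC {q G : ℝ → ℂ} {T : ℝ} (hT : T ≤ 1 / 8)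
    (hG : IntegrableOn G (Ioc 0 T)) {t : ℝ} (ht : t ∈ Ioc 0 T)
    (hq : ∀ s ∈ Ioc 0 T, q s = conv volC G s) :
    conv logC q t = conv (fun _ ↦ 1) G t := by
  have hGt : IntegrableOn G (Ioc 0 t) := hG.mono_set (Ioc_subset_Ioc_right ht.2)
  have a := (conv_assoc (a := logC) (b := volC) (g := G) (t := t) (M := 1) measurable_logC
    measurable_volC ht.1.le (fun u hu ↦
      have := conv_logC_volC hu.1 (hu.2.trans (ht.2.trans hT))
      ⟨this.1, this.2.1⟩) hGt).1
  rw [conv_congr_right ht.1.le fun τ hτ ↦ hq τ ⟨hτ.1, hτ.2.trans ht.2⟩, a]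
  rw [conv_eq_setIntegral _ _ ht.1.le, conv_eq_setIntegral _ _ ht.1.le,
    integral_Ioc_eq_integral_Ioo, integral_Ioc_eq_integral_Ioo]
  refine setIntegral_congr_fun measurableSet_Ioo fun τ hτ ↦ ?_
  have := (conv_logC_volC (sub_pos.2 hτ.2) (by linarith [hτ.1, ht.2])).2.2
  simp only [this]


/-! ### Solution of the charge equation -/

/-- For `2σ ≥ 1` the power `x^(2σ)` has a bounded derivative on `[0, R]`. Splitting the difference
as `|z|^{2σ}(z - w) + (|z|^{2σ} - |w|^{2σ}) w` and the mean value inequality yield the constant. -/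
theorem exists_nl_lipschitz {σ : ℝ} (hσ : 1 / 2 ≤ σ) {R : ℝ} (hR : 0 ≤ R) : ∃ L : ℝ, 0 ≤ L ∧
    ∀ z w : ℂ, ‖z‖ ≤ R → ‖w‖ ≤ R → ‖nl σ z - nl σ w‖ ≤ L * ‖z - w‖ := by
  have hp : 1 ≤ 2 * σ := by linarith
  have key : ∀ x ∈ Icc 0 R, ∀ y ∈ Icc 0 R,
      ‖y ^ (2 * σ) - x ^ (2 * σ)‖ ≤ (2 * σ * R ^ (2 * σ - 1)) * ‖y - x‖ := by
    intro x hx y hy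
    refine Convex.norm_image_sub_le_of_norm_hasDerivWithin_le (s := Icc 0 R)
      (f := fun x : ℝ ↦ x ^ (2 * σ)) (f' := fun x ↦ 2 * σ * x ^ (2 * σ - 1))
      (fun x _ ↦ ?_) (fun x hx ↦ ?_) (convex_Icc 0 R) hx hy
    · exact (Real.hasDerivAt_rpow_const (Or.inr hp)).hasDerivWithinAt
    · have h1 : 0 ≤ x ^ (2 * σ - 1) := Real.rpow_nonneg hx.1 _
      rw [Real.norm_of_nonneg (by positivity)]
      exact mul_le_mul_of_nonneg_left (Real.rpow_le_rpow hx.1 hx.2 (by linarith)) (by linarith)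
  refine ⟨R ^ (2 * σ) + 2 * σ * R ^ (2 * σ - 1) * R, by positivity, fun z w hz hw ↦ ?_⟩
  have e : nl σ z - nl σ w = ((‖z‖ ^ (2 * σ) : ℝ) : ℂ) * (z - w) +
      ((‖z‖ ^ (2 * σ) - ‖w‖ ^ (2 * σ) : ℝ) : ℂ) * w := by
    simp only [nl]; push_cast; ring
  rw [e]
  refine (norm_add_le _ _).trans ?_
  rw [norm_mul, norm_mul, Complex.norm_real, Complex.norm_real, add_mul,
    Real.norm_of_nonneg (by positivity : 0 ≤ ‖z‖ ^ (2 * σ))]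
  have h1 := key ‖w‖ ⟨norm_nonneg _, hw⟩ ‖z‖ ⟨norm_nonneg _, hz⟩
  have h2 : ‖‖z‖ - ‖w‖‖ ≤ ‖z - w‖ := abs_norm_sub_norm_le z w
  have h3 : 0 ≤ 2 * σ * R ^ (2 * σ - 1) := by positivity
  refine add_le_add ?_ ?_
  · exact mul_le_mul_of_nonneg_right (Real.rpow_le_rpow (norm_nonneg _) hz (by linarith))
      (norm_nonneg _)
  · calc _ ≤ (2 * σ * R ^ (2 * σ - 1) * ‖z - w‖) * R :=
          mul_le_mul (h1.trans (mul_le_mul_of_nonneg_left h2 h3)) hw (norm_nonneg _) (by positivity)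
      _ = _ := by ring

theorem exists_regNonlin_lipschitz (β₀ : ℝ) {σ : ℝ} (hσ : 1 / 2 ≤ σ) {R : ℝ} (hR : 0 ≤ R) :
    ∃ L : ℝ, 0 ≤ L ∧ ∀ z w : ℂ, ‖z‖ ≤ R → ‖w‖ ≤ R →
      ‖regNonlin β₀ σ z - regNonlin β₀ σ w‖ ≤ L * ‖z - w‖ := by
  obtain ⟨L, hL, h⟩ := exists_nl_lipschitz hσ hR
  refine ⟨‖2 * chargeConst‖ + ‖(4 * Real.pi * β₀ : ℂ)‖ * L, by positivity, fun z w hz hw ↦ ?_⟩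
  have e : regNonlin β₀ σ z - regNonlin β₀ σ w = 2 * chargeConst * (z - w) -
      4 * Real.pi * β₀ * (nl σ z - nl σ w) := by simp only [regNonlin]; ring
  rw [e]
  refine (norm_sub_le _ _).trans ?_
  rw [norm_mul _ (z - w), norm_mul _ (nl σ z - nl σ w), add_mul, mul_assoc ‖(4 * Real.pi * β₀ : ℂ)‖]
  exact add_le_add le_rfl (mul_le_mul_of_nonneg_left (h z w hz hw) (norm_nonneg _))

theorem norm_conv_volC_le {g : ℝ → ℂ} {k : ℝ → ℝ} {t : ℝ} (h0 : 0 ≤ t) (ht : t ≤ 1 / 8)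
    (hk : ContinuousOn k (Icc 0 t)) (hg : ∀ r ∈ Ioc 0 t, ‖g r‖ ≤ k r) :
    ‖conv volC g t‖ ≤ ∫ τ in (0 : ℝ)..t, volterraI (t - τ) * k τ := by
  refine intervalIntegral.norm_integral_le_of_norm_le h0 (Eventually.of_forall fun τ hτ ↦ ?_) ?_
  · rw [norm_mul, volC, Complex.norm_real, Real.norm_of_nonneg (volterraI_nonneg (by linarith [hτ.2]))]
    exact mul_le_mul_of_nonneg_left (hg τ hτ) (volterraI_nonneg (by linarith [hτ.2]))
  · exact (intervalIntegrable_volterraI_sub le_rfl h0 (by linarith)).mul_continuousOn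
      (by rwa [uIcc_of_le h0])

theorem norm_conv_volC_le_const {g : ℝ → ℂ} {G t : ℝ} (h0 : 0 ≤ t) (ht : t ≤ 1 / 8)
    (hg : ∀ r ∈ Ioc 0 t, ‖g r‖ ≤ G) : ‖conv volC g t‖ ≤ volterraN t * G := by
  refine (norm_conv_volC_le h0 ht continuousOn_const hg).trans_eq ?_
  rw [intervalIntegral.integral_mul_const]
  congr 1
  simp [volterraN]

theorem tendsto_logMod_zero : Tendsto logMod (𝓝[≥] 0) (𝓝 0) := by
  have h := continuousOn_logMod 0 ⟨le_rfl, one_pos⟩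
  have e : 𝓝[Ico (0 : ℝ) 1] 0 = 𝓝[≥] 0 := nhdsWithin_Ico_eq_nhdsGE one_pos
  rw [ContinuousWithinAt, e] at h
  simpa [logMod] using h

theorem tendsto_logMod_abs (t : ℝ) : Tendsto (fun s ↦ logMod |s - t|) (𝓝 t) (𝓝 0) := by
  refine tendsto_logMod_zero.comp ?_
  rw [tendsto_nhdsWithin_iff]
  refine ⟨?_, Eventually.of_forall fun s ↦ mem_Ici.2 (abs_nonneg _)⟩
  have : Continuous fun s : ℝ ↦ |s - t| := by fun_prop
  simpa using this.tendsto t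

theorem continuousOn_conv_volC {g : ℝ → ℂ} {T : ℝ} (hT : T ≤ 1 / 8) (hg : BddMeas g T) :
    ContinuousOn (conv volC g) (Icc 0 T) := by
  obtain ⟨C, hC, h⟩ := exists_norm_volterraConv_sub_le
  obtain ⟨hm, G, hG, hb⟩ := hg
  intro t ht
  rw [ContinuousWithinAt, tendsto_iff_norm_sub_tendsto_zero]
  have hlim : Tendsto (fun s ↦ C * G * logMod |s - t|) (𝓝[Icc 0 T] t) (𝓝 0) := by
    simpa using ((tendsto_logMod_abs t).const_mul (C * G)).mono_left nhdsWithin_le_nhds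
  refine squeeze_zero' (Eventually.of_forall fun _ ↦ norm_nonneg _) ?_ hlim
  filter_upwards [self_mem_nhdsWithin] with s hs
  rcases le_total s t with hst | hst
  · rw [norm_sub_rev, abs_sub_comm, abs_of_nonneg (sub_nonneg.2 hst)]
    exact h g G T hG hT hm hb s t hs.1 hst ht.2
  · rw [abs_of_nonneg (sub_nonneg.2 hst)]
    exact h g G T hG hT hm hb t s ht.1 hst hs.2

/-- Dominated convergence with majorant `I`. In the supremum norm with weight `e^{-μt}`, convolution
with `I` on `[0, T]` has norm at most this integral, so a large `μ` makes it a contraction without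
shrinking `T`. -/
theorem tendsto_integral_volterraI_exp {T : ℝ} (hT : T ≤ 1 / 8) :
    Tendsto (fun μ : ℝ ↦ ∫ r in Ioc 0 T, volterraI r * Real.exp (-(μ * r))) atTop (𝓝 0) := by
  have := tendsto_integral_filter_of_dominated_convergence (μ := volume.restrict (Ioc 0 T))
    (l := (atTop : Filter ℝ)) (F := fun μ r ↦ volterraI r * Real.exp (-(μ * r))) (f := fun _ ↦ 0)
    volterraI ?_ ?_ (integrableOn_volterraI (by linarith)) ?_
  · simpa using this
  · refine Eventually.of_forall fun μ ↦ ?_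
    exact (measurable_volterraI.mul (by fun_prop)).aestronglyMeasurable
  · filter_upwards [eventually_ge_atTop 0] with μ hμ
    filter_upwards [ae_restrict_mem measurableSet_Ioc] with r hr
    rw [Real.norm_of_nonneg (mul_nonneg (volterraI_nonneg hr.1.le) (Real.exp_pos _).le)]
    refine mul_le_of_le_one_right (volterraI_nonneg hr.1.le) (Real.exp_le_one_iff.2 ?_)
    have := mul_nonneg hμ hr.1.le
    linarith
  · filter_upwards [ae_restrict_mem measurableSet_Ioc] with r hr
    have h1 : Tendsto (fun μ : ℝ ↦ -(μ * r)) atTop atBot :=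
      tendsto_neg_atTop_atBot.comp (tendsto_id.atTop_mul_const hr.1)
    simpa using (Real.tendsto_exp_atBot.comp h1).const_mul (volterraI r)

/-- Bounded solutions of the integrated charge equation are unique. -/
theorem eq_of_bounded_solutions {lam β₀ σ T : ℝ} (hlam : 0 < lam) (hσ : 1 / 2 ≤ σ) {q₀ : ℂ}
    {F q q' : ℝ → ℂ} (hF : Continuous F) (hT : T ≤ 1 / 8) (hq : BddMeas q T) (hq' : BddMeas q' T)
    (h : ∀ t ∈ Ioc 0 T, q t = q₀ + conv volC (regRHS lam β₀ σ q₀ F q) t)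
    (h' : ∀ t ∈ Ioc 0 T, q' t = q₀ + conv volC (regRHS lam β₀ σ q₀ F q') t) :
    ∀ t ∈ Ioc 0 T, q t = q' t := by
  intro t₀ ht₀
  have hT0 : 0 ≤ T := ht₀.1.le.trans ht₀.2
  obtain ⟨R₁, hR₁, hb₁⟩ := hq.2
  obtain ⟨R₂, hR₂, hb₂⟩ := hq'.2
  obtain ⟨L, hL, hlip⟩ := exists_regNonlin_lipschitz β₀ hσ (R := max R₁ R₂) (hR₁.trans (le_max_left _ _))
  obtain ⟨μ, hμ⟩ : ∃ μ : ℝ, 0 ≤ μ ∧ L * ∫ r in Ioc 0 T, volterraI r * Real.exp (-(μ * r)) ≤ 1 / 2 := by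
    have h1 := (tendsto_integral_volterraI_exp hT).const_mul L
    rw [mul_zero] at h1
    have := (h1.eventually (gt_mem_nhds (show (0 : ℝ) < 1 / 2 by norm_num))).and (eventually_ge_atTop 0)
    obtain ⟨μ, h2, h3⟩ := this.exists
    exact ⟨μ, h3, h2.le⟩
  -- One passage through the equation halves the weighted bound. Iteration from the a priori bound
  -- `R₁ + R₂` forces equality, with no continuity of `q` or `q'`.
  have step : ∀ K : ℝ, 0 ≤ K → (∀ t ∈ Ioc 0 T, ‖q t - q' t‖ ≤ K * Real.exp (μ * t)) →
      ∀ t ∈ Ioc 0 T, ‖q t - q' t‖ ≤ K / 2 * Real.exp (μ * t) := by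
    intro K hK hk t ht
    have t8 := ht.2.trans hT
    have e : q t - q' t = conv volC (fun τ ↦ regNonlin β₀ σ (q τ) - regNonlin β₀ σ (q' τ)) t := by
      rw [h t ht, h' t ht, add_sub_add_left_eq_sub, ← conv_sub_right ht.1.le]
      · simp only [regRHS, add_sub_add_left_eq_sub]
      · exact (bddMeas_regRHS hlam hσ q₀ hF ht.1.le (hq.mono ht.2)).integrableOn_conv
          (integrableOn_volC t8)
      · exact (bddMeas_regRHS hlam hσ q₀ hF ht.1.le (hq'.mono ht.2)).integrableOn_conv
          (integrableOn_volC t8)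
    have hb := norm_conv_volC_le (g := fun τ ↦ regNonlin β₀ σ (q τ) - regNonlin β₀ σ (q' τ))
      (k := fun τ ↦ L * (K * Real.exp (μ * τ))) ht.1.le t8 (by fun_prop) fun r hr ↦ by
        have hr' : r ∈ Ioc 0 T := ⟨hr.1, hr.2.trans ht.2⟩
        exact (hlip _ _ ((hb₁ r hr').trans (le_max_left _ _)) ((hb₂ r hr').trans (le_max_right _ _))).trans
          (mul_le_mul_of_nonneg_left (hk r hr') hL)
    rw [← e] at hb
    refine hb.trans ?_
    have h1 := intervalIntegral.integral_comp_sub_left (a := 0) (b := t)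
      (fun r ↦ volterraI r * (L * (K * Real.exp (μ * (t - r))))) t
    simp only [sub_sub_cancel, sub_self, sub_zero] at h1
    have h2 : ∀ r, volterraI r * (L * (K * Real.exp (μ * (t - r)))) =
        (L * K * Real.exp (μ * t)) * (volterraI r * Real.exp (-(μ * r))) := fun r ↦ by
      rw [show μ * (t - r) = μ * t + -(μ * r) by ring, Real.exp_add]; ring
    have hint : IntegrableOn (fun r ↦ volterraI r * Real.exp (-(μ * r))) (Ioc 0 T) := by
      have := (intervalIntegrable_volterraI hT0 (show T < 1 by linarith)).mul_continuousOn
        (g := fun r ↦ Real.exp (-(μ * r))) (by fun_prop)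
      exact (intervalIntegrable_iff_integrableOn_Ioc_of_le hT0).1 this
    have h3 : ∫ r in Ioc 0 t, volterraI r * Real.exp (-(μ * r)) ≤
        ∫ r in Ioc 0 T, volterraI r * Real.exp (-(μ * r)) := by
      refine setIntegral_mono_set hint ?_ (Ioc_subset_Ioc_right ht.2).eventuallyLE
      filter_upwards [ae_restrict_mem measurableSet_Ioc] with r hr
      exact mul_nonneg (volterraI_nonneg hr.1.le) (Real.exp_pos _).le
    rw [h1, funext h2, intervalIntegral.integral_const_mul, intervalIntegral.integral_of_le ht.1.le]
    calc _ ≤ L * K * Real.exp (μ * t) * ∫ r in Ioc 0 T, volterraI r * Real.exp (-(μ * r)) :=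
          mul_le_mul_of_nonneg_left h3 (by positivity)
      _ = (K * Real.exp (μ * t)) * (L * ∫ r in Ioc 0 T, volterraI r * Real.exp (-(μ * r))) := by ring
      _ ≤ (K * Real.exp (μ * t)) * (1 / 2) := mul_le_mul_of_nonneg_left hμ.2 (by positivity)
      _ = _ := by ring
  have iter : ∀ n : ℕ, ∀ t ∈ Ioc 0 T, ‖q t - q' t‖ ≤ (R₁ + R₂) / 2 ^ n * Real.exp (μ * t) := by
    intro n
    induction n with
    | zero =>
      intro t ht
      rw [pow_zero, div_one]
      refine ((norm_sub_le _ _).trans (add_le_add (hb₁ t ht) (hb₂ t ht))).trans ?_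
      exact le_mul_of_one_le_right (by positivity) (Real.one_le_exp (mul_nonneg hμ.1 ht.1.le))
    | succ n ih =>
      intro t ht
      have := step _ (by positivity) ih t ht
      rwa [div_div, ← pow_succ] at this
  have hlim : Tendsto (fun n : ℕ ↦ (R₁ + R₂) / 2 ^ n * Real.exp (μ * t₀)) atTop (𝓝 0) := by
    have : Tendsto (fun n : ℕ ↦ (R₁ + R₂) * (1 / 2 : ℝ) ^ n) atTop (𝓝 0) := by
      simpa using (tendsto_pow_atTop_nhds_zero_of_lt_one (r := (1 / 2 : ℝ)) (by norm_num)
        (by norm_num)).const_mul (R₁ + R₂)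
    simpa [div_eq_mul_inv] using this.mul_const (Real.exp (μ * t₀))
  have := ge_of_tendsto' hlim fun n ↦ iter n t₀ ht₀
  exact sub_eq_zero.1 (norm_le_zero_iff.1 this)

/-- Local existence for the integrated charge equation. -/
theorem exists_charge {lam : ℝ} (β₀ : ℝ) {σ : ℝ} (hlam : 0 < lam) (hσ : 1 / 2 ≤ σ) (q₀ : ℂ)
    {F : ℝ → ℂ} (hF : Continuous F) : ∃ (T L : ℝ) (q : ℝ → ℂ), 0 < T ∧ T ≤ 1 / 8 ∧ 0 ≤ L ∧
      volterraN T * L ≤ 1 / 4 ∧ Continuous q ∧ (∃ B, ∀ t, ‖q t‖ ≤ B) ∧ q 0 = q₀ ∧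
      (∀ t ∈ Icc 0 T, q t = q₀ + conv volC (regRHS lam β₀ σ q₀ F q) t) ∧
      ∀ s ∈ Icc 0 T, ∀ t ∈ Icc 0 T, ‖regNonlin β₀ σ (q s) - regNonlin β₀ σ (q t)‖ ≤ L * ‖q s - q t‖ := by
  set R : ℝ := ‖q₀‖ + 1 with hR
  have hR0 : 0 ≤ R := by positivity
  obtain ⟨L, hL, hlip⟩ := exists_regNonlin_lipschitz β₀ hσ hR0
  obtain ⟨M₁, hM₁⟩ := isCompact_Icc.exists_bound_of_continuousOn
    (continuousOn_regSource hlam q₀ hF (show (0 : ℝ) ≤ 1 / 8 by norm_num))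
  obtain ⟨M₂, hM₂⟩ := (isCompact_closedBall (0 : ℂ) R).exists_bound_of_continuousOn
    (continuous_regNonlin β₀ hσ).continuousOn
  set M : ℝ := |M₁| + |M₂| with hM
  -- Since `volterraN T → 0`, a small `T` makes the ball of radius `‖q₀‖ + 1` invariant. The value
  -- `1/4` is smaller than a contraction requires; the surplus allows the nonlinear term to be
  -- absorbed in the half-derivative estimate.
  obtain ⟨T, hT0, hT8, hTM, hTL⟩ : ∃ T : ℝ, 0 < T ∧ T ≤ 1 / 8 ∧ volterraN T * M ≤ 1 ∧
      volterraN T * L ≤ 1 / 4 := by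
    have hlim : Tendsto logMod (𝓝[>] 0) (𝓝 0) :=
      tendsto_logMod_zero.mono_left (nhdsWithin_mono _ Ioi_subset_Ici_self)
    have h1 := (hlim.mul_const (3 * M)).eventually (gt_mem_nhds (show (0 : ℝ) * (3 * M) < 1 by simp))
    have h2 := (hlim.mul_const (3 * L)).eventually
      (gt_mem_nhds (show (0 : ℝ) * (3 * L) < 1 / 4 by simp))
    have h3 : ∀ᶠ t : ℝ in 𝓝[>] 0, t ∈ Ioc (0 : ℝ) (1 / 8) := Ioc_mem_nhdsGT (by norm_num)
    obtain ⟨T, h1, h2, h3⟩ := (h1.and (h2.and h3)).exists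
    have hN := volterraN_le h3.1.le (h3.2.trans_lt (by norm_num))
    refine ⟨T, h3.1, h3.2, ?_, ?_⟩
    · have := mul_le_mul_of_nonneg_right hN (by positivity : 0 ≤ M); linarith
    · have := mul_le_mul_of_nonneg_right hN hL; linarith
  have hbd : ∀ {u : ℝ → ℂ}, (∀ t, ‖u t‖ ≤ R) → ∀ t ∈ Ioc 0 T, ‖regRHS lam β₀ σ q₀ F u t‖ ≤ M := by
    intro u hu t ht
    refine (norm_add_le _ _).trans (add_le_add ?_ ?_)
    · exact (hM₁ t ⟨ht.1.le, ht.2.trans hT8⟩).trans (le_abs_self _)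
    · exact (hM₂ _ (by simpa using hu t)).trans (le_abs_self _)
  -- Extension by constants makes the charge continuous and bounded on the whole line, so that the
  -- later Fourier estimates need no cut-off.
  set ext : C(Icc (0 : ℝ) T, ℂ) → ℝ → ℂ := fun u ↦ IccExtend hT0.le u with hext
  have hextc : ∀ u, Continuous (ext u) := fun u ↦ u.continuous.Icc_extend'
  have hextI : ∀ u (t : Icc (0 : ℝ) T), ext u t = u t := fun u t ↦ IccExtend_val _ _ _
  have hrhs : ∀ u, BddMeas (regRHS lam β₀ σ q₀ F (ext u)) T := fun u ↦
    bddMeas_regRHS hlam hσ q₀ hF hT0.le ((hextc u).bddMeas T)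
  set Φ : C(Icc (0 : ℝ) T, ℂ) → C(Icc (0 : ℝ) T, ℂ) := fun u ↦
    ⟨fun t ↦ q₀ + conv volC (regRHS lam β₀ σ q₀ F (ext u)) t, by
      exact continuous_const.add (continuousOn_iff_continuous_domRestrict.1
        (continuousOn_conv_volC hT8 (hrhs u)))⟩ with hΦ
  set S : Set C(Icc (0 : ℝ) T, ℂ) := Metric.closedBall 0 R with hS
  have hSb : ∀ u ∈ S, ∀ t, ‖ext u t‖ ≤ R := by
    intro u hu t
    have : ‖u‖ ≤ R := by simpa [hS] using hu
    exact (u.norm_coe_le_norm _).trans this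
  have hN : ∀ t ∈ Icc 0 T, volterraN t ≤ volterraN T := fun t ht ↦
    volterraN_mono ht.1 ht.2 (by linarith)
  have hmaps : MapsTo Φ S S := by
    intro u hu
    rw [hS, mem_closedBall_zero_iff, ContinuousMap.norm_le _ hR0]
    intro t
    refine (norm_add_le _ _).trans (add_le_add le_rfl ?_)
    refine (norm_conv_volC_le_const (G := M) t.2.1 (t.2.2.trans hT8) fun r hr ↦
      hbd (hSb u hu) r ⟨hr.1, hr.2.trans t.2.2⟩).trans ?_
    exact (mul_le_mul_of_nonneg_right (hN t t.2) (by positivity)).trans hTM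
  have hcontr : ContractingWith (1 / 2) (hmaps.restrict Φ S S) := by
    refine ⟨by rw [one_div]; exact NNReal.inv_lt_one_iff (by norm_num) |>.2 (by norm_num), ?_⟩
    refine LipschitzWith.of_dist_le_mul fun u v ↦ ?_
    change dist (Φ u) (Φ v) ≤ _ * dist (u : C(Icc (0 : ℝ) T, ℂ)) v
    rw [ContinuousMap.dist_le (by positivity)]
    intro t
    have t8 := t.2.2.trans hT8
    have e : Φ u t - Φ v t = conv volC (fun τ ↦ regNonlin β₀ σ (ext u τ) - regNonlin β₀ σ (ext v τ)) t := by
      change q₀ + conv volC (regRHS lam β₀ σ q₀ F (ext u)) t -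
        (q₀ + conv volC (regRHS lam β₀ σ q₀ F (ext v)) t) = _
      rw [add_sub_add_left_eq_sub, ← conv_sub_right t.2.1]
      · simp only [regRHS, add_sub_add_left_eq_sub]
      · exact ((hrhs u).mono t.2.2).integrableOn_conv (integrableOn_volC t8)
      · exact ((hrhs v).mono t.2.2).integrableOn_conv (integrableOn_volC t8)
    rw [dist_eq_norm, e]
    refine (norm_conv_volC_le_const (G := L * dist (u : C(Icc (0 : ℝ) T, ℂ)) v) t.2.1 t8
      fun r hr ↦ ?_).trans ?_
    · refine (hlip _ _ (hSb u u.2 r) (hSb v v.2 r)).trans (mul_le_mul_of_nonneg_left ?_ hL)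
      rw [← dist_eq_norm]
      exact ContinuousMap.dist_apply_le_dist _
    · rw [← mul_assoc]
      refine mul_le_mul_of_nonneg_right ?_ dist_nonneg
      have := (mul_le_mul_of_nonneg_right (hN t t.2) hL).trans hTL
      refine this.trans ?_
      norm_num
  obtain ⟨u, huS, hfix, -⟩ := ContractingWith.exists_fixedPoint' (f := Φ) (s := S)
    Metric.isClosed_closedBall.isComplete hmaps hcontr (x := 0) (by simp [hS, hR0]) (edist_ne_top _ _)
  have hsol : ∀ t ∈ Icc 0 T, ext u t = q₀ + conv volC (regRHS lam β₀ σ q₀ F (ext u)) t := by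
    intro t ht
    have h1 := hextI u ⟨t, ht⟩
    have h2 : Φ u ⟨t, ht⟩ = u ⟨t, ht⟩ := by rw [hfix]
    rw [h1, ← h2]
    rfl
  refine ⟨T, L, ext u, hT0, hT8, hL, hTL, hextc u, ⟨R, hSb u huS⟩, ?_, hsol, fun s _ t _ ↦
    hlip _ _ (hSb u huS s) (hSb u huS t)⟩
  rw [hsol 0 ⟨le_rfl, hT0.le⟩]
  simp [conv]


/-! ### The half-derivative of the charge -/

theorem lintegral_mul_sq_le {α : Type*} [MeasurableSpace α] {μ : Measure α} {f g : α → ℝ≥0∞}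
    (hf : AEMeasurable f μ) (hg : AEMeasurable g μ) :
    (∫⁻ a, f a * g a ∂μ) ^ 2 ≤ (∫⁻ a, f a ^ 2 ∂μ) * ∫⁻ a, g a ^ 2 ∂μ := by
  have h := ENNReal.lintegral_mul_le_Lp_mul_Lq μ (p := 2) (q := 2)
    (by constructor <;> norm_num) hf hg
  have h2 := pow_le_pow_left' h 2
  rw [mul_pow, ← ENNReal.rpow_natCast, ← ENNReal.rpow_natCast, ← ENNReal.rpow_natCast,
    ← ENNReal.rpow_mul, ← ENNReal.rpow_mul] at h2
  simpa using h2

theorem enorm_add_sq_le (a b : ℂ) : ‖a + b‖ₑ ^ 2 ≤ 2 * ‖a‖ₑ ^ 2 + 2 * ‖b‖ₑ ^ 2 := by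
  have h1 : ‖a + b‖ ^ 2 ≤ 2 * ‖a‖ ^ 2 + 2 * ‖b‖ ^ 2 := by
    have := norm_add_le a b
    nlinarith [sq_nonneg (‖a‖ - ‖b‖), norm_nonneg (a + b), norm_nonneg a, norm_nonneg b]
  have h2 := ENNReal.ofReal_le_ofReal h1
  rw [ENNReal.ofReal_add (by positivity) (by positivity), ENNReal.ofReal_mul (by norm_num),
    ENNReal.ofReal_mul (by norm_num), ENNReal.ofReal_pow (norm_nonneg _),
    ENNReal.ofReal_pow (norm_nonneg _), ENNReal.ofReal_pow (norm_nonneg _)] at h2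
  simpa [ofReal_norm] using h2

theorem incr_add_le {f g : ℝ → ℂ} (hf : Measurable f) (T h : ℝ) :
    incr (fun t ↦ f t + g t) T h ≤ 2 * incr f T h + 2 * incr g T h := by
  have hm : Measurable fun s ↦ ‖f (s + h) - f s‖ₑ ^ 2 := by fun_prop
  rw [incr, incr, incr, ← lintegral_const_mul' _ _ (by norm_num), ← lintegral_const_mul' _ _ (by norm_num),
    ← lintegral_add_left (hm.const_mul 2)]
  refine lintegral_mono fun s ↦ ?_
  rw [add_sub_add_comm]
  exact enorm_add_sq_le _ _

theorem incr_const_mul (c : ℂ) (f : ℝ → ℂ) (T h : ℝ) :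
    incr (fun t ↦ c * f t) T h = ‖c‖ₑ ^ 2 * incr f T h := by
  rw [incr, incr, ← lintegral_const_mul' _ _ (by finiteness)]
  refine lintegral_congr fun s ↦ ?_
  rw [← mul_sub, enorm_mul, mul_pow]

theorem incr_const_add (c : ℂ) (f : ℝ → ℂ) (T h : ℝ) :
    incr (fun t ↦ c + f t) T h = incr f T h := by
  simp only [incr, add_sub_add_left_eq_sub]

theorem incr_congr {f g : ℝ → ℂ} {T h : ℝ} (hh : 0 < h) (hfg : EqOn f g (Icc 0 T)) :
    incr f T h = incr g T h := by
  refine setLIntegral_congr_fun measurableSet_Ioo fun s hs ↦ ?_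
  rw [hfg ⟨hs.1.le, by linarith [hs.2]⟩, hfg ⟨by linarith [hs.1], by linarith [hs.2]⟩]

theorem halfNorm_lt_top_of_incr_le {p f g : ℝ → ℂ} {T : ℝ} {a b : ℝ≥0∞} (ha : a ≠ ∞) (hb : b ≠ ∞)
    (hf : halfNorm f T < ∞) (hg : halfNorm g T < ∞) (hfm : Measurable f)
    (h : ∀ h ∈ Ioo 0 T, incr p T h ≤ a * incr f T h + b * incr g T h) : halfNorm p T < ∞ := by
  have hm : Measurable fun h ↦ a * (incr f T h / ENNReal.ofReal (h ^ 2)) :=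
    ((measurable_incr hfm T).div (by fun_prop)).const_mul a
  refine lt_of_le_of_lt (b := a * halfNorm f T + b * halfNorm g T) ?_
    (ENNReal.add_lt_top.2 ⟨ENNReal.mul_lt_top ha.lt_top hf, ENNReal.mul_lt_top hb.lt_top hg⟩)
  rw [halfNorm, halfNorm, halfNorm, ← lintegral_const_mul' _ _ ha, ← lintegral_const_mul' _ _ hb,
    ← lintegral_add_left hm]
  refine setLIntegral_mono' measurableSet_Ioo fun x hx ↦ ?_
  rw [← mul_div_assoc, ← mul_div_assoc, ← ENNReal.add_div]
  exact ENNReal.div_le_div_right (h x hx) _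

theorem halfNorm_add_lt_top {f g : ℝ → ℂ} {T : ℝ} (hf : halfNorm f T < ∞) (hg : halfNorm g T < ∞)
    (hfm : Measurable f) : halfNorm (fun t ↦ f t + g t) T < ∞ :=
  halfNorm_lt_top_of_incr_le (by norm_num) (by norm_num) hf hg hfm fun h _ ↦ incr_add_le hfm T h

theorem halfNorm_const_mul_lt_top {f : ℝ → ℂ} {T : ℝ} (hf : halfNorm f T < ∞) (hfm : Measurable f)
    (c : ℂ) : halfNorm (fun t ↦ c * f t) T < ∞ :=
  halfNorm_lt_top_of_incr_le (a := ‖c‖ₑ ^ 2) (b := 0) (by finiteness) (by norm_num) hf hf hfm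
    fun h _ ↦ by rw [incr_const_mul]; simp

theorem halfNorm_congr {f g : ℝ → ℂ} {T : ℝ} (hfg : EqOn f g (Icc 0 T)) :
    halfNorm f T = halfNorm g T :=
  setLIntegral_congr_fun measurableSet_Ioo fun h hh ↦ by simp only [incr_congr hh.1 hfg]

/-- Any Hölder exponent above `1/2` suffices; `3/4` leaves the integrable factor `h^(-1/2)`. -/
theorem halfNorm_lt_top_of_holder {f : ℝ → ℂ} {T C : ℝ}
    (h : ∀ s h, 0 < s → 0 < h → s + h < T → ‖f (s + h) - f s‖ ≤ C * h ^ (3 / 4 : ℝ)) :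
    halfNorm f T < ∞ := by
  have hb : ∀ x ∈ Ioo 0 T, incr f T x / ENNReal.ofReal (x ^ 2) ≤
      ENNReal.ofReal (C ^ 2 * T * x ^ (-(1 / 2) : ℝ)) := by
    intro x hx
    have hT : 0 < T := hx.1.trans hx.2
    have h1 : incr f T x ≤ ENNReal.ofReal (C ^ 2 * x ^ (3 / 2 : ℝ)) * ENNReal.ofReal T := by
      calc incr f T x ≤ ∫⁻ _ in Ioo 0 (T - x), ENNReal.ofReal (C ^ 2 * x ^ (3 / 2 : ℝ)) := by
            refine setLIntegral_mono' measurableSet_Ioo fun s hs ↦ ?_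
            have h2 := pow_le_pow_left₀ (norm_nonneg _) (h s x hs.1 hx.1 (by linarith [hs.2])) 2
            rw [mul_pow, ← Real.rpow_mul_natCast hx.1.le] at h2
            rw [← ofReal_norm, ← ENNReal.ofReal_pow (norm_nonneg _)]
            refine ENNReal.ofReal_le_ofReal (h2.trans_eq ?_)
            norm_num
        _ ≤ _ := by
            rw [setLIntegral_const, Real.volume_Ioo]
            gcongr
            linarith [hx.1]
    rw [ENNReal.div_le_iff (by simpa using hx.1.ne') ENNReal.ofReal_ne_top,
      ← ENNReal.ofReal_mul (by have := hx.1; positivity)]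
    rw [← ENNReal.ofReal_mul (by have := hx.1; positivity)] at h1
    refine h1.trans_eq ?_
    congr 1
    have : x ^ (3 / 2 : ℝ) = x ^ (-(1 / 2) : ℝ) * x ^ 2 := by
      rw [← Real.rpow_natCast, ← Real.rpow_add hx.1]; norm_num
    rw [this]
    ring
  refine lt_of_le_of_lt (setLIntegral_mono' measurableSet_Ioo hb) ?_
  refine Integrable.lintegral_lt_top ?_
  refine Integrable.const_mul ?_ _
  have : IntegrableOn (fun x : ℝ ↦ x ^ (-(1 / 2) : ℝ)) (Ioc 0 T) := by
    rcases le_or_gt T 0 with hT | hT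
    · rw [Ioc_eq_empty (by linarith)]; exact integrableOn_empty
    · exact (intervalIntegrable_iff_integrableOn_Ioc_of_le hT.le).1
        (intervalIntegral.intervalIntegrable_rpow' (by norm_num))
  exact this.mono_set Ioo_subset_Ioc_self

/-- Young's inequality for the increments of a convolution with the Volterra function. -/
theorem incr_conv_volC_le {g : ℝ → ℂ} (hg : Measurable g) {T G : ℝ} (hT : T ≤ 1 / 8)
    (hG : ∀ r ∈ Ioc 0 T, ‖g r‖ ≤ G) {h : ℝ} (hh : h ∈ Ioo 0 T) :
    incr (conv volC g) T h ≤ 2 * (ENNReal.ofReal (volterraN T) ^ 2 * incr g T h) +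
      2 * (ENNReal.ofReal G ^ 2 * incr (fun t ↦ (volterraN t : ℂ)) T h) := by
  have hT0 : 0 < T := hh.1.trans hh.2
  have hG0 : 0 ≤ G := (norm_nonneg _).trans (hG T ⟨hT0, le_rfl⟩)
  set Iv : ℝ → ℝ≥0∞ := fun r ↦ ENNReal.ofReal (volterraI r) with hIv
  have hIvm : Measurable Iv := measurable_volterraI.ennreal_ofReal
  have hIN : ∀ t ∈ Icc 0 T, ∫⁻ r in Ioc 0 t, Iv r = ENNReal.ofReal (volterraN t) := by
    intro t ht
    rw [volterraN, intervalIntegral.integral_of_le ht.1, ofReal_integral_eq_lintegral_ofReal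
      (integrableOn_volterraI (by linarith [ht.2]))]
    filter_upwards [ae_restrict_mem measurableSet_Ioc] with r hr using volterraI_nonneg hr.1.le
  set D : ℝ → ℝ≥0∞ := fun s ↦ ‖g (s + h) - g s‖ₑ with hD
  have hDm : Measurable D := by fun_prop
  set A : ℝ → ℝ≥0∞ := fun s ↦ ∫⁻ r in Ioc 0 s, Iv r * D (s - r) with hA
  have hbm : BddMeas g T := ⟨hg.aestronglyMeasurable, G, hG0, hG⟩
  have hpt : ∀ s ∈ Ioo 0 (T - h), ‖conv volC g (s + h) - conv volC g s‖ₑ ^ 2 ≤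
      2 * A s ^ 2 + 2 * (ENNReal.ofReal G ^ 2 * ‖(volterraN (s + h) : ℂ) - volterraN s‖ₑ ^ 2) := by
    intro s hs
    have hsT : s + h ≤ T := by linarith [hs.2]
    have hs0 : 0 ≤ s := hs.1.le
    have hi : ∀ t ∈ Icc 0 T, IntervalIntegrable (fun r ↦ g (t - r) * volC r) volume 0 t := by
      intro t ht
      rw [intervalIntegrable_iff_integrableOn_Ioc_of_le ht.1]
      exact integrableOn_conv_comm ht.1 ((hbm.mono ht.2).integrableOn_conv
        (integrableOn_volC (ht.2.trans hT)))
    have i1 := hi s ⟨hs0, by linarith [hh.1]⟩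
    have i2 := hi (s + h) ⟨by linarith [hh.1], hsT⟩
    have i3 : IntervalIntegrable (fun r ↦ g (s + h - r) * volC r) volume 0 s :=
      i2.mono_set (by rw [uIcc_of_le hs0, uIcc_of_le (by linarith [hh.1])]
                      exact Icc_subset_Icc_right (by linarith [hh.1]))
    have i4 : IntervalIntegrable (fun r ↦ g (s + h - r) * volC r) volume s (s + h) :=
      i2.mono_set (by rw [uIcc_of_le (by linarith [hh.1]), uIcc_of_le (by linarith [hh.1])]
                      exact Icc_subset_Icc_left hs0)
    -- With the translation placed on `g`, the increment is the convolution of `I` with the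
    -- increment of `g`, plus a piece over `[s, s + h]` that is at most `G` times the increment of
    -- `volterraN`.
    have e : conv volC g (s + h) - conv volC g s =
        (∫ r in (0 : ℝ)..s, (g (s + h - r) - g (s - r)) * volC r) +
          ∫ r in s..(s + h), g (s + h - r) * volC r := by
      rw [conv_comm volC, conv_comm volC, conv, conv, ← intervalIntegral.integral_add_adjacent_intervals i3 i4]
      simp only [sub_mul]
      rw [intervalIntegral.integral_sub i3 i1]
      ring
    have b1 : ‖∫ r in (0 : ℝ)..s, (g (s + h - r) - g (s - r)) * volC r‖ₑ ≤ A s := by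
      rw [intervalIntegral.integral_of_le hs0]
      refine (enorm_integral_le_lintegral_enorm _).trans ?_
      refine setLIntegral_mono' measurableSet_Ioc fun r hr ↦ ?_
      rw [enorm_mul, mul_comm, volC, ← ofReal_norm, Complex.norm_real,
        Real.norm_of_nonneg (volterraI_nonneg hr.1.le), hD]
      simp only
      rw [sub_add_eq_add_sub]
    have b2 : ‖∫ r in s..(s + h), g (s + h - r) * volC r‖ₑ ≤
        ENNReal.ofReal G * ‖(volterraN (s + h) : ℂ) - volterraN s‖ₑ := by
      have j1 : IntervalIntegrable volterraI volume 0 (s + h) :=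
        intervalIntegrable_volterraI (by linarith [hh.1]) (by linarith)
      have j2 : IntervalIntegrable volterraI volume 0 s :=
        intervalIntegrable_volterraI hs0 (by linarith [hh.1])
      have hN : volterraN (s + h) - volterraN s = ∫ r in s..(s + h), volterraI r :=
        intervalIntegral.integral_interval_sub_left j1 j2
      have hN0 : 0 ≤ volterraN (s + h) - volterraN s :=
        sub_nonneg.2 (volterraN_mono hs0 (by linarith [hh.1]) (by linarith))
      have : ‖∫ r in s..(s + h), g (s + h - r) * volC r‖ ≤ G * (volterraN (s + h) - volterraN s) := by
        rw [hN, ← intervalIntegral.integral_const_mul]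
        have j3 : IntervalIntegrable volterraI volume s (s + h) :=
          j1.mono_set (by rw [uIcc_of_le (by linarith [hh.1]), uIcc_of_le (by linarith [hh.1])]
                          exact Icc_subset_Icc_left hs0)
        refine intervalIntegral.norm_integral_le_of_norm_le (by linarith [hh.1]) ?_ (j3.const_mul G)
        have hne : ∀ᵐ r : ℝ, r ≠ s + h := by simp [ae_iff]
        filter_upwards [hne] with r hr' hr
        have hr0 : 0 ≤ r := hs0.trans hr.1.le
        rw [norm_mul, volC, Complex.norm_real, Real.norm_of_nonneg (volterraI_nonneg hr0)]
        refine mul_le_mul_of_nonneg_right (hG _ ⟨?_, by linarith [hr.1]⟩) (volterraI_nonneg hr0)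
        have := lt_of_le_of_ne hr.2 hr'
        linarith
      rw [← Complex.ofReal_sub, ← ofReal_norm, ← ofReal_norm, Complex.norm_real,
        Real.norm_of_nonneg hN0, ← ENNReal.ofReal_mul hG0]
      exact ENNReal.ofReal_le_ofReal this
    rw [e]
    refine (enorm_add_sq_le _ _).trans ?_
    rw [← mul_pow]
    gcongr
  have hAm : ∫⁻ s in Ioo 0 (T - h), A s ^ 2 ≤ ENNReal.ofReal (volterraN T) ^ 2 * incr g T h := by
    have h1 : ∀ s ∈ Ioo 0 (T - h), A s ^ 2 ≤ ENNReal.ofReal (volterraN T) *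
        ∫⁻ r in Ioc 0 T, Iv r * ((Ioo 0 (T - h)).indicator (fun s ↦ D s ^ 2) (s - r)) := by
      intro s hs
      have hsT : s ≤ T := by linarith [hs.2, hh.1]
      -- Cauchy–Schwarz with `I` split as `I^(1/2) · I^(1/2)`: one factor gives the mass `volterraN
      -- T`, and the other leaves an integral whose `s`-integration is a translate of `incr g T h`.
      have h2 : A s = ∫⁻ r in Ioc 0 s, (Iv r ^ (1 / 2 : ℝ)) * (Iv r ^ (1 / 2 : ℝ) * D (s - r)) := by
        refine lintegral_congr fun r ↦ ?_
        rw [← mul_assoc, ← ENNReal.rpow_add_of_nonneg _ _ (by norm_num) (by norm_num)]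
        norm_num
      have hsq : ∀ x : ℝ≥0∞, (x ^ (1 / 2 : ℝ)) ^ 2 = x := fun x ↦ by
        rw [← ENNReal.rpow_natCast, ← ENNReal.rpow_mul]; norm_num
      have h3 : Measurable fun r ↦ Iv r ^ (1 / 2 : ℝ) * D (s - r) :=
        (hIvm.pow_const _).mul (hDm.comp (measurable_const.sub measurable_id))
      rw [h2]
      refine (lintegral_mul_sq_le (hIvm.pow_const _).aemeasurable h3.aemeasurable).trans ?_
      simp only [mul_pow, hsq]
      rw [hIN s ⟨hs.1.le, hsT⟩]
      refine mul_le_mul' (ENNReal.ofReal_le_ofReal (volterraN_mono hs.1.le hsT (by linarith))) ?_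
      rw [← lintegral_indicator measurableSet_Ioc, ← lintegral_indicator measurableSet_Ioc]
      refine lintegral_mono_ae ?_
      have hne : ∀ᵐ r : ℝ, r ≠ s := by simp [ae_iff]
      filter_upwards [hne] with r hr
      by_cases hr1 : r ∈ Ioc 0 s
      · rw [indicator_of_mem hr1, indicator_of_mem (show r ∈ Ioc 0 T from ⟨hr1.1, hr1.2.trans hsT⟩),
          indicator_of_mem (mem_Ioo.2 ⟨sub_pos.2 (lt_of_le_of_ne hr1.2 hr), by linarith [hr1.1, hs.2]⟩)]
      · rw [indicator_of_notMem hr1]; exact zero_le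
    have hm : Measurable fun s ↦ (Ioo 0 (T - h)).indicator (fun s ↦ D s ^ 2) s :=
      (hDm.pow_const 2).indicator measurableSet_Ioo
    have hincr : incr g T h = ∫⁻ s, (Ioo 0 (T - h)).indicator (fun s ↦ D s ^ 2) s :=
      (lintegral_indicator measurableSet_Ioo _).symm
    calc ∫⁻ s in Ioo 0 (T - h), A s ^ 2
        ≤ ∫⁻ s in Ioo 0 (T - h), ENNReal.ofReal (volterraN T) *
          ∫⁻ r in Ioc 0 T, Iv r * ((Ioo 0 (T - h)).indicator (fun s ↦ D s ^ 2) (s - r)) :=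
          setLIntegral_mono' measurableSet_Ioo h1
      _ ≤ ∫⁻ s, ENNReal.ofReal (volterraN T) *
          ∫⁻ r in Ioc 0 T, Iv r * ((Ioo 0 (T - h)).indicator (fun s ↦ D s ^ 2) (s - r)) :=
          setLIntegral_le_lintegral _ _
      _ = ENNReal.ofReal (volterraN T) * ∫⁻ s,
          ∫⁻ r in Ioc 0 T, Iv r * ((Ioo 0 (T - h)).indicator (fun s ↦ D s ^ 2) (s - r)) :=
          lintegral_const_mul' _ _ ENNReal.ofReal_ne_top
      _ = ENNReal.ofReal (volterraN T) * ∫⁻ r in Ioc 0 T,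
          ∫⁻ s, Iv r * ((Ioo 0 (T - h)).indicator (fun s ↦ D s ^ 2) (s - r)) := by
          rw [lintegral_lintegral_swap]
          exact ((hIvm.comp measurable_snd).mul
            (hm.comp (measurable_fst.sub measurable_snd))).aemeasurable
      _ = ENNReal.ofReal (volterraN T) * ∫⁻ r in Ioc 0 T, Iv r * incr g T h := by
          congr 1
          refine lintegral_congr fun r ↦ ?_
          rw [lintegral_const_mul' _ _ ENNReal.ofReal_ne_top, hincr,
            lintegral_sub_right_eq_self (fun s ↦ (Ioo 0 (T - h)).indicator (fun s ↦ D s ^ 2) s) r]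
      _ = ENNReal.ofReal (volterraN T) ^ 2 * incr g T h := by
          rw [lintegral_mul_const _ hIvm, hIN T ⟨hT0.le, le_rfl⟩, ← mul_assoc, sq]
  have hAmeas : Measurable fun s ↦ A s := by
    have : A = fun s ↦ ∫⁻ r, (Ioc 0 s).indicator (fun r ↦ Iv r * D (s - r)) r :=
      funext fun s ↦ (lintegral_indicator measurableSet_Ioc _).symm
    rw [this]
    refine Measurable.lintegral_prod_right' (f := fun p : ℝ × ℝ ↦
      (Ioc 0 p.1).indicator (fun r ↦ Iv r * D (p.1 - r)) p.2) ?_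
    have hset : MeasurableSet {p : ℝ × ℝ | 0 < p.2 ∧ p.2 ≤ p.1} :=
      (measurableSet_lt measurable_const measurable_snd).inter
        (measurableSet_le measurable_snd measurable_fst)
    exact ((hIvm.comp measurable_snd).mul
      (hDm.comp (measurable_fst.sub measurable_snd))).indicator hset
  calc incr (conv volC g) T h ≤ ∫⁻ s in Ioo 0 (T - h), (2 * A s ^ 2 +
        2 * (ENNReal.ofReal G ^ 2 * ‖(volterraN (s + h) : ℂ) - volterraN s‖ₑ ^ 2)) :=
        setLIntegral_mono' measurableSet_Ioo hpt
    _ = 2 * (∫⁻ s in Ioo 0 (T - h), A s ^ 2) +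
        2 * (ENNReal.ofReal G ^ 2 * incr (fun t ↦ (volterraN t : ℂ)) T h) := by
        rw [lintegral_add_left ((hAmeas.pow_const 2).const_mul 2), lintegral_const_mul' _ _ (by norm_num),
          lintegral_const_mul' _ _ (by norm_num), lintegral_const_mul' _ _ (by finiteness), incr]
    _ ≤ _ := by gcongr

theorem incr_lt_top {q : ℝ → ℂ} (hq : Continuous q) (T h : ℝ) : incr q T h < ∞ := by
  have hc : Continuous fun s ↦ ‖q (s + h) - q s‖ ^ 2 := by fun_prop
  have := (hc.integrableOn_Icc (a := 0) (b := T - h) (μ := volume)).mono_set Ioo_subset_Icc_self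
  refine lt_of_le_of_lt (le_of_eq ?_) this.lintegral_lt_top
  refine lintegral_congr fun s ↦ ?_
  rw [ENNReal.ofReal_pow (norm_nonneg _), ofReal_norm]

/-- A solution of an integrated charge equation inherits a half-derivative from the source. -/
theorem halfNorm_lt_top_of_volterra {q S : ℝ → ℂ} {N : ℂ → ℂ} {q₀ : ℂ} {T L : ℝ} (hT0 : 0 < T)
    (hT : T ≤ 1 / 8) (hq : Continuous q) (hS : Continuous S) (hN : Continuous N) (hL : 0 ≤ L)
    (hTL : volterraN T * L ≤ 1 / 4)
    (heq : ∀ t ∈ Icc 0 T, q t = q₀ + conv volC (fun τ ↦ S τ + N (q τ)) t)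
    (hlip : ∀ s ∈ Icc 0 T, ∀ t ∈ Icc 0 T, ‖N (q s) - N (q t)‖ ≤ L * ‖q s - q t‖)
    (hSh : halfNorm S T < ∞) : halfNorm q T < ∞ := by
  obtain ⟨-, G₁, hG₁, hb₁⟩ := hS.bddMeas T
  obtain ⟨-, G₂, hG₂, hb₂⟩ := (hN.comp hq).bddMeas T
  have hNq : Continuous fun τ ↦ N (q τ) := hN.comp hq
  set n := ENNReal.ofReal (volterraN T) with hn
  refine halfNorm_lt_top_of_incr_le (p := q) (f := S) (g := fun t ↦ (volterraN t : ℂ))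
    (a := 8 * n ^ 2) (b := 8 * ENNReal.ofReal G₁ ^ 2 + 8 * ENNReal.ofReal G₂ ^ 2) (by finiteness)
    (by finiteness) hSh (halfNorm_volterraN_lt_top hT) hS.measurable fun h hh ↦ ?_
  have hNincr : incr (fun τ ↦ N (q τ)) T h ≤ ENNReal.ofReal L ^ 2 * incr q T h := by
    rw [incr, incr, ← lintegral_const_mul' _ _ (by finiteness)]
    refine setLIntegral_mono' measurableSet_Ioo fun s hs ↦ ?_
    rw [← mul_pow]
    refine pow_le_pow_left' ?_ 2
    have := hlip (s + h) ⟨by linarith [hs.1, hh.1], by linarith [hs.2]⟩ s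
      ⟨hs.1.le, by linarith [hs.2, hh.1]⟩
    rw [← ofReal_norm, ← ofReal_norm, ← ENNReal.ofReal_mul hL]
    exact ENNReal.ofReal_le_ofReal this
  have e : incr q T h ≤ 2 * incr (conv volC S) T h + 2 * incr (conv volC fun τ ↦ N (q τ)) T h := by
    have e1 : incr q T h = incr (fun t ↦ q₀ + (fun t ↦ conv volC S t + conv volC (fun τ ↦ N (q τ)) t) t) T h := by
      refine incr_congr hh.1 fun t ht ↦ ?_
      rw [heq t ht, conv_add_right ht.1]
      · exact (hS.bddMeas t).integrableOn_conv (integrableOn_volC (ht.2.trans hT))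
      · exact (hNq.bddMeas t).integrableOn_conv (integrableOn_volC (ht.2.trans hT))
    rw [e1, incr_const_add]
    set f₁ : ℝ → ℂ := IccExtend hT0.le ((Icc 0 T).domRestrict (conv volC S)) with hf₁
    have c1 : Continuous f₁ := by
      refine Continuous.Icc_extend' ?_
      exact continuousOn_iff_continuous_domRestrict.1 (continuousOn_conv_volC hT (hS.bddMeas T))
    have e2 : EqOn (conv volC S) f₁ (Icc 0 T) := fun t ht ↦ by
      rw [hf₁, IccExtend_of_mem _ _ ht]; rfl
    rw [incr_congr (g := fun t ↦ f₁ t + conv volC (fun τ ↦ N (q τ)) t) hh.1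
      (fun t ht ↦ by simp only [e2 ht]), incr_congr hh.1 e2]
    exact incr_add_le c1.measurable T h
  have a1 := incr_conv_volC_le hS.measurable hT hb₁ hh
  have a2 := incr_conv_volC_le hNq.measurable hT hb₂ hh
  -- From `volterraN T * L ≤ 1/4` follows `4 (volterraN T * L)² ≤ 1/4`, so the nonlinear term is
  -- absorbed on the left.
  have hsmall : 4 * (n ^ 2 * (ENNReal.ofReal L ^ 2 * incr q T h)) ≤ 4⁻¹ * incr q T h := by
    rw [← mul_assoc, ← mul_assoc, mul_assoc 4, ← mul_pow, hn,
      ← ENNReal.ofReal_mul (volterraN_nonneg hT0.le)]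
    refine mul_le_mul_left ?_ _
    have : ENNReal.ofReal (volterraN T * L) ≤ 4⁻¹ := by
      have h4 : (4 : ℝ≥0∞)⁻¹ = ENNReal.ofReal (1 / 4) := by
        rw [one_div, ENNReal.ofReal_inv_of_pos (by norm_num)]; norm_num
      rw [h4]; exact ENNReal.ofReal_le_ofReal hTL
    calc 4 * ENNReal.ofReal (volterraN T * L) ^ 2 ≤ 4 * (4⁻¹) ^ 2 := by gcongr
      _ = 4⁻¹ := by
        rw [sq, ← mul_assoc, ENNReal.mul_inv_cancel (by norm_num) (by norm_num), one_mul]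
  set X := incr q T h with hX
  set Y := incr S T h
  set Z := incr (fun t ↦ (volterraN t : ℂ)) T h
  -- The absorption is carried out for each `h` separately, where continuity of `q` makes the
  -- increment finite; finiteness of `halfNorm q T` is not presupposed.
  have hfin : X ≠ ∞ := (incr_lt_top hq T h).ne
  have total : X ≤ 4⁻¹ * X + (4 * n ^ 2 * Y + (4 * ENNReal.ofReal G₁ ^ 2 + 4 * ENNReal.ofReal G₂ ^ 2) * Z) := by
    calc X ≤ 2 * (2 * (n ^ 2 * Y) + 2 * (ENNReal.ofReal G₁ ^ 2 * Z)) +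
          2 * (2 * (n ^ 2 * (ENNReal.ofReal L ^ 2 * X)) + 2 * (ENNReal.ofReal G₂ ^ 2 * Z)) := by
          refine e.trans (add_le_add (mul_le_mul_right a1 2) (mul_le_mul_right (a2.trans ?_) 2))
          gcongr
      _ = 4 * (n ^ 2 * (ENNReal.ofReal L ^ 2 * X)) + (4 * n ^ 2 * Y + (4 * ENNReal.ofReal G₁ ^ 2 + 4 * ENNReal.ofReal G₂ ^ 2) * Z) := by ring
      _ ≤ _ := by gcongr
  set W := 4 * n ^ 2 * Y + (4 * ENNReal.ofReal G₁ ^ 2 + 4 * ENNReal.ofReal G₂ ^ 2) * Z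
  have hhalf : X ≤ 2 * W := by
    by_cases hW : W = ∞
    · rw [hW]; simp
    rw [← ENNReal.toReal_le_toReal hfin (by finiteness)]
    have h1 := ENNReal.toReal_mono (by finiteness) total
    rw [ENNReal.toReal_add (by finiteness) hW, ENNReal.toReal_mul] at h1
    rw [ENNReal.toReal_mul]
    have h2 : (4⁻¹ : ℝ≥0∞).toReal = 1 / 4 := by simp
    have h3 : (2 : ℝ≥0∞).toReal = 2 := by simp
    rw [h2] at h1
    rw [h3]
    have := ENNReal.toReal_nonneg (a := X)
    have := ENNReal.toReal_nonneg (a := W)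
    linarith
  refine hhalf.trans_eq ?_
  ring


/-! ### The half-derivative of the source -/

/-- Integrating `‖greenTrace lam r‖ ≤ C r^(-1/4) ≤ C (r - s)^(-1/4)` over `[s, s + h]` gives order
`3/4`, above the threshold `1/2`. -/
theorem exists_integral_greenTrace_holder {lam : ℝ} (hlam : 0 < lam) : ∃ C : ℝ, ∀ s h : ℝ,
    0 < s → 0 < h → ‖(∫ r in (0 : ℝ)..(s + h), greenTrace lam r) -
      ∫ r in (0 : ℝ)..s, greenTrace lam r‖ ≤ C * h ^ (3 / 4 : ℝ) := by
  obtain ⟨C, hC, hb⟩ := exists_norm_greenTrace_le hlam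
  refine ⟨C * (4 / 3), fun s h hs hh ↦ ?_⟩
  have hi : ∀ S : ℝ, 0 ≤ S → IntervalIntegrable (greenTrace lam) volume 0 S := fun S hS ↦
    (intervalIntegrable_iff_integrableOn_Ioc_of_le hS).2 (integrableOn_greenTrace hlam S)
  rw [intervalIntegral.integral_interval_sub_left (hi _ (by linarith)) (hi _ hs.le)]
  have hr : IntervalIntegrable (fun r : ℝ ↦ C * (r - s) ^ (-(1 / 4) : ℝ)) volume s (s + h) := by
    have : IntervalIntegrable (fun r : ℝ ↦ r ^ (-(1 / 4) : ℝ)) volume 0 h :=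
      intervalIntegral.intervalIntegrable_rpow' (by norm_num)
    have := (this.comp_sub_right s).const_mul C
    simpa [add_comm] using this
  refine (intervalIntegral.norm_integral_le_of_norm_le (by linarith)
    (g := fun r ↦ C * (r - s) ^ (-(1 / 4) : ℝ)) ?_ hr).trans_eq ?_
  · refine Eventually.of_forall fun r hr ↦ (hb r (hs.trans hr.1)).trans ?_
    exact mul_le_mul_of_nonneg_left
      (Real.rpow_le_rpow_of_nonpos (sub_pos.2 hr.1) (by linarith) (by norm_num)) hC
  · rw [intervalIntegral.integral_const_mul,
      intervalIntegral.integral_comp_sub_right (fun r ↦ r ^ (-(1 / 4) : ℝ)) s, sub_self,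
      add_sub_cancel_left, integral_rpow (Or.inl (by norm_num)), Real.zero_rpow (by norm_num)]
    norm_num
    ring

theorem norm_phase_sub_one_le (t ω : ℝ) : ‖phase t ω - 1‖ ≤ |t * ω| := by
  have := Real.norm_exp_I_mul_ofReal_sub_one_le (x := -(t * ω))
  rw [norm_neg, Real.norm_eq_abs] at this
  convert this using 3
  rw [phase]; congr 1; push_cast; ring

theorem norm_phase_sub_one_le_two (t ω : ℝ) : ‖phase t ω - 1‖ ≤ 2 := by
  refine (norm_sub_le _ _).trans ?_
  rw [norm_phase, norm_one]; norm_num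

theorem lintegral_inv_sq_Ioi {c : ℝ} (hc : 0 < c) :
    ∫⁻ h in Ioi c, ENNReal.ofReal (4 / h ^ 2) = ENNReal.ofReal (4 / c) := by
  have e : ∀ h ∈ Ioi c, 4 / h ^ 2 = 4 * h ^ (-2 : ℝ) := fun h hh ↦ by
    rw [Real.rpow_neg (hc.le.trans (mem_Ioi.1 hh).le), div_eq_mul_inv]; norm_num
  have hi : IntegrableOn (fun h : ℝ ↦ 4 * h ^ (-2 : ℝ)) (Ioi c) :=
    (integrableOn_Ioi_rpow_of_lt (by norm_num) hc).const_mul 4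
  have hi' : IntegrableOn (fun h : ℝ ↦ 4 / h ^ 2) (Ioi c) :=
    hi.congr_fun (fun h hh ↦ (e h hh).symm) measurableSet_Ioi
  rw [← ofReal_integral_eq_lintegral_ofReal hi' (Eventually.of_forall fun h ↦ by positivity),
    setIntegral_congr_fun measurableSet_Ioi e, integral_const_mul,
    integral_Ioi_rpow_of_lt (by norm_num) hc]
  congr 1
  norm_num
  rw [Real.rpow_neg_one]; ring

/-- Cut at `h = 1/ω`: below, `|e^{-ihω} - 1| ≤ hω` contributes `ω`; above, the bound `2` contributes
`4ω`. -/
theorem lintegral_phase_sub_one_sq_le {ω : ℝ} (hω : 0 ≤ ω) :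
    ∫⁻ h in Ioi (0 : ℝ), ‖phase h ω - 1‖ₑ ^ 2 / ENNReal.ofReal (h ^ 2) ≤ ENNReal.ofReal (5 * ω) := by
  have key : ∀ h ∈ Ioi (0 : ℝ), ∀ b : ℝ, ‖phase h ω - 1‖ ≤ b →
      ‖phase h ω - 1‖ₑ ^ 2 / ENNReal.ofReal (h ^ 2) ≤ ENNReal.ofReal (b ^ 2 / h ^ 2) := by
    intro h hh b hb
    rw [← ofReal_norm, ← ENNReal.ofReal_pow (norm_nonneg _),
      ← ENNReal.ofReal_div_of_pos (pow_pos (mem_Ioi.1 hh) 2)]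
    refine ENNReal.ofReal_le_ofReal ?_
    gcongr
  rcases eq_or_lt_of_le hω with rfl | hω
  · simp [phase]
  have hc : 0 < 1 / ω := by positivity
  rw [← Ioc_union_Ioi_eq_Ioi hc.le, lintegral_union measurableSet_Ioi
    (disjoint_left.2 fun x hx hx' ↦ absurd hx.2 (not_le.2 hx'))]
  have h1 : ∫⁻ h in Ioc 0 (1 / ω), ‖phase h ω - 1‖ₑ ^ 2 / ENNReal.ofReal (h ^ 2) ≤
      ENNReal.ofReal ω := by
    calc _ ≤ ∫⁻ _ in Ioc 0 (1 / ω), ENNReal.ofReal (ω ^ 2) := by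
          refine setLIntegral_mono' measurableSet_Ioc fun h hh ↦ ?_
          refine (key h hh.1 (h * ω) ?_).trans_eq ?_
          · exact (norm_phase_sub_one_le h ω).trans_eq (abs_of_nonneg (mul_nonneg hh.1.le hω.le))
          · rw [mul_pow, mul_div_cancel_left₀ _ (pow_pos hh.1 2).ne']
      _ = ENNReal.ofReal ω := by
          rw [setLIntegral_const, Real.volume_Ioc, ← ENNReal.ofReal_mul (by positivity)]
          congr 1; field_simp; ring
  have h2 : ∫⁻ h in Ioi (1 / ω), ‖phase h ω - 1‖ₑ ^ 2 / ENNReal.ofReal (h ^ 2) ≤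
      ENNReal.ofReal (4 * ω) := by
    calc _ ≤ ∫⁻ h in Ioi (1 / ω), ENNReal.ofReal (4 / h ^ 2) := by
          refine setLIntegral_mono' measurableSet_Ioi fun h hh ↦ ?_
          refine (key h (hc.trans (mem_Ioi.1 hh)) 2 (norm_phase_sub_one_le_two h ω)).trans_eq ?_
          norm_num
      _ = _ := by rw [lintegral_inv_sq_Ioi hc]; congr 1; field_simp
  refine (add_le_add h1 h2).trans_eq ?_
  rw [← ENNReal.ofReal_add hω.le (by positivity)]
  congr 1; ring

/-- The superposition `∫ exp (-i τ |2πξ|²) m ξ dξ`. -/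
def specTrace (m : Plane → ℂ) (τ : ℝ) : ℂ := ∫ ξ : Plane, phase τ (symb ξ) * m ξ

theorem continuous_phase_symb (τ : ℝ) : Continuous fun ξ : Plane ↦ phase τ (symb ξ) := by
  have := continuous_symb
  unfold phase; fun_prop

theorem integrable_phase_mul {m : Plane → ℂ} (hm : Integrable m) (τ : ℝ) :
    Integrable fun ξ : Plane ↦ phase τ (symb ξ) * m ξ :=
  hm.bdd_mul (c := 1) (continuous_phase_symb τ).aestronglyMeasurable
    (Eventually.of_forall fun _ ↦ (norm_phase _ _).le)

theorem continuous_specTrace {m : Plane → ℂ} (hm : Integrable m) : Continuous (specTrace m) := by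
  refine continuous_of_dominated (bound := fun ξ ↦ ‖m ξ‖) (fun τ ↦ (integrable_phase_mul hm τ).1)
    (fun τ ↦ Eventually.of_forall fun ξ ↦ ?_) hm.norm (Eventually.of_forall fun ξ ↦ ?_)
  · rw [norm_mul, norm_phase, one_mul]
  · unfold phase; fun_prop

theorem measurable_phase_symb : Measurable fun p : ℝ × Plane ↦ phase p.1 (symb p.2) := by
  have := continuous_symb
  have : Continuous fun p : ℝ × Plane ↦ phase p.1 (symb p.2) := by unfold phase; fun_prop
  exact this.measurable

/-- The dual form of the restriction estimate for the paraboloid. -/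
theorem lintegral_specTrace_sq_le {n : Plane → ℂ} (hn : Integrable n) (S : ℝ) :
    ∫⁻ τ in Ioo 0 S, ‖specTrace n τ‖ₑ ^ 2 ≤ ∫⁻ ξ, ‖n ξ‖ₑ ^ 2 := by
  have hc := continuous_specTrace hn
  set G := specTrace n with hG
  set μ := (volume : Measure ℝ).restrict (Ioo 0 S) with hμ
  have hi2 : Integrable (fun τ ↦ ‖G τ‖ ^ 2) μ :=
    ((hc.norm.pow 2).integrableOn_Icc (a := 0) (b := S)).mono_set Ioo_subset_Icc_self
  have hi1 : Integrable (fun τ ↦ starRingEnd ℂ (G τ)) μ :=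
    ((Complex.continuous_conj.comp hc).integrableOn_Icc (a := 0) (b := S)).mono_set Ioo_subset_Icc_self
  set A := ∫⁻ τ, ‖G τ‖ₑ ^ 2 ∂μ with hA
  have hAeq : A = ENNReal.ofReal (∫ τ, ‖G τ‖ ^ 2 ∂μ) := by
    rw [ofReal_integral_eq_lintegral_ofReal hi2 (Eventually.of_forall fun _ ↦ by positivity)]
    refine lintegral_congr fun τ ↦ ?_
    rw [ENNReal.ofReal_pow (norm_nonneg _), ofReal_norm]
  have hAtop : A ≠ ∞ := by rw [hAeq]; exact ENNReal.ofReal_ne_top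
  -- Duality: `A = ∫ |G|²` is rewritten as a pairing of `n` with `V(|p|²)`, where `V` is the
  -- transform of the truncated conjugate of `G`. Plancherel contributes `2π` and the density of
  -- `|p|²` contributes `1/(4π)`, so the squared norm of `V(|p|²)` is at most `A / 2`.
  set u : ℝ → ℂ := (Ioo 0 S).indicator fun τ ↦ starRingEnd ℂ (G τ) with hu
  set V : ℝ → ℂ := fun ω ↦ ∫ s, phase s ω * u s with hV
  have hui : Integrable u := (integrable_indicator_iff measurableSet_Ioo).2 hi1
  have huA : ∫⁻ s, ‖u s‖ₑ ^ 2 = A := by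
    rw [hA, hμ, ← lintegral_indicator measurableSet_Ioo]
    refine lintegral_congr fun s ↦ ?_
    by_cases hs : s ∈ Ioo 0 S
    · rw [hu, indicator_of_mem hs, indicator_of_mem hs]; simp [← ofReal_norm]
    · rw [hu, indicator_of_notMem hs, indicator_of_notMem hs]; simp
  have hu2 : MemLp u 2 := by
    refine ⟨hui.1, ?_⟩
    have h1 := eLpNorm_two_sq (μ := volume) u
    rw [huA] at h1
    by_contra h
    rw [not_lt, top_le_iff] at h
    rw [h] at h1
    exact hAtop (by rw [← h1]; simp)
  have hVm : Measurable V := by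
    have : Continuous V := by
      refine continuous_of_dominated (bound := fun s ↦ ‖u s‖) (fun ω ↦ ?_)
        (fun ω ↦ Eventually.of_forall fun s ↦ ?_) hui.norm (Eventually.of_forall fun s ↦ ?_)
      · have : Continuous fun s ↦ phase s ω := by unfold phase; fun_prop
        exact this.aestronglyMeasurable.mul hui.1
      · rw [norm_mul, norm_phase, one_mul]
      · unfold phase; fun_prop
    exact this.measurable
  have hpl := lintegral_integral_phase_sq hui hu2
  have hVA : ∫⁻ ξ : Plane, ‖V (symb ξ)‖ₑ ^ 2 ≤ A := by
    have h1 := lintegral_comp_symb (F := fun ω ↦ ‖V ω‖ₑ ^ 2) (by fun_prop)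
    rw [h1]
    have h2 : ∫⁻ ω in Ioi (0 : ℝ), ‖V ω‖ₑ ^ 2 ≤ ENNReal.ofReal (2 * Real.pi) * A := by
      rw [← huA, ← hpl]; exact setLIntegral_le_lintegral _ _
    refine (mul_le_mul_right h2 _).trans ?_
    rw [← mul_assoc, ← ENNReal.ofReal_mul (by positivity)]
    refine mul_le_of_le_one_left zero_le ?_
    rw [ENNReal.ofReal_le_one]
    have := Real.pi_pos
    rw [show 1 / (4 * Real.pi) * (2 * Real.pi) = 1 / 2 by field_simp; norm_num]
    norm_num
  have hid : ((∫ τ, ‖G τ‖ ^ 2 ∂μ : ℝ) : ℂ) = ∫ ξ, n ξ * V (symb ξ) := by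
    have e1 : ((∫ τ, ‖G τ‖ ^ 2 ∂μ : ℝ) : ℂ) =
        ∫ τ, (∫ ξ : Plane, starRingEnd ℂ (G τ) * (phase τ (symb ξ) * n ξ)) ∂μ := by
      rw [← integral_complex_ofReal]
      refine integral_congr_ae (Eventually.of_forall fun τ ↦ ?_)
      simp only
      rw [integral_const_mul]
      change _ = starRingEnd ℂ (G τ) * G τ
      rw [mul_comm, Complex.mul_conj, Complex.normSq_eq_norm_sq]
    rw [e1, integral_integral_swap]
    · refine integral_congr_ae (Eventually.of_forall fun ξ ↦ ?_)
      simp only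
      rw [hV]
      simp only
      rw [← integral_const_mul, hμ, ← integral_indicator measurableSet_Ioo]
      refine integral_congr_ae (Eventually.of_forall fun s ↦ ?_)
      simp only [hu]
      by_cases hs : s ∈ Ioo 0 S
      · rw [indicator_of_mem hs, indicator_of_mem hs]; ring
      · rw [indicator_of_notMem hs, indicator_of_notMem hs]; ring
    · have h1 : Integrable (fun p : ℝ × Plane ↦ starRingEnd ℂ (G p.1) * n p.2)
          (μ.prod volume) := hi1.mul_prod hn
      have h2 := h1.bdd_mul (f := fun p : ℝ × Plane ↦ phase p.1 (symb p.2)) (c := 1)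
        measurable_phase_symb.aestronglyMeasurable
        (Eventually.of_forall fun p ↦ (norm_phase _ _).le)
      refine h2.congr (Eventually.of_forall fun p ↦ ?_)
      simp only [Function.uncurry]
      ring
  have hAle : A ≤ ∫⁻ ξ, ‖n ξ‖ₑ * ‖V (symb ξ)‖ₑ := by
    have h1 : A = ‖((∫ τ, ‖G τ‖ ^ 2 ∂μ : ℝ) : ℂ)‖ₑ := by
      rw [hAeq, ← ofReal_norm, Complex.norm_real, Real.norm_of_nonneg]
      exact integral_nonneg fun _ ↦ by positivity
    rw [h1, hid]
    refine (enorm_integral_le_lintegral_enorm _).trans_eq ?_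
    simp only [enorm_mul]
  -- Cauchy–Schwarz on the pairing; as `A` is finite, one factor `A` can be cancelled.
  have hsq : A ^ 2 ≤ (∫⁻ ξ, ‖n ξ‖ₑ ^ 2) * A :=
    (pow_le_pow_left' hAle 2).trans ((lintegral_mul_sq_le hn.1.enorm
      (hVm.comp continuous_symb.measurable).enorm.aemeasurable).trans (mul_le_mul_right hVA _))
  rcases eq_or_ne A 0 with h0 | h0
  · rw [h0]; exact zero_le
  · rw [sq] at hsq
    exact (ENNReal.mul_le_mul_iff_left h0 hAtop).1 hsq

/-- A time increment multiplies the symbol by `e^{-ih|p|²} - 1`. The dual restriction estimate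
bounds each increment, and the `h`-integral of `|e^{-ih|p|²} - 1|²/h²` is at most `5|p|²`: half a
time derivative costs one space derivative. -/
theorem halfNorm_specTrace_lt_top {m : Plane → ℂ} (hm : Integrable m)
    (hP : ∫⁻ ξ, ENNReal.ofReal (symb ξ) * ‖m ξ‖ₑ ^ 2 < ∞) (T : ℝ) :
    halfNorm (specTrace m) T < ∞ := by
  have h1 : ∀ h, incr (specTrace m) T h ≤ ∫⁻ ξ, ‖phase h (symb ξ) - 1‖ₑ ^ 2 * ‖m ξ‖ₑ ^ 2 := by
    intro h
    have hi : Integrable fun ξ ↦ (phase h (symb ξ) - 1) * m ξ := by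
      simp only [sub_mul, one_mul]
      exact (integrable_phase_mul hm h).sub hm
    refine le_trans (le_of_eq ?_) ((lintegral_specTrace_sq_le hi (T - h)).trans_eq ?_)
    · refine lintegral_congr fun s ↦ ?_
      rw [specTrace, specTrace, ← integral_sub (integrable_phase_mul hm _) (integrable_phase_mul hm _),
        specTrace]
      congr 3
      funext ξ
      rw [phase_add]; ring
    · simp only [enorm_mul, mul_pow]
  have hmeas : AEMeasurable (Function.uncurry fun (h : ℝ) (ξ : Plane) ↦
      ‖phase h (symb ξ) - 1‖ₑ ^ 2 * ‖m ξ‖ₑ ^ 2 / ENNReal.ofReal (h ^ 2))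
      ((volume.restrict (Ioo 0 T)).prod volume) := by
    have h2 : AEMeasurable (fun p : ℝ × Plane ↦ ‖m p.2‖ₑ ^ 2)
        ((volume.restrict (Ioo 0 T)).prod volume) := by
      have := hm.1.comp_snd (μ := volume.restrict (Ioo 0 T))
      exact this.enorm.pow_const 2
    have h3 : Measurable (fun p : ℝ × Plane ↦ ‖phase p.1 (symb p.2) - 1‖ₑ ^ 2) :=
      (measurable_phase_symb.sub_const 1).enorm.pow_const 2
    have h4 : Measurable (fun p : ℝ × Plane ↦ ENNReal.ofReal (p.1 ^ 2)) := by fun_prop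
    exact (h3.aemeasurable.mul h2).div h4.aemeasurable
  calc halfNorm (specTrace m) T
      ≤ ∫⁻ h in Ioo 0 T, ∫⁻ ξ, ‖phase h (symb ξ) - 1‖ₑ ^ 2 * ‖m ξ‖ₑ ^ 2 / ENNReal.ofReal (h ^ 2) := by
        refine setLIntegral_mono' measurableSet_Ioo fun h hh ↦ ?_
        simp only [div_eq_mul_inv]
        rw [lintegral_mul_const' _ _ (ENNReal.inv_ne_top.2 (by simpa using hh.1.ne'))]
        exact mul_le_mul_left (h1 h) _
    _ = ∫⁻ ξ, ∫⁻ h in Ioo 0 T, ‖phase h (symb ξ) - 1‖ₑ ^ 2 * ‖m ξ‖ₑ ^ 2 / ENNReal.ofReal (h ^ 2) :=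
        lintegral_lintegral_swap hmeas
    _ ≤ ∫⁻ ξ, 5 * (ENNReal.ofReal (symb ξ) * ‖m ξ‖ₑ ^ 2) := by
        refine lintegral_mono fun ξ ↦ ?_
        have e : ∀ h : ℝ, ‖phase h (symb ξ) - 1‖ₑ ^ 2 * ‖m ξ‖ₑ ^ 2 / ENNReal.ofReal (h ^ 2) =
            ‖m ξ‖ₑ ^ 2 * (‖phase h (symb ξ) - 1‖ₑ ^ 2 / ENNReal.ofReal (h ^ 2)) := fun h ↦ by
          rw [mul_comm, mul_div_assoc]
        simp only [e]
        rw [lintegral_const_mul' _ _ (by finiteness)]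
        have := (lintegral_mono_set (μ := volume) (show Ioo 0 T ⊆ Ioi (0 : ℝ) from fun x hx ↦ hx.1)).trans
          (lintegral_phase_sub_one_sq_le (symb_nonneg ξ))
        refine (mul_le_mul_right this _).trans_eq ?_
        rw [ENNReal.ofReal_mul (by norm_num)]
        norm_num
        ring
    _ < ∞ := by
        rw [lintegral_const_mul' _ _ (by norm_num)]
        exact ENNReal.mul_lt_top (by norm_num) hP


/-! ### The oscillating primitive of the charge -/

/-- The Duhamel integral `∫₀ᵗ exp (-i (t - τ) ω) Q τ dτ`. -/
def osc (Q : ℝ → ℂ) (t ω : ℝ) : ℂ := ∫ τ in (0 : ℝ)..t, phase (t - τ) ω * Q τ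

theorem osc_eq (Q : ℝ → ℂ) (t ω : ℝ) :
    osc Q t ω = phase t ω * ∫ τ in (0 : ℝ)..t, phase (-τ) ω * Q τ := by
  rw [osc, ← intervalIntegral.integral_const_mul]
  refine intervalIntegral.integral_congr fun τ _ ↦ ?_
  rw [sub_eq_add_neg, phase_add]; ring

theorem osc_eq_comp_sub (Q : ℝ → ℂ) (t ω : ℝ) :
    osc Q t ω = ∫ s in (0 : ℝ)..t, phase s ω * Q (t - s) := by
  have := intervalIntegral.integral_comp_sub_left (a := 0) (b := t)
    (fun s ↦ phase s ω * Q (t - s)) t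
  simpa [osc] using this

theorem norm_osc_le {Q : ℝ → ℂ} {B t : ℝ} (ht : 0 ≤ t) (hB : ∀ τ ∈ Ioc 0 t, ‖Q τ‖ ≤ B) (ω : ℝ) :
    ‖osc Q t ω‖ ≤ B * t := by
  have := intervalIntegral.norm_integral_le_of_norm_le_const (a := 0) (b := t) (C := B)
    (f := fun τ ↦ phase (t - τ) ω * Q τ) fun τ hτ ↦ by
      rw [uIoc_of_le ht] at hτ
      rw [norm_mul, norm_phase, one_mul]; exact hB τ hτ
  rwa [sub_zero, abs_of_nonneg ht] at this

theorem continuous_osc {Q : ℝ → ℂ} (hQ : Continuous Q) :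
    Continuous fun p : ℝ × ℝ ↦ osc Q p.1 p.2 := by
  have : (fun p : ℝ × ℝ ↦ osc Q p.1 p.2) =
      fun p ↦ phase p.1 p.2 * ∫ τ in (0 : ℝ)..p.1, phase (-τ) p.2 * Q τ :=
    funext fun p ↦ osc_eq Q p.1 p.2
  rw [this]
  refine continuous_phase.mul ?_
  exact intervalIntegral.continuous_parametric_intervalIntegral_of_continuous
    (f := fun (p : ℝ × ℝ) τ ↦ phase (-τ) p.2 * Q τ) (by fun_prop) continuous_fst

/-- Continuous functions on `[0, T]` vanishing at `0` with half a derivative and a logarithmic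
modulus of continuity. -/
structure HalfRegular (Q : ℝ → ℂ) (T : ℝ) : Prop where
  continuous : Continuous Q
  zero : Q 0 = 0
  halfNorm_lt_top : halfNorm Q T < ∞
  modulus : ∃ C : ℝ, 0 ≤ C ∧ ∀ s t, 0 ≤ s → s ≤ t → t ≤ T → ‖Q t - Q s‖ ≤ C * logMod (t - s)

theorem logMod_mono {x y : ℝ} (hx : 0 ≤ x) (hxy : x ≤ y) (hy : y < 1) : logMod x ≤ logMod y := by
  rcases eq_or_lt_of_le hx with rfl | hx
  · simpa [logMod] using logMod_nonneg (hx.trans hxy) hy.le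
  · have h1 := neg_log_pos (hx.trans_le hxy) hy
    have h2 := Real.log_le_log hx hxy
    rw [logMod, logMod, ← inv_neg, ← inv_neg]
    exact inv_anti₀ h1 (by linarith)

/-- For `hω` between `π/2` and `3π/2` the cosine is non-positive, so `|e^{-ihω} - 1|² = 2 - 2
cos(hω) ≥ 2`. As `3π/2 < 5`, the condition `ω ≥ 5/T` places this window inside `(0, T)`. -/
theorem lintegral_phase_sub_one_sq_ge {ω T : ℝ} (hT : 0 < T) (hω : 5 / T ≤ ω) :
    ENNReal.ofReal (ω / 4) ≤
      ∫⁻ h in Ioo (0 : ℝ) T, ‖phase h ω - 1‖ₑ ^ 2 / ENNReal.ofReal (h ^ 2) := by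
  have hω0 : 0 < ω := lt_of_lt_of_le (by positivity) hω
  have hpi := Real.pi_pos
  set a := Real.pi / (2 * ω) with ha
  set b := 3 * Real.pi / (2 * ω) with hb
  have ha0 : 0 < a := by positivity
  have hbT : b ≤ T := by
    rw [hb, div_le_iff₀ (by positivity)]
    rw [div_le_iff₀ hT] at hω
    nlinarith [Real.pi_lt_d2]
  have hb0 : 0 < b := by positivity
  have hsub : Ioo a b ⊆ Ioo 0 T := fun x hx ↦ ⟨ha0.trans hx.1, hx.2.trans_le hbT⟩
  have h1 : ∀ h ∈ Ioo a b, ENNReal.ofReal (2 / b ^ 2) ≤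
      ‖phase h ω - 1‖ₑ ^ 2 / ENNReal.ofReal (h ^ 2) := by
    intro h hh
    have hh0 : 0 < h := ha0.trans hh.1
    have hcos : Real.cos (h * ω) ≤ 0 := by
      refine Real.cos_nonpos_of_pi_div_two_le_of_le ?_ ?_
      · have := mul_le_mul_of_nonneg_right hh.1.le hω0.le
        rw [ha] at this
        calc Real.pi / 2 = Real.pi / (2 * ω) * ω := by field_simp
          _ ≤ _ := this
      · have := mul_le_mul_of_nonneg_right hh.2.le hω0.le
        calc h * ω ≤ b * ω := this
          _ = Real.pi + Real.pi / 2 := by rw [hb]; field_simp; ring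
    have hn : 2 ≤ ‖phase h ω - 1‖ ^ 2 := by
      have e : phase h ω = Real.cos (h * ω) - Real.sin (h * ω) * Complex.I := by
        rw [phase, show -Complex.I * ((h * ω : ℝ) : ℂ) = ((-(h * ω) : ℝ) : ℂ) * Complex.I by
          push_cast; ring, Complex.exp_mul_I, ← Complex.ofReal_cos, ← Complex.ofReal_sin, Real.cos_neg,
          Real.sin_neg]
        push_cast; ring
      rw [e, ← Complex.normSq_eq_norm_sq, Complex.normSq_apply]
      simp only [Complex.sub_re, Complex.sub_im, Complex.mul_re, Complex.mul_im, Complex.ofReal_re,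
        Complex.ofReal_im, Complex.I_re, Complex.I_im, Complex.one_re, Complex.one_im]
      nlinarith [Real.sin_sq_add_cos_sq (h * ω)]
    rw [← ofReal_norm, ← ENNReal.ofReal_pow (norm_nonneg _),
      ← ENNReal.ofReal_div_of_pos (pow_pos hh0 2)]
    refine ENNReal.ofReal_le_ofReal ?_
    gcongr
    exact hh.2.le
  calc ENNReal.ofReal (ω / 4) ≤ ENNReal.ofReal (2 / b ^ 2) * volume (Ioo a b) := by
        rw [Real.volume_Ioo, ← ENNReal.ofReal_mul (by positivity)]
        refine ENNReal.ofReal_le_ofReal ?_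
        have : 2 / b ^ 2 * (b - a) = 8 * ω / (9 * Real.pi) := by
          rw [ha, hb]; field_simp; ring
        rw [this, div_le_div_iff₀ (by norm_num) (by positivity)]
        nlinarith [Real.pi_lt_d2]
    _ = ∫⁻ _ in Ioo a b, ENNReal.ofReal (2 / b ^ 2) := (setLIntegral_const _ _).symm
    _ ≤ ∫⁻ h in Ioo a b, ‖phase h ω - 1‖ₑ ^ 2 / ENNReal.ofReal (h ^ 2) :=
        setLIntegral_mono' measurableSet_Ioo h1
    _ ≤ _ := lintegral_mono_set hsub

/-! ### Increments of the charge stopped at time `t`. -/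

section Clamp

variable {Q : ℝ → ℂ} {T t : ℝ}

/-- The extension of `Q` from `[0, t]` by constants. -/
def clamp (Q : ℝ → ℂ) (t τ : ℝ) : ℂ := Q (max 0 (min t τ))

theorem continuous_clamp (hQ : Continuous Q) : Continuous (clamp Q t) := by
  unfold clamp; fun_prop

theorem clamp_of_nonpos {τ : ℝ} (ht : 0 ≤ t) (h : τ ≤ 0) : clamp Q t τ = Q 0 := by
  rw [clamp, min_eq_right (h.trans ht), max_eq_left h]

theorem clamp_of_ge {τ : ℝ} (ht : 0 ≤ t) (h : t ≤ τ) : clamp Q t τ = Q t := by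
  rw [clamp, min_eq_left h, max_eq_right ht]

theorem clamp_of_mem {τ : ℝ} (h : τ ∈ Icc 0 t) : clamp Q t τ = Q τ := by
  rw [clamp, min_eq_right h.2, max_eq_right h.1]

/-- The stopped function is constant on both sides and need not be integrable; its increments have
compact support, so Plancherel applies to them. -/
theorem integrable_clamp_diff (hQ : Continuous Q) (ht : 0 ≤ t) {h : ℝ} (hh : 0 ≤ h) :
    Integrable (fun s ↦ clamp Q t (t + h - s) - clamp Q t (t - s)) ∧
    MemLp (fun s ↦ clamp Q t (t + h - s) - clamp Q t (t - s)) 2 volume ∧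
    ∀ s, s ∉ Icc 0 (t + h) → clamp Q t (t + h - s) - clamp Q t (t - s) = 0 := by
  have hc : Continuous (fun s ↦ clamp Q t (t + h - s) - clamp Q t (t - s)) := by
    have := continuous_clamp (t := t) hQ; fun_prop
  have h0 : ∀ s, s ∉ Icc 0 (t + h) → clamp Q t (t + h - s) - clamp Q t (t - s) = 0 := by
    intro s hs
    rcases lt_or_ge s 0 with h1 | h1
    · rw [clamp_of_ge ht (by linarith), clamp_of_ge ht (by linarith), sub_self]
    · have : t + h < s := by by_contra h2; exact hs ⟨h1, not_lt.1 h2⟩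
      rw [clamp_of_nonpos ht (by linarith), clamp_of_nonpos ht (by linarith), sub_self]
  have hs : HasCompactSupport (fun s ↦ clamp Q t (t + h - s) - clamp Q t (t - s)) :=
    HasCompactSupport.intro isCompact_Icc h0
  exact ⟨hc.integrable_of_hasCompactSupport hs, hc.memLp_of_hasCompactSupport hs, h0⟩

/-- A translation by `h` multiplies the transform by `e^{-ihω}`. The constant value `Q t` on one
side contributes the boundary term `Q t / (iω)`, while `Q 0 = 0` removes the contribution of the
other side. Increments thus control `osc Q t ω` corrected by its leading asymptotic term. -/
theorem integral_phase_clamp_diff (hQ : Continuous Q) (hQ0 : Q 0 = 0) (ht : 0 ≤ t) {h : ℝ}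
    (hh : 0 ≤ h) {ω : ℝ} (hω : 0 < ω) :
    ∫ s, phase s ω * (clamp Q t (t + h - s) - clamp Q t (t - s)) =
      (phase h ω - 1) * (osc Q t ω - Q t / (Complex.I * ω)) := by
  have hR := continuous_clamp (t := t) hQ
  obtain ⟨-, -, h0⟩ := integrable_clamp_diff hQ ht hh
  have hci : ∀ {f : ℝ → ℂ} (a b : ℝ), Continuous f → IntervalIntegrable f volume a b :=
    fun a b hf ↦ hf.intervalIntegrable a b
  have e1 : ∫ s, phase s ω * (clamp Q t (t + h - s) - clamp Q t (t - s)) =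
      ∫ s in (0 : ℝ)..(t + h), phase s ω * (clamp Q t (t + h - s) - clamp Q t (t - s)) := by
    rw [intervalIntegral.integral_of_le (by linarith), ← integral_Icc_eq_integral_Ioc,
      setIntegral_eq_integral_of_forall_compl_eq_zero]
    intro s hs
    rw [h0 s hs, mul_zero]
  have e2 : ∫ s in (0 : ℝ)..(t + h), phase s ω * clamp Q t (t - s) = osc Q t ω := by
    rw [osc_eq_comp_sub, ← intervalIntegral.integral_add_adjacent_intervals (b := t)
      (hci _ _ (by fun_prop)) (hci _ _ (by fun_prop))]
    have a1 : ∫ s in t..(t + h), phase s ω * clamp Q t (t - s) = 0 := by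
      rw [intervalIntegral.integral_congr (g := fun _ ↦ 0) fun s hs ↦ ?_]
      · simp
      · rw [uIcc_of_le (by linarith)] at hs
        simp only
        rw [clamp_of_nonpos ht (by linarith [hs.1]), hQ0, mul_zero]
    rw [a1, add_zero]
    refine intervalIntegral.integral_congr fun s hs ↦ ?_
    rw [uIcc_of_le ht] at hs
    rw [clamp_of_mem ⟨by linarith [hs.2], by linarith [hs.1]⟩]
  have e3 : ∫ s in (0 : ℝ)..(t + h), phase s ω * clamp Q t (t + h - s) =
      (1 - phase h ω) * (Q t / (Complex.I * ω)) + phase h ω * osc Q t ω := by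
    rw [← intervalIntegral.integral_add_adjacent_intervals (b := h)
      (hci _ _ (by fun_prop)) (hci _ _ (by fun_prop))]
    congr 1
    · rw [intervalIntegral.integral_congr (g := fun s ↦ phase s ω * Q t) fun s hs ↦ ?_]
      · rw [intervalIntegral.integral_mul_const]
        have hne : (-Complex.I * ω : ℂ) ≠ 0 := by
          simp [hω.ne']
        have := intervalIntegral.integral_eq_sub_of_hasDerivAt (a := 0) (b := h)
          (f := fun s ↦ phase s ω / (-Complex.I * ω)) (f' := fun s ↦ phase s ω) (fun s _ ↦ by
            refine ((hasDerivAt_phase s ω).div_const (-Complex.I * ω)).congr_deriv ?_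
            exact mul_div_cancel_left₀ _ hne) (hci _ _ (by fun_prop))
        rw [this, phase_zero_left]
        have hne' : (ω : ℂ) ≠ 0 := by exact_mod_cast hω.ne'
        field_simp
        ring
      · rw [uIcc_of_le hh] at hs
        simp only
        rw [clamp_of_ge ht (by linarith [hs.2])]
    · rw [osc_eq_comp_sub, ← intervalIntegral.integral_const_mul]
      have := intervalIntegral.integral_comp_add_right (a := 0) (b := t)
        (fun s ↦ phase s ω * clamp Q t (t + h - s)) h
      rw [zero_add] at this
      rw [← this]
      refine intervalIntegral.integral_congr fun s hs ↦ ?_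
      rw [uIcc_of_le ht] at hs
      rw [add_sub_add_right_eq_sub, clamp_of_mem ⟨by linarith [hs.2], by linarith [hs.1]⟩, phase_add]
      ring
  rw [e1]
  simp only [mul_sub]
  rw [intervalIntegral.integral_sub (hci _ _ (by fun_prop)) (hci _ _ (by fun_prop)), e2, e3]
  ring

/-- Outside two windows of length `h`, next to `0` and to `t`, the stopped increment is an increment
of `Q` or zero. In the windows the logarithmic modulus costs `2h (C logMod h)²`, which remains
integrable after division by `h²`. -/
theorem lintegral_clamp_diff_le {C : ℝ} (ht : t ∈ Icc 0 T) (hT : T ≤ 1 / 8)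
    (hC : ∀ s t, 0 ≤ s → s ≤ t → t ≤ T → ‖Q t - Q s‖ ≤ C * logMod (t - s)) (hC0 : 0 ≤ C)
    {h : ℝ} (hh : h ∈ Ioo 0 T) :
    ∫⁻ s, ‖clamp Q t (t + h - s) - clamp Q t (t - s)‖ₑ ^ 2 ≤
      incr Q T h + 2 * (ENNReal.ofReal h * ENNReal.ofReal (C * logMod h) ^ 2) := by
  set c : ℝ≥0∞ := ENNReal.ofReal (C * logMod h) ^ 2 with hc
  have e : ∫⁻ s, ‖clamp Q t (t + h - s) - clamp Q t (t - s)‖ₑ ^ 2 =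
      ∫⁻ r, ‖clamp Q t (r + h) - clamp Q t r‖ₑ ^ 2 := by
    rw [← lintegral_sub_left_eq_self (fun r ↦ ‖clamp Q t (r + h) - clamp Q t r‖ₑ ^ 2) t]
    refine lintegral_congr fun s ↦ ?_
    rw [sub_add_eq_add_sub]
  have hmod : ∀ r, ‖clamp Q t (r + h) - clamp Q t r‖ₑ ^ 2 ≤ c := by
    intro r
    rw [hc, ← ofReal_norm]
    refine pow_le_pow_left' (ENNReal.ofReal_le_ofReal ?_) 2
    have h1 : max 0 (min t r) ≤ max 0 (min t (r + h)) :=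
      max_le_max le_rfl (min_le_min le_rfl (by linarith [hh.1]))
    have h2 : max 0 (min t (r + h)) - max 0 (min t r) ≤ h := by
      have h3 : min t (r + h) ≤ min t r + h := by
        rcases le_total t r with h | h'
        · rw [min_eq_left h]; exact (min_le_left _ _).trans (by linarith [hh.1])
        · rw [min_eq_right h']; exact min_le_right _ _
      rcases le_total 0 (min t (r + h)) with h | h'
      · rw [max_eq_right h]; linarith [le_max_right 0 (min t r)]
      · rw [max_eq_left h']; linarith [le_max_left 0 (min t r), hh.1]
    refine (hC _ _ (le_max_left _ _) h1 (max_le (ht.1.trans ht.2) ((min_le_left _ _).trans ht.2))).trans ?_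
    exact mul_le_mul_of_nonneg_left (logMod_mono (sub_nonneg.2 h1) h2 (by linarith [hh.2])) hC0
  have hpt : ∀ r, ‖clamp Q t (r + h) - clamp Q t r‖ₑ ^ 2 ≤
      (Ioo 0 (T - h)).indicator (fun s ↦ ‖Q (s + h) - Q s‖ₑ ^ 2) r +
        ((Icc (-h) 0).indicator (fun _ ↦ c) r + (Icc (t - h) t).indicator (fun _ ↦ c) r) := by
    intro r
    by_cases h1 : r ∈ Icc (-h) 0
    · rw [indicator_of_mem h1]
      exact (hmod r).trans (le_add_left (le_add_right le_rfl))
    by_cases h2 : r ∈ Icc (t - h) t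
    · rw [indicator_of_mem h2]
      exact (hmod r).trans (le_add_left (le_add_left le_rfl))
    rcases le_or_gt r 0 with h3 | h3
    · have : r < -h := by by_contra h4; exact h1 ⟨not_lt.1 h4, h3⟩
      rw [clamp_of_nonpos ht.1 (by linarith), clamp_of_nonpos ht.1 h3]; simp
    rcases le_or_gt r t with h4 | h4
    · have h5 : r < t - h := by by_contra h5; exact h2 ⟨not_lt.1 h5, h4⟩
      rw [indicator_of_mem (mem_Ioo.2 ⟨h3, by linarith [ht.2]⟩),
        clamp_of_mem ⟨by linarith [hh.1], by linarith⟩, clamp_of_mem ⟨h3.le, h4⟩]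
      exact le_add_right le_rfl
    · rw [clamp_of_ge ht.1 (by linarith [hh.1]), clamp_of_ge ht.1 h4.le]; simp
  rw [e]
  refine (lintegral_mono hpt).trans ?_
  have m1 : Measurable fun r ↦ ((Icc (-h) 0).indicator (fun _ ↦ c) r +
      (Icc (t - h) t).indicator (fun _ ↦ c) r : ℝ≥0∞) :=
    (measurable_const.indicator measurableSet_Icc).add (measurable_const.indicator measurableSet_Icc)
  rw [lintegral_add_right _ m1, lintegral_add_left (measurable_const.indicator measurableSet_Icc),
    lintegral_indicator measurableSet_Ioo, lintegral_indicator measurableSet_Icc,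
    lintegral_indicator measurableSet_Icc, setLIntegral_const, setLIntegral_const, Real.volume_Icc,
    Real.volume_Icc, ← incr]
  refine add_le_add le_rfl (le_of_eq ?_)
  rw [sub_neg_eq_add, zero_add, sub_sub_cancel]
  ring

end Clamp


/-! ### Uniform `H¹` bound for the regular part of the Duhamel term -/

/-- The radial profile of the regular part of the Duhamel term. -/
def regOsc (lam : ℝ) (Q : ℝ → ℂ) (t ω : ℝ) : ℂ :=
  Complex.I * osc Q t ω - Q t / ((ω + lam : ℝ) : ℂ)

/-- For `ω > 5/T` the weight `ω` is at most four times the integral of `|e^{-ihω} - 1|²/h²` over `h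
∈ (0, T)`. For each such `h`, Plancherel reduces the frequency integral to the stopped increment,
whose bound does not depend on `t`. -/
theorem lintegral_osc_sub_le {Q : ℝ → ℂ} {T : ℝ} (hT0 : 0 < T) (hT : T ≤ 1 / 8)
    (hQ : HalfRegular Q T) : ∃ K : ℝ≥0∞, K ≠ ∞ ∧ ∀ t ∈ Icc 0 T,
      ∫⁻ ω in Ioi (5 / T), ENNReal.ofReal ω * ‖osc Q t ω - Q t / (Complex.I * ω)‖ₑ ^ 2 ≤ K := by
  obtain ⟨C, hC0, hC⟩ := hQ.modulus
  set X : ℝ → ℝ≥0∞ := fun h ↦ ENNReal.ofReal h * ENNReal.ofReal (C * logMod h) ^ 2 with hX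
  have hXfin : ∫⁻ h in Ioo 0 T, 2 * X h / ENNReal.ofReal (h ^ 2) < ∞ := by
    refine lt_of_le_of_lt ?_ (lintegral_deriv_logMod_lt_top (2 * C ^ 2))
    refine (setLIntegral_mono' measurableSet_Ioo fun h hh ↦ ?_).trans
      (lintegral_mono_set (Ioo_subset_Ioo_right hT))
    have hl : 0 ≤ logMod h := logMod_nonneg hh.1.le (by linarith [hh.2])
    rw [hX]
    simp only
    rw [← ENNReal.ofReal_pow (by positivity), ← ENNReal.ofReal_mul hh.1.le,
      show (2 : ℝ≥0∞) = ENNReal.ofReal 2 by simp, ← ENNReal.ofReal_mul (by norm_num),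
      ← ENNReal.ofReal_div_of_pos (pow_pos hh.1 2), ← logMod_sq_div hh.1]
    refine ENNReal.ofReal_le_ofReal (le_of_eq ?_)
    have := hh.1.ne'
    field_simp
  refine ⟨4 * (ENNReal.ofReal (2 * Real.pi) *
    (halfNorm Q T + ∫⁻ h in Ioo 0 T, 2 * X h / ENNReal.ofReal (h ^ 2))), ?_, fun t ht ↦ ?_⟩
  · have := hQ.halfNorm_lt_top
    finiteness
  set D : ℝ → ℝ≥0∞ := fun ω ↦ ‖osc Q t ω - Q t / (Complex.I * ω)‖ₑ ^ 2 with hD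
  have hDm : Measurable D := by
    have h1 : Continuous fun ω ↦ osc Q t ω :=
      (continuous_osc hQ.continuous).comp (continuous_const.prodMk continuous_id)
    have h2 : Measurable fun ω : ℝ ↦ osc Q t ω - Q t / (Complex.I * ω) :=
      h1.measurable.sub (measurable_const.div (by fun_prop))
    exact h2.enorm.pow_const 2
  have hpl : ∀ h ∈ Ioo 0 T, ∫⁻ ω in Ioi (5 / T), ‖phase h ω - 1‖ₑ ^ 2 * D ω ≤
      ENNReal.ofReal (2 * Real.pi) * (incr Q T h + 2 * X h) := by
    intro h hh
    obtain ⟨i1, i2, -⟩ := integrable_clamp_diff hQ.continuous ht.1 hh.1.le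
    refine le_trans ?_ (mul_le_mul_right (lintegral_clamp_diff_le ht hT hC hC0 hh) _)
    rw [← lintegral_integral_phase_sq i1 i2]
    refine le_trans ?_ (setLIntegral_le_lintegral (Ioi (5 / T)) _)
    refine setLIntegral_mono' measurableSet_Ioi fun ω hω ↦ ?_
    have hω0 : 0 < ω := lt_trans (by positivity) (mem_Ioi.1 hω)
    rw [integral_phase_clamp_diff hQ.continuous hQ.zero ht.1 hh.1.le hω0, enorm_mul, mul_pow]
  have hmeas : Measurable (Function.uncurry fun (ω h : ℝ) ↦
      ‖phase h ω - 1‖ₑ ^ 2 / ENNReal.ofReal (h ^ 2) * D ω) := by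
    have h1 : Measurable fun p : ℝ × ℝ ↦ ‖phase p.2 p.1 - 1‖ₑ ^ 2 := by
      have : Continuous fun p : ℝ × ℝ ↦ phase p.2 p.1 - 1 := by fun_prop
      exact this.measurable.enorm.pow_const 2
    exact (h1.div (by fun_prop)).mul (hDm.comp measurable_fst)
  calc ∫⁻ ω in Ioi (5 / T), ENNReal.ofReal ω * D ω
      ≤ ∫⁻ ω in Ioi (5 / T), 4 * ∫⁻ h in Ioo 0 T,
          ‖phase h ω - 1‖ₑ ^ 2 / ENNReal.ofReal (h ^ 2) * D ω := by
        refine setLIntegral_mono' measurableSet_Ioi fun ω hω ↦ ?_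
        rw [lintegral_mul_const _ (by
          have : Continuous fun h : ℝ ↦ phase h ω - 1 := by fun_prop
          exact (this.measurable.enorm.pow_const 2).div (by fun_prop)), ← mul_assoc]
        refine mul_le_mul_left ?_ _
        calc ENNReal.ofReal ω = 4 * ENNReal.ofReal (ω / 4) := by
              rw [show (4 : ℝ≥0∞) = ENNReal.ofReal 4 by simp, ← ENNReal.ofReal_mul (by norm_num)]
              congr 1; ring
          _ ≤ _ := mul_le_mul_right (lintegral_phase_sub_one_sq_ge hT0 (mem_Ioi.1 hω).le) _
    _ = 4 * ∫⁻ ω in Ioi (5 / T), ∫⁻ h in Ioo 0 T,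
          ‖phase h ω - 1‖ₑ ^ 2 / ENNReal.ofReal (h ^ 2) * D ω :=
        lintegral_const_mul' _ _ (by norm_num)
    _ = 4 * ∫⁻ h in Ioo 0 T, ∫⁻ ω in Ioi (5 / T),
          ‖phase h ω - 1‖ₑ ^ 2 / ENNReal.ofReal (h ^ 2) * D ω := by
        rw [lintegral_lintegral_swap hmeas.aemeasurable]
    _ ≤ 4 * ∫⁻ h in Ioo 0 T, ENNReal.ofReal (2 * Real.pi) *
          (incr Q T h / ENNReal.ofReal (h ^ 2) + 2 * X h / ENNReal.ofReal (h ^ 2)) := by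
        gcongr 4 * ?_
        refine setLIntegral_mono' measurableSet_Ioo fun h hh ↦ ?_
        have e : ∀ ω, ‖phase h ω - 1‖ₑ ^ 2 / ENNReal.ofReal (h ^ 2) * D ω =
            (ENNReal.ofReal (h ^ 2))⁻¹ * (‖phase h ω - 1‖ₑ ^ 2 * D ω) := fun ω ↦ by
          rw [div_eq_mul_inv]; ring
        simp only [e]
        rw [lintegral_const_mul' _ _ (ENNReal.inv_ne_top.2 (by simpa using hh.1.ne'))]
        refine (mul_le_mul_right (hpl h hh) _).trans_eq ?_
        rw [div_eq_mul_inv, div_eq_mul_inv]; ring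
    _ = _ := by
        rw [lintegral_const_mul' _ _ ENNReal.ofReal_ne_top, lintegral_add_left]
        · rfl
        · exact (measurable_incr hQ.continuous.measurable T).div (by fun_prop)

/-- At low frequencies everything is bounded. Above `5/T ≥ 1` the profile equals `i (osc - Q
t/(iω))` up to an error of order `ω⁻²`, negligible against the weight. Removing the charge times the
Green function is exactly the removal of the non-`H¹` tail. -/
theorem exists_lintegral_regOsc_le {lam : ℝ} (hlam : 0 < lam) {Q : ℝ → ℂ} {T : ℝ} (hT0 : 0 < T)
    (hT : T ≤ 1 / 8) (hQ : HalfRegular Q T) : ∃ K : ℝ≥0∞, K ≠ ∞ ∧ ∀ t ∈ Icc 0 T,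
      ∫⁻ ω in Ioi (0 : ℝ), ENNReal.ofReal (1 + ω) * ‖regOsc lam Q t ω‖ₑ ^ 2 ≤ K := by
  obtain ⟨K, hK, hb⟩ := lintegral_osc_sub_le hT0 hT hQ
  obtain ⟨B, hB⟩ := isCompact_Icc.exists_bound_of_continuousOn (hQ.continuous.continuousOn (s := Icc 0 T))
  have hB0 : 0 ≤ B := (norm_nonneg _).trans (hB 0 ⟨le_rfl, hT0.le⟩)
  set c := 5 / T with hc
  have hc1 : 1 ≤ c := by rw [hc, le_div_iff₀ hT0]; linarith
  have hc0 : 0 < c := by linarith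
  set M := B * T + B / lam with hM
  refine ⟨ENNReal.ofReal ((1 + c) * M ^ 2) * ENNReal.ofReal c + (4 * K +
    ENNReal.ofReal (B ^ 2 * lam ^ 2) * ENNReal.ofReal (4 / c)), by finiteness, fun t ht ↦ ?_⟩
  rw [← Ioc_union_Ioi_eq_Ioi hc0.le, lintegral_union measurableSet_Ioi
    (disjoint_left.2 fun x hx hx' ↦ absurd hx.2 (not_le.2 hx'))]
  refine add_le_add ?_ ?_
  · calc _ ≤ ∫⁻ _ in Ioc 0 c, ENNReal.ofReal ((1 + c) * M ^ 2) := by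
          refine setLIntegral_mono' measurableSet_Ioc fun ω hω ↦ ?_
          have h1 : ‖regOsc lam Q t ω‖ ≤ M := by
            refine (norm_sub_le _ _).trans (add_le_add ?_ ?_)
            · rw [norm_mul, Complex.norm_I, one_mul]
              exact (norm_osc_le ht.1 (fun τ hτ ↦ hB τ ⟨hτ.1.le, hτ.2.trans ht.2⟩) ω).trans
                (mul_le_mul_of_nonneg_left ht.2 hB0)
            · rw [norm_div, Complex.norm_real, Real.norm_of_nonneg (by linarith [hω.1])]
              have := hω.1
              gcongr
              · exact hB t ht
              · linarith
          rw [← ofReal_norm, ← ENNReal.ofReal_pow (norm_nonneg _),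
            ← ENNReal.ofReal_mul (by linarith [hω.1])]
          refine ENNReal.ofReal_le_ofReal ?_
          have := hω.1
          have := hω.2
          gcongr
      _ = _ := by rw [setLIntegral_const, Real.volume_Ioc, sub_zero]
  · have hpt : ∀ ω ∈ Ioi c, ENNReal.ofReal (1 + ω) * ‖regOsc lam Q t ω‖ₑ ^ 2 ≤
        4 * (ENNReal.ofReal ω * ‖osc Q t ω - Q t / (Complex.I * ω)‖ₑ ^ 2) +
          ENNReal.ofReal (B ^ 2 * lam ^ 2) * ENNReal.ofReal (4 / ω ^ 2) := by
      intro ω hω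
      have hω1 : 1 ≤ ω := hc1.trans (mem_Ioi.1 hω).le
      have hω0 : 0 < ω := by linarith
      have hωc : (ω : ℂ) ≠ 0 := by exact_mod_cast hω0.ne'
      have hωl : ((ω + lam : ℝ) : ℂ) ≠ 0 := by
        have : ω + lam ≠ 0 := by positivity
        exact_mod_cast this
      have e : regOsc lam Q t ω = Complex.I * (osc Q t ω - Q t / (Complex.I * ω)) +
          Q t * lam / (ω * ((ω + lam : ℝ) : ℂ)) := by
        have h1 : Q t / ((ω + lam : ℝ) : ℂ) = Q t / ω - Q t * lam / (ω * ((ω + lam : ℝ) : ℂ)) := by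
          field_simp; push_cast; ring
        have h2 : Complex.I * (Q t / (Complex.I * ω)) = Q t / ω := by
          have := Complex.I_ne_zero
          field_simp
        rw [regOsc, h1, mul_sub, h2]; ring
      have h2 : ‖Q t * lam / (ω * ((ω + lam : ℝ) : ℂ))‖ ≤ B * lam / ω ^ 2 := by
        rw [norm_div, norm_mul, norm_mul, Complex.norm_real, Complex.norm_real, Complex.norm_real,
          Real.norm_of_nonneg hlam.le, Real.norm_of_nonneg hω0.le, Real.norm_of_nonneg (by positivity),
          sq]
        gcongr
        · exact hB t ht
        · linarith
      rw [e]
      have h3 := enorm_add_sq_le (Complex.I * (osc Q t ω - Q t / (Complex.I * ω)))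
        (Q t * lam / (ω * ((ω + lam : ℝ) : ℂ)))
      rw [enorm_mul, show ‖Complex.I‖ₑ = 1 by simp [← ofReal_norm], one_mul] at h3
      have h4 : ‖Q t * lam / (ω * ((ω + lam : ℝ) : ℂ))‖ₑ ^ 2 ≤ ENNReal.ofReal ((B * lam / ω ^ 2) ^ 2) := by
        rw [← ofReal_norm, ← ENNReal.ofReal_pow (norm_nonneg _)]
        exact ENNReal.ofReal_le_ofReal (pow_le_pow_left₀ (norm_nonneg _) h2 2)
      have h5 : ENNReal.ofReal (1 + ω) ≤ 2 * ENNReal.ofReal ω := by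
        rw [show (2 : ℝ≥0∞) = ENNReal.ofReal 2 by simp, ← ENNReal.ofReal_mul (by norm_num)]
        exact ENNReal.ofReal_le_ofReal (by linarith)
      calc _ ≤ (2 * ENNReal.ofReal ω) * (2 * ‖osc Q t ω - Q t / (Complex.I * ω)‖ₑ ^ 2 +
            2 * ENNReal.ofReal ((B * lam / ω ^ 2) ^ 2)) :=
            mul_le_mul' h5 (h3.trans (add_le_add le_rfl (mul_le_mul_right h4 2)))
        _ = 4 * (ENNReal.ofReal ω * ‖osc Q t ω - Q t / (Complex.I * ω)‖ₑ ^ 2) +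
            4 * (ENNReal.ofReal ω * ENNReal.ofReal ((B * lam / ω ^ 2) ^ 2)) := by ring
        _ ≤ _ := by
            refine add_le_add le_rfl ?_
            rw [show (4 : ℝ≥0∞) = ENNReal.ofReal 4 by simp, ← ENNReal.ofReal_mul hω0.le,
              ← ENNReal.ofReal_mul (by norm_num), ← ENNReal.ofReal_mul (by positivity)]
            refine ENNReal.ofReal_le_ofReal ?_
            have h6 : 4 * (ω * (B * lam / ω ^ 2) ^ 2) = B ^ 2 * lam ^ 2 * (4 / ω ^ 3) := by
              field_simp
            rw [h6]
            gcongr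
            · norm_num
    refine (setLIntegral_mono' measurableSet_Ioi hpt).trans ?_
    have hm : Measurable fun ω : ℝ ↦ ENNReal.ofReal (B ^ 2 * lam ^ 2) * ENNReal.ofReal (4 / ω ^ 2) := by
      fun_prop
    rw [lintegral_add_right _ hm, lintegral_const_mul' _ _ (by norm_num),
      lintegral_const_mul' _ _ ENNReal.ofReal_ne_top, lintegral_inv_sq_Ioi hc0]
    gcongr
    exact hb t ht


/-! ### Superpositions of complex heat kernels -/

/-- The heat kernel of the plane at complex time `z`. -/
def heat (z : ℂ) (r : ℝ) : ℂ := Complex.exp (-(r : ℂ) ^ 2 / (4 * z)) / (4 * Real.pi * z)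

/-- The Gaussian transform with parameter `(2π)² z`. In the plane the exponent `finrank / 2` is `1`,
so no branch of a complex power occurs. -/
theorem fourierInv_wave_mul_gaussian (y x : Plane) {z : ℂ} (hz : 0 < z.re) :
    𝓕⁻ (fun ξ : Plane ↦ wave y ξ * Complex.exp (-z * symb ξ)) x = heat z ‖x - y‖ := by
  have hpi : (Real.pi : ℂ) ≠ 0 := by exact_mod_cast Real.pi_ne_zero
  have hz0 : z ≠ 0 := by rintro rfl; simp at hz
  set b : ℂ := ((2 * Real.pi) ^ 2 : ℝ) * z with hb
  have hbre : 0 < b.re := by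
    rw [hb, Complex.re_ofReal_mul]; positivity
  have e : (fun ξ : Plane ↦ wave y ξ * Complex.exp (-z * symb ξ)) = fun v : Plane ↦
      Complex.exp (-b * ↑‖v‖ ^ 2 + 2 * ↑Real.pi * Complex.I * ↑(inner ℝ (-y) v)) := by
    funext ξ
    rw [wave, ← Complex.exp_add]
    congr 1
    rw [inner_neg_left, real_inner_comm, hb, symb]
    push_cast
    ring
  have hd : ((Module.finrank ℝ Plane : ℂ) / 2) = 1 := by simp
  rw [e, Real.fourierInv_eq_fourier_neg, fourier_gaussian_innerProductSpace' hbre, hd,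
    Complex.cpow_one, heat]
  have h1 : ‖-y - -x‖ = ‖x - y‖ := by rw [neg_sub_neg]
  rw [h1, hb, mul_comm, div_eq_mul_inv (Complex.exp _)]
  congr 1
  · congr 1
    push_cast
    field_simp
    norm_num
  · push_cast
    field_simp
    norm_num

/-- `Re z ≥ 0` implies `Re (1/z) ≥ 0`, so the exponential has modulus at most `1`. Purely imaginary
times, where the Schrödinger kernel lives, are included. -/
theorem norm_heat_le {z : ℂ} {c : ℝ} (hc : 0 < c) (hz : 0 ≤ z.re) (hcz : c ≤ ‖z‖) (r : ℝ) :
    ‖heat z r‖ ≤ 1 / (4 * Real.pi * c) := by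
  have hz0 : z ≠ 0 := by rintro rfl; simp at hcz; linarith
  have h1 : ‖Complex.exp (-(r : ℂ) ^ 2 / (4 * z))‖ ≤ 1 := by
    rw [Complex.norm_exp, Real.exp_le_one_iff]
    have e : -(r : ℂ) ^ 2 / (4 * z) = ((-(r ^ 2 / 4) : ℝ) : ℂ) * z⁻¹ := by
      push_cast; field_simp
    rw [e, Complex.re_ofReal_mul, Complex.inv_re]
    have : 0 ≤ z.re / Complex.normSq z := div_nonneg hz (Complex.normSq_nonneg _)
    nlinarith [sq_nonneg r]
  have hpi := Real.pi_pos
  rw [heat, norm_div, norm_mul, norm_mul, Complex.norm_real, Real.norm_of_nonneg hpi.le]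
  simp only [Complex.norm_ofNat]
  gcongr

theorem measurable_heat : Measurable fun p : ℂ × ℝ ↦ heat p.1 p.2 := by
  unfold heat
  fun_prop

theorem continuousAt_heat {z : ℂ} (hz : z ≠ 0) (r : ℝ) :
    ContinuousAt (fun p : ℂ × ℝ ↦ heat p.1 p.2) (z, r) := by
  unfold heat
  have hpi : (Real.pi : ℂ) ≠ 0 := by exact_mod_cast Real.pi_ne_zero
  have h4 : 4 * z ≠ 0 := by simpa using hz
  have h5 : (4 * Real.pi * z : ℂ) ≠ 0 := mul_ne_zero (mul_ne_zero (by norm_num) hpi) hz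
  refine ContinuousAt.div ?_ (by fun_prop) h5
  refine Complex.continuous_exp.continuousAt.comp ?_
  exact ContinuousAt.div (by fun_prop) (by fun_prop) h4

theorem tendsto_heat {ι : Type*} {l : Filter ι} {ζ : ι → ℂ} {z : ℂ} (hz : z ≠ 0)
    (h : Tendsto ζ l (𝓝 z)) (r : ℝ) : Tendsto (fun n ↦ heat (ζ n) r) l (𝓝 (heat z r)) := by
  have hpi : (Real.pi : ℂ) ≠ 0 := by exact_mod_cast Real.pi_ne_zero
  have h5 : (4 * Real.pi * z : ℂ) ≠ 0 := mul_ne_zero (mul_ne_zero (by norm_num) hpi) hz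
  have h4 : 4 * z ≠ 0 := mul_ne_zero (by norm_num) hz
  unfold heat
  refine Tendsto.div ?_ (h.const_mul _) h5
  have := (tendsto_const_nhds (x := -(r : ℂ) ^ 2)).div (h.const_mul 4) h4
  exact (Complex.continuous_exp.tendsto _).comp this

theorem tendsto_eLpNorm_two_zero {α ι : Type*} [MeasurableSpace α] {μ : Measure α} {l : Filter ι}
    {f : ι → α → ℂ} (h : Tendsto (fun n ↦ ∫⁻ x, ‖f n x‖ₑ ^ 2 ∂μ) l (𝓝 0)) :
    Tendsto (fun n ↦ eLpNorm (f n) 2 μ) l (𝓝 0) := by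
  have h1 := (ENNReal.continuous_rpow_const (y := 1 / 2)).tendsto 0 |>.comp h
  rw [ENNReal.zero_rpow_of_pos (by norm_num)] at h1
  refine h1.congr fun n ↦ ?_
  simp only [Function.comp]
  rw [← eLpNorm_two_sq, ← ENNReal.rpow_natCast, ← ENNReal.rpow_mul]
  norm_num

variable {α : Type*} [MeasurableSpace α] {μ : Measure α} {z w : α → ℂ} {c : ℝ}

theorem norm_le_norm_add {z : ℂ} (hz : 0 ≤ z.re) {δ : ℝ} (hδ : 0 ≤ δ) : ‖z‖ ≤ ‖(δ : ℂ) + z‖ := by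
  rw [Complex.norm_def, Complex.norm_def]
  refine Real.sqrt_le_sqrt ?_
  rw [Complex.normSq_apply, Complex.normSq_apply]
  simp only [Complex.add_re, Complex.add_im, Complex.ofReal_re, Complex.ofReal_im]
  nlinarith

theorem continuous_integral_heat (hz : Measurable z) (hw : Integrable w μ) (hc : 0 < c)
    (hzc : ∀ᵐ a ∂μ, 0 ≤ (z a).re ∧ c ≤ ‖z a‖) (y : Plane) :
    Continuous fun x : Plane ↦ ∫ a, heat (z a) ‖x - y‖ * w a ∂μ := by
  refine continuous_of_dominated (bound := fun a ↦ 1 / (4 * Real.pi * c) * ‖w a‖) (fun x ↦ ?_)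
    (fun x ↦ ?_) (hw.norm.const_mul _) ?_
  · exact (measurable_heat.comp (hz.prodMk measurable_const)).aestronglyMeasurable.mul hw.1
  · filter_upwards [hzc] with a ha
    rw [norm_mul]
    exact mul_le_mul_of_nonneg_right (norm_heat_le hc ha.1 ha.2 _) (norm_nonneg _)
  · filter_upwards [hzc] with a ha
    have hz0 : z a ≠ 0 := by intro h; rw [h, norm_zero] at ha; linarith [ha.2]
    refine Continuous.mul ?_ continuous_const
    refine continuous_iff_continuousAt.2 fun x ↦ ?_
    exact (continuousAt_heat hz0 ‖x - y‖).comp (f := fun x : Plane ↦ (z a, ‖x - y‖)) (by fun_prop)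

/-- At imaginary times the Gaussian is not integrable in frequency. The factor `e^{-δ|p|²}` moves
every time to `δ + z`, where Fubini and the Gaussian formula hold. As `δ → 0` the symbols converge
in `L²` and the kernels converge dominatedly, because `‖z‖ ≥ c`. -/
theorem fourierInv_wave_integral [SFinite μ] (hz : Measurable z) (hw : Integrable w μ) (hc : 0 < c)
    (hzc : ∀ᵐ a ∂μ, 0 ≤ (z a).re ∧ c ≤ ‖z a‖) {y : Plane}
    (hm : MemLp (fun ξ : Plane ↦ wave y ξ * ∫ a, Complex.exp (-(z a) * symb ξ) * w a ∂μ) 2 volume) :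
    (𝓕⁻ (hm.toLp _) : L2) =ᵐ[volume] fun x ↦ ∫ a, heat (z a) ‖x - y‖ * w a ∂μ := by
  set m : Plane → ℂ := fun ξ ↦ wave y ξ * ∫ a, Complex.exp (-(z a) * symb ξ) * w a ∂μ with hmdef
  set δ : ℕ → ℝ := fun n ↦ 1 / ((n : ℝ) + 1) with hδ
  have hδ0 : ∀ n, 0 < δ n := fun n ↦ by positivity
  have hδlim : Tendsto δ atTop (𝓝 0) := tendsto_one_div_add_atTop_nhds_zero_nat
  set g : ℕ → Plane → ℂ := fun n ξ ↦ ((Real.exp (-(δ n * symb ξ)) : ℝ) : ℂ) with hg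
  have hgc : ∀ n, Continuous (g n) := fun n ↦ by have := continuous_symb; fun_prop
  have hg1 : ∀ n ξ, ‖g n ξ‖ ≤ 1 := fun n ξ ↦ by
    rw [Complex.norm_real, Real.norm_of_nonneg (Real.exp_pos _).le, Real.exp_le_one_iff]
    have := mul_nonneg (hδ0 n).le (symb_nonneg ξ); linarith
  have hgi : ∀ n, Integrable (g n) := fun n ↦ by
    have := GaussianFourier.integrable_cexp_neg_mul_sq_norm_add (V := Plane)
      (b := ((δ n * (2 * Real.pi) ^ 2 : ℝ) : ℂ)) (by
        rw [Complex.ofReal_re]; have := hδ0 n; positivity) 0 0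
    refine this.congr (Eventually.of_forall fun ξ ↦ ?_)
    simp only [hg, symb]
    push_cast
    congr 1
    ring
  have hexp : ∀ᵐ a ∂μ, ∀ ξ : Plane, ‖Complex.exp (-(z a) * symb ξ)‖ ≤ 1 := by
    filter_upwards [hzc] with a ha ξ
    rw [Complex.norm_exp, Real.exp_le_one_iff, neg_mul, Complex.neg_re, mul_comm, Complex.re_ofReal_mul]
    have := mul_nonneg (symb_nonneg ξ) ha.1; linarith
  have hmb : ∀ ξ, ‖m ξ‖ ≤ ∫ a, ‖w a‖ ∂μ := by
    intro ξ
    rw [hmdef]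
    simp only
    rw [norm_mul, norm_wave, one_mul]
    refine norm_integral_le_of_norm_le hw.norm ?_
    filter_upwards [hexp] with a ha
    rw [norm_mul]
    exact mul_le_of_le_one_left (norm_nonneg _) (ha ξ)
  refine fourierInv_toLp_ae_eq_of_tendsto (M := fun n ξ ↦ g n ξ * m ξ) hm (fun n ↦ ?_) (fun n ↦ ?_)
    ?_ fun x ↦ ?_
  · exact (hgi n).mul_bdd (c := ∫ a, ‖w a‖ ∂μ) hm.1 (Eventually.of_forall hmb)
  · refine hm.of_le ((hgc n).aestronglyMeasurable.mul hm.1) (Eventually.of_forall fun ξ ↦ ?_)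
    rw [norm_mul]
    exact mul_le_of_le_one_left (norm_nonneg _) (hg1 n ξ)
  · refine tendsto_eLpNorm_two_zero ?_
    have hfin : ∫⁻ ξ, ‖m ξ‖ₑ ^ 2 ≠ ∞ := by
      rw [← eLpNorm_two_sq]; exact ENNReal.pow_ne_top hm.eLpNorm_ne_top
    have := tendsto_lintegral_of_dominated_convergence' (μ := (volume : Measure Plane))
      (F := fun n ξ ↦ ‖g n ξ * m ξ - m ξ‖ₑ ^ 2) (f := fun _ ↦ 0) (fun ξ ↦ ‖m ξ‖ₑ ^ 2)
      (fun n ↦ ((((hgc n).aestronglyMeasurable.mul hm.1).sub hm.1).enorm.pow_const 2)) (fun n ↦ ?_) hfin ?_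
    · simpa using this
    · refine Eventually.of_forall fun ξ ↦ ?_
      simp only
      refine pow_le_pow_left' ?_ 2
      rw [← sub_one_mul, enorm_mul]
      refine mul_le_of_le_one_left zero_le ?_
      rw [← ofReal_norm, ENNReal.ofReal_le_one, hg]
      simp only
      rw [← Complex.ofReal_one, ← Complex.ofReal_sub, Complex.norm_real, Real.norm_eq_abs, abs_le]
      have h1 := Real.exp_pos (-(δ n * symb ξ))
      have h2 : Real.exp (-(δ n * symb ξ)) ≤ 1 := by
        rw [Real.exp_le_one_iff]; have := mul_nonneg (hδ0 n).le (symb_nonneg ξ); linarith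
      constructor <;> linarith
    · refine Eventually.of_forall fun ξ ↦ ?_
      have h1 : Tendsto (fun n ↦ g n ξ) atTop (𝓝 1) := by
        have h2 : Tendsto (fun n ↦ -(δ n * symb ξ)) atTop (𝓝 0) := by
          simpa using (hδlim.mul_const (symb ξ)).neg
        have h3 := (Real.continuous_exp.tendsto 0).comp h2
        rw [Real.exp_zero] at h3
        have h4 := (Complex.continuous_ofReal.tendsto 1).comp h3
        rwa [Complex.ofReal_one] at h4
      have h2 : Tendsto (fun n ↦ ‖g n ξ * m ξ - m ξ‖) atTop (𝓝 0) := by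
        have := ((h1.mul_const (m ξ)).sub_const (m ξ)).norm
        simpa using this
      have h3 := (ENNReal.continuous_ofReal.tendsto 0).comp h2
      have h4 := (ENNReal.continuous_pow 2).tendsto _ |>.comp h3
      simpa [Function.comp_def, ofReal_norm] using h4
  · have hF : ∀ n, 𝓕⁻ (fun ξ ↦ g n ξ * m ξ) x = ∫ a, heat (δ n + z a) ‖x - y‖ * w a ∂μ := by
      intro n
      have e1 : ∀ ξ : Plane, Complex.exp (↑(2 * Real.pi * inner ℝ ξ x) * Complex.I) • (g n ξ * m ξ) =
          ∫ a, (Complex.exp (↑(2 * Real.pi * inner ℝ ξ x) * Complex.I) * (wave y ξ *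
            Complex.exp (-(δ n + z a) * symb ξ))) * w a ∂μ := by
        intro ξ
        rw [hmdef]
        simp only [smul_eq_mul]
        rw [← integral_const_mul, ← integral_const_mul, ← integral_const_mul]
        refine integral_congr_ae (Eventually.of_forall fun a ↦ ?_)
        simp only [hg]
        rw [show -((δ n : ℂ) + z a) * symb ξ = ((-(δ n * symb ξ) : ℝ) : ℂ) + -(z a) * symb ξ by
          push_cast; ring, Complex.exp_add, ← Complex.ofReal_exp]
        ring
      rw [Real.fourierInv_eq', funext e1, integral_integral_swap]
      · refine integral_congr_ae ?_
        filter_upwards [hzc] with a ha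
        rw [integral_mul_const, ← fourierInv_wave_mul_gaussian y x, Real.fourierInv_eq']
        · rfl
        · rw [Complex.add_re, Complex.ofReal_re]; linarith [hδ0 n, ha.1]
      · have h1 : Integrable (fun p : Plane × α ↦ g n p.1 * w p.2) (volume.prod μ) := (hgi n).mul_prod hw
        have hk : Measurable fun p : Plane × α ↦ Complex.exp (↑(2 * Real.pi * inner ℝ p.1 x) * Complex.I) *
            (wave y p.1 * Complex.exp (-(z p.2) * symb p.1)) := by
          have a1 : Continuous fun ξ : Plane ↦ Complex.exp (↑(2 * Real.pi * inner ℝ ξ x) * Complex.I) *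
            wave y ξ := by fun_prop
          have a2 : Measurable fun p : Plane × α ↦ Complex.exp (-(z p.2) * symb p.1) := by
            have := continuous_symb.measurable
            fun_prop
          have e2 : (fun p : Plane × α ↦ Complex.exp (↑(2 * Real.pi * inner ℝ p.1 x) * Complex.I) *
              (wave y p.1 * Complex.exp (-(z p.2) * symb p.1))) = fun p ↦
              (Complex.exp (↑(2 * Real.pi * inner ℝ p.1 x) * Complex.I) * wave y p.1) *
                Complex.exp (-(z p.2) * symb p.1) := funext fun p ↦ by ring
          rw [e2]
          exact (a1.measurable.comp measurable_fst).mul a2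
        have h2 := h1.bdd_mul (c := 1) hk.aestronglyMeasurable ?_
        · refine h2.congr (Eventually.of_forall fun p ↦ ?_)
          simp only [Function.uncurry, hg]
          rw [show -((δ n : ℂ) + z p.2) * symb p.1 =
            ((-(δ n * symb p.1) : ℝ) : ℂ) + -(z p.2) * symb p.1 by
            push_cast; ring, Complex.exp_add, ← Complex.ofReal_exp]
          ring
        · have h3 : ∀ᵐ p ∂((volume : Measure Plane).prod μ),
              ∀ ξ : Plane, ‖Complex.exp (-(z p.2) * symb ξ)‖ ≤ 1 :=
            Measure.quasiMeasurePreserving_snd.ae hexp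
          filter_upwards [h3] with p hp
          rw [norm_mul, norm_mul, norm_wave, Complex.norm_exp_ofReal_mul_I, one_mul, one_mul]
          exact hp p.1
    simp only [hF]
    refine tendsto_integral_of_dominated_convergence (fun a ↦ 1 / (4 * Real.pi * c) * ‖w a‖)
      (fun n ↦ ?_) (hw.norm.const_mul _) (fun n ↦ ?_) ?_
    · exact (measurable_heat.comp ((hz.const_add _).prodMk measurable_const)).aestronglyMeasurable.mul hw.1
    · filter_upwards [hzc] with a ha
      rw [norm_mul]
      refine mul_le_mul_of_nonneg_right (norm_heat_le hc ?_ ?_ _) (norm_nonneg _)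
      · rw [Complex.add_re, Complex.ofReal_re]; linarith [hδ0 n, ha.1]
      · exact ha.2.trans (norm_le_norm_add ha.1 (hδ0 n).le)
    · filter_upwards [hzc] with a ha
      have hz0 : z a ≠ 0 := by intro h; rw [h, norm_zero] at ha; linarith [ha.2]
      refine Tendsto.mul_const _ ?_
      refine tendsto_heat hz0 ?_ ‖x - y‖
      have := ((Complex.continuous_ofReal.tendsto 0).comp hδlim).add_const (z a)
      rwa [Complex.ofReal_zero, zero_add] at this


/-! ### The free evolution in position space -/

theorem fourier_add_smul (f g : L2) (c : ℂ) : (𝓕 (f + c • g) : L2) = 𝓕 f + c • 𝓕 g := by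
  rw [FourierTransform.fourier_add, FourierTransform.fourier_smul]

theorem U₀_add_smul (t : ℝ) (f g : L2) (c : ℂ) : U₀ t (f + c • g) = U₀ t f + c • U₀ t g := by
  refine L2.ext_fourier ?_
  rw [fourier_add_smul]
  have h := fourier_U₀ t (f + c • g)
  rw [fourier_add_smul] at h
  filter_upwards [h, fourier_U₀ t f, fourier_U₀ t g, Lp.coeFn_add (𝓕 f : L2) (c • 𝓕 g),
    Lp.coeFn_smul c (𝓕 g : L2), Lp.coeFn_add (𝓕 (U₀ t f) : L2) (c • 𝓕 (U₀ t g)),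
    Lp.coeFn_smul c (𝓕 (U₀ t g) : L2)] with ξ h1 h2 h3 h4 h5 h6 h7
  rw [h1, h6, h4]
  simp only [Pi.add_apply, h5, h7, Pi.smul_apply, h2, h3, smul_eq_mul]
  ring

/-- Continuous functions equal almost everywhere coincide, so the choice made in `valueAt` is
immaterial. -/
theorem valueAt_eq {f : L2} {g : Plane → ℂ} (hg : Continuous g) (h : f =ᵐ[volume] g) (y : Plane) :
    valueAt f y = g y := by
  have hex : ∃ g : Plane → ℂ, Continuous g ∧ f =ᵐ[volume] g := ⟨g, hg, h⟩
  rw [valueAt, dif_pos hex]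
  have := (Continuous.ae_eq_iff_eq volume hex.choose_spec.1 hg).1
    (hex.choose_spec.2.symm.trans h)
  rw [this]

/-- Divide by a weight that is at least `1` and rescale `p = 2πξ`. Integrability of the transform
gives the free evolution of the regular part a continuous representative and an absolutely
convergent value at `y`. -/
theorem FormDomain.IsAdmissible.integrable_fourier {y : Plane} {lam : ℝ} {hlam : 0 < lam}
    {ψ : FormDomain y hlam} (h : ψ.IsAdmissible) : Integrable (𝓕 ψ.reg : L2) volume := by
  obtain ⟨ε, hε, hi⟩ := h
  have hpi : (2 * Real.pi : ℝ)⁻¹ ≠ 0 := by positivity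
  have hpos : ∀ p : Plane, 1 ≤ 1 + ‖p‖ ^ ε := fun p ↦ by
    have := Real.rpow_nonneg (norm_nonneg p) ε; linarith
  have h1 : Integrable (fun p : Plane ↦ hat ψ.reg p) := by
    have hc : Continuous fun p : Plane ↦ (((1 + ‖p‖ ^ ε : ℝ)⁻¹ : ℝ) : ℂ) := by
      refine Complex.continuous_ofReal.comp (Continuous.inv₀ ?_ fun p ↦ by have := hpos p; positivity)
      exact continuous_const.add (continuous_norm.rpow_const fun _ ↦ Or.inr hε.le)
    refine (hi.bdd_mul (c := 1) hc.aestronglyMeasurable (Eventually.of_forall fun p ↦ ?_)).congr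
      (Eventually.of_forall fun p ↦ ?_)
    · rw [Complex.norm_real, Real.norm_of_nonneg (inv_nonneg.2 (by linarith [hpos p]))]
      exact inv_le_one_of_one_le₀ (hpos p)
    · have hne : ((1 + ‖p‖ ^ ε : ℝ) : ℂ) ≠ 0 := by
        exact_mod_cast (zero_lt_one.trans_le (hpos p)).ne'
      simp only
      rw [← mul_assoc, Complex.ofReal_inv, inv_mul_cancel₀ hne, one_mul]
  have h2 : Integrable (fun p : Plane ↦ (𝓕 ψ.reg : L2) ((2 * Real.pi : ℝ)⁻¹ • p)) := by
    have := h1.const_mul (2 * Real.pi : ℂ)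
    refine this.congr (Eventually.of_forall fun p ↦ ?_)
    have hne : (2 * Real.pi : ℂ) ≠ 0 := by
      have := Real.pi_ne_zero
      exact mul_ne_zero two_ne_zero (by exact_mod_cast this)
    simp only [hat]
    rw [← mul_assoc, mul_inv_cancel₀ hne, one_mul]
  exact (integrable_comp_smul_iff volume (fun p ↦ (𝓕 ψ.reg : L2) p) hpi).1 h2

theorem lintegral_symb_fourier_lt_top {f : L2} {g : Fin 2 → L2} (h : IsWeakGradient f g) :
    ∫⁻ ξ, ENNReal.ofReal (symb ξ) * ‖(𝓕 f : L2) ξ‖ₑ ^ 2 < ∞ := by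
  rw [isWeakGradient_iff] at h
  have e : ∫⁻ ξ, ENNReal.ofReal (symb ξ) * ‖(𝓕 f : L2) ξ‖ₑ ^ 2 =
      ∫⁻ ξ, ∑ j, ‖(𝓕 (g j) : L2) ξ‖ₑ ^ 2 := by
    refine lintegral_congr_ae ?_
    filter_upwards [h 0, h 1] with ξ h0 h1
    rw [Fin.sum_univ_two, h0, h1, enorm_mul _ ((𝓕 f : L2) ξ), enorm_mul _ ((𝓕 f : L2) ξ), mul_pow, mul_pow,
      ← add_mul]
    congr 1
    have hn : ∀ a : ℝ, ‖(2 * Real.pi * Complex.I * (a : ℂ) : ℂ)‖ₑ ^ 2 =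
        ENNReal.ofReal ((2 * Real.pi * a) ^ 2) := by
      intro a
      rw [← ofReal_norm, ← ENNReal.ofReal_pow (norm_nonneg _)]
      congr 1
      rw [norm_mul, norm_mul, norm_mul, Complex.norm_I, Complex.norm_real, Complex.norm_real,
        Real.norm_of_nonneg Real.pi_pos.le]
      simp only [Complex.norm_ofNat, Real.norm_eq_abs, mul_pow, sq_abs]
      ring
    rw [hn, hn, ← ENNReal.ofReal_add (by positivity) (by positivity), symb]
    congr 1
    rw [mul_pow, EuclideanSpace.norm_sq_eq, Fin.sum_univ_two]
    simp only [Real.norm_eq_abs, sq_abs]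
    ring
  rw [e, lintegral_finsetSum' _ fun j _ ↦ ((Lp.aestronglyMeasurable _).enorm.pow_const 2)]
  refine ENNReal.sum_lt_top.2 fun j _ ↦ ?_
  rw [← eLpNorm_two_sq]
  exact ENNReal.pow_lt_top (Lp.memLp (𝓕 (g j) : L2)).eLpNorm_lt_top

theorem exists_rep_U₀_of_integrable {f : L2} (hf : Integrable (𝓕 f : L2) volume) (t : ℝ) (y : Plane) :
    ∃ g : Plane → ℂ, Continuous g ∧ U₀ t f =ᵐ[volume] g ∧
      g y = specTrace (fun ξ ↦ starRingEnd ℂ (wave y ξ) * (𝓕 f : L2) ξ) t := by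
  have hi := integrable_phase_mul hf t
  refine ⟨_, ?_, fourierInv_toLp_ae_eq hi (memLp_phase_mul t (𝓕 f)), ?_⟩
  · have h1 : Continuous (𝓕 (fun ξ ↦ phase t (symb ξ) * (𝓕 f : L2) ξ)) :=
      VectorFourier.fourierIntegral_continuous Real.continuous_fourierChar
        (by simpa using continuous_inner) hi
    have h2 : (𝓕⁻ (fun ξ ↦ phase t (symb ξ) * (𝓕 f : L2) ξ) : Plane → ℂ) =
        fun x ↦ 𝓕 (fun ξ ↦ phase t (symb ξ) * (𝓕 f : L2) ξ) (-x) := by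
      funext x; rw [Real.fourierInv_eq_fourier_neg]
    exact h2 ▸ h1.comp continuous_neg
  · rw [Real.fourierInv_eq', specTrace]
    refine integral_congr_ae (Eventually.of_forall fun ξ ↦ ?_)
    have : Complex.exp (↑(2 * Real.pi * inner ℝ ξ y) * Complex.I) = starRingEnd ℂ (wave y ξ) := by
      rw [wave, ← Complex.exp_conj]
      congr 1
      rw [map_mul, map_neg, Complex.conj_I, neg_neg, Complex.conj_ofReal, mul_comm]
    simp only [smul_eq_mul]
    rw [this]
    change _ * (phase t (symb ξ) * _) = _
    ring

/-- As `1/(|p|² + λ) = ∫₀^∞ e^{-s(|p|² + λ)} ds`, the evolved Green function superposes heat kernels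
at the complex times `s + it`. These stay at distance at least `t` from `0`, hence continuity for `t
> 0`; at the centre each kernel is `1/(4π(s + it))`, the kernel of `greenTrace`. -/
theorem exists_rep_U₀_green (y : Plane) {lam : ℝ} (hlam : 0 < lam) {t : ℝ} (ht : 0 < t) :
    ∃ g : Plane → ℂ, Continuous g ∧ U₀ t (green y hlam) =ᵐ[volume] g ∧
      g y = greenTrace lam t / (4 * Real.pi) := by
  set μ := (volume : Measure ℝ).restrict (Ioi 0) with hμ
  set z : ℝ → ℂ := fun s ↦ s + Complex.I * t with hz
  set w : ℝ → ℂ := fun s ↦ Real.exp (-(lam * s)) with hw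
  have hzm : Measurable z := by fun_prop
  have hwi : Integrable w μ := by
    have := integrableOn_exp_mul_Ioi (a := -lam) (by linarith) 0
    have h2 := this.ofReal (𝕜 := ℂ)
    refine h2.congr (Eventually.of_forall fun s ↦ ?_)
    simp [hw]
  have hzc : ∀ᵐ s ∂μ, 0 ≤ (z s).re ∧ t ≤ ‖z s‖ := by
    filter_upwards [ae_restrict_mem measurableSet_Ioi] with s hs
    have h1 : (z s).re = s := by simp [hz]
    have h2 : (z s).im = t := by simp [hz]
    refine ⟨by rw [h1]; exact (mem_Ioi.1 hs).le, ?_⟩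
    have := Complex.abs_im_le_norm (z s)
    rw [h2] at this
    exact (le_abs_self t).trans this
  have hint : ∀ ξ : Plane, ∫ s, Complex.exp (-(z s) * symb ξ) * w s ∂μ =
      phase t (symb ξ) / ((symb ξ + lam : ℝ) : ℂ) := by
    intro ξ
    have hp : 0 < symb ξ + lam := add_pos_of_nonneg_of_pos (symb_nonneg ξ) hlam
    have e : ∀ s : ℝ, Complex.exp (-(z s) * symb ξ) * w s =
        phase t (symb ξ) * Complex.exp (((-(symb ξ + lam) : ℝ) : ℂ) * s) := by
      intro s
      simp only [hz, hw, phase, Complex.ofReal_exp]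
      rw [← Complex.exp_add, ← Complex.exp_add]
      congr 1
      push_cast
      ring
    simp only [e]
    rw [integral_const_mul, hμ, integral_exp_mul_complex_Ioi (by rw [Complex.ofReal_re]; linarith)]
    push_cast
    rw [mul_zero, Complex.exp_zero, neg_div_neg_eq, mul_one_div]
  have hm : MemLp (fun ξ : Plane ↦ wave y ξ * ∫ s, Complex.exp (-(z s) * symb ξ) * w s ∂μ) 2 volume := by
    have h1 := memLp_phase_mul t (𝓕 (green y hlam))
    refine (memLp_congr_ae ?_).1 h1
    filter_upwards [fourier_green y hlam] with ξ hξ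
    rw [hint, hξ]
    change phase t (symb ξ) * _ = _
    ring
  have hU : U₀ t (green y hlam) = 𝓕⁻ (hm.toLp _) := by
    refine L2.ext_fourier ?_
    rw [FourierTransform.fourier_fourierInv_eq]
    filter_upwards [fourier_U₀ t (green y hlam), fourier_green y hlam, hm.coeFn_toLp] with ξ h1 h2 h3
    rw [h1, h2, h3, hint]
    ring
  refine ⟨_, continuous_integral_heat hzm hwi ht hzc y, ?_, ?_⟩
  · rw [hU]
    exact fourierInv_wave_integral hzm hwi ht hzc hm
  · rw [greenTrace, ← integral_div]
    refine integral_congr_ae (Eventually.of_forall fun s ↦ ?_)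
    simp only [hz, hw, heat, greenTraceKer, sub_self, norm_zero]
    simp
    ring

/-- The symbol of the source generated by the regular part of the datum. -/
def sourceSymb {y : Plane} {lam : ℝ} {hlam : 0 < lam} (ψ : FormDomain y hlam) (ξ : Plane) : ℂ :=
  starRingEnd ℂ (wave y ξ) * (𝓕 ψ.reg : L2) ξ

theorem exists_rep_U₀ {y : Plane} {lam : ℝ} {hlam : 0 < lam} {ψ : FormDomain y hlam}
    (h : ψ.IsAdmissible) {t : ℝ} (ht : 0 < t) :
    ∃ g : Plane → ℂ, Continuous g ∧ U₀ t ψ.toL2 =ᵐ[volume] g ∧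
      g y = specTrace (sourceSymb ψ) t + ψ.charge / (4 * Real.pi) * greenTrace lam t := by
  obtain ⟨g₁, c₁, e₁, v₁⟩ := exists_rep_U₀_of_integrable h.integrable_fourier t y
  obtain ⟨g₂, c₂, e₂, v₂⟩ := exists_rep_U₀_green y hlam ht
  refine ⟨fun x ↦ g₁ x + ψ.charge * g₂ x, by fun_prop, ?_, ?_⟩
  · rw [FormDomain.toL2, U₀_add_smul]
    filter_upwards [e₁, e₂, Lp.coeFn_add (U₀ t ψ.reg) (ψ.charge • U₀ t (green y hlam)),
      Lp.coeFn_smul ψ.charge (U₀ t (green y hlam))] with x h1 h2 h3 h4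
    rw [h3, Pi.add_apply, h4, Pi.smul_apply, h1, h2, smul_eq_mul]
  · simp only [v₁, v₂]
    have : specTrace (fun ξ ↦ starRingEnd ℂ (wave y ξ) * (𝓕 ψ.reg : L2) ξ) t =
      specTrace (sourceSymb ψ) t := rfl
    rw [this]
    ring

theorem integrable_sourceSymb {y : Plane} {lam : ℝ} {hlam : 0 < lam} {ψ : FormDomain y hlam}
    (h : ψ.IsAdmissible) : Integrable (sourceSymb ψ) :=
  h.integrable_fourier.bdd_mul (c := 1)
    (Complex.continuous_conj.comp (continuous_wave y)).aestronglyMeasurable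
    (Eventually.of_forall fun ξ ↦ by simp)

theorem lintegral_symb_sourceSymb_lt_top {y : Plane} {lam : ℝ} {hlam : 0 < lam}
    (ψ : FormDomain y hlam) : ∫⁻ ξ, ENNReal.ofReal (symb ξ) * ‖sourceSymb ψ ξ‖ₑ ^ 2 < ∞ := by
  refine lt_of_le_of_lt (le_of_eq ?_) (lintegral_symb_fourier_lt_top ψ.isWeakGradient)
  refine lintegral_congr fun ξ ↦ ?_
  rw [sourceSymb, enorm_mul, ← ofReal_norm (starRingEnd ℂ (wave y ξ))]
  simp

/-! ### The Duhamel term in position space -/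

theorem lintegral_enorm_sq_fourier (f : L2) :
    ∫⁻ ξ, ‖(𝓕 f : L2) ξ‖ₑ ^ 2 = ∫⁻ x, ‖f x‖ₑ ^ 2 := by
  rw [← eLpNorm_two_sq, ← eLpNorm_two_sq]
  congr 1
  have h := Lp.norm_fourier_eq f
  rw [Lp.norm_def, Lp.norm_def] at h
  exact (ENNReal.toReal_eq_toReal_iff' (Lp.eLpNorm_ne_top _) (Lp.eLpNorm_ne_top _)).1 h

/-- In the radial variable `ω = |p|²` the plane norm is a half-line norm, and Plancherel in time
bounds it by `∫ |q|²`. A point source thus produces an `L²` function although the kernel is not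
absolutely integrable at `τ = t`, and the bound vanishes with the length of the interval. -/
theorem lintegral_wave_osc_le {q : ℝ → ℂ} {B : ℝ} (hq : Measurable q) (hB : ∀ τ, ‖q τ‖ ≤ B)
    (y : Plane) (t : ℝ) {a b : ℝ} (hab : a ≤ b) :
    MemLp (fun ξ : Plane ↦ wave y ξ * (Complex.I * ∫ τ in a..b, phase (t - τ) (symb ξ) * q τ)) 2
      volume ∧
    ∫⁻ ξ : Plane, ‖wave y ξ * (Complex.I * ∫ τ in a..b, phase (t - τ) (symb ξ) * q τ)‖ₑ ^ 2 ≤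
      ENNReal.ofReal (B ^ 2 * (b - a)) := by
  have hB0 : 0 ≤ B := (norm_nonneg _).trans (hB 0)
  have hqB : ∫⁻ τ in Ioc a b, ‖q τ‖ₑ ^ 2 ≤ ENNReal.ofReal (B ^ 2 * (b - a)) := by
    calc _ ≤ ∫⁻ _ in Ioc a b, ENNReal.ofReal (B ^ 2) := by
          refine lintegral_mono fun τ ↦ ?_
          rw [← ofReal_norm, ← ENNReal.ofReal_pow (norm_nonneg _)]
          exact ENNReal.ofReal_le_ofReal (pow_le_pow_left₀ (norm_nonneg _) (hB τ) 2)
      _ = _ := by rw [setLIntegral_const, Real.volume_Ioc, ← ENNReal.ofReal_mul (by positivity)]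
  set u : ℝ → ℂ := fun s ↦ (Ioc a b).indicator q (-s) with hu
  have hi0 : Integrable ((Ioc a b).indicator q) :=
    (integrable_indicator_iff measurableSet_Ioc).2
      ((integrableOn_const (C := B) measure_Ioc_lt_top.ne).mono' hq.aestronglyMeasurable
        (Eventually.of_forall hB))
  have hui : Integrable u := hi0.comp_neg
  have hun : ∫⁻ s, ‖u s‖ₑ ^ 2 = ∫⁻ τ in Ioc a b, ‖q τ‖ₑ ^ 2 := by
    rw [← lintegral_indicator measurableSet_Ioc]
    have := lintegral_sub_left_eq_self (μ := (volume : Measure ℝ)) (fun τ ↦ ‖(Ioc a b).indicator q τ‖ₑ ^ 2) 0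
    simp only [zero_sub] at this
    rw [hu]
    simp only
    rw [this]
    refine lintegral_congr fun s ↦ ?_
    by_cases hs : s ∈ Ioc a b
    · rw [indicator_of_mem hs, indicator_of_mem hs]
    · rw [indicator_of_notMem hs, indicator_of_notMem hs]; simp
  have hfin : ∫⁻ τ in Ioc a b, ‖q τ‖ₑ ^ 2 < ∞ := hqB.trans_lt ENNReal.ofReal_lt_top
  have hu2 : MemLp u 2 := by
    refine ⟨hui.1, ?_⟩
    have h1 := eLpNorm_two_sq (μ := volume) u
    rw [hun] at h1
    by_contra h
    rw [not_lt, top_le_iff] at h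
    rw [h] at h1
    exact hfin.ne (by rw [← h1]; simp)
  have hW : ∀ ω, ∫ τ in a..b, phase (t - τ) ω * q τ = phase t ω * ∫ s, phase s ω * u s := by
    intro ω
    rw [intervalIntegral.integral_of_le hab, ← integral_const_mul,
      ← integral_indicator measurableSet_Ioc,
      ← integral_neg_eq_self (fun s ↦ phase t ω * (phase s ω * u s))]
    refine integral_congr_ae (Eventually.of_forall fun τ ↦ ?_)
    simp only [hu, neg_neg]
    by_cases hs : τ ∈ Ioc a b
    · rw [indicator_of_mem hs, indicator_of_mem hs, sub_eq_add_neg, phase_add]; ring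
    · rw [indicator_of_notMem hs, indicator_of_notMem hs]; ring
  have hc : Continuous fun ω ↦ ∫ τ in a..b, phase (t - τ) ω * q τ := by
    refine intervalIntegral.continuous_of_dominated_interval (bound := fun _ ↦ B) (fun ω ↦ ?_)
      (fun ω ↦ Eventually.of_forall fun τ _ ↦ ?_) intervalIntegrable_const
      (Eventually.of_forall fun τ _ ↦ by fun_prop)
    · have : Continuous fun τ ↦ phase (t - τ) ω := by fun_prop
      exact this.aestronglyMeasurable.mul hq.aestronglyMeasurable
    · rw [norm_mul, norm_phase, one_mul]; exact hB τ
  have hbound : ∫⁻ ξ : Plane, ‖wave y ξ * (Complex.I * ∫ τ in a..b, phase (t - τ) (symb ξ) * q τ)‖ₑ ^ 2 ≤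
      ∫⁻ τ in Ioc a b, ‖q τ‖ₑ ^ 2 := by
    have e : ∀ ξ : Plane, ‖wave y ξ * (Complex.I * ∫ τ in a..b, phase (t - τ) (symb ξ) * q τ)‖ₑ ^ 2 =
        ‖∫ τ in a..b, phase (t - τ) (symb ξ) * q τ‖ₑ ^ 2 := fun ξ ↦ by
      rw [← ofReal_norm, norm_mul, norm_mul, norm_wave, Complex.norm_I, one_mul, one_mul, ofReal_norm]
    simp only [e]
    rw [lintegral_comp_symb (F := fun ω ↦ ‖∫ τ in a..b, phase (t - τ) ω * q τ‖ₑ ^ 2)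
      (hc.measurable.enorm.pow_const 2)]
    have h1 : ∫⁻ ω in Ioi (0 : ℝ), ‖∫ τ in a..b, phase (t - τ) ω * q τ‖ₑ ^ 2 ≤
        ENNReal.ofReal (2 * Real.pi) * ∫⁻ τ in Ioc a b, ‖q τ‖ₑ ^ 2 := by
      rw [← hun, ← lintegral_integral_phase_sq hui hu2]
      refine (setLIntegral_le_lintegral _ _).trans (le_of_eq ?_)
      refine lintegral_congr fun ω ↦ ?_
      rw [hW, ← ofReal_norm, norm_mul, norm_phase, one_mul, ofReal_norm]
    refine (mul_le_mul_right h1 _).trans ?_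
    rw [← mul_assoc, ← ENNReal.ofReal_mul (by positivity)]
    refine mul_le_of_le_one_left zero_le ?_
    rw [ENNReal.ofReal_le_one]
    have := Real.pi_pos
    rw [show 1 / (4 * Real.pi) * (2 * Real.pi) = 1 / 2 by field_simp; norm_num]
    norm_num
  refine ⟨⟨?_, ?_⟩, hbound.trans hqB⟩
  · have := hc.comp continuous_symb
    exact ((continuous_wave y).mul (continuous_const.mul this)).aestronglyMeasurable
  · have h1 := hbound.trans_lt hfin
    rw [← eLpNorm_two_sq] at h1
    by_contra h
    rw [not_lt, top_le_iff] at h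
    rw [h] at h1
    simp at h1

theorem heat_I_mul (s r : ℝ) : heat (Complex.I * s) r = freeKernel s r / (2 * Real.pi) := by
  rw [heat, freeKernel, div_div]
  congr 1
  · congr 1; ring
  · ring

/-- Up to time `t - ε` the kernels are bounded and the superposition formula identifies the
truncated integral. The discarded frequency profile over `[t - ε, t]` has squared norm at most `B²
ε`. -/
theorem isAnsatz_of_fourier {y : Plane} {ψ₀ f : L2} {q : ℝ → ℂ} {B : ℝ} (hq : Continuous q)
    (hB : ∀ τ, ‖q τ‖ ≤ B) {t : ℝ} (ht : 0 ≤ t) (hf : (𝓕 f : L2) =ᵐ[volume] fun ξ ↦ phase t (symb ξ) * (𝓕 ψ₀ : L2) ξ +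
      wave y ξ * (Complex.I * osc q t (symb ξ))) : IsAnsatz y ψ₀ q t f := by
  rw [IsAnsatz]
  rcases eq_or_lt_of_le ht with rfl | ht
  · have hfU : f = U₀ 0 ψ₀ := by
      refine L2.ext_fourier ?_
      filter_upwards [hf, fourier_U₀ 0 ψ₀] with ξ h1 h2
      rw [h1, h2, osc, intervalIntegral.integral_same, mul_zero, mul_zero, add_zero]
    refine tendsto_nhds_of_eventually_eq ?_
    filter_upwards [self_mem_nhdsWithin] with ε hε
    have h0 : (fun x : Plane ↦ f x - ((U₀ 0 ψ₀ : L2) x + Complex.I / (2 * Real.pi) *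
        ∫ τ in Icc 0 (0 - ε), freeKernel (0 - τ) ‖x - y‖ * q τ)) = fun _ ↦ 0 := by
      funext x
      rw [Icc_eq_empty (by have := mem_Ioi.1 hε; linarith), hfU]; simp
    rw [h0]; simp
  refine tendsto_eLpNorm_two_zero ?_
  have hlim : Tendsto (fun ε : ℝ ↦ ENNReal.ofReal (B ^ 2 * ε)) (𝓝[>] 0) (𝓝 0) := by
    have : Continuous fun ε : ℝ ↦ ENNReal.ofReal (B ^ 2 * ε) :=
      ENNReal.continuous_ofReal.comp (by fun_prop)
    simpa using (this.tendsto 0).mono_left nhdsWithin_le_nhds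
  refine tendsto_of_tendsto_of_tendsto_of_le_of_le' tendsto_const_nhds hlim
    (Eventually.of_forall fun _ ↦ zero_le) ?_
  filter_upwards [Ioo_mem_nhdsGT ht] with ε hε
  have hε0 := hε.1
  set μ := (volume : Measure ℝ).restrict (Icc 0 (t - ε)) with hμ
  set z : ℝ → ℂ := fun τ ↦ Complex.I * ((t - τ : ℝ) : ℂ) with hz
  set w : ℝ → ℂ := fun τ ↦ Complex.I * q τ with hw
  have hzm : Measurable z := by fun_prop
  have hwi : Integrable w μ := (show Continuous w by fun_prop).integrableOn_Icc
  have hzc : ∀ᵐ τ ∂μ, 0 ≤ (z τ).re ∧ ε ≤ ‖z τ‖ := by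
    filter_upwards [ae_restrict_mem measurableSet_Icc] with τ hτ
    refine ⟨by simp [hz], ?_⟩
    rw [hz]
    simp only
    rw [norm_mul, Complex.norm_I, one_mul, Complex.norm_real]
    exact le_trans (by linarith [hτ.2]) (le_abs_self (t - τ))
  have hint : ∀ ξ : Plane, ∫ τ, Complex.exp (-(z τ) * symb ξ) * w τ ∂μ =
      Complex.I * ∫ τ in (0 : ℝ)..(t - ε), phase (t - τ) (symb ξ) * q τ := by
    intro ξ
    rw [intervalIntegral.integral_of_le (by linarith [hε.2]), hμ, integral_Icc_eq_integral_Ioc,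
      ← integral_const_mul]
    refine integral_congr_ae (Eventually.of_forall fun τ ↦ ?_)
    simp only [hz, hw, phase]
    rw [show -(Complex.I * ((t - τ : ℝ) : ℂ)) * symb ξ = -Complex.I * (((t - τ) * symb ξ : ℝ) : ℂ) by
      push_cast; ring]
    ring
  have hm : MemLp (fun ξ : Plane ↦ wave y ξ * ∫ τ, Complex.exp (-(z τ) * symb ξ) * w τ ∂μ) 2 volume := by
    simp only [hint]
    exact (lintegral_wave_osc_le hq.measurable hB y t (by linarith [hε.2])).1
  set N : L2 := 𝓕⁻ (hm.toLp _) with hN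
  have hNrep := fourierInv_wave_integral hzm hwi hε0 hzc hm
  set R : L2 := f + (-1 : ℂ) • (U₀ t ψ₀ + (1 : ℂ) • N) with hR
  have e1 : ∫⁻ x : Plane, ‖f x - ((U₀ t ψ₀ : L2) x + Complex.I / (2 * Real.pi) *
      ∫ τ in Icc 0 (t - ε), freeKernel (t - τ) ‖x - y‖ * q τ)‖ₑ ^ 2 = ∫⁻ x, ‖R x‖ₑ ^ 2 := by
    refine lintegral_congr_ae ?_
    filter_upwards [hNrep, Lp.coeFn_add f ((-1 : ℂ) • (U₀ t ψ₀ + (1 : ℂ) • N)),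
      Lp.coeFn_smul (-1 : ℂ) (U₀ t ψ₀ + (1 : ℂ) • N), Lp.coeFn_add (U₀ t ψ₀) ((1 : ℂ) • N)] with x h1 h2 h3 h4
    rw [hR, h2, Pi.add_apply, h3, Pi.smul_apply, h4, Pi.add_apply, one_smul, hN, h1]
    have : ∫ τ, heat (z τ) ‖x - y‖ * w τ ∂μ = Complex.I / (2 * Real.pi) *
      ∫ τ in Icc 0 (t - ε), freeKernel (t - τ) ‖x - y‖ * q τ := by
      rw [← integral_const_mul]
      refine integral_congr_ae (Eventually.of_forall fun τ ↦ ?_)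
      simp only [hz, hw, heat_I_mul]
      ring
    rw [this, neg_one_smul, sub_eq_add_neg]
  have e2 : (𝓕 R : L2) =ᵐ[volume] fun ξ ↦ wave y ξ * (Complex.I *
      ∫ τ in (t - ε)..t, phase (t - τ) (symb ξ) * q τ) := by
    rw [hR, fourier_add_smul, fourier_add_smul, hN, FourierTransform.fourier_fourierInv_eq]
    filter_upwards [hf, hm.coeFn_toLp, fourier_U₀ t ψ₀,
      Lp.coeFn_add (𝓕 f : L2) ((-1 : ℂ) • (𝓕 (U₀ t ψ₀) + (1 : ℂ) • hm.toLp _)),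
      Lp.coeFn_smul (-1 : ℂ) ((𝓕 (U₀ t ψ₀) : L2) + (1 : ℂ) • hm.toLp _),
      Lp.coeFn_add (𝓕 (U₀ t ψ₀) : L2) ((1 : ℂ) • hm.toLp _)] with ξ h1 h2 h3 h4 h5 h6
    rw [h4, Pi.add_apply, h5, Pi.smul_apply, h6, Pi.add_apply, one_smul, h2, hint, h1, h3, osc]
    have hcont : Continuous fun τ ↦ phase (t - τ) (symb ξ) * q τ := by fun_prop
    rw [← intervalIntegral.integral_add_adjacent_intervals (b := t - ε)
      (hcont.intervalIntegrable 0 (t - ε)) (hcont.intervalIntegrable _ _), smul_eq_mul]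
    ring
  rw [e1, ← lintegral_enorm_sq_fourier]
  refine (le_of_eq (lintegral_congr_ae (e2.fun_comp fun c ↦ ‖c‖ₑ ^ 2))).trans ?_
  refine (lintegral_wave_osc_le hq.measurable hB y t (by linarith : t - ε ≤ t)).2.trans_eq ?_
  rw [sub_sub_cancel]


/-! ### The Duhamel formula on the Fourier side -/

theorem measurable_osc {q : ℝ → ℂ} (hq : Measurable q) : Measurable fun p : ℝ × ℝ ↦ osc q p.1 p.2 := by
  have e : (fun p : ℝ × ℝ ↦ osc q p.1 p.2) = fun p ↦
      (∫ τ, {x : (ℝ × ℝ) × ℝ | 0 < x.2 ∧ x.2 ≤ x.1.1}.indicator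
        (fun x ↦ phase (x.1.1 - x.2) x.1.2 * q x.2) (p, τ)) -
      ∫ τ, {x : (ℝ × ℝ) × ℝ | x.1.1 < x.2 ∧ x.2 ≤ 0}.indicator
        (fun x ↦ phase (x.1.1 - x.2) x.1.2 * q x.2) (p, τ) := by
    funext p
    rw [osc, intervalIntegral, ← integral_indicator measurableSet_Ioc,
      ← integral_indicator measurableSet_Ioc]
    rfl
  have hf : Measurable fun x : (ℝ × ℝ) × ℝ ↦ phase (x.1.1 - x.2) x.1.2 * q x.2 := by
    have : Continuous fun x : (ℝ × ℝ) × ℝ ↦ phase (x.1.1 - x.2) x.1.2 := by fun_prop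
    exact this.measurable.mul (hq.comp measurable_snd)
  have m1 : Measurable fun x : (ℝ × ℝ) × ℝ ↦ x.1.1 := measurable_fst.comp measurable_fst
  have s1 : MeasurableSet {x : (ℝ × ℝ) × ℝ | 0 < x.2 ∧ x.2 ≤ x.1.1} :=
    (measurableSet_lt measurable_const measurable_snd).inter (measurableSet_le measurable_snd m1)
  have s2 : MeasurableSet {x : (ℝ × ℝ) × ℝ | x.1.1 < x.2 ∧ x.2 ≤ 0} :=
    (measurableSet_lt m1 measurable_snd).inter (measurableSet_le measurable_snd measurable_const)
  rw [e]
  exact ((hf.indicator s1).stronglyMeasurable.integral_prod_right').measurable.sub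
    ((hf.indicator s2).stronglyMeasurable.integral_prod_right').measurable

theorem continuous_osc_left {q : ℝ → ℂ} {B : ℝ} (hq : Measurable q) (hB : ∀ τ, ‖q τ‖ ≤ B) (ω : ℝ) :
    Continuous fun t ↦ osc q t ω := by
  simp only [osc_eq]
  refine Continuous.mul (by fun_prop) (intervalIntegral.continuous_primitive (fun a b ↦ ?_) 0)
  refine (intervalIntegrable_const (c := B)).mono_fun' ?_ (Eventually.of_forall fun τ ↦ ?_)
  · have : Continuous fun τ : ℝ ↦ phase (-τ) ω := by fun_prop
    exact (this.measurable.mul hq).aestronglyMeasurable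
  · simpa using hB τ

theorem measurable_symb_fst : Measurable fun p : Plane × ℝ ↦ symb p.1 :=
  continuous_symb.measurable.comp measurable_fst

theorem measurable_osc_symb {q : ℝ → ℂ} (hq : Measurable q) :
    Measurable fun p : Plane × ℝ ↦ osc q p.2 (symb p.1) := by
  have h := (measurable_osc hq).comp (measurable_snd.prodMk measurable_symb_fst)
  exact h

theorem bddMeas_of_measurable {q : ℝ → ℂ} {B : ℝ} (hq : Measurable q) (hB : ∀ τ, ‖q τ‖ ≤ B)
    (T : ℝ) : BddMeas q T :=
  ⟨hq.aestronglyMeasurable, B, (norm_nonneg _).trans (hB 0), fun r _ ↦ hB r⟩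

/-- This is `u' = -iωu + q` in integrated form. As `q` is merely measurable, differentiation is
replaced by associativity of convolution together with `iω (1 * e^{-iω·}) = 1 - e^{-iω·}`. -/
theorem osc_eq_integral {q : ℝ → ℂ} {B : ℝ} (hq : Measurable q) (hB : ∀ τ, ‖q τ‖ ≤ B) {t : ℝ}
    (ht : 0 ≤ t) (ω : ℝ) :
    osc q t ω = (∫ s in (0 : ℝ)..t, q s) - Complex.I * ω * ∫ s in (0 : ℝ)..t, osc q s ω := by
  have hp : Continuous fun s : ℝ ↦ phase s ω := by fun_prop
  have hqi := (bddMeas_of_measurable hq hB t).integrableOn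
  have h1 := (conv_assoc (a := fun _ ↦ 1) (b := fun s ↦ phase s ω) (g := q) (t := t) (M := t)
    measurable_const hp.measurable ht (fun u hu ↦ ⟨by
      simpa using (hp.integrableOn_Icc (a := 0) (b := u)).mono_set Ioc_subset_Icc_self, by
      simpa [hu.1.le] using hu.2⟩) hqi)
  have h2 : ∀ u, Complex.I * ω * conv (fun _ ↦ 1) (fun s ↦ phase s ω) u = 1 - phase u ω := by
    intro u
    have h3 := intervalIntegral.integral_eq_sub_of_hasDerivAt (a := 0) (b := u)
      (fun s _ ↦ hasDerivAt_phase s ω) ((by fun_prop : Continuous fun s : ℝ ↦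
        -Complex.I * ω * phase s ω).intervalIntegrable _ _)
    rw [intervalIntegral.integral_const_mul, phase_zero_left] at h3
    rw [conv_one]
    linear_combination -h3
  have h4 : conv (fun s ↦ phase s ω) q = fun s ↦ osc q s ω := rfl
  rw [h4, conv_one] at h1
  have h5 : Complex.I * ω * conv (conv (fun _ ↦ 1) fun s ↦ phase s ω) q t =
      (∫ s in (0 : ℝ)..t, q s) - osc q t ω := by
    rw [conv, osc, ← intervalIntegral.integral_const_mul, ← intervalIntegral.integral_sub]
    · refine intervalIntegral.integral_congr fun s _ ↦ ?_
      rw [← mul_assoc, h2]; ring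
    · exact (intervalIntegrable_iff_integrableOn_Ioc_of_le ht).2 hqi
    · refine (intervalIntegrable_iff_integrableOn_Ioc_of_le ht).2 (hqi.bdd_mul (c := 1) ?_
        (Eventually.of_forall fun s ↦ (norm_phase _ _).le))
      exact (by fun_prop : Continuous fun s ↦ phase (t - s) ω).aestronglyMeasurable
  rw [h1.1, h5]; ring

/-- The Fourier transform of the Duhamel formula with datum `a` and charge `q`. -/
def duhamelHat (y : Plane) (a : L2) (q : ℝ → ℂ) (t : ℝ) (ξ : Plane) : ℂ :=
  phase t (symb ξ) * a ξ + wave y ξ * (Complex.I * osc q t (symb ξ))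

section Duhamel

variable {y : Plane} {a : L2} {q : ℝ → ℂ} {B : ℝ}

theorem memLp_duhamelHat (hq : Measurable q) (hB : ∀ τ, ‖q τ‖ ≤ B) {t : ℝ} (ht : 0 ≤ t) :
    MemLp (duhamelHat y a q t) 2 volume :=
  (memLp_phase_mul t a).add (lintegral_wave_osc_le hq hB y t ht).1

theorem norm_duhamelHat_le (hB : ∀ τ, ‖q τ‖ ≤ B) {t : ℝ} (ht : 0 ≤ t) (ξ : Plane) :
    ‖duhamelHat y a q t ξ‖ ≤ ‖a ξ‖ + B * t := by
  refine (norm_add_le _ _).trans (add_le_add ?_ ?_)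
  · rw [norm_mul, norm_phase, one_mul]
  · rw [norm_mul, norm_mul, norm_wave, Complex.norm_I, one_mul, one_mul]
    exact norm_osc_le ht (fun τ _ ↦ hB τ) _

theorem duhamelHat_zero (ξ : Plane) : duhamelHat y a q 0 ξ = a ξ := by
  simp [duhamelHat, osc]

theorem continuous_duhamelHat (hq : Measurable q) (hB : ∀ τ, ‖q τ‖ ≤ B) (ξ : Plane) :
    Continuous fun t ↦ duhamelHat y a q t ξ := by
  have := continuous_osc_left hq hB (symb ξ)
  unfold duhamelHat
  fun_prop

theorem duhamelHat_sub (hq : Measurable q) (hB : ∀ τ, ‖q τ‖ ≤ B) {t : ℝ} (ht : 0 ≤ t) (ξ : Plane) :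
    duhamelHat y a q t ξ - a ξ = ∫ s in (0 : ℝ)..t,
      (-Complex.I * (symb ξ * duhamelHat y a q s ξ) + Complex.I * (q s * wave y ξ)) := by
  have hqi : IntervalIntegrable q volume 0 t :=
    (intervalIntegrable_iff_integrableOn_Ioc_of_le ht).2 (bddMeas_of_measurable hq hB t).integrableOn
  have h3 := intervalIntegral.integral_eq_sub_of_hasDerivAt (a := 0) (b := t)
    (fun s _ ↦ hasDerivAt_phase s (symb ξ)) ((by fun_prop : Continuous fun s : ℝ ↦
      -Complex.I * symb ξ * phase s (symb ξ)).intervalIntegrable _ _)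
  rw [intervalIntegral.integral_const_mul, phase_zero_left] at h3
  have hD : IntervalIntegrable (fun s ↦ duhamelHat y a q s ξ) volume 0 t :=
    (continuous_duhamelHat hq hB ξ).intervalIntegrable _ _
  have h4 : ∫ s in (0 : ℝ)..t, duhamelHat y a q s ξ =
      (∫ s in (0 : ℝ)..t, phase s (symb ξ)) * a ξ +
        wave y ξ * (Complex.I * ∫ s in (0 : ℝ)..t, osc q s (symb ξ)) := by
    unfold duhamelHat
    rw [intervalIntegral.integral_add, intervalIntegral.integral_mul_const,
      intervalIntegral.integral_const_mul, intervalIntegral.integral_const_mul]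
    · exact (by fun_prop : Continuous fun s ↦ phase s (symb ξ) * a ξ).intervalIntegrable _ _
    · exact ((continuous_osc_left hq hB (symb ξ)).const_mul _ |>.const_mul _).intervalIntegrable _ _
  rw [intervalIntegral.integral_add ((hD.const_mul _).const_mul _) ((hqi.mul_const _).const_mul _),
    intervalIntegral.integral_const_mul, intervalIntegral.integral_const_mul,
    intervalIntegral.integral_const_mul, intervalIntegral.integral_mul_const, h4, duhamelHat,
    osc_eq_integral hq hB ht]
  linear_combination (norm := skip) -a ξ * h3
  ring_nf

end Duhamel

/-! ### Band-limited functions -/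

/-- `X` vanishes outside the ball of radius `R`. -/
def Band (R : ℝ) (X : L2) : Prop := ∀ᵐ ξ, R < ‖ξ‖ → X ξ = 0

theorem Band.memLp_mul {R : ℝ} {X : L2} (hX : Band R X) {c : Plane → ℂ} (hc : Continuous c) :
    MemLp (fun ξ ↦ c ξ * X ξ) 2 volume := by
  obtain ⟨C, hC⟩ := (isCompact_closedBall (0 : Plane) R).exists_bound_of_continuousOn hc.continuousOn
  refine (Lp.memLp X).of_le_mul (c := C) (hc.aestronglyMeasurable.mul (Lp.aestronglyMeasurable X)) ?_
  filter_upwards [hX] with ξ h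
  rcases le_or_gt ‖ξ‖ R with h1 | h1
  · rw [norm_mul]
    exact mul_le_mul_of_nonneg_right (hC ξ (by simpa using h1)) (norm_nonneg _)
  · simp [h h1]

theorem Band.integrable {R : ℝ} {X : L2} (hX : Band R X) : Integrable X volume := by
  have h1 : IntegrableOn X (Metric.closedBall 0 R) := by
    have : IsFiniteMeasure ((volume : Measure Plane).restrict (Metric.closedBall 0 R)) :=
      ⟨by rw [Measure.restrict_apply_univ]; exact measure_closedBall_lt_top⟩
    exact (Lp.memLp X).restrict _ |>.integrable (by norm_num)
  refine ((integrable_indicator_iff measurableSet_closedBall).2 h1).congr ?_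
  filter_upwards [hX] with ξ h
  by_cases h2 : ξ ∈ Metric.closedBall 0 R
  · rw [indicator_of_mem h2]
  · rw [indicator_of_notMem h2, h (by simpa using h2)]

theorem Band.integrable_mul {R : ℝ} {X : L2} (hX : Band R X) {c : Plane → ℂ} (hc : Continuous c)
    {f : Plane → ℂ} (hf : MemLp f 2 volume) :
    Integrable (fun ξ ↦ starRingEnd ℂ (X ξ) * (c ξ * f ξ)) := by
  have hc' : Continuous fun ξ ↦ starRingEnd ℂ (c ξ) := by fun_prop
  have h1 := (hX.memLp_mul hc').star.integrable_mul hf (p := 2) (q := 2)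
  refine h1.congr (Eventually.of_forall fun ξ ↦ ?_)
  simp only [Pi.mul_apply, Pi.star_apply, RCLike.star_def, map_mul, RingHomCompTriple.comp_apply,
    RingHom.id_apply]
  ring

theorem Band.integrable_conj_mul {R : ℝ} {X : L2} (hX : Band R X) {c : Plane → ℂ}
    (hc : Continuous c) : Integrable (fun ξ ↦ starRingEnd ℂ (X ξ) * c ξ) := by
  obtain ⟨C, hC⟩ := (isCompact_closedBall (0 : Plane) R).exists_bound_of_continuousOn hc.continuousOn
  have hm : AEStronglyMeasurable (fun ξ ↦ starRingEnd ℂ (X ξ)) volume :=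
    Complex.continuous_conj.comp_aestronglyMeasurable (Lp.aestronglyMeasurable X)
  refine (hX.integrable.norm.mul_const C).mono' (hm.mul hc.aestronglyMeasurable) ?_
  filter_upwards [hX] with ξ h
  rw [norm_mul, RCLike.norm_conj]
  rcases le_or_gt ‖ξ‖ R with h1 | h1
  · exact mul_le_mul_of_nonneg_left (hC ξ (by simpa using h1)) (norm_nonneg _)
  · simp [h h1]

theorem Band.integrable_conj_wave {R : ℝ} {X : L2} (hX : Band R X) (y : Plane) :
    Integrable (fun ξ ↦ starRingEnd ℂ (X ξ) * wave y ξ) :=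
  hX.integrable_conj_mul (continuous_wave y)

theorem continuous_symb_ofReal : Continuous fun ξ : Plane ↦ (symb ξ : ℂ) :=
  Complex.continuous_ofReal.comp continuous_symb

theorem aestronglyMeasurable_duhamelHat_pairing {y : Plane} {a : L2} {q : ℝ → ℂ} (hq : Measurable q)
    (X : L2) {ν : Measure ℝ} [SFinite ν] :
    AEStronglyMeasurable (fun p : Plane × ℝ ↦ starRingEnd ℂ (X p.1) *
      (-Complex.I * (symb p.1 * duhamelHat y a q p.2 p.1) + Complex.I * (q p.2 * wave y p.1)))
      ((volume : Measure Plane).prod ν) := by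
  have m1 : AEStronglyMeasurable (fun p : Plane × ℝ ↦ starRingEnd ℂ (X p.1))
      ((volume : Measure Plane).prod ν) :=
    Complex.continuous_conj.comp_aestronglyMeasurable (Lp.aestronglyMeasurable X).comp_fst
  have m2 : AEStronglyMeasurable (fun p : Plane × ℝ ↦ a p.1) ((volume : Measure Plane).prod ν) :=
    (Lp.aestronglyMeasurable a).comp_fst
  have m4 : Measurable fun p : Plane × ℝ ↦ phase p.2 (symb p.1) := by
    have : Continuous fun p : ℝ × ℝ ↦ phase p.1 p.2 := by fun_prop
    exact this.measurable.comp (measurable_snd.prodMk measurable_symb_fst)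
  have m5 : Measurable fun p : Plane × ℝ ↦ wave y p.1 :=
    (continuous_wave y).measurable.comp measurable_fst
  have m6 : Measurable fun p : Plane × ℝ ↦ (symb p.1 : ℂ) :=
    continuous_symb_ofReal.measurable.comp measurable_fst
  have m7 : Measurable fun p : Plane × ℝ ↦ Complex.I * (q p.2 * wave y p.1) :=
    ((hq.comp measurable_snd).mul m5).const_mul _
  have m8 : Measurable fun p : Plane × ℝ ↦ wave y p.1 * (Complex.I * osc q p.2 (symb p.1)) :=
    m5.mul ((measurable_osc_symb hq).const_mul _)
  have m9 : AEStronglyMeasurable (fun p : Plane × ℝ ↦ duhamelHat y a q p.2 p.1)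
      ((volume : Measure Plane).prod ν) := by
    have m4' := m4.aestronglyMeasurable (μ := (volume : Measure Plane).prod ν)
    have m8' := m8.aestronglyMeasurable (μ := (volume : Measure Plane).prod ν)
    have := m4'.mul m2
    unfold duhamelHat
    exact this.add m8'
  have m10 : AEStronglyMeasurable (fun p : Plane × ℝ ↦
      -Complex.I * (symb p.1 * duhamelHat y a q p.2 p.1)) ((volume : Measure Plane).prod ν) :=
    (m6.aestronglyMeasurable.mul m9).const_mul _
  have m11 := m10.add m7.aestronglyMeasurable
  exact m1.mul m11

/-- The multiplier `c` is bounded on the band, so one majorant serves for all `t ∈ [0, T]`. -/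
theorem Band.continuousOn_pairing {y : Plane} {a : L2} {q : ℝ → ℂ} {B : ℝ} (hq : Measurable q)
    (hB : ∀ τ, ‖q τ‖ ≤ B) {R : ℝ} {X : L2} (hX : Band R X) {c : Plane → ℂ} (hc : Continuous c)
    (T : ℝ) :
    ContinuousOn (fun t ↦ ∫ ξ, starRingEnd ℂ (X ξ) * (c ξ * duhamelHat y a q t ξ)) (Icc 0 T) := by
  have hB0 : 0 ≤ B := (norm_nonneg _).trans (hB 0)
  refine continuousOn_of_dominated (bound := fun ξ ↦ ‖starRingEnd ℂ (X ξ) * (c ξ * a ξ)‖ +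
    (B * T) * ‖starRingEnd ℂ (X ξ) * c ξ‖) (fun t ht ↦ ?_) (fun t ht ↦ ?_) ?_ ?_
  · exact (hX.integrable_mul hc (memLp_duhamelHat hq hB ht.1)).1
  · refine Eventually.of_forall fun ξ ↦ ?_
    have h2 := norm_duhamelHat_le (y := y) (a := a) hB ht.1 ξ
    have h3 : B * t ≤ B * T := mul_le_mul_of_nonneg_left ht.2 hB0
    simp only [norm_mul, RCLike.norm_conj]
    calc _ ≤ ‖X ξ‖ * (‖c ξ‖ * (‖a ξ‖ + B * T)) := by gcongr; linarith
      _ = _ := by ring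
  · exact (hX.integrable_mul hc (Lp.memLp a)).norm.add ((hX.integrable_conj_mul hc).norm.const_mul _)
  · exact Eventually.of_forall fun ξ ↦
      (continuous_const.mul (continuous_const.mul (continuous_duhamelHat hq hB ξ))).continuousOn

/-- The Duhamel formula tested with a band-limited function. -/
theorem band_pairing_duhamelHat {y : Plane} {a : L2} {q : ℝ → ℂ} {B : ℝ} (hq : Measurable q)
    (hB : ∀ τ, ‖q τ‖ ≤ B) {t : ℝ} (ht : 0 ≤ t) {R : ℝ} {X : L2} (hX : Band R X) :
    (∫ ξ, starRingEnd ℂ (X ξ) * duhamelHat y a q t ξ) - ∫ ξ, starRingEnd ℂ (X ξ) * a ξ =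
      ∫ s in (0 : ℝ)..t, -Complex.I * ((∫ ξ, starRingEnd ℂ (X ξ) * (symb ξ * duhamelHat y a q s ξ)) -
        q s * ∫ ξ, starRingEnd ℂ (X ξ) * wave y ξ) := by
  have hB0 : 0 ≤ B := (norm_nonneg _).trans (hB 0)
  have hi : ∀ s, 0 ≤ s → Integrable (fun ξ ↦ starRingEnd ℂ (X ξ) * (symb ξ * duhamelHat y a q s ξ)) :=
    fun s hs ↦ hX.integrable_mul continuous_symb_ofReal (memLp_duhamelHat hq hB hs)
  have h1 : ∀ {f : Plane → ℂ}, MemLp f 2 volume → Integrable (fun ξ ↦ starRingEnd ℂ (X ξ) * f ξ) :=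
    fun hf ↦ by simpa using hX.integrable_mul continuous_const (c := fun _ ↦ 1) hf
  rw [← integral_sub (h1 (memLp_duhamelHat hq hB ht)) (h1 (Lp.memLp a))]
  set Φ : ℝ → Plane → ℂ := fun s ξ ↦ starRingEnd ℂ (X ξ) *
    (-Complex.I * (symb ξ * duhamelHat y a q s ξ) + Complex.I * (q s * wave y ξ)) with hΦ
  have e1 : ∀ ξ, starRingEnd ℂ (X ξ) * duhamelHat y a q t ξ - starRingEnd ℂ (X ξ) * a ξ =
      ∫ s in Ioc 0 t, Φ s ξ := by
    intro ξ
    rw [← mul_sub, duhamelHat_sub hq hB ht, intervalIntegral.integral_of_le ht, ← integral_const_mul]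
  rw [integral_congr_ae (Eventually.of_forall e1), integral_integral_swap,
    intervalIntegral.integral_of_le ht]
  · refine setIntegral_congr_fun measurableSet_Ioc fun s hs ↦ ?_
    simp only [hΦ]
    have e2 : ∀ ξ, starRingEnd ℂ (X ξ) *
        (-Complex.I * (symb ξ * duhamelHat y a q s ξ) + Complex.I * (q s * wave y ξ)) =
        -Complex.I * (starRingEnd ℂ (X ξ) * (symb ξ * duhamelHat y a q s ξ)) +
          Complex.I * q s * (starRingEnd ℂ (X ξ) * wave y ξ) := fun ξ ↦ by ring
    simp only [e2]
    rw [integral_add ((hi s hs.1.le).const_mul _) ((hX.integrable_conj_wave y).const_mul _),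
      integral_const_mul, integral_const_mul]
    ring
  · have hb : Integrable (fun ξ ↦ ‖starRingEnd ℂ (X ξ) * (symb ξ * a ξ)‖ +
        (B * t) * ‖starRingEnd ℂ (X ξ) * (symb ξ * wave y ξ)‖ + B * ‖starRingEnd ℂ (X ξ) * wave y ξ‖) := by
      exact ((hX.integrable_mul continuous_symb_ofReal (Lp.memLp a)).norm.add
        ((hX.integrable_conj_mul (continuous_symb_ofReal.mul (continuous_wave y))).norm.const_mul _)).add
        ((hX.integrable_conj_wave y).norm.const_mul _)
    have hb2 := (integrable_const (1 : ℝ) (μ := (volume : Measure ℝ).restrict (Ioc 0 t))).mul_prod hb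
      |>.swap
    refine Integrable.mono' hb2 ?_ ?_
    · exact aestronglyMeasurable_duhamelHat_pairing hq X
    · have hs : ∀ᵐ p ∂((volume : Measure Plane).prod (volume.restrict (Ioc 0 t))), p.2 ∈ Ioc 0 t :=
        Measure.quasiMeasurePreserving_snd.ae (ae_restrict_mem measurableSet_Ioc)
      filter_upwards [hs] with p hp
      simp only [Function.uncurry, hΦ, Function.comp, Prod.swap, one_mul]
      rw [mul_add]
      refine (norm_add_le _ _).trans (add_le_add ?_ ?_)
      · have h2 := norm_duhamelHat_le (y := y) (a := a) hB hp.1.le p.1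
        have h3 : B * p.2 ≤ B * t := mul_le_mul_of_nonneg_left hp.2 hB0
        simp only [norm_mul, RCLike.norm_conj, norm_neg, Complex.norm_I, one_mul, norm_wave, mul_one]
        calc _ ≤ ‖X p.1‖ * (‖(symb p.1 : ℂ)‖ * (‖a p.1‖ + B * t)) := by gcongr; linarith
          _ = _ := by ring
      · simp only [norm_mul, RCLike.norm_conj, Complex.norm_I, one_mul, norm_wave, mul_one]
        rw [mul_comm]
        exact mul_le_mul_of_nonneg_right (hB _) (norm_nonneg _)


/-! ### The form in Fourier variables -/

theorem memLp_two_of_lintegral {f : Plane → ℂ} (hf : AEStronglyMeasurable f volume)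
    (h : ∫⁻ ξ, ‖f ξ‖ₑ ^ 2 < ∞) : MemLp f 2 volume := by
  rw [← eLpNorm_two_sq] at h
  exact ⟨hf, by by_contra h'; simp [not_lt_top_iff.1 h'] at h⟩

theorem norm_le_of_lintegral_fourier {f : L2} {K : ℝ≥0∞} (hK : K ≠ ∞)
    (h : ∫⁻ ξ, ‖(𝓕 f : L2) ξ‖ₑ ^ 2 ≤ K) : ‖f‖ ≤ Real.sqrt K.toReal := by
  rw [← Lp.norm_fourier_eq, Lp.norm_def]
  refine Real.le_sqrt_of_sq_le ?_
  rw [← ENNReal.toReal_pow]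
  refine ENNReal.toReal_mono hK ?_
  rwa [eLpNorm_two_sq]

theorem norm_coord_sq_sum (ξ : Plane) :
    ∑ j : Fin 2, ‖2 * Real.pi * Complex.I * ((ξ j : ℝ) : ℂ)‖ ^ 2 = symb ξ := by
  simp only [symb, mul_pow, EuclideanSpace.real_norm_sq_eq, norm_mul, Complex.norm_I, Complex.norm_real,
    Fin.sum_univ_two, Real.norm_eq_abs, sq_abs, Complex.norm_ofNat]
  ring

theorem enorm_coord_sq_le (ξ : Plane) (j : Fin 2) :
    ‖2 * Real.pi * Complex.I * ((ξ j : ℝ) : ℂ)‖ₑ ^ 2 ≤ ENNReal.ofReal (symb ξ) := by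
  rw [← ofReal_norm, ← ENNReal.ofReal_pow (norm_nonneg _), ← norm_coord_sq_sum]
  exact ENNReal.ofReal_le_ofReal
    (Finset.single_le_sum (f := fun j : Fin 2 ↦ ‖2 * Real.pi * Complex.I * ((ξ j : ℝ) : ℂ)‖ ^ 2)
      (fun _ _ ↦ sq_nonneg _) (Finset.mem_univ j))

theorem lintegral_coord_le (r : Plane → ℂ) (j : Fin 2) :
    ∫⁻ ξ : Plane, ‖2 * Real.pi * Complex.I * ((ξ j : ℝ) : ℂ) * r ξ‖ₑ ^ 2 ≤
      ∫⁻ ξ, ENNReal.ofReal (symb ξ) * ‖r ξ‖ₑ ^ 2 := by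
  refine lintegral_mono fun ξ ↦ ?_
  rw [enorm_mul, mul_pow]
  exact mul_le_mul_left (enorm_coord_sq_le ξ j) _

theorem continuous_coord (j : Fin 2) :
    Continuous fun ξ : Plane ↦ 2 * Real.pi * Complex.I * ((ξ j : ℝ) : ℂ) := by fun_prop

variable {y : Plane} {lam : ℝ} {hlam : 0 < lam}

theorem exists_formDomain (y : Plane) {lam : ℝ} (hlam : 0 < lam) {r : Plane → ℂ}
    (hr : MemLp r 2 volume) (h : ∫⁻ ξ, ENNReal.ofReal (symb ξ) * ‖r ξ‖ₑ ^ 2 < ∞) (c : ℂ) :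
    ∃ φ : FormDomain y hlam, φ.charge = c ∧ (𝓕 φ.reg : L2) =ᵐ[volume] r := by
  have hm : ∀ j : Fin 2, MemLp (fun ξ : Plane ↦ 2 * Real.pi * Complex.I * ((ξ j : ℝ) : ℂ) * r ξ) 2
      volume := fun j ↦ memLp_two_of_lintegral ((continuous_coord j).aestronglyMeasurable.mul hr.1)
        ((lintegral_coord_le r j).trans_lt h)
  have hreg : (𝓕 (𝓕⁻ (hr.toLp r) : L2) : L2) =ᵐ[volume] r := by
    rw [FourierTransform.fourier_fourierInv_eq]
    exact hr.coeFn_toLp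
  refine ⟨⟨𝓕⁻ (hr.toLp r), fun j ↦ 𝓕⁻ ((hm j).toLp _), ?_, c⟩, rfl, hreg⟩
  rw [isWeakGradient_iff]
  intro j
  rw [FourierTransform.fourier_fourierInv_eq]
  filter_upwards [(hm j).coeFn_toLp, hreg] with ξ h1 h2
  rw [h1, h2]

theorem fourier_toL2 (ψ : FormDomain y hlam) : (𝓕 ψ.toL2 : L2) =ᵐ[volume]
    fun ξ ↦ (𝓕 ψ.reg : L2) ξ + ψ.charge * (wave y ξ / ((symb ξ + lam : ℝ) : ℂ)) := by
  rw [FormDomain.toL2, fourier_add_smul]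
  filter_upwards [Lp.coeFn_add (𝓕 ψ.reg : L2) (ψ.charge • (𝓕 (green y hlam) : L2)),
    Lp.coeFn_smul ψ.charge (𝓕 (green y hlam) : L2), fourier_green y hlam] with ξ h1 h2 h3
  rw [h1, Pi.add_apply, h2, Pi.smul_apply, h3, smul_eq_mul]

/-- The part of the form that depends on the regular part of the first argument only. -/
def regForm (χ ψ : FormDomain y hlam) : ℂ :=
  (∑ j : Fin 2, inner ℂ (χ.grad j) (ψ.grad j)) + lam * inner ℂ χ.reg ψ.reg -
    lam * inner ℂ χ.reg ψ.toL2

/-- Sorting by the components of the test function decouples the weak equation: `regForm` contains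
neither `α` nor the charge of the test function, and the Green component is one scalar equation
carrying the nonlinearity. -/
theorem form_eq (α : ℝ) (χ ψ : FormDomain y hlam) :
    form α χ ψ = regForm χ ψ + starRingEnd ℂ χ.charge *
      (-lam * inner ℂ (green y hlam) ψ.toL2 + (α + formConst lam) * ψ.charge) := by
  rw [form, regForm]
  have : inner ℂ χ.toL2 ψ.toL2 = inner ℂ χ.reg ψ.toL2 +
      starRingEnd ℂ χ.charge * inner ℂ (green y hlam) ψ.toL2 := by
    rw [FormDomain.toL2, inner_add_left, inner_smul_left]
  rw [this, formConst]
  push_cast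
  ring

theorem integrable_conj_mul {f g : L2} :
    Integrable (fun ξ ↦ starRingEnd ℂ (f ξ) * g ξ) volume := by
  refine (L2.integrable_inner (𝕜 := ℂ) f g).congr (Eventually.of_forall fun ξ ↦ ?_)
  exact (RCLike.inner_apply _ _).trans (mul_comm _ _)

theorem sum_inner_grad (χ ψ : FormDomain y hlam) :
    ∑ j : Fin 2, inner ℂ (χ.grad j) (ψ.grad j) =
      ∫ ξ, starRingEnd ℂ ((𝓕 χ.reg : L2) ξ) * (symb ξ * (𝓕 ψ.reg : L2) ξ) := by
  simp only [inner_eq_integral_fourier]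
  rw [← integral_finsetSum _ fun j _ ↦ integrable_conj_mul]
  have h1 := (isWeakGradient_iff _ _).1 χ.isWeakGradient
  have h2 := (isWeakGradient_iff _ _).1 ψ.isWeakGradient
  refine integral_congr_ae ?_
  filter_upwards [h1 0, h1 1, h2 0, h2 1] with ξ a0 a1 b0 b1
  rw [Fin.sum_univ_two, a0, a1, b0, b1]
  simp only [map_mul, Complex.conj_I, Complex.conj_ofReal, Complex.conj_ofNat, symb,
    EuclideanSpace.real_norm_sq_eq, mul_pow, Fin.sum_univ_two]
  push_cast
  linear_combination (-4 * Real.pi ^ 2 * ((ξ 0 : ℂ) ^ 2 + (ξ 1 : ℂ) ^ 2) * (starRingEnd ℂ) ((𝓕 χ.reg : L2) ξ) *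
    (𝓕 ψ.reg : L2) ξ) * Complex.I_mul_I

/-- The factor `|p|² + λ` turns the Green part of `ψ` into a plane wave, and the terms with `λ`
cancel. The result needs only the `L²` function of `ψ` and its charge, and it has the shape of the
integrated Duhamel formula. -/
theorem regForm_band {R : ℝ} {χ : FormDomain y hlam} (hX : Band R (𝓕 χ.reg : L2))
    (ψ : FormDomain y hlam) :
    regForm χ ψ = (∫ ξ, starRingEnd ℂ ((𝓕 χ.reg : L2) ξ) * (symb ξ * (𝓕 ψ.toL2 : L2) ξ)) -
      ψ.charge * ∫ ξ, starRingEnd ℂ ((𝓕 χ.reg : L2) ξ) * wave y ξ := by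
  rw [regForm, sum_inner_grad, inner_eq_integral_fourier, inner_eq_integral_fourier]
  have h1 := hX.integrable_mul continuous_symb_ofReal (Lp.memLp (𝓕 ψ.reg : L2))
  have h2 := hX.integrable_mul continuous_symb_ofReal (Lp.memLp (𝓕 ψ.toL2 : L2))
  have h3 := hX.integrable_conj_wave y
  have h4 := integrable_conj_mul (f := (𝓕 χ.reg : L2)) (g := (𝓕 ψ.reg : L2))
  have h5 := integrable_conj_mul (f := (𝓕 χ.reg : L2)) (g := (𝓕 ψ.toL2 : L2))
  have h6 : Integrable (fun ξ ↦ starRingEnd ℂ ((𝓕 χ.reg : L2) ξ) * (symb ξ * (𝓕 ψ.reg : L2) ξ) +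
      lam * (starRingEnd ℂ ((𝓕 χ.reg : L2) ξ) * (𝓕 ψ.reg : L2) ξ)) := h1.add (h4.const_mul _)
  rw [← integral_const_mul, ← integral_const_mul, ← integral_const_mul, ← integral_add h1 (h4.const_mul _),
    ← integral_sub h6 (h5.const_mul _), ← integral_sub h2 (h3.const_mul _)]
  refine integral_congr_ae ?_
  filter_upwards [fourier_toL2 ψ] with ξ h
  have hne : ((symb ξ + lam : ℝ) : ℂ) ≠ 0 := by
    exact_mod_cast (add_pos_of_nonneg_of_pos (symb_nonneg ξ) hlam).ne'
  rw [h]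
  field_simp
  push_cast
  ring

theorem norm_regForm_sub_le {χ χ' ψ : FormDomain y hlam} {ε M : ℝ}
    (hg : ∀ j, ‖χ.grad j - χ'.grad j‖ ≤ ε) (hr : ‖χ.reg - χ'.reg‖ ≤ ε)
    (hψg : ∀ j, ‖ψ.grad j‖ ≤ M) (hψr : ‖ψ.reg‖ ≤ M) (hψ : ‖ψ.toL2‖ ≤ M) :
    ‖regForm χ ψ - regForm χ' ψ‖ ≤ (2 + 2 * lam) * (ε * M) := by
  have e : regForm χ ψ - regForm χ' ψ = (∑ j : Fin 2, inner ℂ (χ.grad j - χ'.grad j) (ψ.grad j)) +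
      lam * inner ℂ (χ.reg - χ'.reg) ψ.reg - lam * inner ℂ (χ.reg - χ'.reg) ψ.toL2 := by
    simp only [regForm, inner_sub_left, Fin.sum_univ_two]
    ring
  have hb : ∀ {f g : L2}, ‖f‖ ≤ ε → ‖g‖ ≤ M → ‖inner ℂ f g‖ ≤ ε * M := fun h h' ↦
    (norm_inner_le_norm _ _).trans (mul_le_mul h h' (norm_nonneg _) ((norm_nonneg _).trans h))
  rw [e, Fin.sum_univ_two]
  have b1 := hb (hg 0) (hψg 0)
  have b2 := hb (hg 1) (hψg 1)
  have b3 := hb hr hψr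
  have b4 := hb hr hψ
  refine (norm_sub_le _ _).trans ?_
  refine (add_le_add (norm_add_le _ _) le_rfl).trans ?_
  rw [norm_mul, norm_mul, Complex.norm_real, Real.norm_of_nonneg hlam.le]
  have b5 := mul_le_mul_of_nonneg_left b3 hlam.le
  have b6 := mul_le_mul_of_nonneg_left b4 hlam.le
  have b7 := norm_add_le (inner ℂ (χ.grad 0 - χ'.grad 0) (ψ.grad 0)) (inner ℂ (χ.grad 1 - χ'.grad 1) (ψ.grad 1))
  linarith

/-! ### Frequency cut-off -/

theorem exists_bandCut (f : L2) (n : ℕ) : ∃ g : L2, (𝓕 g : L2) =ᵐ[volume]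
    (Metric.closedBall 0 n).indicator (𝓕 f : L2) := by
  have h := (Lp.memLp (𝓕 f : L2)).indicator (s := Metric.closedBall (0 : Plane) n) measurableSet_closedBall
  refine ⟨𝓕⁻ (h.toLp _), ?_⟩
  rw [FourierTransform.fourier_fourierInv_eq]
  exact h.coeFn_toLp

theorem tendsto_bandCut {f : L2} {g : ℕ → L2} (hg : ∀ n : ℕ, (𝓕 (g n) : L2) =ᵐ[volume]
    (Metric.closedBall 0 n).indicator (𝓕 f : L2)) : Tendsto (fun n ↦ ‖f - g n‖) atTop (𝓝 0) := by
  have e : ∀ n : ℕ, ‖f - g n‖ₑ = eLpNorm ((Metric.closedBall (0 : Plane) n)ᶜ.indicator (𝓕 f : L2)) 2 volume := by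
    intro n
    rw [← ofReal_norm, ← Lp.norm_fourier_eq, sub_eq_add_neg, ← neg_one_smul ℂ, fourier_add_smul,
      ofReal_norm, Lp.enorm_def]
    refine eLpNorm_congr_ae ?_
    filter_upwards [hg n, Lp.coeFn_add (𝓕 f : L2) ((-1 : ℂ) • (𝓕 (g n) : L2)),
      Lp.coeFn_smul (-1 : ℂ) (𝓕 (g n) : L2)] with ξ h1 h2 h3
    rw [h2, Pi.add_apply, h3, Pi.smul_apply, h1]
    by_cases h : ξ ∈ Metric.closedBall (0 : Plane) n <;> simp [h]
  have h1 : Tendsto (fun n : ℕ ↦ ∫⁻ ξ, ‖(Metric.closedBall (0 : Plane) n)ᶜ.indicator (𝓕 f : L2) ξ‖ₑ ^ 2)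
      atTop (𝓝 (∫⁻ _ : Plane, 0)) := by
    refine tendsto_lintegral_of_dominated_convergence' (fun ξ ↦ ‖(𝓕 f : L2) ξ‖ₑ ^ 2) (fun n ↦ ?_)
      (fun n ↦ Eventually.of_forall fun ξ ↦ ?_) ?_ (Eventually.of_forall fun ξ ↦ ?_)
    · exact (((Lp.aestronglyMeasurable _).indicator measurableSet_closedBall.compl).enorm).pow_const 2
    · by_cases h : ξ ∈ (Metric.closedBall (0 : Plane) n)ᶜ
      · simp only [indicator_of_mem h, le_refl]
      · simp [indicator_of_notMem h]
    · rw [← eLpNorm_two_sq]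
      exact ENNReal.pow_ne_top (Lp.memLp _).2.ne
    · refine tendsto_const_nhds.congr' ?_
      obtain ⟨N, hN⟩ := exists_nat_ge ‖ξ‖
      filter_upwards [eventually_ge_atTop N] with n hn
      have : ‖ξ‖ ≤ n := hN.trans (by exact_mod_cast hn)
      rw [indicator_of_notMem (by simpa using this)]; simp
  rw [lintegral_zero] at h1
  have h2 := tendsto_eLpNorm_two_zero h1
  have h3 : Tendsto (fun n ↦ ‖f - g n‖ₑ) atTop (𝓝 0) := by simpa only [e] using h2
  have h4 := (ENNReal.tendsto_toReal ENNReal.zero_ne_top).comp h3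
  simpa [Function.comp_def] using h4

/-- Every element of the form domain is approximated by elements of charge zero with band-limited
regular part, up to its charge. -/
theorem exists_band_approx (χ : FormDomain y hlam) : ∃ X : ℕ → FormDomain y hlam,
    (∀ n : ℕ, Band n (𝓕 (X n).reg : L2)) ∧
    (∀ j, Tendsto (fun n ↦ ‖χ.grad j - (X n).grad j‖) atTop (𝓝 0)) ∧
    Tendsto (fun n ↦ ‖χ.reg - (X n).reg‖) atTop (𝓝 0) := by
  choose cut hcut using exists_bandCut
  refine ⟨fun n ↦ ⟨cut χ.reg n, fun j ↦ cut (χ.grad j) n, ?_, 0⟩, fun n ↦ ?_,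
    fun j ↦ tendsto_bandCut (hcut _), tendsto_bandCut (hcut _)⟩
  · rw [isWeakGradient_iff]
    intro j
    filter_upwards [hcut χ.reg n, hcut (χ.grad j) n, (isWeakGradient_iff _ _).1 χ.isWeakGradient j]
      with ξ h1 h2 h3
    rw [h1, h2]
    by_cases h : ξ ∈ Metric.closedBall (0 : Plane) n
    · simp [h, h3]
    · simp [h]
  · filter_upwards [hcut χ.reg n] with ξ h h'
    rw [h, indicator_of_notMem (by simpa using h')]


/-! ### The trace of the Duhamel integral against the Green function -/

theorem integrable_cexp_neg_mul_symb {z : ℂ} (hz : 0 < z.re) :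
    Integrable fun ξ : Plane ↦ Complex.exp (-z * symb ξ) := by
  have h := GaussianFourier.integrable_cexp_neg_mul_sq_norm_add (V := Plane)
    (b := ((2 * Real.pi) ^ 2 : ℝ) * z) (by
      rw [Complex.re_ofReal_mul]; positivity) 0 0
  refine h.congr (Eventually.of_forall fun ξ ↦ ?_)
  simp only [symb]
  congr 1
  push_cast
  simp
  ring

theorem integral_cexp_neg_mul_symb {z : ℂ} (hz : 0 < z.re) :
    ∫ ξ : Plane, Complex.exp (-z * symb ξ) = 1 / (4 * Real.pi * z) := by
  have h := fourierInv_wave_mul_gaussian 0 0 hz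
  rw [Real.fourierInv_eq] at h
  simpa [wave, heat] using h

theorem integral_exp_neg_mul_Ioi {c : ℝ} (hc : 0 < c) : ∫ r in Ioi (0 : ℝ), (Real.exp (-(r * c)) : ℂ) = 1 / (c : ℂ) := by
  rw [integral_complex_ofReal]
  have := integral_exp_mul_Ioi (a := -c) (by linarith) 0
  have e : ∀ r : ℝ, Real.exp (-(r * c)) = Real.exp (-c * r) := fun r ↦ by ring_nf
  simp only [e, this]
  push_cast
  simp

theorem integrableOn_exp_neg_mul_Ioi {c : ℝ} (hc : 0 < c) :
    IntegrableOn (fun r : ℝ ↦ (Real.exp (-(r * c)) : ℂ)) (Ioi 0) := by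
  have := (integrableOn_exp_mul_Ioi (a := -c) (by linarith) 0).ofReal (𝕜 := ℂ)
  refine this.congr (Eventually.of_forall fun r ↦ ?_)
  simp only
  rw [neg_mul, mul_comm]
  rfl

theorem memLp_osc_symb {Q : ℝ → ℂ} {B : ℝ} (hQ : Measurable Q) (hB : ∀ τ, ‖Q τ‖ ≤ B) (t : ℝ)
    (ht : 0 ≤ t) : MemLp (fun ξ : Plane ↦ osc Q t (symb ξ)) 2 volume := by
  have h := (lintegral_wave_osc_le hQ hB 0 t ht).1
  have hm : AEStronglyMeasurable (fun ξ : Plane ↦ osc Q t (symb ξ)) volume := by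
    have := (measurable_osc_symb hQ).comp (measurable_id.prodMk (measurable_const (a := t)))
    exact (this : Measurable fun ξ : Plane ↦ osc Q t (symb ξ)).aestronglyMeasurable
  refine h.of_le hm (Eventually.of_forall fun ξ ↦ ?_)
  simp [osc]

theorem symb_add_pos {lam : ℝ} (hlam : 0 < lam) (ξ : Plane) : 0 < symb ξ + lam :=
  add_pos_of_nonneg_of_pos (symb_nonneg ξ) hlam

theorem memLp_inv_symb {lam : ℝ} (hlam : 0 < lam) :
    MemLp (fun ξ : Plane ↦ 1 / ((symb ξ + lam : ℝ) : ℂ)) 2 volume := by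
  have h := memLp_green 0 hlam
  simpa [symb] using h

/-- The Gaussian is an absolutely integrable majorant, so Fubini applies; every frequency integral
is then the Gaussian one at complex time `r + i(t - τ)`. -/
theorem integral_osc_mul_gaussian {Q : ℝ → ℂ} {B : ℝ} (hQ : Measurable Q) (hB : ∀ τ, ‖Q τ‖ ≤ B)
    {t : ℝ} (ht : 0 ≤ t) {r : ℝ} (hr : 0 < r) :
    ∫ ξ : Plane, osc Q t (symb ξ) * (Real.exp (-(r * symb ξ)) : ℂ) =
      ∫ τ in Ioc 0 t, 1 / (4 * Real.pi * (r + Complex.I * (t - τ : ℝ))) * Q τ := by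
  have e : ∀ (ξ : Plane) (τ : ℝ), phase (t - τ) (symb ξ) * Q τ * (Real.exp (-(r * symb ξ)) : ℂ) =
      Complex.exp (-(r + Complex.I * (t - τ : ℝ)) * symb ξ) * Q τ := by
    intro ξ τ
    rw [phase, mul_right_comm, Complex.ofReal_exp, ← Complex.exp_add]
    congr 2
    push_cast
    ring
  have e1 : ∀ ξ : Plane, osc Q t (symb ξ) * (Real.exp (-(r * symb ξ)) : ℂ) =
      ∫ τ in Ioc 0 t, Complex.exp (-(r + Complex.I * (t - τ : ℝ)) * symb ξ) * Q τ := by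
    intro ξ
    rw [osc, intervalIntegral.integral_of_le ht, ← integral_mul_const]
    simp only [e]
  have hg := integrable_cexp_neg_mul_symb (z := r) (by simpa using hr)
  simp only [e1]
  rw [integral_integral_swap]
  · refine integral_congr_ae (Eventually.of_forall fun τ ↦ ?_)
    simp only
    rw [integral_mul_const, integral_cexp_neg_mul_symb (by simpa using hr)]
  · have hQi := (bddMeas_of_measurable hQ hB t).integrableOn
    have hd := hg.mul_prod hQi
    refine hd.mono ?_ (Eventually.of_forall fun p ↦ ?_)
    · have h1 : Continuous fun p : Plane × ℝ ↦
          Complex.exp (-(r + Complex.I * (t - p.2 : ℝ)) * symb p.1) := by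
        have := continuous_symb.comp (continuous_fst (X := Plane) (Y := ℝ))
        have h2 : Continuous fun p : Plane × ℝ ↦ (symb p.1 : ℂ) := Complex.continuous_ofReal.comp this
        fun_prop
      exact (h1.measurable.mul (hQ.comp measurable_snd)).aestronglyMeasurable
    · simp only [Function.uncurry, norm_mul, Complex.norm_exp]
      simp

/-- The frequency and time integrals cannot be exchanged directly, since `1/(|p|² + λ)` is not
integrable on the plane. Writing it as a Laplace integral in `r` inserts a Gaussian for each `r >
0`; integrability in `(ξ, r)` comes from `osc` and the resolvent both being in `L²`. -/
theorem integral_osc_div {lam : ℝ} (hlam : 0 < lam) {Q : ℝ → ℂ} {B : ℝ} (hQ : Measurable Q)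
    (hB : ∀ τ, ‖Q τ‖ ≤ B) {t : ℝ} (ht : 0 ≤ t) :
    ∫ ξ : Plane, osc Q t (symb ξ) / ((symb ξ + lam : ℝ) : ℂ) =
      1 / (4 * Real.pi) * conv (greenTrace lam) Q t := by
  have hm : Measurable fun ξ : Plane ↦ osc Q t (symb ξ) := by
    have := (measurable_osc_symb hQ).comp (measurable_id.prodMk (measurable_const (a := t)))
    exact this
  have e1 : ∀ ξ : Plane, osc Q t (symb ξ) / ((symb ξ + lam : ℝ) : ℂ) =
      ∫ r in Ioi (0 : ℝ), osc Q t (symb ξ) * (Real.exp (-(r * (symb ξ + lam))) : ℂ) := by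
    intro ξ
    rw [integral_const_mul, integral_exp_neg_mul_Ioi (symb_add_pos hlam ξ), mul_one_div]
  simp only [e1]
  rw [integral_integral_swap]
  · have e2 : ∀ r ∈ Ioi (0 : ℝ), ∫ ξ : Plane, osc Q t (symb ξ) * (Real.exp (-(r * (symb ξ + lam))) : ℂ) =
        1 / (4 * Real.pi) * ∫ τ in Ioc 0 t, greenTraceKer lam r (t - τ) * Q τ := by
      intro r hr
      have e3 : ∀ ξ : Plane, osc Q t (symb ξ) * (Real.exp (-(r * (symb ξ + lam))) : ℂ) =
          (Real.exp (-(lam * r)) : ℂ) * (osc Q t (symb ξ) * (Real.exp (-(r * symb ξ)) : ℂ)) := by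
        intro ξ
        rw [mul_add, neg_add, Real.exp_add, mul_comm r lam]
        push_cast
        ring
      simp only [e3]
      rw [integral_const_mul, integral_osc_mul_gaussian hQ hB ht hr, ← integral_const_mul,
        ← integral_const_mul]
      refine integral_congr_ae (Eventually.of_forall fun τ ↦ ?_)
      simp only [greenTraceKer]
      have hz : (r : ℂ) + Complex.I * ((t - τ : ℝ) : ℂ) ≠ 0 := by
        intro h
        have := congrArg Complex.re h
        simp at this
        exact (mem_Ioi.1 hr).ne' this
      have hpi : (Real.pi : ℂ) ≠ 0 := by exact_mod_cast Real.pi_ne_zero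
      field_simp
    rw [setIntegral_congr_fun measurableSet_Ioi e2, integral_const_mul, conv_eq_setIntegral _ _ ht]
    congr 1
    have hker : Integrable (Function.uncurry fun r τ : ℝ ↦ greenTraceKer lam r (t - τ) * Q τ)
        ((volume.restrict (Ioi 0)).prod (volume.restrict (Ioc 0 t))) := by
      have h1 := integrable_greenTraceKer hlam t
      -- The open interval is used because it is invariant under `τ ↦ t - τ`.
      have hmp : MeasurePreserving (fun p : ℝ × ℝ ↦ (t - p.2, p.1))
          ((volume.restrict (Ioi 0)).prod (volume.restrict (Ioo 0 t)))
          ((volume.restrict (Ioo 0 t)).prod (volume.restrict (Ioi 0))) := by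
        have h2 : MeasurePreserving (fun τ : ℝ ↦ t - τ) (volume.restrict (Ioo 0 t))
            (volume.restrict (Ioo 0 t)) := by
          have := (Measure.measurePreserving_sub_left (volume : Measure ℝ) t).restrict_preimage
            (measurableSet_Ioo (a := (0 : ℝ)) (b := t))
          simpa using this
        have h3 := (h2.prod (MeasurePreserving.id (volume.restrict (Ioi (0 : ℝ))))).comp
          (Measure.measurePreserving_swap (μ := (volume : Measure ℝ).restrict (Ioi 0))
            (ν := (volume : Measure ℝ).restrict (Ioo 0 t)))
        exact h3
      rw [← Measure.restrict_congr_set (Ioo_ae_eq_Ioc (a := (0 : ℝ)) (b := t))] at h1 ⊢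
      have h4 := hmp.integrable_comp_of_integrable h1
      have h5 : AEStronglyMeasurable (fun p : ℝ × ℝ ↦ Q p.2)
          (((volume : Measure ℝ).restrict (Ioi 0)).prod ((volume : Measure ℝ).restrict (Ioo 0 t))) :=
        (hQ.comp measurable_snd).aestronglyMeasurable
      exact h4.mul_bdd (c := B) h5 (Eventually.of_forall fun p ↦ hB _)
    rw [integral_integral_swap hker]
    refine integral_congr_ae (Eventually.of_forall fun τ ↦ ?_)
    simp only
    rw [integral_mul_const, greenTrace]
  · have hmeas : AEStronglyMeasurable (Function.uncurry fun (ξ : Plane) (r : ℝ) ↦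
        osc Q t (symb ξ) * (Real.exp (-(r * (symb ξ + lam))) : ℂ))
        ((volume : Measure Plane).prod (volume.restrict (Ioi 0))) := by
      have h1 : Measurable fun p : Plane × ℝ ↦ (Real.exp (-(p.2 * (symb p.1 + lam))) : ℂ) :=
        Complex.measurable_ofReal.comp (Real.measurable_exp.comp
          (measurable_snd.mul (measurable_symb_fst.add_const lam)).neg)
      exact ((hm.comp measurable_fst).mul h1).aestronglyMeasurable
    rw [integrable_prod_iff hmeas]
    refine ⟨Eventually.of_forall fun ξ ↦
      Integrable.const_mul (integrableOn_exp_neg_mul_Ioi (symb_add_pos hlam ξ)) (osc Q t (symb ξ)), ?_⟩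
    have e4 : ∀ ξ : Plane, ∫ r in Ioi (0 : ℝ), ‖osc Q t (symb ξ) * (Real.exp (-(r * (symb ξ + lam))) : ℂ)‖ =
        ‖osc Q t (symb ξ) * (1 / ((symb ξ + lam : ℝ) : ℂ))‖ := by
      intro ξ
      have h0 := symb_add_pos hlam ξ
      have h1 := integral_exp_neg_mul_Ioi h0
      rw [integral_complex_ofReal] at h1
      have h2 : ∫ r in Ioi (0 : ℝ), Real.exp (-(r * (symb ξ + lam))) = 1 / (symb ξ + lam) := by
        exact_mod_cast h1
      simp only [norm_mul, Complex.norm_real, Real.norm_of_nonneg (Real.exp_pos _).le]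
      rw [integral_const_mul, h2, norm_div, norm_one, Complex.norm_real, Real.norm_of_nonneg h0.le]
    simp only [Function.uncurry]
    simp only [e4]
    exact ((memLp_osc_symb hQ hB t ht).integrable_mul (memLp_inv_symb hlam)).norm


/-! ### Evolution of the pairing with the Green function. -/

/-- The Duhamel integral with charge `e^{iλt}` is explicit. Multiplied by the initial charge, it
cancels the free evolution of the Green part of the datum and leaves `e^{iλt}` times that part; what
remains is driven by `relCharge`, which vanishes at `0` when `q` starts at the initial charge. -/
theorem osc_phase_right {lam : ℝ} {ω : ℝ} (h : 0 < ω + lam) (t : ℝ) :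
    Complex.I * osc (phase (-lam)) t ω =
      (phase (-lam) t - phase t ω) / ((ω + lam : ℝ) : ℂ) := by
  have e2 : ∀ τ, phase (t - τ) ω * phase (-lam) τ = phase t ω * phase τ (-(ω + lam)) := by
    intro τ
    rw [phase, phase, phase, phase, ← Complex.exp_add, ← Complex.exp_add]
    congr 1
    push_cast
    ring
  have h3 := intervalIntegral.integral_eq_sub_of_hasDerivAt (a := 0) (b := t)
    (fun s _ ↦ hasDerivAt_phase s (-(ω + lam))) ((by fun_prop : Continuous fun s : ℝ ↦
      -Complex.I * ((-(ω + lam) : ℝ) : ℂ) * phase s (-(ω + lam))).intervalIntegrable _ _)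
  rw [intervalIntegral.integral_const_mul, phase_zero_left] at h3
  have hne : ((ω + lam : ℝ) : ℂ) ≠ 0 := by exact_mod_cast h.ne'
  have e3 : phase (-lam) t = phase t ω * phase t (-(ω + lam)) := by
    have := e2 t
    rwa [sub_self, phase_zero_left, one_mul] at this
  rw [osc, intervalIntegral.integral_congr (g := fun τ ↦ phase t ω * phase τ (-(ω + lam)))
    (fun τ _ ↦ e2 τ), intervalIntegral.integral_const_mul, e3, eq_div_iff hne]
  push_cast at h3 ⊢
  linear_combination phase t ω * h3

theorem osc_relCharge {lam : ℝ} {q : ℝ → ℂ} {t : ℝ} (ht : 0 ≤ t) (hq : BddMeas q t) (q₀ : ℂ) (ω : ℝ) :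
    osc q t ω = osc (relCharge lam q₀ q) t ω + q₀ * osc (phase (-lam)) t ω := by
  have h1 : ∀ {g : ℝ → ℂ}, BddMeas g t →
      IntervalIntegrable (fun τ ↦ phase (t - τ) ω * g τ) volume 0 t := fun hg ↦
    (intervalIntegrable_iff_integrableOn_Ioc_of_le ht).2 (hg.integrableOn.bdd_mul (c := 1)
      (by fun_prop : Continuous fun s ↦ phase (t - s) ω).aestronglyMeasurable
      (Eventually.of_forall fun s ↦ (norm_phase _ _).le))
  rw [osc, osc, osc, ← intervalIntegral.integral_const_mul, ← intervalIntegral.integral_add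
    (h1 (hq.relCharge lam q₀)) ((h1 ((continuous_phase_right (-lam)).bddMeas t)).const_mul _)]
  refine intervalIntegral.integral_congr fun τ _ ↦ ?_
  simp only [relCharge]
  ring

variable {y : Plane} {lam : ℝ} {hlam : 0 < lam}

/-- The Duhamel formula in terms of the regular part of the datum. -/
theorem duhamelHat_eq (ψ : FormDomain y hlam) {q : ℝ → ℂ} {t : ℝ} (ht : 0 ≤ t)
    (hq : BddMeas q t) : ∀ᵐ ξ, duhamelHat y (𝓕 ψ.toL2) q t ξ =
      phase t (symb ξ) * (𝓕 ψ.reg : L2) ξ +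
      ψ.charge * phase (-lam) t * (wave y ξ / ((symb ξ + lam : ℝ) : ℂ)) +
      wave y ξ * (Complex.I * osc (relCharge lam ψ.charge q) t (symb ξ)) := by
  filter_upwards [fourier_toL2 ψ] with ξ h
  have h1 := osc_phase_right (symb_add_pos hlam ξ) t
  rw [duhamelHat, h, osc_relCharge (lam := lam) ht hq ψ.charge]
  linear_combination wave y ξ * ψ.charge * h1

/-- The Fourier representation of the pairing of the Duhamel formula with the Green function. -/
def greenPairing (ψ : FormDomain y hlam) (q : ℝ → ℂ) (t : ℝ) : ℂ :=
  ∫ ξ, starRingEnd ℂ (wave y ξ / ((symb ξ + lam : ℝ) : ℂ)) * duhamelHat y (𝓕 ψ.toL2) q t ξ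

theorem inner_green {f : L2} {ψ : FormDomain y hlam} {q : ℝ → ℂ} {t : ℝ}
    (hf : (𝓕 f : L2) =ᵐ[volume] duhamelHat y (𝓕 ψ.toL2) q t) :
    inner ℂ (green y hlam) f = greenPairing ψ q t := by
  rw [inner_eq_integral_fourier, greenPairing]
  refine integral_congr_ae ?_
  filter_upwards [hf, fourier_green y hlam] with ξ h1 h2
  rw [h1, h2]

/-- `m / (|p|² + λ)`. -/
def resolventSymb (lam : ℝ) (m : Plane → ℂ) (ξ : Plane) : ℂ := m ξ / ((symb ξ + lam : ℝ) : ℂ)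

theorem integrable_resolventSymb (hlam : 0 < lam) {m : Plane → ℂ} (hm : Integrable m) :
    Integrable (resolventSymb lam m) := by
  have hc : Continuous fun ξ ↦ (((symb ξ + lam : ℝ) : ℂ))⁻¹ := by
    refine Continuous.inv₀ (Complex.continuous_ofReal.comp (continuous_symb.add continuous_const))
      fun ξ ↦ ?_
    exact_mod_cast (symb_add_pos hlam ξ).ne'
  refine (hm.mul_bdd (c := lam⁻¹) hc.aestronglyMeasurable (Eventually.of_forall fun ξ ↦ ?_))
  rw [norm_inv, Complex.norm_real, Real.norm_of_nonneg (symb_add_pos hlam ξ).le]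
  exact inv_anti₀ hlam (by linarith [symb_nonneg ξ])

/-- The plane wave of the Green function cancels against those of the other factors. The regular
datum gives a `specTrace`, the Green part its own squared norm, and the relative charge a
convolution by `integral_osc_div`. -/
theorem greenPairing_eq {ψ : FormDomain y hlam} (hψ : ψ.IsAdmissible) {q : ℝ → ℂ} {B : ℝ}
    (hq : Measurable q) (hB : ∀ τ, ‖q τ‖ ≤ B) {t : ℝ} (ht : 0 ≤ t) :
    greenPairing ψ q t = specTrace (resolventSymb lam (sourceSymb ψ)) t +
      ψ.charge * (∫ ξ : Plane, (1 / ((symb ξ + lam : ℝ) : ℂ)) * (1 / ((symb ξ + lam : ℝ) : ℂ))) *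
        phase (-lam) t +
      Complex.I / (4 * Real.pi) * conv (greenTrace lam) (relCharge lam ψ.charge q) t := by
  have hQm : Measurable (relCharge lam ψ.charge q) :=
    hq.sub (((continuous_phase_right (-lam)).measurable).const_mul _)
  have hQB : ∀ τ, ‖relCharge lam ψ.charge q τ‖ ≤ B + ‖ψ.charge‖ := fun τ ↦ by
    refine (norm_sub_le _ _).trans (add_le_add (hB τ) ?_)
    rw [norm_mul, norm_phase, mul_one]
  have i1 : Integrable fun ξ ↦ phase t (symb ξ) * resolventSymb lam (sourceSymb ψ) ξ :=
    integrable_phase_mul (integrable_resolventSymb hlam (integrable_sourceSymb hψ)) t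
  have i2 : Integrable fun ξ : Plane ↦ (1 / ((symb ξ + lam : ℝ) : ℂ)) * (1 / ((symb ξ + lam : ℝ) : ℂ)) :=
    (memLp_inv_symb hlam).integrable_mul (memLp_inv_symb hlam)
  have i3 : Integrable fun ξ : Plane ↦ osc (relCharge lam ψ.charge q) t (symb ξ) / ((symb ξ + lam : ℝ) : ℂ) := by
    refine ((memLp_osc_symb hQm hQB t ht).integrable_mul (memLp_inv_symb hlam)).congr
      (Eventually.of_forall fun ξ ↦ ?_)
    simp only [Pi.mul_apply, mul_one_div]
  have e : ∀ᵐ ξ, starRingEnd ℂ (wave y ξ / ((symb ξ + lam : ℝ) : ℂ)) * duhamelHat y (𝓕 ψ.toL2) q t ξ =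
      (phase t (symb ξ) * resolventSymb lam (sourceSymb ψ) ξ +
      ψ.charge * phase (-lam) t * ((1 / ((symb ξ + lam : ℝ) : ℂ)) * (1 / ((symb ξ + lam : ℝ) : ℂ)))) +
      Complex.I * (osc (relCharge lam ψ.charge q) t (symb ξ) / ((symb ξ + lam : ℝ) : ℂ)) := by
    filter_upwards [duhamelHat_eq ψ ht (bddMeas_of_measurable hq hB t)] with ξ h
    have hw := conj_wave_mul_wave y ξ
    have hne : ((symb ξ + lam : ℝ) : ℂ) ≠ 0 := by exact_mod_cast (symb_add_pos hlam ξ).ne'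
    rw [h, map_div₀, Complex.conj_ofReal, resolventSymb, sourceSymb]
    linear_combination (1 / ((symb ξ + lam : ℝ) : ℂ)) * (ψ.charge * phase (-lam) t *
      (1 / ((symb ξ + lam : ℝ) : ℂ)) + Complex.I * osc (relCharge lam ψ.charge q) t (symb ξ)) * hw
  have i12 : Integrable fun ξ ↦ phase t (symb ξ) * resolventSymb lam (sourceSymb ψ) ξ +
      ψ.charge * phase (-lam) t * ((1 / ((symb ξ + lam : ℝ) : ℂ)) * (1 / ((symb ξ + lam : ℝ) : ℂ))) :=
    i1.add (i2.const_mul _)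
  rw [greenPairing, integral_congr_ae e, integral_add i12 (i3.const_mul _),
    integral_add i1 (i2.const_mul _), integral_const_mul, integral_const_mul,
    integral_osc_div hlam hQm hQB ht, specTrace]
  ring

theorem integral_specTrace {m : Plane → ℂ} (hm : Integrable m) {t : ℝ} (ht : 0 ≤ t) :
    ∫ s in (0 : ℝ)..t, specTrace m s = ∫ ξ, (∫ s in (0 : ℝ)..t, phase s (symb ξ)) * m ξ := by
  simp only [intervalIntegral.integral_of_le ht, specTrace]
  rw [integral_integral_swap]
  · simp only [integral_mul_const]
  · have h1 : Integrable (fun p : ℝ × Plane ↦ 1 * m p.2) ((volume.restrict (Ioc 0 t)).prod volume) :=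
      (integrable_const (1 : ℂ)).mul_prod hm
    refine h1.mono ?_ (Eventually.of_forall fun p ↦ ?_)
    · exact measurable_phase_symb.aestronglyMeasurable.mul hm.1.comp_snd
    · simp [Function.uncurry]

/-- At each frequency `i d/ds e^{-is|p|²} = |p|² e^{-is|p|²}`; adding `λ` produces the factor that
undoes the resolvent. -/
theorem specTrace_resolvent (hlam : 0 < lam) {m : Plane → ℂ} (hm : Integrable m) {t : ℝ} (ht : 0 ≤ t) :
    Complex.I * (specTrace (resolventSymb lam m) t - specTrace (resolventSymb lam m) 0) +
      lam * ∫ s in (0 : ℝ)..t, specTrace (resolventSymb lam m) s =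
      ∫ s in (0 : ℝ)..t, specTrace m s := by
  have hr := integrable_resolventSymb hlam hm
  have hi : ∀ {m : Plane → ℂ}, Integrable m →
      Integrable fun ξ ↦ (∫ s in (0 : ℝ)..t, phase s (symb ξ)) * m ξ := by
    intro m hm
    refine hm.bdd_mul (c := 1 * |t - 0|) ?_ (Eventually.of_forall fun ξ ↦
      intervalIntegral.norm_integral_le_of_norm_le_const fun s _ ↦ (norm_phase _ _).le)
    have : Continuous fun ω ↦ ∫ s in (0 : ℝ)..t, phase s ω :=
      intervalIntegral.continuous_parametric_intervalIntegral_of_continuous' (by fun_prop) _ _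
    exact (this.comp continuous_symb).aestronglyMeasurable
  rw [integral_specTrace hr ht, integral_specTrace hm ht, specTrace, specTrace,
    ← integral_sub (integrable_phase_mul hr t) (integrable_phase_mul hr 0), ← integral_const_mul,
    ← integral_const_mul, ← integral_add]
  · refine integral_congr_ae (Eventually.of_forall fun ξ ↦ ?_)
    have h3 := intervalIntegral.integral_eq_sub_of_hasDerivAt (a := 0) (b := t)
      (fun s _ ↦ hasDerivAt_phase s (symb ξ)) ((by fun_prop : Continuous fun s : ℝ ↦
        -Complex.I * symb ξ * phase s (symb ξ)).intervalIntegrable _ _)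
    rw [intervalIntegral.integral_const_mul] at h3
    have hne : ((symb ξ + lam : ℝ) : ℂ) ≠ 0 := by exact_mod_cast (symb_add_pos hlam ξ).ne'
    simp only [resolventSymb]
    generalize (∫ s in (0 : ℝ)..t, phase s (symb ξ)) = P at *
    have h4 : Complex.I * (phase t (symb ξ) - phase 0 (symb ξ)) = symb ξ * P := by
      rw [← h3]
      linear_combination (-symb ξ * P) * Complex.I_mul_I
    calc _ = (Complex.I * (phase t (symb ξ) - phase 0 (symb ξ)) + lam * P) * (m ξ / ((symb ξ + lam : ℝ) : ℂ)) := by ring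
      _ = _ := by
        rw [h4, ← add_mul, mul_right_comm, ← Complex.ofReal_add, mul_div_cancel₀ _ hne, mul_comm]
  · exact (((integrable_phase_mul hr t).sub (integrable_phase_mul hr 0)).const_mul _)
  · exact (hi hr).const_mul _

/-- The evolution of the pairing with the Green function: the defect is the convolved charge
equation. -/
theorem greenPairing_evolution {ψ : FormDomain y hlam} (hψ : ψ.IsAdmissible) {β₀ σ : ℝ}
    (hσ : 1 / 2 ≤ σ) {q : ℝ → ℂ} {B : ℝ} (hq : Measurable q) (hB : ∀ τ, ‖q τ‖ ≤ B) {t : ℝ}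
    (ht : 0 ≤ t) :
    IntervalIntegrable (greenPairing ψ q) volume 0 t ∧
    Complex.I * (greenPairing ψ q t - greenPairing ψ q 0) + lam * ∫ s in (0 : ℝ)..t, greenPairing ψ q s =
      conv (fun _ ↦ 1) (fun s ↦ β₀ * nl σ (q s) + formConst lam * q s) t -
      1 / (4 * Real.pi) * (conv logC q t - conv (fun _ ↦ 1)
        (chargeRHS lam β₀ σ ψ.charge (specTrace (sourceSymb ψ)) q) t) := by
  set κ : ℂ := ∫ ξ : Plane, (1 / ((symb ξ + lam : ℝ) : ℂ)) * (1 / ((symb ξ + lam : ℝ) : ℂ)) with hκ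
  set Q := relCharge lam ψ.charge q with hQ
  set u := specTrace (resolventSymb lam (sourceSymb ψ)) with hu
  have hqb := bddMeas_of_measurable hq hB t
  have hu1 : IntervalIntegrable u volume 0 t :=
    (continuous_specTrace (integrable_resolventSymb hlam (integrable_sourceSymb hψ))).intervalIntegrable _ _
  have hE : IntervalIntegrable (phase (-lam)) volume 0 t :=
    (continuous_phase_right (-lam)).intervalIntegrable _ _
  have hK : IntervalIntegrable (conv (greenTrace lam) Q) volume 0 t :=
    (intervalIntegrable_iff_integrableOn_Ioc_of_le ht).2
      (conv_one_greenTrace_assoc hlam ht (hqb.relCharge lam ψ.charge).integrableOn).2.1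
  have hsum : IntervalIntegrable (fun s ↦ u s + ψ.charge * κ * phase (-lam) s +
      Complex.I / (4 * Real.pi) * conv (greenTrace lam) Q s) volume 0 t :=
    (hu1.add (hE.const_mul _)).add (hK.const_mul _)
  have heq : ∀ s ∈ Icc 0 t, greenPairing ψ q s = u s + ψ.charge * κ * phase (-lam) s +
      Complex.I / (4 * Real.pi) * conv (greenTrace lam) Q s := fun s hs ↦
    greenPairing_eq hψ hq hB hs.1
  refine ⟨hsum.congr (fun s hs ↦ ?_), ?_⟩
  · rw [uIoc_of_le ht] at hs
    exact (heq s (Ioc_subset_Icc_self hs)).symm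
  have hint : ∫ s in (0 : ℝ)..t, greenPairing ψ q s = (∫ s in (0 : ℝ)..t, u s) +
      ψ.charge * κ * (∫ s in (0 : ℝ)..t, phase (-lam) s) +
      Complex.I / (4 * Real.pi) * ∫ s in (0 : ℝ)..t, conv (greenTrace lam) Q s := by
    rw [intervalIntegral.integral_congr (g := fun s ↦ u s + ψ.charge * κ * phase (-lam) s +
      Complex.I / (4 * Real.pi) * conv (greenTrace lam) Q s) (fun s hs ↦ heq s (by rwa [uIcc_of_le ht] at hs)),
      intervalIntegral.integral_add (hu1.add (hE.const_mul _)) (hK.const_mul _),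
      intervalIntegral.integral_add hu1 (hE.const_mul _), intervalIntegral.integral_const_mul,
      intervalIntegral.integral_const_mul]
  have h1 := specTrace_resolvent hlam (integrable_sourceSymb hψ) ht
  have h2 := conv_one_phase (lam := lam) t
  have h3 := conv_logC_sub_eq (β₀ := β₀) hlam hσ ψ.charge
    (continuous_specTrace (integrable_sourceSymb hψ)) ht hqb
  have h4 : conv (greenTrace lam) Q 0 = 0 := by simp [conv]
  have h5 : phase (-lam) 0 = 1 := by simp [phase]
  rw [conv_one] at h2
  rw [conv_one (conv _ _), conv_one (specTrace _)] at h3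
  rw [hint, heq t ⟨ht, le_rfl⟩, heq 0 ⟨le_rfl, ht⟩, h4, h5, h3]
  have hpi : (Real.pi : ℂ) ≠ 0 := by exact_mod_cast Real.pi_ne_zero
  rw [← hu] at h1
  have h6 : (1 / (4 * Real.pi) : ℂ) * (4 * Real.pi) = 1 := by field_simp
  have hI := Complex.I_mul_I
  linear_combination h1 - Complex.I * ψ.charge * κ * h2 +
    (1 / (4 * Real.pi) * conv (greenTrace lam) Q t + ψ.charge * κ * lam *
      ∫ s in (0 : ℝ)..t, phase (-lam) s) * hI +
    (conv (fun _ ↦ 1) (fun s ↦ β₀ * nl σ (q s) + formConst lam * q s) t -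
      ∫ s in (0 : ℝ)..t, specTrace (sourceSymb ψ) s) * h6


/-! ### The path of the weak solution -/

variable {y : Plane} {lam : ℝ} {hlam : 0 < lam}

/-- The regular part is prescribed by its transform: the free evolution of the regular datum plus
the profile `regOsc` of the relative charge. Both have weighted `L²` norms bounded uniformly in `t`,
and this uniform `M` later permits passing from band-limited to arbitrary regular test functions. -/
theorem exists_path (ψ : FormDomain y hlam) {T : ℝ} (hT0 : 0 < T) (hT : T ≤ 1 / 8) {q : ℝ → ℂ}
    {B : ℝ} (hq : Measurable q) (hB : ∀ τ, ‖q τ‖ ≤ B)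
    (hQ : HalfRegular (relCharge lam ψ.charge q) T) :
    ∃ (Ψ : ℝ → FormDomain y hlam) (M : ℝ), ∀ t ∈ Icc 0 T, (Ψ t).charge = q t ∧
      (𝓕 (Ψ t).toL2 : L2) =ᵐ[volume] duhamelHat y (𝓕 ψ.toL2) q t ∧
      (∀ j, ‖(Ψ t).grad j‖ ≤ M) ∧ ‖(Ψ t).reg‖ ≤ M ∧ ‖(Ψ t).toL2‖ ≤ M := by
  set Q := relCharge lam ψ.charge q with hQdef
  obtain ⟨K, hK, hKb⟩ := exists_lintegral_regOsc_le hlam hT0 hT hQ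
  set r : ℝ → Plane → ℂ := fun t ξ ↦ phase t (symb ξ) * (𝓕 ψ.reg : L2) ξ +
    wave y ξ * regOsc lam Q t (symb ξ) with hr
  have hmo : ∀ t, Measurable (regOsc lam Q t) := fun t ↦ by
    have h1 : Continuous fun ω ↦ osc Q t ω :=
      (continuous_osc hQ.continuous).comp (continuous_const.prodMk continuous_id)
    exact (h1.measurable.const_mul _).sub (measurable_const.div
      (Complex.measurable_ofReal.comp (measurable_id.add_const lam)))
  have hrm : ∀ t, AEStronglyMeasurable (r t) volume := fun t ↦
    (memLp_phase_mul t (𝓕 ψ.reg)).1.add ((continuous_wave y).measurable.mul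
      ((hmo t).comp continuous_symb.measurable)).aestronglyMeasurable
  set A : ℝ≥0∞ := ∫⁻ ξ, ENNReal.ofReal (1 + symb ξ) * ‖(𝓕 ψ.reg : L2) ξ‖ₑ ^ 2 with hA
  have hAfin : A ≠ ∞ := by
    have e : A = (∫⁻ ξ, ‖(𝓕 ψ.reg : L2) ξ‖ₑ ^ 2) +
        ∫⁻ ξ, ENNReal.ofReal (symb ξ) * ‖(𝓕 ψ.reg : L2) ξ‖ₑ ^ 2 := by
      rw [hA, ← lintegral_add_left' ((Lp.aestronglyMeasurable _).enorm.pow_const 2)]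
      refine lintegral_congr fun ξ ↦ ?_
      rw [ENNReal.ofReal_add zero_le_one (symb_nonneg ξ), ENNReal.ofReal_one, add_mul, one_mul]
    rw [e]
    refine ENNReal.add_ne_top.2 ⟨?_, (lintegral_symb_fourier_lt_top ψ.isWeakGradient).ne⟩
    rw [← eLpNorm_two_sq]
    exact ENNReal.pow_ne_top (Lp.memLp _).2.ne
  set K' : ℝ≥0∞ := 2 * A + 2 * (ENNReal.ofReal (1 / (4 * Real.pi)) * K) with hK'
  have hK'fin : K' ≠ ∞ := ENNReal.add_ne_top.2 ⟨ENNReal.mul_ne_top (by norm_num) hAfin,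
    ENNReal.mul_ne_top (by norm_num) (ENNReal.mul_ne_top ENNReal.ofReal_ne_top hK)⟩
  have hrK : ∀ t ∈ Icc 0 T, ∫⁻ ξ, ENNReal.ofReal (1 + symb ξ) * ‖r t ξ‖ₑ ^ 2 ≤ K' := by
    intro t ht
    have hF : Measurable fun ω ↦ ENNReal.ofReal (1 + ω) * ‖regOsc lam Q t ω‖ₑ ^ 2 :=
      (ENNReal.measurable_ofReal.comp (measurable_const.add measurable_id)).mul
        ((hmo t).enorm.pow_const 2)
    calc _ ≤ ∫⁻ ξ, (2 * (ENNReal.ofReal (1 + symb ξ) * ‖(𝓕 ψ.reg : L2) ξ‖ₑ ^ 2) +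
          2 * (ENNReal.ofReal (1 + symb ξ) * ‖regOsc lam Q t (symb ξ)‖ₑ ^ 2)) := by
          refine lintegral_mono fun ξ ↦ ?_
          have h := enorm_add_sq_le (phase t (symb ξ) * (𝓕 ψ.reg : L2) ξ)
            (wave y ξ * regOsc lam Q t (symb ξ))
          have e1 : ‖phase t (symb ξ) * (𝓕 ψ.reg : L2) ξ‖ₑ = ‖(𝓕 ψ.reg : L2) ξ‖ₑ := by
            rw [← ofReal_norm, norm_mul, norm_phase, one_mul, ofReal_norm]
          have e2 : ‖wave y ξ * regOsc lam Q t (symb ξ)‖ₑ = ‖regOsc lam Q t (symb ξ)‖ₑ := by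
            rw [← ofReal_norm, norm_mul, norm_wave, one_mul, ofReal_norm]
          rw [e1, e2] at h
          refine (mul_le_mul_right h _).trans (le_of_eq ?_)
          ring
      _ = 2 * A + 2 * ∫⁻ ξ, ENNReal.ofReal (1 + symb ξ) * ‖regOsc lam Q t (symb ξ)‖ₑ ^ 2 := by
          have hm2 : Measurable fun ξ ↦ ENNReal.ofReal (1 + symb ξ) * ‖regOsc lam Q t (symb ξ)‖ₑ ^ 2 :=
            hF.comp continuous_symb.measurable
          rw [lintegral_add_right _ (hm2.const_mul 2), lintegral_const_mul' _ _ (by norm_num),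
            lintegral_const_mul' _ _ (by norm_num)]
      _ ≤ K' := by
          rw [lintegral_comp_symb hF, hK']
          gcongr
          exact hKb t ht
  have hr0 : ∀ t ∈ Icc 0 T, ∫⁻ ξ, ‖r t ξ‖ₑ ^ 2 ≤ K' := fun t ht ↦
    (lintegral_mono fun ξ ↦ by
      refine le_mul_of_one_le_left' ?_
      rw [← ENNReal.ofReal_one]
      exact ENNReal.ofReal_le_ofReal (by linarith [symb_nonneg ξ])).trans (hrK t ht)
  have hr1 : ∀ t ∈ Icc 0 T, ∫⁻ ξ, ENNReal.ofReal (symb ξ) * ‖r t ξ‖ₑ ^ 2 ≤ K' := fun t ht ↦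
    (lintegral_mono fun ξ ↦ by
      gcongr
      linarith).trans (hrK t ht)
  set M : ℝ := Real.sqrt K'.toReal + B * ‖green y hlam‖ with hM
  have hB0 : 0 ≤ B := (norm_nonneg _).trans (hB 0)
  have hM1 : Real.sqrt K'.toReal ≤ M := le_add_of_nonneg_right (by positivity)
  have hex : ∀ t, ∃ φ : FormDomain y hlam, t ∈ Icc 0 T →
      φ.charge = q t ∧ (𝓕 φ.reg : L2) =ᵐ[volume] r t := by
    intro t
    by_cases ht : t ∈ Icc 0 T
    · obtain ⟨φ, h1, h2⟩ := exists_formDomain y hlam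
        (memLp_two_of_lintegral (hrm t) ((hr0 t ht).trans_lt hK'fin.lt_top))
        ((hr1 t ht).trans_lt hK'fin.lt_top) (q t)
      exact ⟨φ, fun _ ↦ ⟨h1, h2⟩⟩
    · exact ⟨ψ, fun h ↦ absurd h ht⟩
  choose Ψ hΨ using hex
  refine ⟨Ψ, M, fun t ht ↦ ?_⟩
  obtain ⟨hc, hreg⟩ := hΨ t ht
  have hnr : ‖(Ψ t).reg‖ ≤ Real.sqrt K'.toReal := by
    refine norm_le_of_lintegral_fourier hK'fin (le_trans (le_of_eq ?_) (hr0 t ht))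
    refine lintegral_congr_ae ?_
    filter_upwards [hreg] with ξ h
    rw [h]
  refine ⟨hc, ?_, fun j ↦ ?_, hnr.trans hM1, ?_⟩
  · filter_upwards [fourier_toL2 (Ψ t), hreg, duhamelHat_eq ψ ht.1 (bddMeas_of_measurable hq hB t)]
      with ξ h1 h2 h3
    rw [h1, h2, h3, hc, hr, ← hQdef]
    simp only [regOsc]
    have : Q t = q t - ψ.charge * phase (-lam) t := rfl
    rw [this]
    ring
  · refine (norm_le_of_lintegral_fourier hK'fin (le_trans ?_ (hr1 t ht))).trans hM1
    refine le_trans (le_of_eq ?_) (lintegral_coord_le (r t) j)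
    refine lintegral_congr_ae ?_
    filter_upwards [(isWeakGradient_iff _ _).1 (Ψ t).isWeakGradient j, hreg] with ξ h1 h2
    rw [h1, h2]
  · refine (norm_add_le _ _).trans (add_le_add hnr ?_)
    rw [norm_smul, hc]
    exact mul_le_mul_of_nonneg_right (hB t) (norm_nonneg _)

/-- Extending the integrand by constants beyond `[0, T]` lets the two-sided fundamental theorem
deliver the one-sided derivatives at the end points. -/
theorem hasDerivWithinAt_of_primitive {f g : ℝ → ℂ} {T : ℝ} (hT : 0 ≤ T) (hg : ContinuousOn g (Icc 0 T))
    (h : ∀ t ∈ Icc 0 T, f t = f 0 + ∫ s in (0 : ℝ)..t, g s) {t : ℝ} (ht : t ∈ Icc 0 T) :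
    HasDerivWithinAt f (g t) (Icc 0 T) t := by
  have hc : Continuous (IccExtend hT ((Icc 0 T).domRestrict g)) :=
    (continuousOn_iff_continuous_domRestrict.1 hg).Icc_extend'
  have he : ∀ s ∈ Icc 0 T, IccExtend hT ((Icc 0 T).domRestrict g) s = g s := fun s hs ↦ by
    rw [IccExtend_of_mem _ _ hs]; rfl
  have hd := ((hc.integral_hasStrictDerivAt 0 t).hasDerivAt.const_add (f 0)).hasDerivWithinAt (s := Icc 0 T)
  rw [he t ht] at hd
  refine hd.congr (fun s hs ↦ ?_) ?_
  · rw [h s hs]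
    congr 1
    refine intervalIntegral.integral_congr fun u hu ↦ ?_
    rw [uIcc_of_le hs.1] at hu
    exact (he u ⟨hu.1, hu.2.trans hs.2⟩).symm
  · rw [h t ht]
    congr 1
    refine intervalIntegral.integral_congr fun u hu ↦ ?_
    rw [uIcc_of_le ht.1] at hu
    exact (he u ⟨hu.1, hu.2.trans ht.2⟩).symm

/-- A path with the Fourier representation of the Duhamel formula and bounded energy satisfies the
weak equation for all regular test functions. -/
theorem inner_reg_path {ψ : FormDomain y hlam} {T : ℝ} (hT : 0 ≤ T) {q : ℝ → ℂ} {B M : ℝ} (hq : Continuous q)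
    (hB : ∀ τ, ‖q τ‖ ≤ B) {Ψ : ℝ → FormDomain y hlam}
    (hΨ : ∀ t ∈ Icc 0 T, (Ψ t).charge = q t ∧
      (𝓕 (Ψ t).toL2 : L2) =ᵐ[volume] duhamelHat y (𝓕 ψ.toL2) q t ∧
      (∀ j, ‖(Ψ t).grad j‖ ≤ M) ∧ ‖(Ψ t).reg‖ ≤ M ∧ ‖(Ψ t).toL2‖ ≤ M) (χ : FormDomain y hlam) {t : ℝ}
    (ht : t ∈ Icc 0 T) : HasDerivWithinAt (fun s ↦ inner ℂ χ.reg (Ψ s).toL2)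
      (-Complex.I * regForm χ (Ψ t)) (Icc 0 T) t := by
  obtain ⟨X, hX, hXg, hXr⟩ := exists_band_approx χ
  have hM : 0 ≤ M := (norm_nonneg _).trans (hΨ t ht).2.2.2.1
  have hreg : ∀ n : ℕ, ∀ s ∈ Icc 0 T, regForm (X n) (Ψ s) =
      (∫ ξ, starRingEnd ℂ ((𝓕 (X n).reg : L2) ξ) * (symb ξ * duhamelHat y (𝓕 ψ.toL2) q s ξ)) -
        q s * ∫ ξ, starRingEnd ℂ ((𝓕 (X n).reg : L2) ξ) * wave y ξ := by
    intro n s hs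
    rw [regForm_band (hX n), (hΨ s hs).1]
    congr 1
    refine integral_congr_ae ?_
    filter_upwards [(hΨ s hs).2.1] with ξ h
    rw [h]
  have hcn : ∀ n, ContinuousOn (fun s ↦ regForm (X n) (Ψ s)) (Icc 0 T) := fun n ↦
    (((hX n).continuousOn_pairing hq.measurable hB continuous_symb_ofReal T).sub (hq.continuousOn.mul continuousOn_const)).congr
      (hreg n)
  have hprim : ∀ n, ∀ s ∈ Icc 0 T, inner ℂ (X n).reg (Ψ s).toL2 = inner ℂ (X n).reg (Ψ 0).toL2 +
      ∫ u in (0 : ℝ)..s, -Complex.I * regForm (X n) (Ψ u) := by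
    intro n s hs
    have h := band_pairing_duhamelHat (y := y) (a := (𝓕 ψ.toL2 : L2)) hq.measurable hB hs.1 (hX n)
    have e : ∀ u ∈ Icc 0 T, inner ℂ (X n).reg (Ψ u).toL2 =
        ∫ ξ, starRingEnd ℂ ((𝓕 (X n).reg : L2) ξ) * duhamelHat y (𝓕 ψ.toL2) q u ξ := by
      intro u hu
      rw [inner_eq_integral_fourier]
      refine integral_congr_ae ?_
      filter_upwards [(hΨ u hu).2.1] with ξ h
      rw [h]
    rw [e s hs, e 0 ⟨le_rfl, hT⟩]
    simp only [duhamelHat_zero]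
    rw [← sub_eq_iff_eq_add', h]
    refine intervalIntegral.integral_congr fun u hu ↦ ?_
    rw [uIcc_of_le hs.1] at hu
    rw [hreg n u ⟨hu.1, hu.2.trans hs.2⟩]
  set ε : ℕ → ℝ := fun n ↦ ‖χ.grad 0 - (X n).grad 0‖ + ‖χ.grad 1 - (X n).grad 1‖ +
    ‖χ.reg - (X n).reg‖ with hε
  have hε0 : Tendsto ε atTop (𝓝 0) := by simpa using ((hXg 0).add (hXg 1)).add hXr
  have hbd : ∀ n, ∀ s ∈ Icc 0 T, ‖regForm χ (Ψ s) - regForm (X n) (Ψ s)‖ ≤ (2 + 2 * lam) * (ε n * M) := by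
    intro n s hs
    have n0 := norm_nonneg (χ.grad 0 - (X n).grad 0)
    have n1 := norm_nonneg (χ.grad 1 - (X n).grad 1)
    have n2 := norm_nonneg (χ.reg - (X n).reg)
    refine norm_regForm_sub_le (fun j ↦ ?_) (by simp only [hε]; linarith) (hΨ s hs).2.2.1 (hΨ s hs).2.2.2.1
      (hΨ s hs).2.2.2.2
    fin_cases j <;> simp only [hε, Fin.zero_eta, Fin.mk_one] <;> linarith
  have hlim0 : Tendsto (fun n ↦ (2 + 2 * lam) * (ε n * M)) atTop (𝓝 0) := by
    simpa using (hε0.mul_const M).const_mul (2 + 2 * lam)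
  -- The energy bound is uniform in time, so the band-limited derivatives converge uniformly; their
  -- limit is continuous and the integral identities pass to the limit.
  have huc : TendstoUniformlyOn (fun n s ↦ regForm (X n) (Ψ s)) (fun s ↦ regForm χ (Ψ s)) atTop (Icc 0 T) := by
    rw [Metric.tendstoUniformlyOn_iff]
    intro δ hδ
    filter_upwards [hlim0.eventually (gt_mem_nhds hδ)] with n hn s hs
    rw [dist_eq_norm]
    exact (hbd n s hs).trans_lt hn
  have hcont : ContinuousOn (fun s ↦ regForm χ (Ψ s)) (Icc 0 T) :=
    huc.continuousOn (Frequently.of_forall hcn)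
  refine hasDerivWithinAt_of_primitive hT (continuousOn_const.mul hcont) (fun s hs ↦ ?_) ht
  have l1 : ∀ u, Tendsto (fun n ↦ inner ℂ (X n).reg (Ψ u).toL2) atTop (𝓝 (inner ℂ χ.reg (Ψ u).toL2)) := by
    intro u
    have : Tendsto (fun n ↦ (X n).reg) atTop (𝓝 χ.reg) := by
      rw [tendsto_iff_norm_sub_tendsto_zero]
      simpa only [norm_sub_rev] using hXr
    exact this.inner tendsto_const_nhds
  have hii : ∀ {g : ℝ → ℂ}, ContinuousOn g (Icc 0 T) → IntervalIntegrable g volume 0 s := fun hg ↦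
    (hg.mono (by rw [uIcc_of_le hs.1]; exact Icc_subset_Icc_right hs.2)).intervalIntegrable
  have l2 : Tendsto (fun n ↦ ∫ u in (0 : ℝ)..s, -Complex.I * regForm (X n) (Ψ u)) atTop
      (𝓝 (∫ u in (0 : ℝ)..s, -Complex.I * regForm χ (Ψ u))) := by
    rw [tendsto_iff_norm_sub_tendsto_zero]
    refine squeeze_zero (fun n ↦ norm_nonneg _) (fun n ↦ ?_) (g := fun n ↦ (2 + 2 * lam) * (ε n * M) * |s - 0|) (by simpa using hlim0.mul_const |s - 0|)
    rw [← intervalIntegral.integral_sub ((hii (hcn n)).const_mul _) ((hii hcont).const_mul _)]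
    refine intervalIntegral.norm_integral_le_of_norm_le_const fun u hu ↦ ?_
    rw [uIoc_of_le hs.1] at hu
    rw [← mul_sub, norm_mul, norm_neg, Complex.norm_I, one_mul, norm_sub_rev]
    exact hbd n u ⟨hu.1.le, hu.2.trans hs.2⟩
  exact tendsto_nhds_unique ((l1 s).congr fun n ↦ hprim n s hs) ((l1 0).add l2)

/-- The regular component of a test function is covered by `inner_reg_path`. For the Green
component, `hJ` annihilates the defect in `greenPairing_evolution`; solved for the pairing, the
resulting integral identity gives first continuity and then differentiability. -/
theorem isWeakSolution_of_path {ψ : FormDomain y hlam} (hψ : ψ.IsAdmissible) {β₀ σ : ℝ} (hσ : 1 / 2 ≤ σ)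
    {T : ℝ} (hT : 0 ≤ T) {q : ℝ → ℂ} {B M : ℝ} (hq : Continuous q)
    (hB : ∀ τ, ‖q τ‖ ≤ B) (hJ : ∀ t ∈ Ioc 0 T, conv logC q t = conv (fun _ ↦ 1)
      (chargeRHS lam β₀ σ ψ.charge (specTrace (sourceSymb ψ)) q) t) {Ψ : ℝ → FormDomain y hlam}
    (hΨ : ∀ t ∈ Icc 0 T, (Ψ t).charge = q t ∧
      (𝓕 (Ψ t).toL2 : L2) =ᵐ[volume] duhamelHat y (𝓕 ψ.toL2) q t ∧
      (∀ j, ‖(Ψ t).grad j‖ ≤ M) ∧ ‖(Ψ t).reg‖ ≤ M ∧ ‖(Ψ t).toL2‖ ≤ M) :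
    IsWeakSolution β₀ σ T ψ Ψ := by
  refine ⟨L2.ext_fourier ?_, ⟨B, fun t ht ↦ (hΨ t ht).1 ▸ hB t⟩, fun χ t ht ↦ ?_⟩
  · filter_upwards [(hΨ 0 ⟨le_rfl, hT⟩).2.1] with ξ h
    rw [h, duhamelHat_zero]
  set Y := greenPairing ψ q with hY
  set N : ℝ → ℂ := fun s ↦ β₀ * nl σ (q s) + formConst lam * q s with hN
  have hNc : Continuous N :=
    (continuous_const.mul ((continuous_nl hσ).comp hq)).add (continuous_const.mul hq)
  have hev : ∀ s ∈ Icc 0 T, Complex.I * (Y s - Y 0) + lam * ∫ u in (0 : ℝ)..s, Y u =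
      ∫ u in (0 : ℝ)..s, N u := by
    intro s hs
    have h := (greenPairing_evolution hψ (β₀ := β₀) hσ hq.measurable hB hs.1).2
    have h0 : conv logC q s = conv (fun _ ↦ 1)
        (chargeRHS lam β₀ σ ψ.charge (specTrace (sourceSymb ψ)) q) s := by
      rcases eq_or_lt_of_le hs.1 with rfl | hs0
      · simp [conv]
      · exact hJ s ⟨hs0, hs.2⟩
    rw [h0, sub_self, mul_zero, sub_zero, conv_one] at h
    exact h
  have hYi := (greenPairing_evolution hψ (β₀ := β₀) hσ hq.measurable hB hT).1
  have hYp : ContinuousOn (fun s ↦ ∫ u in (0 : ℝ)..s, Y u) (Icc 0 T) := by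
    have := intervalIntegral.continuousOn_primitive_interval (f := Y) (a := 0) (b := T) (μ := volume) (by
      rw [uIcc_of_le hT, integrableOn_Icc_iff_integrableOn_Ioc]
      exact (intervalIntegrable_iff_integrableOn_Ioc_of_le hT).1 hYi)
    rwa [uIcc_of_le hT] at this
  have hNp : Continuous fun s ↦ ∫ u in (0 : ℝ)..s, N u :=
    intervalIntegral.continuous_primitive (fun a b ↦ hNc.intervalIntegrable a b) 0
  have hYeq : ∀ s ∈ Icc 0 T, Y s = Y 0 - Complex.I * (∫ u in (0 : ℝ)..s, N u) +
      Complex.I * lam * ∫ u in (0 : ℝ)..s, Y u := by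
    intro s hs
    have := hev s hs
    linear_combination -Complex.I * this + (Y s - Y 0) * Complex.I_mul_I
  have hYc : ContinuousOn Y (Icc 0 T) :=
    ((continuousOn_const.sub (continuous_const.mul hNp).continuousOn).add
      (continuousOn_const.mul hYp)).congr hYeq
  have hYd : HasDerivWithinAt Y (-Complex.I * (-lam * Y t + N t)) (Icc 0 T) t := by
    refine hasDerivWithinAt_of_primitive (g := fun s ↦ -Complex.I * (-lam * Y s + N s)) hT
      (continuousOn_const.mul ((continuousOn_const.mul hYc).add hNc.continuousOn)) (fun s hs ↦ ?_) ht
    have i1 : IntervalIntegrable Y volume 0 s :=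
      (hYc.mono (by rw [uIcc_of_le hs.1]; exact Icc_subset_Icc_right hs.2)).intervalIntegrable
    rw [intervalIntegral.integral_const_mul, intervalIntegral.integral_add (i1.const_mul _)
      (hNc.intervalIntegrable _ _), intervalIntegral.integral_const_mul, hYeq s hs]
    ring
  have hG : HasDerivWithinAt (fun s ↦ inner ℂ (green y hlam) (Ψ s).toL2)
      (-Complex.I * (-lam * Y t + N t)) (Icc 0 T) t :=
    hYd.congr (fun s hs ↦ inner_green (hΨ s hs).2.1) (inner_green (hΨ t ht).2.1)
  have hsum := (inner_reg_path hT hq hB hΨ χ ht).add (hG.const_mul (starRingEnd ℂ χ.charge))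
  have e1 : ∀ s, inner ℂ χ.toL2 (Ψ s).toL2 = inner ℂ χ.reg (Ψ s).toL2 +
      starRingEnd ℂ χ.charge * inner ℂ (green y hlam) (Ψ s).toL2 := fun s ↦ by
    rw [FormDomain.toL2, inner_add_left, inner_smul_left]
  simp only [e1]
  refine hsum.congr_deriv ?_
  rw [form_eq, inner_green (hΨ t ht).2.1, (hΨ t ht).1]
  simp only [hN, nl]
  push_cast
  ring


/-! ### Uniqueness for the band-limited Volterra system -/

theorem inner_eq_integral (X f : L2) : inner ℂ X f = ∫ ξ, starRingEnd ℂ (X ξ) * f ξ := by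
  rw [L2.inner_def]
  refine integral_congr_ae (Eventually.of_forall fun ξ ↦ ?_)
  exact (RCLike.inner_apply _ _).trans (mul_comm _ _)

/-- Multiplication of a band-limited function by `|p|²`. -/
def Band.symbMul {R : ℝ} {X : L2} (hX : Band R X) : L2 :=
  (hX.memLp_mul continuous_symb_ofReal).toLp _

theorem Band.coeFn_symbMul {R : ℝ} {X : L2} (hX : Band R X) :
    hX.symbMul =ᵐ[volume] fun ξ ↦ symb ξ * X ξ :=
  MemLp.coeFn_toLp _

theorem Band.band_symbMul {R : ℝ} {X : L2} (hX : Band R X) : Band R hX.symbMul := by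
  filter_upwards [hX.coeFn_symbMul, hX] with ξ h h' hR
  rw [h, h' hR, mul_zero]

theorem Band.norm_symbMul_le {R : ℝ} {X : L2} (hX : Band R X) :
    ‖hX.symbMul‖ ≤ (2 * Real.pi * R) ^ 2 * ‖X‖ := by
  refine Lp.norm_le_mul_norm_of_ae_le_mul ?_
  filter_upwards [hX.coeFn_symbMul, hX] with ξ h h'
  rw [h, norm_mul, Complex.norm_real, Real.norm_of_nonneg (symb_nonneg ξ)]
  rcases le_or_gt ‖ξ‖ R with hR | hR
  · refine mul_le_mul_of_nonneg_right ?_ (norm_nonneg _)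
    unfold symb
    gcongr
  · simp [h' hR]

theorem Band.inner_symbMul {R : ℝ} {X : L2} (hX : Band R X) (f : L2) :
    inner ℂ hX.symbMul f = ∫ ξ, starRingEnd ℂ (X ξ) * (symb ξ * f ξ) := by
  rw [inner_eq_integral]
  refine integral_congr_ae ?_
  filter_upwards [hX.coeFn_symbMul] with ξ h
  rw [h, map_mul, Complex.conj_ofReal]
  ring

/-- The restriction of an `L²` function to the ball of radius `R`. -/
def bandCut (R : ℝ) (f : L2) : L2 :=
  ((Lp.memLp f).indicator (s := Metric.closedBall 0 R) measurableSet_closedBall).toLp _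

theorem coeFn_bandCut (R : ℝ) (f : L2) :
    bandCut R f =ᵐ[volume] (Metric.closedBall 0 R).indicator f := MemLp.coeFn_toLp _

theorem band_bandCut (R : ℝ) (f : L2) : Band R (bandCut R f) := by
  filter_upwards [coeFn_bandCut R f] with ξ h h'
  rw [h, indicator_of_notMem (by simpa using h')]

theorem inner_bandCut (R : ℝ) (f g : L2) : inner ℂ (bandCut R f) g = inner ℂ f (bandCut R g) := by
  rw [inner_eq_integral, inner_eq_integral]
  refine integral_congr_ae ?_
  filter_upwards [coeFn_bandCut R f, coeFn_bandCut R g] with ξ h1 h2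
  rw [h1, h2]
  by_cases h : ξ ∈ Metric.closedBall (0 : Plane) R <;> simp [h]

theorem Band.inner_bandCut_right {R : ℝ} {X : L2} (hX : Band R X) (f : L2) :
    inner ℂ X (bandCut R f) = inner ℂ X f := by
  rw [inner_eq_integral, inner_eq_integral]
  refine integral_congr_ae ?_
  filter_upwards [hX, coeFn_bandCut R f] with ξ h1 h2
  rw [h2]
  rcases le_or_gt ‖ξ‖ R with h | h
  · rw [indicator_of_mem (by simpa using h)]
  · simp [h1 h]

theorem eq_zero_of_bandCut {f : L2} (h : ∀ n : ℕ, bandCut n f = 0) : f = 0 := by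
  rw [Lp.eq_zero_iff_ae_eq_zero]
  have h1 : ∀ n : ℕ, (Metric.closedBall (0 : Plane) n).indicator f =ᵐ[volume] 0 := fun n ↦
    (coeFn_bandCut n f).symm.trans ((Lp.eq_zero_iff_ae_eq_zero).1 (h n))
  filter_upwards [ae_all_iff.2 h1] with ξ h2
  obtain ⟨n, hn⟩ := exists_nat_ge ‖ξ‖
  have := h2 n
  rwa [indicator_of_mem (by simpa using hn)] at this

/-- On a frequency ball `|p|²` acts as a bounded operator, so iterating the homogeneous equation `k`
times produces `(Mt)^k / k!`. The hypotheses give only weak continuity; the uniform norm bound that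
starts the iteration comes from the Banach–Steinhaus theorem on each band. -/
theorem eq_zero_of_band_volterra {z : ℝ → L2} {T : ℝ}
    (hc : ∀ {R : ℝ} {X : L2}, Band R X → ContinuousOn (fun t ↦ inner ℂ X (z t)) (Icc 0 T))
    (hz : ∀ {R : ℝ} {X : L2} (hX : Band R X), ∀ t ∈ Icc 0 T,
      inner ℂ X (z t) = ∫ s in (0 : ℝ)..t, -Complex.I * inner ℂ hX.symbMul (z s)) :
    ∀ t ∈ Icc 0 T, z t = 0 := by
  intro t ht
  refine eq_zero_of_bandCut fun n ↦ ?_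
  obtain ⟨C, hC⟩ : ∃ C, ∀ s : Icc (0 : ℝ) T, ‖innerSL ℂ (bandCut n (z s))‖ ≤ C := by
    refine banach_steinhaus fun X ↦ ?_
    obtain ⟨C, hC⟩ := isCompact_Icc.exists_bound_of_continuousOn (hc (band_bandCut n X))
    refine ⟨C, fun s ↦ ?_⟩
    rw [innerSL_apply_apply, inner_bandCut, norm_inner_symm]
    exact hC s s.2
  simp only [innerSL_apply_norm] at hC
  have hC0 : 0 ≤ C := (norm_nonneg _).trans (hC ⟨t, ht⟩)
  set M : ℝ := (2 * Real.pi * n) ^ 2 with hM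
  have key : ∀ k : ℕ, ∀ X : L2, Band n X → ∀ s ∈ Icc 0 T,
      ‖inner ℂ X (z s)‖ ≤ ‖X‖ * C * (M ^ k * s ^ k / k.factorial) := by
    intro k
    induction k with
    | zero =>
      intro X hX s hs
      rw [← hX.inner_bandCut_right]
      simpa using (norm_inner_le_norm _ _).trans
        (mul_le_mul_of_nonneg_left (hC ⟨s, hs⟩) (norm_nonneg X))
    | succ k ih =>
      intro X hX s hs
      rw [hz hX s hs]
      have hb : ∀ u ∈ Ioc 0 s, ‖-Complex.I * inner ℂ hX.symbMul (z u)‖ ≤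
          ‖X‖ * C * (M ^ (k + 1) / k.factorial) * u ^ k := by
        intro u hu
        rw [norm_mul, norm_neg, Complex.norm_I, one_mul]
        refine (ih _ hX.band_symbMul u ⟨hu.1.le, hu.2.trans hs.2⟩).trans ?_
        have hu0 := hu.1.le
        calc _ ≤ (M * ‖X‖) * C * (M ^ k * u ^ k / k.factorial) := by
              gcongr
              exact hX.norm_symbMul_le
          _ = _ := by rw [pow_succ]; ring
      refine (intervalIntegral.norm_integral_le_of_norm_le hs.1 (Eventually.of_forall hb)
        ((continuous_const.mul (continuous_pow k)).intervalIntegrable _ _)).trans (le_of_eq ?_)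
      rw [intervalIntegral.integral_const_mul, integral_pow, Nat.factorial_succ]
      have : (k.factorial : ℝ) ≠ 0 := by positivity
      push_cast
      field_simp
      ring
  have hlim := (FloorSemiring.tendsto_pow_div_factorial_atTop (M * t)).const_mul
    (‖bandCut n (z t)‖ * C)
  rw [mul_zero] at hlim
  have h0 : ‖inner ℂ (bandCut n (z t)) (z t)‖ ≤ 0 := by
    refine ge_of_tendsto' hlim fun k ↦ ?_
    rw [mul_pow]
    exact key k _ (band_bandCut n (z t)) t ht
  rw [← (band_bandCut n (z t)).inner_bandCut_right] at h0
  exact inner_self_eq_zero.1 (norm_le_zero_iff.1 h0)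

/-! ### Weak solutions in Fourier variables -/

variable {y : Plane} {lam : ℝ} {hlam : 0 < lam}

theorem Band.exists_formDomain {R : ℝ} {X : L2} (hX : Band R X) (y : Plane) {lam : ℝ}
    (hlam : 0 < lam) : ∃ χ : FormDomain y hlam, χ.charge = 0 ∧ (𝓕 χ.reg : L2) = X := by
  have hm := hX.memLp_mul (c := fun ξ ↦ ((Real.sqrt (symb ξ) : ℝ) : ℂ))
    (Complex.continuous_ofReal.comp (Real.continuous_sqrt.comp continuous_symb))
  have h : ∫⁻ ξ, ENNReal.ofReal (symb ξ) * ‖X ξ‖ₑ ^ 2 < ∞ := by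
    have h1 := ENNReal.pow_lt_top (n := 2) hm.2
    rw [eLpNorm_two_sq] at h1
    refine lt_of_le_of_lt (le_of_eq (lintegral_congr fun ξ ↦ ?_)) h1
    rw [enorm_mul, mul_pow, ← ofReal_norm (((Real.sqrt (symb ξ) : ℝ) : ℂ)), Complex.norm_real,
      ← ENNReal.ofReal_pow (norm_nonneg _), Real.norm_of_nonneg (Real.sqrt_nonneg _),
      Real.sq_sqrt (symb_nonneg ξ)]
  obtain ⟨χ, h1, h2⟩ := PointNLS.exists_formDomain y hlam (Lp.memLp X) h 0
  exact ⟨χ, h1, Lp.ext h2⟩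

/-- The test function has charge zero and transform `X`. By `regForm_band` the regular part and
gradient of the solution disappear, leaving only its `L²` function and its charge. -/
theorem IsWeakSolution.hasDerivWithinAt_band {β₀ σ T : ℝ} {ψ : FormDomain y hlam}
    {Ψ : ℝ → FormDomain y hlam} (hW : IsWeakSolution β₀ σ T ψ Ψ) {R : ℝ} {X : L2} (hX : Band R X)
    {t : ℝ} (ht : t ∈ Icc 0 T) :
    HasDerivWithinAt (fun s ↦ inner ℂ X (𝓕 (Ψ s).toL2 : L2))
      (-Complex.I * (inner ℂ hX.symbMul (𝓕 (Ψ t).toL2 : L2) -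
        (Ψ t).charge * ∫ ξ, starRingEnd ℂ (X ξ) * wave y ξ)) (Icc 0 T) t := by
  obtain ⟨χ, h1, h2⟩ := hX.exists_formDomain y hlam
  have h := hW.equation χ t ht
  have e : ∀ s, inner ℂ χ.toL2 (Ψ s).toL2 = inner ℂ X (𝓕 (Ψ s).toL2 : L2) := fun s ↦ by
    rw [FormDomain.toL2, h1, zero_smul, add_zero, ← h2, Lp.inner_fourier_eq]
  simp only [e] at h
  rw [form_eq, h1, map_zero, zero_mul, add_zero, regForm_band (R := R) (by rwa [h2])] at h
  simp only [h2] at h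
  rwa [hX.inner_symbMul]

/-- The test function has zero regular part and charge `1`, so only the Green component of `form_eq`
survives. -/
theorem IsWeakSolution.hasDerivWithinAt_green {β₀ σ T : ℝ} {ψ : FormDomain y hlam}
    {Ψ : ℝ → FormDomain y hlam} (hW : IsWeakSolution β₀ σ T ψ Ψ) {t : ℝ} (ht : t ∈ Icc 0 T) :
    HasDerivWithinAt (fun s ↦ inner ℂ (green y hlam) (Ψ s).toL2)
      (-Complex.I * (-lam * inner ℂ (green y hlam) (Ψ t).toL2 +
        (β₀ * nl σ (Ψ t).charge + formConst lam * (Ψ t).charge))) (Icc 0 T) t := by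
  obtain ⟨χ, h1, h2⟩ := exists_formDomain y hlam (r := 0) MemLp.zero (by simp) 1
  have h3 : χ.reg = 0 := by
    refine L2.ext_fourier (h2.trans ?_)
    rw [FourierTransform.fourier_zero]
    exact (Lp.coeFn_zero _ _ _).symm
  have h4 : ∀ j, χ.grad j = 0 := by
    intro j
    refine L2.ext_fourier (((isWeakGradient_iff _ _).1 χ.isWeakGradient j).trans ?_)
    rw [FourierTransform.fourier_zero]
    filter_upwards [h2, Lp.coeFn_zero ℂ 2 (volume : Measure Plane)] with ξ a b
    rw [a, b]
    simp
  have h := hW.equation χ t ht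
  have e : ∀ s, inner ℂ χ.toL2 (Ψ s).toL2 = inner ℂ (green y hlam) (Ψ s).toL2 := fun s ↦ by
    rw [FormDomain.toL2, h1, h3, one_smul, zero_add]
  simp only [e] at h
  refine h.congr_deriv ?_
  rw [form_eq, regForm, h1, h3]
  simp only [h4, inner_zero_left, Finset.sum_const_zero, nl]
  push_cast
  simp
  ring

/-- A weak solution carries no measurability assumption on its charge, but the equation supplies it.
For `X` the plane wave cut to the unit ball, the coefficient of the charge is the area of the ball,
so the charge is a combination of a continuous function and the derivative of another one, and
derivatives are measurable. Only the open interval is covered; its end points do not matter for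
integrals. -/
theorem exists_measurable_charge {v : ℝ → L2} {c : ℝ → ℂ} {C T : ℝ} (hT : 0 < T)
    (hC : ∀ t ∈ Icc 0 T, ‖c t‖ ≤ C)
    (hd : ∀ {R : ℝ} {X : L2} (hX : Band R X), ∀ t ∈ Icc 0 T,
      HasDerivWithinAt (fun s ↦ inner ℂ X (v s)) (-Complex.I * (inner ℂ hX.symbMul (v t) -
        c t * ∫ ξ, starRingEnd ℂ (X ξ) * wave y ξ)) (Icc 0 T) t) :
    ∃ q : ℝ → ℂ, Measurable q ∧ (∀ t, ‖q t‖ ≤ C) ∧ ∀ t ∈ Ioo 0 T, q t = c t := by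
  have hmw : MemLp ((Metric.closedBall (0 : Plane) 1).indicator (wave y)) 2 volume := by
    have h1 : MemLp ((Metric.closedBall (0 : Plane) 1).indicator fun _ ↦ (1 : ℂ)) 2 volume :=
      memLp_indicator_const 2 measurableSet_closedBall 1 (Or.inr measure_closedBall_lt_top.ne)
    refine h1.of_le ((continuous_wave y).aestronglyMeasurable.indicator measurableSet_closedBall)
      (Eventually.of_forall fun ξ ↦ ?_)
    by_cases h : ξ ∈ Metric.closedBall (0 : Plane) 1 <;> simp [h]
  set X : L2 := hmw.toLp _ with hXdef
  have hXc : X =ᵐ[volume] (Metric.closedBall (0 : Plane) 1).indicator (wave y) := hmw.coeFn_toLp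
  have hX : Band 1 X := by
    filter_upwards [hXc] with ξ h h'
    rw [h, indicator_of_notMem (by simpa using h')]
  set w : ℂ := ∫ ξ, starRingEnd ℂ (X ξ) * wave y ξ with hw
  have hw0 : w ≠ 0 := by
    have e : w = ∫ ξ, (Metric.closedBall (0 : Plane) 1).indicator (fun _ ↦ (1 : ℂ)) ξ := by
      refine integral_congr_ae ?_
      filter_upwards [hXc] with ξ h
      rw [h]
      by_cases h' : ξ ∈ Metric.closedBall (0 : Plane) 1
      · rw [indicator_of_mem h', indicator_of_mem h', conj_wave_mul_wave]
      · simp [h']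
    rw [e, integral_indicator measurableSet_closedBall, setIntegral_const]
    have : 0 < volume.real (Metric.closedBall (0 : Plane) 1) :=
      ENNReal.toReal_pos (Metric.measure_closedBall_pos _ _ one_pos).ne' measure_closedBall_lt_top.ne
    simpa using this.ne'
  have hcont : ∀ {R : ℝ} {X : L2} (hX : Band R X), ContinuousOn (fun s ↦ inner ℂ X (v s)) (Icc 0 T) :=
    fun hX t ht ↦ (hd hX t ht).continuousWithinAt
  set f : ℝ → ℂ := IccExtend hT.le ((Icc 0 T).domRestrict fun s ↦ inner ℂ X (v s)) with hf
  have hfc : Continuous f := (continuousOn_iff_continuous_domRestrict.1 (hcont hX)).Icc_extend'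
  set g : ℝ → ℂ := IccExtend hT.le ((Icc 0 T).domRestrict fun s ↦ inner ℂ hX.symbMul (v s)) with hg
  have hgc : Continuous g :=
    (continuousOn_iff_continuous_domRestrict.1 (hcont hX.band_symbMul)).Icc_extend'
  have hq : ∀ t ∈ Ioo 0 T, (g t - Complex.I * deriv f t) / w = c t := by
    intro t ht
    have ht' := Ioo_subset_Icc_self ht
    have h1 := (hd hX t ht').hasDerivAt (Icc_mem_nhds ht.1 ht.2)
    have h2 : f =ᶠ[𝓝 t] fun s ↦ inner ℂ X (v s) := by
      filter_upwards [Icc_mem_nhds ht.1 ht.2] with s hs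
      rw [hf, IccExtend_of_mem _ _ hs]
      rfl
    have h3 : g t = inner ℂ hX.symbMul (v t) := by
      rw [hg, IccExtend_of_mem _ _ ht']
      rfl
    rw [(h1.congr_of_eventuallyEq h2).deriv, h3, div_eq_iff hw0]
    linear_combination (inner ℂ hX.symbMul (v t) - c t * w) * Complex.I_mul_I
  refine ⟨(Ioo 0 T).indicator fun t ↦ (g t - Complex.I * deriv f t) / w, ?_, fun t ↦ ?_, fun t ht ↦ ?_⟩
  · exact ((hgc.measurable.sub ((measurable_deriv f).const_mul _)).div_const w).indicator measurableSet_Ioo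
  · by_cases ht : t ∈ Ioo 0 T
    · rw [indicator_of_mem ht, hq t ht]
      exact hC t (Ioo_subset_Icc_self ht)
    · rw [indicator_of_notMem ht, norm_zero]
      exact (norm_nonneg _).trans (hC 0 ⟨le_rfl, hT.le⟩)
  · rw [indicator_of_mem ht, hq t ht]


/-! ### Uniqueness of the weak solution -/

variable {y : Plane} {lam : ℝ} {hlam : 0 < lam}

/-- A weak solution is given by the Duhamel formula with its own charge. -/
theorem IsWeakSolution.fourier_eq_duhamelHat {β₀ σ T : ℝ} {ψ : FormDomain y hlam}
    {Ψ : ℝ → FormDomain y hlam} (hW : IsWeakSolution β₀ σ T ψ Ψ) {q : ℝ → ℂ} {B : ℝ}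
    (hq : Measurable q) (hB : ∀ t, ‖q t‖ ≤ B) (hqc : ∀ t ∈ Ioo 0 T, q t = (Ψ t).charge) :
    ∀ t ∈ Icc 0 T, (𝓕 (Ψ t).toL2 : L2) =ᵐ[volume] duhamelHat y (𝓕 ψ.toL2) q t := by
  set v : ℝ → L2 := fun t ↦ 𝓕 (Ψ t).toL2 with hv
  have hD : ∀ t, ∃ D : L2, 0 ≤ t → D =ᵐ[volume] duhamelHat y (𝓕 ψ.toL2) q t := by
    intro t
    by_cases ht : 0 ≤ t
    · exact ⟨(memLp_duhamelHat hq hB ht).toLp _, fun _ ↦ MemLp.coeFn_toLp _⟩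
    · exact ⟨0, fun h ↦ absurd h ht⟩
  choose D hD using hD
  have hDi : ∀ {R : ℝ} {X : L2} (hX : Band R X) (t : ℝ), 0 ≤ t →
      inner ℂ X (D t) = ∫ ξ, starRingEnd ℂ (X ξ) * duhamelHat y (𝓕 ψ.toL2) q t ξ := by
    intro R X hX t ht
    rw [inner_eq_integral]
    refine integral_congr_ae ?_
    filter_upwards [hD t ht] with ξ h
    rw [h]
  have hvc : ∀ {R : ℝ} {X : L2}, Band R X → ContinuousOn (fun t ↦ inner ℂ X (v t)) (Icc 0 T) :=
    fun hX t ht ↦ (hW.hasDerivWithinAt_band hX ht).continuousWithinAt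
  have hDc : ∀ {R : ℝ} {X : L2}, Band R X → ContinuousOn (fun t ↦ inner ℂ X (D t)) (Icc 0 T) := by
    intro R X hX
    refine (hX.continuousOn_pairing (y := y) (a := (𝓕 ψ.toL2 : L2)) hq hB (c := fun _ ↦ 1) continuous_const T).congr fun t ht ↦ ?_
    simp only [one_mul]
    exact hDi hX t ht.1
  -- The solution and the Duhamel formula have the same charge and the same datum, so in the
  -- difference the inhomogeneous terms cancel.
  have hz := eq_zero_of_band_volterra (z := fun t ↦ v t - D t) (T := T)
    (fun hX ↦ by simp only [inner_sub_right]; exact (hvc hX).sub (hDc hX)) (by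
      intro R X hX t ht
      have hsub : Icc 0 t ⊆ Icc 0 T := Icc_subset_Icc_right ht.2
      have hci : ∀ {f : ℝ → ℂ}, ContinuousOn f (Icc 0 T) → IntervalIntegrable f volume 0 t := fun hf ↦
        (hf.mono (by rwa [uIcc_of_le ht.1])).intervalIntegrable
      have hqi : IntervalIntegrable q volume 0 t :=
        (intervalIntegrable_iff_integrableOn_Ioc_of_le ht.1).2 (bddMeas_of_measurable hq hB t).integrableOn
      set w : ℂ := ∫ ξ, starRingEnd ℂ (X ξ) * wave y ξ with hw
      have i1 : IntervalIntegrable (fun s ↦ -Complex.I * (inner ℂ hX.symbMul (v s) - q s * w)) volume 0 t :=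
        ((hci (hvc hX.band_symbMul)).sub (hqi.mul_const w)).const_mul _
      have i2 : IntervalIntegrable (fun s ↦ -Complex.I * (inner ℂ hX.symbMul (D s) - q s * w)) volume 0 t :=
        ((hci (hDc hX.band_symbMul)).sub (hqi.mul_const w)).const_mul _
      have h1 := intervalIntegral.integral_eq_sub_of_hasDerivAt_of_le ht.1 ((hvc hX).mono hsub)
        (f' := fun s ↦ -Complex.I * (inner ℂ hX.symbMul (v s) - q s * w)) (fun s hs ↦ by
          have hs' : s ∈ Ioo 0 T := ⟨hs.1, hs.2.trans_le ht.2⟩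
          have := (hW.hasDerivWithinAt_band hX (Ioo_subset_Icc_self hs')).hasDerivAt
            (Icc_mem_nhds hs'.1 hs'.2)
          rwa [← hqc s hs'] at this) i1
      have h2 : ∫ s in (0 : ℝ)..t, -Complex.I * (inner ℂ hX.symbMul (D s) - q s * w) =
          inner ℂ X (D t) - inner ℂ X (D 0) := by
        have h := band_pairing_duhamelHat (y := y) (a := (𝓕 ψ.toL2 : L2)) hq hB ht.1 hX
        rw [hDi hX t ht.1, hDi hX 0 le_rfl]
        simp only [duhamelHat_zero]
        rw [h]
        refine intervalIntegral.integral_congr fun s hs ↦ ?_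
        rw [uIcc_of_le ht.1] at hs
        rw [hX.inner_symbMul]
        congr 2
        refine integral_congr_ae ?_
        filter_upwards [hD s hs.1] with ξ h
        rw [h]
      have h0 : v 0 = D 0 := by
        refine Lp.ext ?_
        filter_upwards [hD 0 le_rfl] with ξ h
        rw [h, duhamelHat_zero, hv]
        simp only [hW.initial]
      have h3 := intervalIntegral.integral_sub i1 i2
      rw [h1, h2, h0] at h3
      simp only [inner_sub_right]
      rw [sub_sub_sub_cancel_right] at h3
      rw [← h3]
      refine intervalIntegral.integral_congr fun s _ ↦ ?_
      ring)
  intro t ht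
  have h := sub_eq_zero.1 (hz t ht)
  filter_upwards [hD t ht.1] with ξ h1
  rw [← h1, ← h]

/-- The charge of a weak solution solves the convolved charge equation. -/
theorem IsWeakSolution.conv_logC_eq {β₀ σ T : ℝ} {ψ : FormDomain y hlam} (hψ : ψ.IsAdmissible)
    (hσ : 1 / 2 ≤ σ)
    {Ψ : ℝ → FormDomain y hlam} (hW : IsWeakSolution β₀ σ T ψ Ψ) {q : ℝ → ℂ} {B : ℝ}
    (hq : Measurable q) (hB : ∀ t, ‖q t‖ ≤ B) (hqc : ∀ t ∈ Ioo 0 T, q t = (Ψ t).charge) :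
    ∀ t ∈ Ioc 0 T, conv logC q t = conv (fun _ ↦ 1)
      (chargeRHS lam β₀ σ ψ.charge (specTrace (sourceSymb ψ)) q) t := by
  intro t ht
  have hF := hW.fourier_eq_duhamelHat hq hB hqc
  have hY : ∀ s ∈ Icc 0 T, inner ℂ (green y hlam) (Ψ s).toL2 = greenPairing ψ q s := fun s hs ↦
    inner_green (hF s hs)
  obtain ⟨hi, hev⟩ := greenPairing_evolution hψ (β₀ := β₀) hσ hq hB ht.1.le
  have hsub : Icc 0 t ⊆ Icc 0 T := Icc_subset_Icc_right ht.2
  have hqb := bddMeas_of_measurable hq hB t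
  have hii : ∀ {g : ℝ → ℂ}, BddMeas g t → IntervalIntegrable g volume 0 t := fun hg ↦
    (intervalIntegrable_iff_integrableOn_Ioc_of_le ht.1.le).2 hg.integrableOn
  have hN : IntervalIntegrable (fun s ↦ β₀ * nl σ (q s) + formConst lam * q s) volume 0 t :=
    ((hii (hqb.comp (continuous_nl hσ))).const_mul _).add ((hii hqb).const_mul _)
  have h1 := intervalIntegral.integral_eq_sub_of_hasDerivAt_of_le ht.1.le
    (f := fun s ↦ inner ℂ (green y hlam) (Ψ s).toL2)
    (f' := fun s ↦ -Complex.I * (-lam * greenPairing ψ q s + (β₀ * nl σ (q s) + formConst lam * q s)))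
    (fun s hs ↦ ((hW.hasDerivWithinAt_green (hsub hs)).continuousWithinAt.mono hsub)) (fun s hs ↦ by
      have hs' : s ∈ Ioo 0 T := ⟨hs.1, hs.2.trans_le ht.2⟩
      have := (hW.hasDerivWithinAt_green (Ioo_subset_Icc_self hs')).hasDerivAt (Icc_mem_nhds hs'.1 hs'.2)
      rwa [← hqc s hs', hY s (Ioo_subset_Icc_self hs')] at this)
    (((hi.const_mul _).add hN).const_mul _)
  rw [hY t ⟨ht.1.le, ht.2⟩, hY 0 ⟨le_rfl, ht.1.le.trans ht.2⟩, intervalIntegral.integral_const_mul,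
    intervalIntegral.integral_add (hi.const_mul _) hN, intervalIntegral.integral_const_mul] at h1
  rw [conv_one (fun s ↦ β₀ * nl σ (q s) + formConst lam * q s), ← h1] at hev
  have hpi : (Real.pi : ℂ) ≠ 0 := by exact_mod_cast Real.pi_ne_zero
  set N := ∫ s in (0 : ℝ)..t, (β₀ * nl σ (q s) + formConst lam * q s) with hNdef
  set S := ∫ s in (0 : ℝ)..t, greenPairing ψ q s with hS
  have h2 : (1 / (4 * Real.pi) : ℂ) * (conv logC q t - conv (fun _ ↦ 1)
      (chargeRHS lam β₀ σ ψ.charge (specTrace (sourceSymb ψ)) q) t) = 0 := by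
    linear_combination hev + (-lam * S + N) * Complex.I_mul_I
  have h3 : (1 / (4 * Real.pi) : ℂ) ≠ 0 := one_div_ne_zero (mul_ne_zero (by norm_num) hpi)
  exact sub_eq_zero.1 ((mul_eq_zero.1 h2).resolve_left h3)

/-- A bounded solution of the convolved charge equation agrees almost everywhere with the solution
of the charge equation. -/
theorem ae_eq_of_conv_logC {β₀ σ T : ℝ} (hlam : 0 < lam) (hσ : 1 / 2 ≤ σ) (hT0 : 0 < T) (hT : T ≤ 1 / 8)
    {q₀ : ℂ} {F q p : ℝ → ℂ} (hF : Continuous F) (hq : BddMeas q T) (hp : BddMeas p T)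
    (hqe : ∀ t ∈ Ioc 0 T, q t = q₀ + conv volC (regRHS lam β₀ σ q₀ F q) t)
    (hpe : ∀ t ∈ Ioc 0 T, conv logC p t = conv (fun _ ↦ 1) (chargeRHS lam β₀ σ q₀ F p) t) :
    ∀ᵐ t ∂volume.restrict (Ioc 0 T), p t = q t := by
  have h1 := ae_eq_conv_volC_of_conv_logC hT hp.integrableOn
    (integrableOn_chargeRHS (β₀ := β₀) hlam hσ q₀ hF hT0.le hp) hpe
  -- `r` is the continuous representative of `p`. Replacing `p` by `r` inside the convolution
  -- changes nothing, so `r` satisfies the equation at every time in `(0, T]` and uniqueness of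
  -- bounded solutions applies.
  set r : ℝ → ℂ := fun t ↦ q₀ + conv volC (regRHS lam β₀ σ q₀ F p) t with hr
  have h2 : ∀ᵐ t ∂volume.restrict (Ioc 0 T), p t = r t := by
    filter_upwards [h1, ae_restrict_mem measurableSet_Ioc] with t h ht
    rw [h, conv_volC_chargeRHS hlam hσ q₀ hF ht.1 (ht.2.trans hT) (hp.mono ht.2)]
  have hrc : ContinuousOn r (Icc 0 T) :=
    continuousOn_const.add (continuousOn_conv_volC hT (bddMeas_regRHS hlam hσ q₀ hF hT0.le hp))
  have h3 : ∀ t ∈ Ioc 0 T, r t = q₀ + conv volC (regRHS lam β₀ σ q₀ F r) t := by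
    intro t ht
    simp only [hr]
    congr 1
    rw [conv_eq_setIntegral _ _ ht.1.le, conv_eq_setIntegral _ _ ht.1.le]
    refine integral_congr_ae ?_
    filter_upwards [ae_restrict_of_ae_restrict_of_subset (Ioc_subset_Ioc_right ht.2) h2] with s hs
    simp only [regRHS]
    rw [hs]
  have h4 := eq_of_bounded_solutions hlam hσ hF hT hrc.bddMeas hq h3 hqe
  filter_upwards [h2, ae_restrict_mem measurableSet_Ioc] with t h ht
  rw [h, h4 t ht]

/-- The charge of the weak solution is identified with `q` only almost everywhere. That suffices,
because the Duhamel formula sees the charge only under an integral, and hence the conclusion holds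
at every time. -/
theorem IsWeakSolution.fourier_eq {β₀ σ T : ℝ} {ψ : FormDomain y hlam} (hψ : ψ.IsAdmissible)
    (hσ : 1 / 2 ≤ σ) (hT0 : 0 < T) (hT : T ≤ 1 / 8) {q : ℝ → ℂ} (hq : BddMeas q T)
    (hqe : ∀ t ∈ Ioc 0 T, q t = ψ.charge +
      conv volC (regRHS lam β₀ σ ψ.charge (specTrace (sourceSymb ψ)) q) t)
    {Ψ : ℝ → FormDomain y hlam} (hW : IsWeakSolution β₀ σ T ψ Ψ) :
    ∀ t ∈ Icc 0 T, (𝓕 (Ψ t).toL2 : L2) =ᵐ[volume] duhamelHat y (𝓕 ψ.toL2) q t := by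
  obtain ⟨C, hC⟩ := hW.bounded_charge
  obtain ⟨p, hpm, hpC, hpc⟩ := exists_measurable_charge (v := fun t ↦ (𝓕 (Ψ t).toL2 : L2))
    (c := fun t ↦ (Ψ t).charge) (y := y) hT0 hC fun hX t ht ↦ hW.hasDerivWithinAt_band hX ht
  have h1 := hW.fourier_eq_duhamelHat hpm hpC hpc
  have h2 := ae_eq_of_conv_logC hlam hσ hT0 hT (continuous_specTrace (integrable_sourceSymb hψ)) hq
    (bddMeas_of_measurable hpm hpC T) hqe (hW.conv_logC_eq hψ hσ hpm hpC hpc)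
  intro t ht
  filter_upwards [h1 t ht] with ξ h
  have e : osc p t (symb ξ) = osc q t (symb ξ) := by
    rw [osc, osc, intervalIntegral.integral_of_le ht.1, intervalIntegral.integral_of_le ht.1]
    refine integral_congr_ae ?_
    filter_upwards [ae_restrict_of_ae_restrict_of_subset (Ioc_subset_Ioc_right ht.2) h2] with s hs
    rw [hs]
  rw [h, duhamelHat, duhamelHat, e]


/-! ### Regularity of the charge -/

theorem norm_phase_right_sub_le {lam : ℝ} (hlam : 0 < lam) (s t : ℝ) :
    ‖phase (-lam) t - phase (-lam) s‖ ≤ lam * |t - s| := by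
  have e : phase (-lam) t - phase (-lam) s = phase s (-lam) * (phase (t - s) (-lam) - 1) := by
    rw [mul_sub, mul_one, ← phase_add, add_sub_cancel, phase, phase, phase, phase, mul_comm (-lam),
      mul_comm (-lam)]
  rw [e, norm_mul, norm_phase, one_mul]
  refine (norm_phase_sub_one_le _ _).trans (le_of_eq ?_)
  rw [abs_mul, abs_neg, abs_of_pos hlam, mul_comm]

/-- Constants have no increments, the primitive of `greenTrace` is Hölder of order `3/4`, and the
remaining term is the free source. -/
theorem halfNorm_regSource_lt_top {lam : ℝ} (hlam : 0 < lam) (q₀ : ℂ) {F : ℝ → ℂ} (hF : Continuous F)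
    {T : ℝ} (hFh : halfNorm F T < ∞) : halfNorm (regSource lam q₀ F) T < ∞ := by
  obtain ⟨C, hC⟩ := exists_integral_greenTrace_holder hlam
  set p : ℝ → ℂ := fun τ ↦ -q₀ * (Real.log lam + Complex.I * Real.pi / 2) +
    Complex.I * lam * q₀ * ∫ s in (0 : ℝ)..τ, greenTrace lam s with hp
  have h1 : halfNorm p T < ∞ := by
    refine halfNorm_lt_top_of_holder (C := ‖Complex.I * lam * q₀‖ * C) fun s h hs hh _ ↦ ?_
    simp only [hp]
    rw [add_sub_add_left_eq_sub, ← mul_sub, norm_mul]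
    exact (mul_le_mul_of_nonneg_left (hC s h hs hh) (norm_nonneg (Complex.I * lam * q₀))).trans_eq
      (mul_assoc _ _ _).symm
  have h2 := halfNorm_add_lt_top (halfNorm_const_mul_lt_top hFh hF.measurable (4 * Real.pi)) h1
    (hF.measurable.const_mul _)
  refine lt_of_eq_of_lt (halfNorm_congr fun t _ ↦ ?_) h2
  simp only [regSource, hp]
  ring

theorem halfNorm_charge_lt_top {lam β₀ σ : ℝ} (hlam : 0 < lam) (hσ : 1 / 2 ≤ σ) {q₀ : ℂ} {F q : ℝ → ℂ}
    (hF : Continuous F) {T L : ℝ} (hT0 : 0 < T) (hT : T ≤ 1 / 8) (hFh : halfNorm F T < ∞) (hL : 0 ≤ L)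
    (hTL : volterraN T * L ≤ 1 / 4) (hq : Continuous q)
    (heq : ∀ t ∈ Icc 0 T, q t = q₀ + conv volC (regRHS lam β₀ σ q₀ F q) t)
    (hlip : ∀ s ∈ Icc 0 T, ∀ t ∈ Icc 0 T,
      ‖regNonlin β₀ σ (q s) - regNonlin β₀ σ (q t)‖ ≤ L * ‖q s - q t‖) : halfNorm q T < ∞ := by
  set S : ℝ → ℂ := IccExtend hT0.le ((Icc 0 T).domRestrict (regSource lam q₀ F)) with hS
  have hSc : Continuous S :=
    (continuousOn_iff_continuous_domRestrict.1 (continuousOn_regSource hlam q₀ hF hT0.le)).Icc_extend'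
  have hSe : EqOn S (regSource lam q₀ F) (Icc 0 T) := fun t ht ↦ by
    rw [hS, IccExtend_of_mem _ _ ht]
    rfl
  refine halfNorm_lt_top_of_volterra (q₀ := q₀) hT0 hT hq hSc (continuous_regNonlin β₀ hσ) hL hTL
    (fun t ht ↦ ?_) hlip ?_
  · rw [heq t ht]
    congr 1
    refine conv_congr_right ht.1 fun τ hτ ↦ ?_
    rw [regRHS, hSe ⟨hτ.1.le, hτ.2.trans ht.2⟩]
  · rw [halfNorm_congr hSe]
    exact halfNorm_regSource_lt_top hlam q₀ hF hFh

/-- The logarithmic modulus is that of a convolution of `I` with a bounded function; the exponential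
is Lipschitz and therefore harmless. Its subtraction arranges the vanishing at `0` that the stopped
Fourier identity requires. -/
theorem halfRegular_relCharge {lam β₀ σ : ℝ} (hlam : 0 < lam) (hσ : 1 / 2 ≤ σ) {q₀ : ℂ} {F q : ℝ → ℂ}
    (hF : Continuous F) {T : ℝ} (hT0 : 0 < T) (hT : T ≤ 1 / 8) (hq : Continuous q) (hq0 : q 0 = q₀)
    (heq : ∀ t ∈ Icc 0 T, q t = q₀ + conv volC (regRHS lam β₀ σ q₀ F q) t)
    (hh : halfNorm q T < ∞) : HalfRegular (relCharge lam q₀ q) T where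
  continuous := hq.sub (continuous_const.mul (continuous_phase_right (-lam)))
  zero := by simp [relCharge, hq0, phase]
  halfNorm_lt_top := by
    have h1 : halfNorm (fun t ↦ -q₀ * phase (-lam) t) T < ∞ := by
      refine halfNorm_const_mul_lt_top (halfNorm_lt_top_of_holder (C := lam) fun s h hs hh hsh ↦ ?_)
        (continuous_phase_right (-lam)).measurable _
      refine (norm_phase_right_sub_le hlam _ _).trans ?_
      rw [add_sub_cancel_left, abs_of_pos hh]
      refine mul_le_mul_of_nonneg_left ?_ hlam.le
      have := Real.rpow_le_rpow_of_exponent_ge hh (by linarith) (by norm_num : (3 / 4 : ℝ) ≤ 1)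
      rwa [Real.rpow_one] at this
    refine lt_of_eq_of_lt (halfNorm_congr fun t _ ↦ ?_) (halfNorm_add_lt_top hh h1 hq.measurable)
    simp only [relCharge]
    ring
  modulus := by
    obtain ⟨C, hC, hb⟩ := exists_norm_volterraConv_sub_le
    obtain ⟨hm, G, hG, hGb⟩ := bddMeas_regRHS (β₀ := β₀) hlam hσ q₀ hF hT0.le (hq.bddMeas T)
    refine ⟨C * G + ‖q₀‖ * lam, by positivity, fun s t hs hst ht ↦ ?_⟩
    have h1 := hb _ G T hG hT hm hGb s t hs hst ht
    have h2 := norm_phase_right_sub_le hlam s t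
    rw [abs_of_nonneg (sub_nonneg.2 hst)] at h2
    have h3 := self_le_logMod (sub_nonneg.2 hst) (by linarith)
    have e : relCharge lam q₀ q t - relCharge lam q₀ q s =
        (volterraConv (regRHS lam β₀ σ q₀ F q) t - volterraConv (regRHS lam β₀ σ q₀ F q) s) -
        q₀ * (phase (-lam) t - phase (-lam) s) := by
      rw [relCharge, relCharge, heq t ⟨hs.trans hst, ht⟩, heq s ⟨hs, hst.trans ht⟩, conv_volC, conv_volC]
      ring
    rw [e]
    refine (norm_sub_le _ _).trans ?_
    rw [norm_mul, add_mul]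
    refine add_le_add h1 ?_
    rw [mul_assoc]
    exact mul_le_mul_of_nonneg_left (h2.trans (mul_le_mul_of_nonneg_left h3 hlam.le)) (norm_nonneg _)

end PointNLS

end

/-! ### Local well-posedness. -/

open PointNLS
theorem mainTheorem1 (y : Plane) (β₀ σ : ℝ) (hσ : 1 / 2 ≤ σ) {lam : ℝ} (hlam : 0 < lam)
    (ψ₀ : FormDomain y hlam) (hψ₀ : ψ₀.IsAdmissible) :
    (∀ t : ℝ, 0 < t → ∃ g : Plane → ℂ, Continuous g ∧ U₀ t ψ₀.toL2 =ᵐ[volume] g) ∧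
    ∃ T : ℝ, 0 < T ∧ ∃ (q : ℝ → ℂ) (ψ : ℝ → FormDomain y hlam),
      (IsChargeSolution y β₀ σ T ψ₀.toL2 q ∧ FiniteHalfSeminorm T q ∧
        ∀ q' : ℝ → ℂ, IsChargeSolution y β₀ σ T ψ₀.toL2 q' → EqOn q' q (Icc 0 T)) ∧
      (∀ t ∈ Icc 0 T, (ψ t).charge = q t ∧ IsAnsatz y ψ₀.toL2 q t (ψ t).toL2) ∧
      IsWeakSolution β₀ σ T ψ₀ ψ ∧
      ∀ ψ' : ℝ → FormDomain y hlam, IsWeakSolution β₀ σ T ψ₀ ψ' →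
        ∀ t ∈ Icc 0 T, (ψ' t).toL2 = (ψ t).toL2 := by
  refine ⟨fun t ht ↦ (exists_rep_U₀ hψ₀ ht).imp fun g hg ↦ ⟨hg.1, hg.2.1⟩, ?_⟩
  set F : ℝ → ℂ := specTrace (sourceSymb ψ₀)
  have hF : Continuous F := continuous_specTrace (integrable_sourceSymb hψ₀)
  obtain ⟨T, L, q, hT0, hT, hL, hTL, hq, ⟨B, hB⟩, hq0, heq, hlip⟩ :=
    exists_charge β₀ hlam hσ ψ₀.charge hF
  have hv : ∀ τ, 0 < τ → valueAt (U₀ τ ψ₀.toL2) y =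
      F τ + ψ₀.charge / (4 * Real.pi) * greenTrace lam τ := fun τ hτ ↦ by
    obtain ⟨g, hg, he, hgy⟩ := exists_rep_U₀ hψ₀ hτ
    rw [valueAt_eq hg he, hgy]
  have hiff : ∀ q' : ℝ → ℂ, IsChargeSolution y β₀ σ T ψ₀.toL2 q' ↔ ContinuousOn q' (Icc 0 T) ∧
      ∀ t ∈ Ioc 0 T, q' t = ψ₀.charge + conv volC (regRHS lam β₀ σ ψ₀.charge F q') t := fun q' ↦
    isChargeSolution_iff hlam hσ hF hT hv
  have hh : halfNorm q T < ∞ := halfNorm_charge_lt_top hlam hσ hF hT0 hT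
    (halfNorm_specTrace_lt_top (integrable_sourceSymb hψ₀) (lintegral_symb_sourceSymb_lt_top ψ₀) T)
    hL hTL hq heq hlip
  have heq' : ∀ t ∈ Ioc 0 T, q t = ψ₀.charge + conv volC (regRHS lam β₀ σ ψ₀.charge F q) t :=
    fun t ht ↦ heq t (Ioc_subset_Icc_self ht)
  obtain ⟨Ψ, M, hΨ⟩ := exists_path ψ₀ hT0 hT hq.measurable hB
    (halfRegular_relCharge hlam hσ hF hT0 hT hq hq0 heq hh)
  refine ⟨T, hT0, q, Ψ, ⟨(hiff q).2 ⟨hq.continuousOn, heq'⟩,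
    finiteHalfSeminorm_of_halfNorm hq.measurable hh, fun q' hq' ↦ ?_⟩,
    fun t ht ↦ ⟨(hΨ t ht).1, isAnsatz_of_fourier hq hB ht.1 (hΨ t ht).2.1⟩, ?_, fun Ψ' hΨ' t ht ↦ ?_⟩
  · obtain ⟨hc, he⟩ := (hiff q').1 hq'
    have h : EqOn q' q (Ioc 0 T) :=
      eq_of_bounded_solutions hlam hσ hF hT hc.bddMeas (hq.bddMeas T) he heq'
    -- The charge equation speaks of `t > 0` only; continuity of both functions extends the equality
    -- to `t = 0`.
    exact h.of_subset_closure hc hq.continuousOn Ioc_subset_Icc_self (closure_Ioc hT0.ne).superset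
  · refine isWeakSolution_of_path hψ₀ hσ hT0.le hq hB (fun t ht ↦ ?_) hΨ
    -- The charge equation `q = I * G` is convolved with `-γ - log` to recover the form that makes
    -- the Green-tested equation hold.
    refine conv_logC_of_eq_conv_volC hT
      (integrableOn_chargeRHS hlam hσ ψ₀.charge hF hT0.le (hq.bddMeas T)) ht fun s hs ↦ ?_
    rw [conv_volC_chargeRHS hlam hσ ψ₀.charge hF hs.1 (hs.2.trans hT) (hq.bddMeas s)]
    exact heq' s hs
  -- Both paths have the Duhamel formula with the same `q` as their transform.
  · refine L2.ext_fourier ?_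
    exact (hΨ'.fourier_eq hψ₀ hσ hT0 hT (hq.bddMeas T) heq' t ht).trans (hΨ t ht).2.1.symm
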